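/- **Multicomponent CKP hierarchy: bosonization, Hirota equations, wave function, Sato–Wilson and Lax equations.** Let $s,r\ge 0$; throughout $1\le a,b\le s<c,d\le s+r$, $z\cdot t^{(a)}=\sum_{k\ge1}z^kt^{(a)}_k$, $z\circ t^{(c)}=\sum_{k\text{ odd}}z^kt^{(c)}_k$, $\tilde\partial_{t}=(\partial_{t_1},\tfrac12\partial_{t_2},\tfrac13\partial_{t_3},\dots)$. *Weyl module.* $F$ is the (formally completed) Weyl module with vacuum $|0\rangle$, i.e. the space of formal power series in the commuting operators $b^{\pm a}_{-i},b^{c}_{-i}$, $i\in\frac12+\mathbb Z_{\ge0}$, with $b^{\pm a}_i|0\rangle=b^c_i|0\rangle=0$ for $i>0$ and non-zero commutators $[b^{+a}_i,b^{-b}_j]=\delta_{ab}\delta_{i,-j}$, $[b^c_i,b^d_j]=(-1)^{i-1/2}\delta_{cd}\delta_{i,-j}$; $F_c\subset F$ consists of the polynomials and $F^{\bar0}$ of the series with only even monomials. Put $b^{\pm a}(z)=\sum_ib_i^{\pm a}z^{-i-1/2}$, $b^{c}(z)=\sum_ib_i^{c}z^{-i-1/2}$. The CKP equation for $\tau\in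 F^{\bar 0}$ is $$\sum_a\sum_{i\in\frac12+\mathbb Z}\big(b^{-a}_i\tau\otimes b^{+a}_{-i}\tau-b^{+a}_i\tau\otimes b^{-a}_{-i}\tau\big)+\sum_c\sum_{i\in\frac12+\mathbb Z}(-1)^{i+\frac12}b^c_i\tau\otimes b^c_{-i}\tau=0.\qquad(\mathrm{CKP})$$ *Bosonization.* Let $\hat C$ be the space of formal series $\sum_w\tau_w(t)\,w$, where $\tau_w$ is a formal power series in $t^{(a)}_k$ ($k\ge1$), $t^{(c)}_k$ ($k\ge 1$ odd) and $w$ runs over the finite monomials in anticommuting variables $\xi^a_k$ ($0\ne k\in\mathbb Z$), $\xi^c_m$ ($m\in\frac12+\mathbb Z_{\ge0}$), written in lexicographic order; $C_{s,r}\subset\hat C$ is the space of polynomials. For a monomial $w$ let $i_a$, $j_a$ be the number of $\xi^a_k$ in $w$ with $k<0$, resp. $k>0$; let $T_a w=(i_a-j_a)w$, and let $S_b$ change the sign of all $\xi$'s of components $<b$. There is a unique linear isomorphism $\sigma:F\to\hat C$ that is continuous (each coefficient of $\sigma(\tau)$ depends on finitely many coefficients of $\tau$), with $\sigma|0\rangle=1$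 and $$\sigma b^{\pm a}(z)\sigma^{-1}=e^{\pm z\cdot t^{(a)}}\Xi^{\pm a}(z)z^{\pm T_a}e^{\pm z^{-1}\cdot\tilde\partial_{t^{(a)}}}S_a,\qquad \sigma b^c(z)\sigma^{-1}=e^{z\circ t^{(c)}}\Xi^c(z)e^{2z^{-1}\circ\tilde\partial_{t^{(c)}}}S_c,$$ $$\Xi^{\pm a}(z)=\sum_{k\ge1}\Big(\mp k\xi^a_{\pm k}z^{k-1}+\tfrac{\partial}{\partial\xi^a_{\mp k}}z^{-k-1}\Big),\qquad \Xi^c(z)=\sum_{m\in\frac12+\mathbb Z_{\ge0}}\Big((-1)^{m-\frac12}2m\,\xi^c_mz^{m-\frac12}+\tfrac{\partial}{\partial\xi^c_m}z^{-m-\frac12}\Big).$$ It maps $F_c$ onto $C_{s,r}$ and $F^{\bar0}$ onto the series with $\tau_w=0$ for all $w$ of odd length. *Hirota equations.* For $\tau\in F^{\bar0}$, with $\sigma(\tau)=\sum_w\tau_ww$, (CKP) is equivalent to: for all monomials $w,\bar w$ of odd length (bars denote the data of $\bar w$) $$\mathrm{Res}_{z=0}\Big\{\sum_a\Big[z^{n_a}e^{z\cdot(t^{(a)}-\bar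 t^{(a)})}e^{z^{-1}\cdot(\tilde\partial_{t^{(a)}}-\tilde\partial_{\bar t^{(a)}})}B^{+a}_w(t,z)B^{-a}_{\bar w}(\bar t,z)+(-z)^{-n_a}e^{-(-z)\cdot(t^{(a)}-\bar t^{(a)})}e^{-(-z^{-1})\cdot(\tilde\partial_{t^{(a)}}-\tilde\partial_{\bar t^{(a)}})}B^{-a}_w(t,-z)B^{+a}_{\bar w}(\bar t,-z)\Big]$$ $$+\sum_ce^{z\circ(t^{(c)}-\bar t^{(c)})}e^{2z^{-1}\circ(\tilde\partial_{t^{(c)}}-\tilde\partial_{\bar t^{(c)}})}B^c_w(t,z)B^c_{\bar w}(\bar t,-z)\Big\}dz=0,\qquad n_a=i_a-\bar i_a-j_a+\bar j_a,$$ where, with $N=N(w,\xi^b_n)=(-1)^{\#\{\xi^b_p\text{ in }w:\,p<n\}}$, $$B^{\pm a}_w(t,z)=\sum_{k>0,\ \xi^a_{\mp k}\notin w}N z^{-k}\tau_{w\cup\xi^a_{\mp k}}(t)\;\mp\sum_{k>0,\ \xi^a_{\pm k}\in w}kN z^{k}\tau_{w\setminus\xi^a_{\pm k}}(t),$$ $$B^c_w(t,z)=\sum_{\xi^c_m\notin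 w}Nz^{-m-\frac12}\tau_{w\cup\xi^c_m}(t)-\sum_{\xi^c_m\in w}(-1)^{m+\frac12}2mN z^{m-\frac12}\tau_{w\setminus\xi^c_m}(t).$$ *Wave function.* Let $0\ne\tau\in F^{\bar0}$ satisfy (CKP). Then $\tau_0:=\tau_\emptyset$ has non-zero constant term. Replace every $t^{(b)}_1$, $1\le b\le s+r$, in the $\tau_w$ by $t_1^{(b)}+x$, let $\partial=\partial_x$, number the rows and columns $1,\dots,2s+r$ by $a$, $s+a$, $s+c$ ($1\le a\le s<c\le s+r$), and put $V^\pm(x,t,z)=P^\pm(x,t,\pm z)S^\pm(t,\pm z)e^{\pm xz}$ with $S^\pm(t,\pm z)=\mathrm{diag}\big(e^{\pm z\cdot t^{(a)}},e^{\mp(-z)\cdot t^{(a)}},e^{\pm z\circ t^{(c)}}\big)$ and ($a\ne b$, $c\ne d$; $\tau_{\xi\cup\eta}$ is the coefficient of the lexicographically ordered product) $$\begin{aligned} \tau_0P^\pm(\pm z)_{a,a}&=e^{\pm z^{-1}\cdot\tilde\partial_{t^{(a)}}}\big(\tau_0-\textstyle\sum_{k\ge1}\tau_{\xi^a_{\mp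 k}\cup\xi^a_{\pm1}}z^{-k-1}\big),\\ \tau_0P^\pm(\pm z)_{a,b}&=e^{\pm z^{-1}\cdot\tilde\partial_{t^{(b)}}}\big(\mp\textstyle\sum_{k\ge1}\tau_{\xi^b_{\mp k}\cup\xi^a_{\pm1}}z^{-k}\big),\\ \tau_0P^\pm(\pm z)_{a,s+a}&=e^{\mp(-z^{-1})\cdot\tilde\partial_{t^{(a)}}}\big(\textstyle\sum_{k\ge2}\tau_{\xi^a_{\pm k}\cup\xi^a_{\pm1}}(-z)^{1-k}\big),\\ \tau_0P^\pm(\pm z)_{a,s+b}&=e^{\mp(-z^{-1})\cdot\tilde\partial_{t^{(b)}}}\big(\mp\textstyle\sum_{k\ge1}\tau_{\xi^b_{\pm k}\cup\xi^a_{\pm1}}(-z)^{-k}\big),\\ \tau_0P^\pm(\pm z)_{a,s+c}&=e^{\pm2z^{-1}\circ\tilde\partial_{t^{(c)}}}\big(\mp\textstyle\sum_{m}\tau_{\xi^a_{\pm1}\cup\xi^c_m}(\pm z)^{-m-\frac12}\big),\\ \tau_0P^\pm(\pm z)_{s+c,a}&=e^{\pm z^{-1}\cdot\tilde\partial_{t^{(a)}}}\big(\textstyle\sum_{k\ge1}\tau_{\xi^a_{\mp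 k}\cup\xi^c_{1/2}}z^{-k}\big),\\ \tau_0P^\pm(\pm z)_{s+c,s+c}&=e^{\pm2z^{-1}\circ\tilde\partial_{t^{(c)}}}\big(\tau_0-\textstyle\sum_{m>\frac12}\tau_{\xi^c_{1/2}\cup\xi^c_m}(\pm z)^{-m-\frac12}\big),\\ \tau_0P^\pm(\pm z)_{s+c,s+d}&=e^{\pm2z^{-1}\circ\tilde\partial_{t^{(d)}}}\big(\textstyle\sum_{m}\tau_{\xi^c_{1/2}\cup\xi^d_m}(\pm z)^{-m-\frac12}\big), \end{aligned}$$ the other entries being given by $P^\pm(\partial)_{s+a,s+b}=P^\mp(\partial)_{a,b}$ (also for $a=b$), $P^\pm(\partial)_{s+a,b}=P^\mp(\partial)_{a,s+b}$ (also for $a=b$), $P^\pm(\partial)_{s+a,s+c}=P^\mp(\partial)_{a,s+c}$, $P^\pm(\partial)_{s+c,s+a}=P^\mp(\partial)_{s+c,a}$; here $P^\pm(\partial)$ is the pseudo-differential operator with symbol $P^\pm(\zeta)$, $\zeta=\pm z$. Then: 1. $\mathrm{Res}_{z=0}V^+(x,t,z)V^-(\bar x,\bar t,z)^Tdz=0$.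 2. $P^\pm=1+\sum_{k\ge1}P^\pm_k\partial^{-k}$, and $P^\pm=(N+I)P^\mp(N+I)$ with $N=\sum_a(E_{a,s+a}+E_{s+a,a})$, $I=\sum_cE_{s+c,s+c}$; $P^+$ is invertible and $(P^+)^{-1}=(P^-)^*=(N+I)(P^+)^*(N+I)$. 3. (Sato–Wilson) With $P=P^+$, for $k\ge1$ and $\ell\ge1$ odd, $$\frac{\partial P}{\partial t^{(a)}_k}=-\big(P(\partial^kE_{aa}-(-\partial)^kE_{s+a,s+a})P^{-1}\big)_-P,\qquad\frac{\partial P}{\partial t^{(c)}_\ell}=-\big(P\,\partial^\ell E_{s+c,s+c}P^{-1}\big)_-P.$$ 4. (Lax–Sato) Let $L=P\big(\sum_a(\partial E_{aa}-\partial E_{s+a,s+a})+\sum_c\partial E_{s+c,s+c}\big)P^{-1}$, $C^b=PE_{bb}P^{-1}$ ($1\le b\le 2s+r$), $D^a=P(E_{aa}-E_{s+a,s+a})P^{-1}$, $E^a=(D^a)^2=P(E_{aa}+E_{s+a,s+a})P^{-1}$. Each $X\in\{L,C^b,D^{a'},E^{a'}\}$, $1\le a'\le s$, satisfies, for $j\ge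 1$ (odd in the second equation), $$\frac{\partial X}{\partial t^{(a)}_j}=[(L^jD^a)_+,X],\qquad\frac{\partial X}{\partial t^{(c)}_j}=[(L^jC^{s+c})_+,X].$$ 5. $(C^{s+c})^*=(N+I)C^{s+c}(N+I)$, $(D^a)^*=-(N+I)D^a(N+I)$, $(E^a)^*=(N+I)E^a(N+I)$ and $$L^*=(N+I)\Big(\big(\textstyle\sum_aE^a-\sum_cC^{s+c}\big)L\Big)(N+I).$$ In particular $L^*=-L$ and $(C^{s+c})^*=C^{s+c}$ if $s=0$, and $L^*=NLN$ if $r=0$. -/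

import Mathlib

noncomputable section

namespace MCKP

/-! ## Formal exponentials -/

/-- The exponential `exp f = ∑ f ^ m / m!` of a power series `f` without constant term over a
(not necessarily commutative) `ℂ`-algebra: only `m ≤ n` contributes to the `n`-th coefficient. -/
def pexp {E : Type*} [Ring E] [Algebra ℂ E] (f : PowerSeries E) : PowerSeries E :=
  PowerSeries.mk fun n =>
    ∑ m ∈ Finset.range (n + 1), ((m.factorial : ℂ)⁻¹) • PowerSeries.coeff n (f ^ m)

/-- The value `±1` of a sign; `true` is `+`. -/
def sg (ε : Bool) : ℂ := if ε then 1 else -1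

/-! ## The Weyl module

There are `s` charged pairs of fields `b^{+a}(z), b^{-a}(z)` and `r` neutral fields `b^{s+c}(z)`.
The mode `b_i`, `i ∈ 1/2 + ℤ`, is indexed by the integer `j = i - 1/2`; so `i > 0` iff `0 ≤ j`,
and `-i` has index `-j-1`. -/

/-- Field labels: `inl (a, true)` is `b^{+a}`, `inl (a, false)` is `b^{-a}`, `inr c` is
`b^{s+c}`. -/
abbrev Fld (s r : ℕ) := (Fin s × Bool) ⊕ Fin r

/-- The field that is dual to a given one. -/
def Fld.conj {s r : ℕ} : Fld s r → Fld s r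
  | Sum.inl (a, δ) => Sum.inl (a, !δ)
  | Sum.inr c => Sum.inr c

/-- The (completed) Weyl module: formal power series in the commuting creation operators,
the variable `(φ, n)` being `b^φ_{-n-1/2}`. The vacuum is `1`. The polynomials form the
irreducible module `F_c` itself. -/
abbrev FFock (s r : ℕ) := MvPowerSeries (Fld s r × ℕ) ℂ

/-- `[b^φ_{n+1/2}, b^{conj φ}_{-n-1/2}]`. -/
def Fld.comm {s r : ℕ} : Fld s r → ℕ → ℂ
  | Sum.inl (_, δ), _ => sg δ
  | Sum.inr _, n => (-1) ^ n

/-- The mode `b^φ_{j+1/2}` on the Weyl module. -/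
def bF {s r : ℕ} (φ : Fld s r) (j : ℤ) (f : FFock s r) : FFock s r :=
  match j with
  | Int.ofNat n => φ.comm n • MvPowerSeries.pderiv ℂ (φ.conj, n) f
  | Int.negSucc n => MvPowerSeries.X (φ, n) * f

/-- Membership in the even part `F_c^{0}`. -/
def IsEvenF {s r : ℕ} (f : FFock s r) : Prop :=
  ∀ m : (Fld s r × ℕ) →₀ ℕ, MvPowerSeries.coeff m f ≠ 0 → Even m.degree

/-- The CKP hierarchy in the Weyl module, coefficient by coefficient of the tensor square:
`∑_a ∑_i (b^{-a}_i τ ⊗ b^{+a}_{-i} τ - b^{+a}_i τ ⊗ b^{-a}_{-i} τ)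
  + ∑_c ∑_i (-1)^{i+1/2} b^c_i τ ⊗ b^c_{-i} τ = 0`.
Each coefficient of the sum over `i` has only finitely many non-zero terms. -/
def FermionicCKP {s r : ℕ} (f : FFock s r) : Prop :=
  ∀ m m' : (Fld s r × ℕ) →₀ ℕ,
    ∑ᶠ j : ℤ,
      ((∑ a : Fin s,
          (MvPowerSeries.coeff m (bF (Sum.inl (a, false)) j f) *
              MvPowerSeries.coeff m' (bF (Sum.inl (a, true)) (-j - 1) f) -
            MvPowerSeries.coeff m (bF (Sum.inl (a, true)) j f) *
              MvPowerSeries.coeff m' (bF (Sum.inl (a, false)) (-j - 1) f))) +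
        ∑ c : Fin r,
          (-1 : ℂ) ^ (j + 1) *
            (MvPowerSeries.coeff m (bF (Sum.inr c) j f) *
              MvPowerSeries.coeff m' (bF (Sum.inr c) (-j - 1) f))) = 0

/-! ## The bosonic Fock space -/

/-- The times: `inl (a, n)` is `t^{(a)}_{n+1}` and `inr (c, n)` is `t^{(s+c)}_{2n+1}`. -/
abbrev Time (s r : ℕ) := (Fin s × ℕ) ⊕ (Fin r × ℕ)

/-- The components: `inl a` is the `a`-th charged one, `inr c` the `c`-th neutral one. -/
abbrev Cmp (s r : ℕ) := Fin s ⊕ Fin r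

/-- The time `t^{(b)}_k`, if there is one (`k ≥ 1`, and `k` odd if `b` is neutral). -/
def timeIdx {s r : ℕ} : Cmp s r → ℕ → Option (Time s r)
  | Sum.inl _, 0 => none
  | Sum.inl a, k + 1 => some (Sum.inl (a, k))
  | Sum.inr c, k => if k % 2 = 1 then some (Sum.inr (c, k / 2)) else none

/-- Formal power series in the times. -/
abbrev TSer (s r : ℕ) := MvPowerSeries (Time s r) ℂ

/-- The variable `t^{(b)}_k`, embedded by `e` into a larger set of variables; `0` if there is no
such time. -/
def tvar {s r : ℕ} {V : Type} (e : Time s r → V) (b : Cmp s r) (k : ℕ) : MvPowerSeries V ℂ :=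
  match timeIdx b k with
  | some i => MvPowerSeries.X (e i)
  | none => 0

/-- The operator `∂/∂t^{(b)}_k`; `0` if there is no such time. -/
def dvar {s r : ℕ} {V : Type} (e : Time s r → V) (b : Cmp s r) (k : ℕ) :
    Module.End ℂ (MvPowerSeries V ℂ) :=
  match timeIdx b k with
  | some i => (MvPowerSeries.pderiv ℂ (e i)).toLinearMap
  | none => 0

/-- `1 / k` for charged and `2 / k` for neutral components. -/
def dfac {s r : ℕ} : Cmp s r → ℕ → ℂ
  | Sum.inl _, k => 1 / k
  | Sum.inr _, k => 2 / k

/-- The Grassmann variables: `inl (a, k)` is `ξ^a_k`, `k ≠ 0`, and `inr (c, n)` is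
`ξ^{s+c}_{n+1/2}`. -/
abbrev Xi (s r : ℕ) := (Fin s × {k : ℤ // k ≠ 0}) ⊕ (Fin r × ℕ)

/-- `ξ^a_{n+1}` for `δ = true`, `ξ^a_{-(n+1)}` for `δ = false`. -/
def xi {s r : ℕ} (a : Fin s) (δ : Bool) (n : ℕ) : Xi s r :=
  Sum.inl (a, ⟨(if δ then 1 else -1) * ((n : ℤ) + 1), by cases δ <;> simp <;> omega⟩)

/-- The number of a component in the list of all `s + r` components. -/
def cmpNum {s r : ℕ} : Cmp s r → ℕ
  | Sum.inl a => a
  | Sum.inr c => s + c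

/-- The component of a Grassmann variable. -/
def Xi.cmp {s r : ℕ} : Xi s r → Cmp s r
  | Sum.inl (a, _) => Sum.inl a
  | Sum.inr (c, _) => Sum.inr c

/-- The position of a Grassmann variable in its component. -/
def Xi.pos {s r : ℕ} : Xi s r → ℤ
  | Sum.inl (_, k) => k
  | Sum.inr (_, n) => n

/-- The lexicographical order of the Grassmann variables. -/
def Xi.Before {s r : ℕ} (ξ η : Xi s r) : Prop :=
  cmpNum ξ.cmp < cmpNum η.cmp ∨ (ξ.cmp = η.cmp ∧ ξ.pos < η.pos)

/-- The (completed) bosonic Fock space `C_{s,r}`: formal series in the commuting times and the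
anticommuting `ξ`'s. The value `τ w` is the coefficient `τ_w(t)` of the monomial that is the
product of the elements of `w` in increasing lexicographical order. -/
abbrev BFock (s r : ℕ) := Finset (Xi s r) → TSer s r

/-- The vacuum `1` of the bosonic Fock space. -/
def bvac {s r : ℕ} : BFock s r := Pi.single ∅ 1

open Classical in
/-- The sign of moving `ξ` through the variables of `w` that come before it. -/
def lexSign {s r : ℕ} (w : Finset (Xi s r)) (ξ : Xi s r) : ℂ :=
  (-1) ^ (w.filter fun η => η.Before ξ).card

open Classical in
/-- Left multiplication by `ξ`. -/
def gmul {s r : ℕ} (ξ : Xi s r) (τ : BFock s r) : BFock s r := fun w =>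
  if ξ ∈ w then lexSign w ξ • τ (w.erase ξ) else 0

open Classical in
/-- The left derivative `∂/∂ξ`. -/
def gder {s r : ℕ} (ξ : Xi s r) (τ : BFock s r) : BFock s r := fun w =>
  if ξ ∈ w then 0 else lexSign w ξ • τ (insert ξ w)

open Classical in
/-- The operator `S_b`, which changes the sign of the `ξ`'s of the components before `b`. -/
def gS {s r : ℕ} (b : Cmp s r) (τ : BFock s r) : BFock s r := fun w =>
  (-1 : ℂ) ^ (w.filter fun η => cmpNum η.cmp < cmpNum b).card • τ w

open Classical in
/-- The number of `ξ^a_k` in `w` with `k < 0`. -/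
def iNum {s r : ℕ} (a : Fin s) (w : Finset (Xi s r)) : ℕ :=
  (w.filter fun η => η.cmp = Sum.inl a ∧ η.pos < 0).card

open Classical in
/-- The number of `ξ^a_k` in `w` with `0 < k`. -/
def jNum {s r : ℕ} (a : Fin s) (w : Finset (Xi s r)) : ℕ :=
  (w.filter fun η => η.cmp = Sum.inl a ∧ 0 < η.pos).card

/-- The projection onto the eigenspace with eigenvalue `c` of the operator
`T_a = -∑_{k>0} ξ^a_k ∂/∂ξ^a_k + ∑_{k<0} ξ^a_k ∂/∂ξ^a_k`, of which the monomial `w` is an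
eigenvector with eigenvalue `iNum a w - jNum a w`. -/
def chargeProj {s r : ℕ} (a : Fin s) (c : ℤ) (τ : BFock s r) : BFock s r := fun w =>
  if (iNum a w : ℤ) - jNum a w = c then τ w else 0

/-- The coefficient of `z ^ g` in
`Ξ^{+a}(z) = -∑_{k>0} k ξ^a_k z^{k-1} + ∑_{k>0} ∂/∂ξ^a_{-k} z^{-k-1}`,
`Ξ^{-a}(z) = ∑_{k>0} k ξ^a_{-k} z^{k-1} + ∑_{k>0} ∂/∂ξ^a_k z^{-k-1}`,
`Ξ^{c}(z) = ∑_{i∈1/2+ℤ≥0} ((-1)^{i-1/2} 2i ξ^c_i z^{i-1/2} + ∂/∂ξ^c_i z^{-i-1/2})`. -/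
def XiMode {s r : ℕ} (φ : Fld s r) (g : ℤ) (τ : BFock s r) : BFock s r :=
  match φ, g with
  | Sum.inl (a, δ), Int.ofNat n => (-(sg δ) * ((n : ℂ) + 1)) • gmul (xi a δ n) τ
  | Sum.inl (_, _), Int.negSucc 0 => 0
  | Sum.inl (a, δ), Int.negSucc (n + 1) => gder (xi a (!δ) n) τ
  | Sum.inr c, Int.ofNat n => ((-1 : ℂ) ^ n * (2 * n + 1)) • gmul (Sum.inr (c, n)) τ
  | Sum.inr c, Int.negSucc n => gder (Sum.inr (c, n)) τ

/-- The component of a field. -/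
def Fld.cmp {s r : ℕ} : Fld s r → Cmp s r
  | Sum.inl (a, _) => Sum.inl a
  | Sum.inr c => Sum.inr c

/-- The sign in the exponents of the vertex operator of a field. -/
def Fld.sgn {s r : ℕ} : Fld s r → ℂ
  | Sum.inl (_, δ) => sg δ
  | Sum.inr _ => 1

/-- The coefficient of `z ^ g` in `Ξ^{±a}(z) z^{±T_a} S_a τ`, resp. `Ξ^c(z) S_c τ`. -/
def grass {s r : ℕ} (φ : Fld s r) (τ : BFock s r) (g : ℤ) : BFock s r :=
  match φ with
  | Sum.inl (a, δ) => fun w =>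
      ∑ᶠ h : ℤ, XiMode (Sum.inl (a, δ)) h
        (chargeProj a ((if δ then 1 else -1) * (g - h)) (gS (Sum.inl a) τ)) w
  | Sum.inr c => XiMode (Sum.inr c) g (gS (Sum.inr c) τ)

/-- `exp(±∑ z^k t^{(a)}_k)`, resp. `exp(∑_{k odd} z^k t^{(c)}_k)`, as a series in `z`. -/
def expT {s r : ℕ} (φ : Fld s r) : PowerSeries (TSer s r) :=
  pexp (PowerSeries.mk fun k => φ.sgn • tvar id φ.cmp k)

/-- `exp(±∑ z^{-k} k^{-1} ∂/∂t^{(a)}_k)`, resp. `exp(2 ∑_{k odd} z^{-k} k^{-1} ∂/∂t^{(c)}_k)`,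
as a series in `z⁻¹`. -/
def expD {s r : ℕ} (φ : Fld s r) : PowerSeries (Module.End ℂ (TSer s r)) :=
  pexp (PowerSeries.mk fun k => (φ.sgn * dfac φ.cmp k) • dvar id φ.cmp k)

/-- The mode `j + 1/2`, which is the coefficient of `z^{-j-1}`, of the vertex operators
`exp(±z·t^{(a)}) Ξ^{±a}(z) z^{±T_a} exp(±z⁻¹·∂̃_{t^{(a)}}) S_a` and
`exp(z∘t^{(c)}) Ξ^c(z) exp(2 z⁻¹∘∂̃_{t^{(c)}}) S_c`.
Each coefficient of the result is a sum of finitely many non-zero terms. -/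
def bB {s r : ℕ} (φ : Fld s r) (j : ℤ) (τ : BFock s r) : BFock s r := fun w m =>
  ∑ᶠ p : ℕ, MvPowerSeries.coeff m
    (PowerSeries.coeff p (expT φ) *
      ∑ᶠ q : ℕ, PowerSeries.coeff q (expD φ) (grass φ τ (-j - 1 - p + q) w))

/-- The bosonization: the vacuum goes to `1`, the modes of the fields become the modes of the
vertex operators, and the map is continuous (every coefficient of the image depends on finitely
many coefficients of the argument). -/
structure IsBosonization {s r : ℕ} (σ : FFock s r ≃ₗ[ℂ] BFock s r) : Prop where
  vacuum : σ 1 = bvac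
  intertwines : ∀ (φ : Fld s r) (j : ℤ) (f : FFock s r), σ (bF φ j f) = bB φ j (σ f)
  continuous : ∀ (w : Finset (Xi s r)) (m : Time s r →₀ ℕ),
    ∃ S : Finset ((Fld s r × ℕ) →₀ ℕ), ∀ f : FFock s r,
      (∀ μ ∈ S, MvPowerSeries.coeff μ f = 0) → MvPowerSeries.coeff m (σ f w) = 0

/-- The elements of the polynomial module `F_c`. -/
def IsPolyF {s r : ℕ} (f : FFock s r) : Prop :=
  ∃ p : MvPolynomial (Fld s r × ℕ) ℂ, (p : FFock s r) = f

/-- The elements of the polynomial Fock space `C_{s,r}`. -/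
def IsPolyB {s r : ℕ} (τ : BFock s r) : Prop :=
  {w | τ w ≠ 0}.Finite ∧ ∀ w, ∃ p : MvPolynomial (Time s r) ℂ, (p : TSer s r) = τ w

/-! ## The Hirota bilinear equations -/

/-- Formal power series in two sets of times, `t` (`inl`) and `t̄` (`inr`). -/
abbrev TSer2 (s r : ℕ) := MvPowerSeries (Time s r ⊕ Time s r) ℂ

/-- `f(t)` as a series in `t, t̄`. -/
def inT {s r : ℕ} (f : TSer s r) : TSer2 s r :=
  MvPowerSeries.rename (Function.Embedding.inl : Time s r ↪ Time s r ⊕ Time s r) f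

/-- `f(t̄)` as a series in `t, t̄`. -/
def inTbar {s r : ℕ} (f : TSer s r) : TSer2 s r :=
  MvPowerSeries.rename (Function.Embedding.inr : Time s r ↪ Time s r ⊕ Time s r) f

/-- `t^{(b)}_k - t̄^{(b)}_k`. -/
def tdiff {s r : ℕ} (b : Cmp s r) (k : ℕ) : TSer2 s r :=
  tvar Sum.inl b k - tvar Sum.inr b k

/-- `∂/∂t^{(b)}_k - ∂/∂t̄^{(b)}_k`. -/
def ddiff {s r : ℕ} (b : Cmp s r) (k : ℕ) : Module.End ℂ (TSer2 s r) :=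
  dvar Sum.inl b k - dvar Sum.inr b k

open Classical in
/-- `N_b(w, ξ^b_n)`: the sign of the number of `ξ^b_p` in `w` with `p < n`. -/
def Nsign {s r : ℕ} (w : Finset (Xi s r)) (ξ : Xi s r) : ℂ :=
  (-1) ^ (w.filter fun η => η.cmp = ξ.cmp ∧ η.pos < ξ.pos).card

open Classical in
/-- The coefficient of `z ^ g` in the brackets
`B^{+a}_w(t,z) = ∑_{k<0, ξ^a_k∉w} N z^k τ_{w∪ξ^a_k} - ∑_{k>0, ξ^a_k∈w} k N z^k τ_{w∖ξ^a_k}`,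
`B^{-a}_w(t,z) = ∑_{k>0, ξ^a_k∉w} N z^{-k} τ_{w∪ξ^a_k} - ∑_{k<0, ξ^a_k∈w} k N z^{-k} τ_{w∖ξ^a_k}`,
`B^c_w(t,z) = ∑_{ξ^c_m∉w} N z^{-m-1/2} τ_{w∪ξ^c_m}
  - ∑_{ξ^c_m∈w} (-1)^{m+1/2} 2m N z^{m-1/2} τ_{w∖ξ^c_m}`. -/
def bracket {s r : ℕ} (φ : Fld s r) (τ : BFock s r) (w : Finset (Xi s r)) (g : ℤ) : TSer s r :=
  match φ, g with
  | Sum.inl (_, _), Int.ofNat 0 => 0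
  | Sum.inl (a, δ), Int.ofNat (n + 1) =>
      if xi a δ n ∈ w then
        -((sg δ * ((n : ℂ) + 1) * Nsign w (xi a δ n)) • τ (w.erase (xi a δ n)))
      else 0
  | Sum.inl (a, δ), Int.negSucc n =>
      if xi a (!δ) n ∈ w then 0
      else Nsign w (xi a (!δ) n) • τ (insert (xi a (!δ) n) w)
  | Sum.inr c, Int.ofNat n =>
      if Sum.inr (c, n) ∈ w then
        -(((-1 : ℂ) ^ (n + 1) * (2 * n + 1) * Nsign w (Sum.inr (c, n))) •
          τ (w.erase (Sum.inr (c, n))))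
      else 0
  | Sum.inr c, Int.negSucc n =>
      if Sum.inr (c, n) ∈ w then 0
      else Nsign w (Sum.inr (c, n)) • τ (insert (Sum.inr (c, n)) w)

/-- The residue at `z = 0` of `X(z) Y(z⁻¹) C(z)`, where `X` is a series in `z` of functions, `Y` a
series in `z⁻¹` of operators, and `C g` is the coefficient of `z ^ g` in `C(z)`. -/
def resid {s r : ℕ} (X : PowerSeries (TSer2 s r)) (Y : PowerSeries (Module.End ℂ (TSer2 s r)))
    (C : ℤ → TSer2 s r) : TSer2 s r := fun M =>
  ∑ᶠ p : ℕ, MvPowerSeries.coeff M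
    (PowerSeries.coeff p X * ∑ᶠ q : ℕ, PowerSeries.coeff q Y (C (q - p - 1)))

/-- The exponent `i_a - ī_a - j_a + j̄_a`. -/
def zexp {s r : ℕ} (a : Fin s) (w w' : Finset (Xi s r)) : ℤ :=
  (iNum a w : ℤ) - iNum a w' - jNum a w + jNum a w'

/-- The residue of
`z^{i_a-ī_a-j_a+j̄_a} e^{z·(t^{(a)}-t̄^{(a)})} e^{z⁻¹·(∂̃_{t^{(a)}}-∂̃_{t̄^{(a)}})}
  B^{+a}_w(t,z) B^{-a}_{w'}(t̄,z)`. -/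
def hirotaPlus {s r : ℕ} (τ : BFock s r) (w w' : Finset (Xi s r)) (a : Fin s) : TSer2 s r :=
  resid
    (pexp (PowerSeries.mk fun k => tdiff (Sum.inl a) k))
    (pexp (PowerSeries.mk fun k => (1 / k : ℂ) • ddiff (Sum.inl a) k))
    (fun g => ∑ᶠ h : ℤ, inT (bracket (Sum.inl (a, true)) τ w h) *
      inTbar (bracket (Sum.inl (a, false)) τ w' (g - zexp a w w' - h)))

/-- The residue of
`(-z)^{j_a-j̄_a-i_a+ī_a} e^{-((-z)·(t^{(a)}-t̄^{(a)}))} e^{-((-z⁻¹)·(∂̃_{t^{(a)}}-∂̃_{t̄^{(a)}}))}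
  B^{-a}_w(t,-z) B^{+a}_{w'}(t̄,-z)`. -/
def hirotaMinus {s r : ℕ} (τ : BFock s r) (w w' : Finset (Xi s r)) (a : Fin s) : TSer2 s r :=
  resid
    (pexp (PowerSeries.mk fun k => (-(-1 : ℂ) ^ k) • tdiff (Sum.inl a) k))
    (pexp (PowerSeries.mk fun k => (-(-1 : ℂ) ^ k / k) • ddiff (Sum.inl a) k))
    (fun g => (-1 : ℂ) ^ g • ∑ᶠ h : ℤ, inT (bracket (Sum.inl (a, false)) τ w h) *
      inTbar (bracket (Sum.inl (a, true)) τ w' (g + zexp a w w' - h)))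

/-- The residue of
`e^{z∘(t^{(c)}-t̄^{(c)})} e^{2(z⁻¹∘(∂̃_{t^{(c)}}-∂̃_{t̄^{(c)}}))} B^c_w(t,z) B^c_{w'}(t̄,-z)`. -/
def hirotaNeutral {s r : ℕ} (τ : BFock s r) (w w' : Finset (Xi s r)) (c : Fin r) : TSer2 s r :=
  resid
    (pexp (PowerSeries.mk fun k => tdiff (Sum.inr c) k))
    (pexp (PowerSeries.mk fun k => (2 / k : ℂ) • ddiff (Sum.inr c) k))
    (fun g => ∑ᶠ h : ℤ, inT (bracket (Sum.inr c) τ w h) *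
      inTbar ((-1 : ℂ) ^ (g - h) • bracket (Sum.inr c) τ w' (g - h)))

/-- The multicomponent CKP hierarchy of Hirota bilinear equations. -/
def HirotaCKP {s r : ℕ} (τ : BFock s r) : Prop :=
  ∀ w w' : Finset (Xi s r), Odd w.card → Odd w'.card →
    ∑ a : Fin s, (hirotaPlus τ w w' a + hirotaMinus τ w w' a) +
      ∑ c : Fin r, hirotaNeutral τ w w' c = 0

/-! ## Matrix pseudo-differential operators -/

/-- The index set `{1, …, 2s+r}`: `inl a` is `a`, `inr (inl a)` is `s + a`, and `inr (inr c)` is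
`2s + c`. -/
abbrev Idx (s r : ℕ) := Fin s ⊕ (Fin s ⊕ Fin r)

/-- Functions of `x` and `t`: power series in `x` with coefficients in the series in `t`. -/
abbrev XSer (s r : ℕ) := PowerSeries (TSer s r)

/-- `f(t)` with every `t^{(b)}_1` replaced by `t^{(b)}_1 + x`, by Taylor's formula. -/
def shiftX {s r : ℕ} (f : TSer s r) : XSer s r :=
  PowerSeries.mk fun n =>
    ((n.factorial : ℂ)⁻¹) • ((∑ b : Cmp s r, dvar id b 1 : Module.End ℂ (TSer s r)) ^ n) f

/-- `(2s+r) × (2s+r)`-matrices of functions of `x` and `t`. -/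
abbrev Mat (s r : ℕ) := Matrix (Idx s r) (Idx s r) (XSer s r)

/-- The `l`-th `x`-derivative of a matrix. -/
def dx {s r : ℕ} (l : ℕ) (M : Mat s r) : Mat s r :=
  M.map fun f => (PowerSeries.derivative (TSer s r))^[l] f

/-- The derivative of a matrix with respect to a time. -/
def dtMat {s r : ℕ} (i : Time s r) (M : Mat s r) : Mat s r :=
  M.map fun f => PowerSeries.mk fun n => MvPowerSeries.pderiv ℂ i (PowerSeries.coeff n f)

/-- The coefficient sequences that vanish for large indices. -/
def boundedAbove (s r : ℕ) : AddSubgroup (ℤ → Mat s r) where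
  carrier := {f | ∃ N : ℤ, ∀ k, N < k → f k = 0}
  zero_mem' := ⟨0, fun _ _ => rfl⟩
  add_mem' := by
    rintro f g ⟨N, hN⟩ ⟨N', hN'⟩
    refine ⟨max N N', fun k hk => ?_⟩
    have h1 := hN k (lt_of_le_of_lt (le_max_left _ _) hk)
    have h2 := hN' k (lt_of_le_of_lt (le_max_right _ _) hk)
    simp [h1, h2]
  neg_mem' := by
    rintro f ⟨N, hN⟩
    exact ⟨N, fun k hk => by simp [hN k hk]⟩

/-- Formal matrix pseudo-differential operators `∑_{k ≤ N} M_k ∂^k`, `∂ = ∂/∂x`. -/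
def PDO (s r : ℕ) : Type := boundedAbove s r

namespace PDO

variable {s r : ℕ}

instance : AddCommGroup (PDO s r) := inferInstanceAs (AddCommGroup (boundedAbove s r))

/-- The coefficient of `∂^k`. -/
def coeff (P : PDO s r) (k : ℤ) : Mat s r := P.1 k

/-- `M ∂^k`. -/
def single (k : ℤ) (M : Mat s r) : PDO s r :=
  ⟨Pi.single k M, k, fun j hj => by simp [hj.ne']⟩

instance : One (PDO s r) := ⟨single 0 1⟩

/-- The product, by the Leibniz rule
`A ∂^i ∘ B ∂^j = ∑_l (i choose l) A (∂_x^l B) ∂^{i+j-l}`. -/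
instance : Mul (PDO s r) where
  mul P Q :=
    ⟨fun n => ∑ᶠ il : ℤ × ℕ,
        Ring.choose il.1 il.2 • (P.coeff il.1 * dx il.2 (Q.coeff (n - il.1 + il.2))), by
      obtain ⟨N, hN⟩ := P.2
      obtain ⟨N', hN'⟩ := Q.2
      refine ⟨N + N', fun n hn => finsum_eq_zero_of_forall_eq_zero fun il => ?_⟩
      by_cases hi : N < il.1
      · have h0 : P.coeff il.1 = 0 := hN _ hi
        simp [h0]
      · have h0 : Q.coeff (n - il.1 + il.2) = 0 := hN' _ (by omega)
        have h1 : dx il.2 (0 : Mat s r) = 0 := by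
          ext1 i j
          simp [dx, iterate_map_zero]
        simp [h0, h1]⟩

/-- The powers `P^j`. -/
def npow (P : PDO s r) : ℕ → PDO s r
  | 0 => 1
  | j + 1 => npow P j * P

instance : Pow (PDO s r) ℕ := ⟨npow⟩

/-- The formal adjoint `(∑ M_k ∂^k)^* = ∑ (-∂)^k ∘ M_kᵀ`. -/
def adj (P : PDO s r) : PDO s r :=
  ⟨fun n => ∑ᶠ l : ℕ,
      (((n + l).negOnePow : ℤ) * Ring.choose (n + l) l) • dx l (P.coeff (n + l)).transpose, by
    obtain ⟨N, hN⟩ := P.2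
    refine ⟨N, fun n hn => finsum_eq_zero_of_forall_eq_zero fun l => ?_⟩
    have h0 : P.coeff (n + l) = 0 := hN _ (by omega)
    have h1 : dx l (0 : Mat s r) = 0 := by
      ext1 i j
      simp [dx, iterate_map_zero]
    simp [h0, h1]⟩

/-- The differential part `P_+`. -/
def pos (P : PDO s r) : PDO s r :=
  ⟨fun k => if 0 ≤ k then P.coeff k else 0, by
    obtain ⟨N, hN⟩ := P.2
    exact ⟨N, fun k hk => by
      have h0 : P.coeff k = 0 := hN k hk
      simp [h0]⟩⟩

/-- The integral part `P_-`. -/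
def neg (P : PDO s r) : PDO s r :=
  ⟨fun k => if k < 0 then P.coeff k else 0, 0, fun k hk => by simp [hk.le]⟩

/-- The derivative of the coefficients with respect to a time. -/
def dt (i : Time s r) (P : PDO s r) : PDO s r :=
  ⟨fun k => dtMat i (P.coeff k), by
    obtain ⟨N, hN⟩ := P.2
    refine ⟨N, fun k hk => ?_⟩
    have h0 : P.coeff k = 0 := hN k hk
    simp only [h0]
    ext1 a b
    ext1 n
    simp [dtMat]⟩

/-- The commutator. -/
def comm (P Q : PDO s r) : PDO s r := P * Q - Q * P

end PDO

/-! ## The wave functions -/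

open Classical in
/-- The coefficient in `τ` of the monomial consisting of `ξ` and `η`, in lexicographical order. -/
def tau2 {s r : ℕ} (τ : BFock s r) (ξ η : Xi s r) : TSer s r := τ {ξ, η}

/-- `Y` applied to `f`, for a series `Y` of operators and a series `f` of functions. -/
def applyOp {s r : ℕ} (Y : PowerSeries (Module.End ℂ (TSer s r))) (f : PowerSeries (TSer s r)) :
    PowerSeries (TSer s r) :=
  PowerSeries.mk fun n => ∑ q ∈ Finset.HasAntidiagonal.antidiagonal n,
    PowerSeries.coeff q.1 Y (PowerSeries.coeff q.2 f)

/-- `exp(ε z⁻¹·∂̃_{t^{(a)}})` as a series in `y = z⁻¹`. -/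
def eUp {s r : ℕ} (ε : Bool) (a : Fin s) : PowerSeries (Module.End ℂ (TSer s r)) :=
  pexp (PowerSeries.mk fun k => (sg ε / k) • dvar id (Sum.inl a : Cmp s r) k)

/-- `exp(-ε ((-z⁻¹)·∂̃_{t^{(a)}}))` as a series in `y = z⁻¹`. -/
def eDown {s r : ℕ} (ε : Bool) (a : Fin s) : PowerSeries (Module.End ℂ (TSer s r)) :=
  pexp (PowerSeries.mk fun k => (-(sg ε) * (-1 : ℂ) ^ k / k) • dvar id (Sum.inl a : Cmp s r) k)

/-- `exp(2 ε (z⁻¹∘∂̃_{t^{(s+c)}}))` as a series in `y = z⁻¹`. -/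
def eNeut {s r : ℕ} (ε : Bool) (c : Fin r) : PowerSeries (Module.End ℂ (TSer s r)) :=
  pexp (PowerSeries.mk fun k => (2 * sg ε / k) • dvar id (Sum.inr c : Cmp s r) k)

/-- The series `τ_0 P^ε(εz)_{a,j}` in `y = z⁻¹`, for a row `a ≤ s`. The coefficients of
`y^0, y^1, y^2, …` of the argument of the exponential operator are listed. -/
def numA {s r : ℕ} (τ : BFock s r) (ε : Bool) (a : Fin s) : Idx s r → PowerSeries (TSer s r)
  | Sum.inl b =>
      if a = b then
        applyOp (eUp ε a) (PowerSeries.mk fun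
          | 0 => τ ∅
          | 1 => 0
          | n + 2 => -tau2 τ (xi a (!ε) n) (xi a ε 0))
      else
        applyOp (eUp ε b) (PowerSeries.mk fun
          | 0 => 0
          | n + 1 => -(sg ε • tau2 τ (xi b (!ε) n) (xi a ε 0)))
  | Sum.inr (Sum.inl b) =>
      if a = b then
        applyOp (eDown ε a) (PowerSeries.mk fun
          | 0 => 0
          | n + 1 => (-1 : ℂ) ^ (n + 1) • tau2 τ (xi a ε (n + 1)) (xi a ε 0))
      else
        applyOp (eDown ε b) (PowerSeries.mk fun
          | 0 => 0
          | n + 1 => -((sg ε * (-1 : ℂ) ^ (n + 1)) • tau2 τ (xi b ε n) (xi a ε 0)))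
  | Sum.inr (Sum.inr c) =>
      applyOp (eNeut ε c) (PowerSeries.mk fun
        | 0 => 0
        | n + 1 => -((sg ε * sg ε ^ (n + 1)) • tau2 τ (xi a ε 0) (Sum.inr (c, n))))

/-- The series `τ_0 P^ε(εz)_{2s+c,a}` in `y = z⁻¹`. -/
def numCA {s r : ℕ} (τ : BFock s r) (ε : Bool) (c : Fin r) (a : Fin s) :
    PowerSeries (TSer s r) :=
  applyOp (eUp ε a) (PowerSeries.mk fun
    | 0 => 0
    | n + 1 => tau2 τ (xi a (!ε) n) (Sum.inr (c, 0)))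

/-- The series `τ_0 P^ε(εz)_{2s+c,2s+d}` in `y = z⁻¹`. -/
def numCC {s r : ℕ} (τ : BFock s r) (ε : Bool) (c d : Fin r) : PowerSeries (TSer s r) :=
  if c = d then
    applyOp (eNeut ε c) (PowerSeries.mk fun
      | 0 => τ ∅
      | 1 => 0
      | n + 2 => -(sg ε ^ (n + 2) • tau2 τ (Sum.inr (c, 0)) (Sum.inr (c, n + 1))))
  else
    applyOp (eNeut ε d) (PowerSeries.mk fun
      | 0 => 0
      | n + 1 => sg ε ^ (n + 1) • tau2 τ (Sum.inr (c, 0)) (Sum.inr (d, n)))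

/-- Interchange of the indices `a` and `s + a`. -/
def swapIdx {s r : ℕ} : Idx s r → Idx s r
  | Sum.inl a => Sum.inr (Sum.inl a)
  | Sum.inr (Sum.inl a) => Sum.inl a
  | Sum.inr (Sum.inr c) => Sum.inr (Sum.inr c)

/-- The coefficient of `ζ^{-n}` in a series that is given in `y = z⁻¹`, where `ζ = εz`, divided
by `τ_0`. -/
def symb {s r : ℕ} (τ : BFock s r) (ε : Bool) (f : PowerSeries (TSer s r)) (n : ℕ) : TSer s r :=
  (sg ε ^ n) • (PowerSeries.coeff n f * (τ ∅)⁻¹)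

/-- The coefficient of `∂^{-n}` in the entries of `P^ε(∂)`, at `x = 0`. The rows `a` and `2s+c` are
explicit; the remaining entries are
`P^ε(∂)_{s+a,j} = P^{-ε}(∂)_{a,j'}` and `P^ε(∂)_{2s+c,s+a} = P^{-ε}(∂)_{2s+c,a}`, where `j ↦ j'`
interchanges `b` and `s + b`. -/
def waveCoeff {s r : ℕ} (τ : BFock s r) (ε : Bool) (n : ℕ) : Idx s r → Idx s r → TSer s r
  | Sum.inl a, j => symb τ ε (numA τ ε a j) n
  | Sum.inr (Sum.inl a), j => symb τ (!ε) (numA τ (!ε) a (swapIdx j)) n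
  | Sum.inr (Sum.inr c), Sum.inl a => symb τ ε (numCA τ ε c a) n
  | Sum.inr (Sum.inr c), Sum.inr (Sum.inl a) => symb τ (!ε) (numCA τ (!ε) c a) n
  | Sum.inr (Sum.inr c), Sum.inr (Sum.inr d) => symb τ ε (numCC τ ε c d) n

/-- The wave operator `P^ε(x,t,∂)`. -/
def waveOp {s r : ℕ} (τ : BFock s r) (ε : Bool) : PDO s r :=
  ⟨fun k => if k ≤ 0 then Matrix.of fun i j => shiftX (waveCoeff τ ε (-k).toNat i j) else 0,
    0, fun k hk => by simp [hk]⟩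

/-- The diagonal entries of `S^ε(t, εz)`, as series in `z`: `exp(ε z·t^{(a)})`,
`exp(-ε ((-z)·t^{(a)}))` and `exp(ε z∘t^{(s+c)})`. -/
def waveS {s r : ℕ} (ε : Bool) : Idx s r → PowerSeries (XSer s r)
  | Sum.inl a => pexp (PowerSeries.mk fun k =>
      sg ε • PowerSeries.C (tvar id (Sum.inl a : Cmp s r) k))
  | Sum.inr (Sum.inl a) => pexp (PowerSeries.mk fun k =>
      (-(sg ε) * (-1 : ℂ) ^ k) • PowerSeries.C (tvar id (Sum.inl a : Cmp s r) k))
  | Sum.inr (Sum.inr c) => pexp (PowerSeries.mk fun k =>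
      sg ε • PowerSeries.C (tvar id (Sum.inr c : Cmp s r) k))

/-- `exp(ε x z)` as a series in `z`. -/
def waveX {s r : ℕ} (ε : Bool) : PowerSeries (XSer s r) :=
  pexp (PowerSeries.mk fun k => if k = 1 then sg ε • (PowerSeries.X : XSer s r) else 0)

/-- The coefficient of `z^n` in the entry `i, k` of the wave function
`V^ε(x,t,z) = P^ε(x,t,εz) S^ε(t,εz) e^{εxz}`. Each coefficient of the result is a sum of finitely
many non-zero terms. -/
def waveV {s r : ℕ} (τ : BFock s r) (ε : Bool) (i k : Idx s r) (n : ℤ) : XSer s r :=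
  PowerSeries.mk fun l m => ∑ᶠ p : ℕ, MvPowerSeries.coeff m (PowerSeries.coeff l
    (PowerSeries.coeff p (waveS ε k * waveX ε) *
      (sg ε ^ (n - p) • (waveOp τ ε).coeff (n - p) i k)))

/-- The bilinear identity `Res V^+(x,t,z) V^-(x̄,t̄,z)ᵀ dz = 0`, coefficient by coefficient in
`x, t` and `x̄, t̄`. -/
def WaveBilinear {s r : ℕ} (τ : BFock s r) : Prop :=
  ∀ (i j : Idx s r) (l l' : ℕ) (m m' : Time s r →₀ ℕ),
    ∑ᶠ n : ℤ, ∑ k : Idx s r,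
      MvPowerSeries.coeff m (PowerSeries.coeff l (waveV τ true i k n)) *
        MvPowerSeries.coeff m' (PowerSeries.coeff l' (waveV τ false j k (-1 - n))) = 0

/-! ## Dressing -/

/-- The matrix unit `E_{ii}`. -/
def eMat {s r : ℕ} (i : Idx s r) : Mat s r := Matrix.single i i 1

/-- The matrix `N + I = ∑_a (E_{a,s+a} + E_{s+a,a}) + ∑_c E_{2s+c,2s+c}`, as an operator. -/
def opNI (s r : ℕ) : PDO s r :=
  PDO.single 0 (∑ a : Fin s,
      (Matrix.single (Sum.inl a) (Sum.inr (Sum.inl a)) 1 +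
        Matrix.single (Sum.inr (Sum.inl a)) (Sum.inl a) 1) +
    ∑ c : Fin r, eMat (Sum.inr (Sum.inr c)))

/-- The constant operator `∂^k E_{aa} - (-∂)^k E_{s+a,s+a}`. -/
def chargedFlow {s r : ℕ} (a : Fin s) (k : ℕ) : PDO s r :=
  PDO.single k (eMat (Sum.inl a) - (-1 : ℤ) ^ k • eMat (Sum.inr (Sum.inl a)))

/-- The constant operator `∂^k E_{2s+c,2s+c}`. -/
def neutralFlow {s r : ℕ} (c : Fin r) (k : ℕ) : PDO s r :=
  PDO.single k (eMat (Sum.inr (Sum.inr c)))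

/-- `L = P (∑_a (∂ E_{aa} - ∂ E_{s+a,s+a}) + ∑_c ∂ E_{2s+c,2s+c}) P⁻¹`, with `Q = P⁻¹`. -/
def laxL {s r : ℕ} (P Q : PDO s r) : PDO s r :=
  P * PDO.single 1 (∑ a : Fin s, (eMat (Sum.inl a) - eMat (Sum.inr (Sum.inl a))) +
    ∑ c : Fin r, eMat (Sum.inr (Sum.inr c))) * Q

/-- `C^b = P E_{bb} P⁻¹`, with `Q = P⁻¹`. -/
def laxC {s r : ℕ} (P Q : PDO s r) (b : Idx s r) : PDO s r :=
  P * PDO.single 0 (eMat b) * Q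

/-- `D^a = P (E_{aa} - E_{s+a,s+a}) P⁻¹`, with `Q = P⁻¹`. -/
def laxD {s r : ℕ} (P Q : PDO s r) (a : Fin s) : PDO s r :=
  P * PDO.single 0 (eMat (Sum.inl a) - eMat (Sum.inr (Sum.inl a))) * Q

/-- `E^a = P (E_{aa} + E_{s+a,s+a}) P⁻¹`, with `Q = P⁻¹`. -/
def laxE {s r : ℕ} (P Q : PDO s r) (a : Fin s) : PDO s r :=
  P * PDO.single 0 (eMat (Sum.inl a) + eMat (Sum.inr (Sum.inl a))) * Q

/-- The Sato–Wilson equations for `P`, with `Q = P⁻¹`. -/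
structure SatoWilson {s r : ℕ} (P Q : PDO s r) : Prop where
  charged : ∀ (a : Fin s) (n : ℕ),
    PDO.dt (Sum.inl (a, n)) P = -((P * chargedFlow a (n + 1) * Q).neg * P)
  neutral : ∀ (c : Fin r) (n : ℕ),
    PDO.dt (Sum.inr (c, n)) P = -((P * neutralFlow c (2 * n + 1) * Q).neg * P)

/-- `X` satisfies the Lax–Sato equations `∂X/∂t^{(a)}_j = [(L^j D^a)_+, X]` and
`∂X/∂t^{(s+c)}_j = [(L^j C^{2s+c})_+, X]` (`j` odd in the latter). -/
structure LaxSato {s r : ℕ} (P Q X : PDO s r) : Prop where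
  charged : ∀ (a : Fin s) (n : ℕ),
    PDO.dt (Sum.inl (a, n)) X = PDO.comm ((laxL P Q ^ (n + 1) * laxD P Q a).pos) X
  neutral : ∀ (c : Fin r) (n : ℕ),
    PDO.dt (Sum.inr (c, n)) X =
      PDO.comm ((laxL P Q ^ (2 * n + 1) * laxC P Q (Sum.inr (Sum.inr c))).pos) X

/-- The behaviour of the Lax operators under the formal adjoint. -/
structure LaxSymmetry {s r : ℕ} (P Q : PDO s r) : Prop where
  adjC : ∀ c : Fin r, (laxC P Q (Sum.inr (Sum.inr c))).adj =
    opNI s r * laxC P Q (Sum.inr (Sum.inr c)) * opNI s r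
  adjD : ∀ a : Fin s, (laxD P Q a).adj = -(opNI s r * laxD P Q a * opNI s r)
  adjE : ∀ a : Fin s, (laxE P Q a).adj = opNI s r * laxE P Q a * opNI s r
  adjL : (laxL P Q).adj =
    opNI s r *
      ((∑ a : Fin s, laxE P Q a - ∑ c : Fin r, laxC P Q (Sum.inr (Sum.inr c))) * laxL P Q) *
      opNI s r
  noCharged : s = 0 → (laxL P Q).adj = -laxL P Q ∧
    ∀ c : Fin r, (laxC P Q (Sum.inr (Sum.inr c))).adj = laxC P Q (Sum.inr (Sum.inr c))
  noNeutral : r = 0 → (laxL P Q).adj = opNI s r * laxL P Q * opNI s r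

end MCKP

end

noncomputable section
namespace MCKP

/-! ## Formal exponentials -/

section Pexp

set_option linter.unusedSectionVars false

variable {E : Type*} [Ring E] [Algebra ℂ E]

/-- The operator on power series that acts on the `n`-th coefficient by `θ n`. -/
def coeffMap (θ : ℕ → E →ₗ[ℂ] E) (f : PowerSeries E) : PowerSeries E :=
  PowerSeries.mk fun n => θ n (PowerSeries.coeff n f)

@[simp] lemma coeff_coeffMap (θ : ℕ → E →ₗ[ℂ] E) (f : PowerSeries E) (n : ℕ) :
    PowerSeries.coeff n (coeffMap θ f) = θ n (PowerSeries.coeff n f) := by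
  simp [coeffMap]

/-- The Leibniz rule for a family of operators on coefficients. -/
def IsCoeffDeriv (θ : ℕ → E →ₗ[ℂ] E) : Prop :=
  ∀ i j a b, θ (i + j) (a * b) = θ i a * b + a * θ j b

lemma IsCoeffDeriv.mul {θ : ℕ → E →ₗ[ℂ] E} (hθ : IsCoeffDeriv θ) (f g : PowerSeries E) :
    coeffMap θ (f * g) = coeffMap θ f * g + f * coeffMap θ g := by
  ext n
  simp only [coeff_coeffMap, PowerSeries.coeff_mul, map_add, map_sum, ← Finset.sum_add_distrib]
  refine Finset.sum_congr rfl fun p hp => ?_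
  rw [← Finset.HasAntidiagonal.mem_antidiagonal.mp hp, hθ]

lemma IsCoeffDeriv.zero_one {θ : ℕ → E →ₗ[ℂ] E} (hθ : IsCoeffDeriv θ) : θ 0 1 = 0 := by
  have := hθ 0 0 1 1
  simpa using this

lemma IsCoeffDeriv.pow {θ : ℕ → E →ₗ[ℂ] E} (hθ : IsCoeffDeriv θ) {f : PowerSeries E}
    (h : Commute f (coeffMap θ f)) (m : ℕ) :
    coeffMap θ (f ^ (m + 1)) = (m + 1 : PowerSeries E) * (f ^ m * coeffMap θ f) := by
  induction m with
  | zero => simp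
  | succ m ih =>
    rw [pow_succ, hθ.mul, ih, mul_assoc, mul_assoc, ← h.eq, pow_succ]
    push_cast
    noncomm_ring

/-- The Euler operator `z d/dz` on power series. -/
def euler : PowerSeries E → PowerSeries E := coeffMap fun n => (n : ℂ) • LinearMap.id

lemma isCoeffDeriv_euler : IsCoeffDeriv (E := E) fun n => (n : ℂ) • LinearMap.id := by
  intro i j a b
  simp [add_smul]

@[simp] lemma coeff_euler (f : PowerSeries E) (n : ℕ) :
    PowerSeries.coeff n (euler f) = (n : ℂ) • PowerSeries.coeff n f := by
  simp [euler]

lemma commute_of_coeff {f g : PowerSeries E}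
    (h : ∀ i j, Commute (PowerSeries.coeff i f) (PowerSeries.coeff j g)) : Commute f g := by
  ext n
  rw [PowerSeries.coeff_mul, PowerSeries.coeff_mul, ← Finset.Nat.sum_antidiagonal_swap]
  exact Finset.sum_congr rfl fun p _ => h _ _

lemma coeff_pow_eq_zero {f : PowerSeries E} (h0 : PowerSeries.coeff 0 f = 0) :
    ∀ (m n : ℕ), n < m → PowerSeries.coeff n (f ^ m) = 0 := by
  intro m
  induction m with
  | zero => intro n hn; omega
  | succ m ih =>
    intro n hn
    rw [pow_succ, PowerSeries.coeff_mul]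
    refine Finset.sum_eq_zero fun p hp => ?_
    have := Finset.HasAntidiagonal.mem_antidiagonal.mp hp
    by_cases h : p.2 = 0
    · rw [h, h0, mul_zero]
    · rw [ih p.1 (by omega), zero_mul]

lemma coeff_pexp_of_le {f : PowerSeries E} (h0 : PowerSeries.coeff 0 f = 0) {n N : ℕ}
    (h : n < N) : PowerSeries.coeff n (pexp f) =
      ∑ m ∈ Finset.range N, ((m.factorial : ℂ)⁻¹) • PowerSeries.coeff n (f ^ m) := by
  rw [pexp, PowerSeries.coeff_mk]
  refine Finset.sum_subset (Finset.range_mono (by omega)) fun m _ hm => ?_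
  rw [coeff_pow_eq_zero h0 _ _ (by simpa using hm), smul_zero]

lemma coeff_zero_pexp (f : PowerSeries E) : PowerSeries.coeff 0 (pexp f) = 1 := by
  simp [pexp]

lemma IsCoeffDeriv.pexp {θ : ℕ → E →ₗ[ℂ] E} (hθ : IsCoeffDeriv θ) {f : PowerSeries E}
    (h0 : PowerSeries.coeff 0 f = 0)
    (h : ∀ i j, Commute (PowerSeries.coeff i f) (θ j (PowerSeries.coeff j f))) :
    coeffMap θ (pexp f) = coeffMap θ f * pexp f := by
  have hc : Commute f (coeffMap θ f) := commute_of_coeff fun i j => by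
    rw [coeff_coeffMap]
    exact h i j
  ext n
  have e : ∀ m : ℕ, PowerSeries.coeff n (coeffMap θ (f ^ (m + 1))) =
      ((m : ℂ) + 1) • PowerSeries.coeff n (coeffMap θ f * f ^ m) := by
    intro m
    rw [hθ.pow hc, (hc.pow_left m).eq]
    have : (m + 1 : PowerSeries E) = ((m + 1 : ℕ) : PowerSeries E) := by push_cast; rfl
    rw [this, ← nsmul_eq_mul, map_nsmul, ← Nat.cast_smul_eq_nsmul ℂ]
    push_cast
    rfl
  rw [coeff_coeffMap, coeff_pexp_of_le h0 (Nat.lt_succ_of_lt (Nat.lt_succ_self n)), map_sum,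
    Finset.sum_range_succ', PowerSeries.coeff_mul]
  have e2 : ∀ m : ℕ, θ n ((m.factorial : ℂ)⁻¹ • PowerSeries.coeff n (f ^ m)) =
      (m.factorial : ℂ)⁻¹ • PowerSeries.coeff n (coeffMap θ (f ^ m)) := by
    intro m
    rw [coeff_coeffMap, map_smul]
  simp only [e2, e]
  have e3 : PowerSeries.coeff n (coeffMap θ (f ^ 0)) = 0 := by
    rw [coeff_coeffMap, pow_zero, PowerSeries.coeff_one]
    split_ifs with h
    · rw [h, hθ.zero_one]
    · rw [map_zero]
  rw [e3, smul_zero, add_zero]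
  have e4 : ∀ p ∈ Finset.HasAntidiagonal.antidiagonal n,
      PowerSeries.coeff p.1 (coeffMap θ f) * PowerSeries.coeff p.2 (MCKP.pexp f) =
      ∑ m ∈ Finset.range (n + 1), (m.factorial : ℂ)⁻¹ •
        (PowerSeries.coeff p.1 (coeffMap θ f) * PowerSeries.coeff p.2 (f ^ m)) := by
    intro p hp
    have := Finset.HasAntidiagonal.mem_antidiagonal.mp hp
    rw [coeff_pexp_of_le h0 (show p.2 < n + 1 by omega), Finset.mul_sum]
    exact Finset.sum_congr rfl fun m _ => mul_smul_comm _ _ _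
  rw [Finset.sum_congr rfl e4, Finset.sum_comm]
  refine Finset.sum_congr rfl fun m _ => ?_
  rw [← Finset.smul_sum, ← PowerSeries.coeff_mul, smul_smul]
  congr 1
  rw [Nat.factorial_succ]
  have : (m.factorial : ℂ) ≠ 0 := by exact_mod_cast m.factorial_ne_zero
  have : (m : ℂ) + 1 ≠ 0 := by exact_mod_cast m.succ_ne_zero
  push_cast
  field_simp

lemma euler_pexp {f : PowerSeries E} (h0 : PowerSeries.coeff 0 f = 0)
    (h : ∀ i j, Commute (PowerSeries.coeff i f) (PowerSeries.coeff j f)) :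
    euler (pexp f) = euler f * pexp f :=
  isCoeffDeriv_euler.pexp h0 fun i j => by
    simpa using (h i j).smul_right (j : ℂ)

/-- A series is determined by its logarithmic derivative and its constant term. -/
lemma euler_unique {f G K : PowerSeries E}
    (hG : euler G = euler f * G) (hK : euler K = euler f * K)
    (h : PowerSeries.coeff 0 G = PowerSeries.coeff 0 K) : G = K := by
  ext n
  induction n using Nat.strong_induction_on with
  | _ n ih =>
    rcases Nat.eq_zero_or_pos n with rfl | hn
    · exact h
    have e : (n : ℂ) • PowerSeries.coeff n G = (n : ℂ) • PowerSeries.coeff n K := by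
      rw [← coeff_euler, ← coeff_euler, hG, hK, PowerSeries.coeff_mul, PowerSeries.coeff_mul]
      refine Finset.sum_congr rfl fun p hp => ?_
      have := Finset.HasAntidiagonal.mem_antidiagonal.mp hp
      by_cases hp0 : p.1 = 0
      · rw [hp0, coeff_euler]; simp
      · rw [ih p.2 (by omega)]
    have hn' : (n : ℂ) ≠ 0 := by exact_mod_cast hn.ne'
    exact smul_right_injective _ hn' e

lemma pexp_unique {f G : PowerSeries E} (h0 : PowerSeries.coeff 0 f = 0)
    (h : ∀ i j, Commute (PowerSeries.coeff i f) (PowerSeries.coeff j f))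
    (hG : euler G = euler f * G) (h1 : PowerSeries.coeff 0 G = 1) : G = pexp f :=
  euler_unique hG (euler_pexp h0 h) (by rw [h1, coeff_zero_pexp])

lemma pexp_add {f g : PowerSeries E} (hf0 : PowerSeries.coeff 0 f = 0)
    (hg0 : PowerSeries.coeff 0 g = 0)
    (hf : ∀ i j, Commute (PowerSeries.coeff i f) (PowerSeries.coeff j f))
    (hg : ∀ i j, Commute (PowerSeries.coeff i g) (PowerSeries.coeff j g))
    (hfg : ∀ i j, Commute (PowerSeries.coeff i f) (PowerSeries.coeff j g)) :
    pexp (f + g) = pexp f * pexp g := by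
  symm
  refine pexp_unique (by rw [map_add, hf0, hg0, add_zero]) (fun i j => ?_) ?_ ?_
  · simp only [map_add]
    exact ((hf i j).add_right (hfg i j)).add_left (((hfg j i).symm).add_right (hg i j))
  · have hc : Commute (pexp f) (euler g) := by
      refine commute_of_coeff fun i j => ?_
      rw [coeff_euler]
      refine Commute.smul_right ?_ _
      rw [pexp, PowerSeries.coeff_mk]
      refine Commute.sum_left _ _ _ fun m _ => Commute.smul_left ?_ _
      have : Commute f (PowerSeries.C (PowerSeries.coeff j g)) := commute_of_coeff fun a b => by
        rw [PowerSeries.coeff_C]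
        split_ifs
        · exact hfg a j
        · exact Commute.zero_right _
      have h2 := congrArg (PowerSeries.coeff i) (this.pow_left m).eq
      rw [Commute, SemiconjBy]
      simpa using h2
    have he : euler (f + g) = euler f + euler g := by ext n; simp
    rw [euler, isCoeffDeriv_euler.mul, ← euler, euler_pexp hf0 hf, euler_pexp hg0 hg, he, ← mul_assoc (pexp f), hc.eq]
    noncomm_ring
  · simp [PowerSeries.coeff_mul, coeff_zero_pexp]

lemma pexp_rescale (c : ℂ) (f : PowerSeries E) (n : ℕ) :
    PowerSeries.coeff n (pexp (PowerSeries.mk fun k => c ^ k • PowerSeries.coeff k f)) =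
      c ^ n • PowerSeries.coeff n (pexp f) := by
  have key : ∀ m n, PowerSeries.coeff n
      ((PowerSeries.mk fun k => c ^ k • PowerSeries.coeff k f) ^ m) =
      c ^ n • PowerSeries.coeff n (f ^ m) := by
    intro m
    induction m with
    | zero =>
      intro n
      rw [pow_zero, pow_zero, PowerSeries.coeff_one]
      split_ifs with h <;> simp [h]
    | succ m ih =>
      intro n
      rw [pow_succ, pow_succ, PowerSeries.coeff_mul, PowerSeries.coeff_mul, Finset.smul_sum]
      refine Finset.sum_congr rfl fun p hp => ?_
      rw [ih, PowerSeries.coeff_mk, smul_mul_smul_comm, ← pow_add, Finset.HasAntidiagonal.mem_antidiagonal.mp hp]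
  simp only [pexp, PowerSeries.coeff_mk, key, Finset.smul_sum]
  exact Finset.sum_congr rfl fun m _ => smul_comm _ _ _

lemma pexp_map {E' : Type*} [Ring E'] [Algebra ℂ E'] (φ : E →ₐ[ℂ] E') (f : PowerSeries E) (n : ℕ) :
    PowerSeries.coeff n (pexp (PowerSeries.map (φ : E →+* E') f)) =
      φ (PowerSeries.coeff n (pexp f)) := by
  simp only [pexp, PowerSeries.coeff_mk, map_sum, map_smul]
  refine Finset.sum_congr rfl fun m _ => ?_
  rw [← map_pow, PowerSeries.coeff_map]
  rfl

/-- The recursion for the coefficients of an exponential. -/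
lemma pexp_recursion {f : ℕ → E} (h0 : f 0 = 0) (h : ∀ i j, Commute (f i) (f j)) (n : ℕ) :
    (n : ℂ) • PowerSeries.coeff n (pexp (PowerSeries.mk f)) =
      ∑ p ∈ Finset.HasAntidiagonal.antidiagonal n,
        (p.1 : ℂ) • (f p.1 * PowerSeries.coeff p.2 (pexp (PowerSeries.mk f))) := by
  have e := congrArg (PowerSeries.coeff n) (euler_pexp (f := PowerSeries.mk f) (by simpa using h0)
    (by simpa using h))
  rw [coeff_euler, PowerSeries.coeff_mul] at e
  simp only [coeff_euler, PowerSeries.coeff_mk] at e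
  rw [e]
  exact Finset.sum_congr rfl fun p _ => by rw [smul_mul_assoc]

end Pexp

end MCKP
end

noncomputable section
namespace MCKP

variable {s r : ℕ}

/-! ## Times -/

/-- The component of a time. -/
def tcmp : Time s r → Cmp s r
  | Sum.inl (a, _) => Sum.inl a
  | Sum.inr (c, _) => Sum.inr c

/-- The degree of a time. -/
def tdeg : Time s r → ℕ
  | Sum.inl (_, n) => n + 1
  | Sum.inr (_, n) => 2 * n + 1

lemma tdeg_pos (i : Time s r) : 0 < tdeg i := by
  rcases i with ⟨a, n⟩ | ⟨c, n⟩ <;> simp [tdeg]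

lemma timeIdx_eq_some (b : Cmp s r) (k : ℕ) (i : Time s r) :
    timeIdx b k = some i ↔ tcmp i = b ∧ tdeg i = k := by
  rcases b with a | c <;> rcases i with ⟨a', n⟩ | ⟨c', n⟩
  · rcases k with _ | k
    · simp [timeIdx, tdeg]
    · simp [timeIdx, tdeg, tcmp, eq_comm]
  · rcases k with _ | k <;> simp [timeIdx, tcmp]
  · simp only [timeIdx, tcmp]
    split_ifs <;> simp
  · simp only [timeIdx, tcmp, tdeg]
    split_ifs with h
    · simp only [Option.some.injEq, Sum.inr.injEq, Prod.mk.injEq]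
      constructor
      · rintro ⟨rfl, rfl⟩; exact ⟨rfl, by omega⟩
      · rintro ⟨rfl, rfl⟩; exact ⟨rfl, by omega⟩
    · simp only [reduceCtorEq, Sum.inr.injEq, false_iff, not_and]
      intro _; omega

lemma timeIdx_tcmp (i : Time s r) : timeIdx (tcmp i) (tdeg i) = some i :=
  (timeIdx_eq_some _ _ _).2 ⟨rfl, rfl⟩

lemma tdeg_odd {i : Time s r} {c : Fin r} (h : tcmp i = Sum.inr c) : Odd (tdeg i) := by
  rcases i with ⟨a', n⟩ | ⟨c', n⟩
  · simp [tcmp] at h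
  · exact ⟨n, rfl⟩

section
variable {V : Type} (e : Time s r → V)

lemma tvar_of_some {b : Cmp s r} {k : ℕ} {i : Time s r} (h : timeIdx b k = some i) :
    tvar e b k = MvPowerSeries.X (e i) := by simp [tvar, h]

lemma tvar_of_none {b : Cmp s r} {k : ℕ} (h : timeIdx b k = none) : tvar e b k = 0 := by
  simp [tvar, h]

lemma dvar_of_some {b : Cmp s r} {k : ℕ} {i : Time s r} (h : timeIdx b k = some i) :
    dvar e b k = (MvPowerSeries.pderiv ℂ (e i)).toLinearMap := by simp [dvar, h]

lemma dvar_of_none {b : Cmp s r} {k : ℕ} (h : timeIdx b k = none) : dvar e b k = 0 := by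
  simp [dvar, h]

lemma timeIdx_zero (b : Cmp s r) : timeIdx b 0 = none := by rcases b with a | c <;> simp [timeIdx]

lemma tvar_zero (b : Cmp s r) : tvar e b 0 = 0 := tvar_of_none e (timeIdx_zero b)

lemma dvar_zero (b : Cmp s r) : dvar e b 0 = 0 := dvar_of_none e (timeIdx_zero b)

lemma pderiv_comm {R : Type*} [CommRing R] (i j : V) (f : MvPowerSeries V R) :
    MvPowerSeries.pderiv R i (MvPowerSeries.pderiv R j f) =
      MvPowerSeries.pderiv R j (MvPowerSeries.pderiv R i f) := by
  classical
  ext m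
  simp only [MvPowerSeries.coeff_pderiv, add_assoc, add_comm (Finsupp.single i 1)]
  by_cases h : i = j
  · rw [h]
  · simp [Finsupp.single_apply, h, Ne.symm h, mul_right_comm]

lemma dvar_commute_pderiv (b : Cmp s r) (k : ℕ) (i : V) :
    Commute (dvar e b k) (MvPowerSeries.pderiv ℂ i).toLinearMap := by
  rcases h : timeIdx b k with _ | i'
  · rw [dvar_of_none e h]; exact Commute.zero_left _
  · rw [dvar_of_some e h]
    exact LinearMap.ext fun f => pderiv_comm _ _ _

lemma dvar_commute (b b' : Cmp s r) (k k' : ℕ) : Commute (dvar e b k) (dvar e b' k') := by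
  rcases h : timeIdx b' k' with _ | i'
  · rw [dvar_of_none e h]; exact Commute.zero_right _
  · rw [dvar_of_some e h]; exact dvar_commute_pderiv e b k _

end

/-- The coefficients of the multiplication part of a vertex operator. -/
def Hc (φ : Fld s r) (p : ℕ) : TSer s r := PowerSeries.coeff p (expT φ)

/-- The coefficients of the differentiation part of a vertex operator. -/
def Dc (φ : Fld s r) (q : ℕ) : Module.End ℂ (TSer s r) := PowerSeries.coeff q (expD φ)

/-- The coefficient of a time in the exponent of the multiplication part. -/
def tsgn (φ : Fld s r) (i : Time s r) : ℂ := if tcmp i = φ.cmp then φ.sgn else 0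

/-- The coefficient of a time derivative in the exponent of the differentiation part. -/
def dsgn (φ : Fld s r) (i : Time s r) : ℂ := tsgn φ i * dfac φ.cmp (tdeg i)

@[simp] lemma Hc_zero (φ : Fld s r) : Hc φ 0 = 1 := coeff_zero_pexp _
@[simp] lemma Dc_zero (φ : Fld s r) : Dc φ 0 = 1 := coeff_zero_pexp _

lemma pderiv_expT_exponent (φ : Fld s r) (i : Time s r) (k : ℕ) :
    MvPowerSeries.pderiv ℂ i (φ.sgn • tvar id φ.cmp k) =
      if k = tdeg i then MvPowerSeries.C (tsgn φ i) else 0 := by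
  classical
  rw [Derivation.map_smul]
  rcases h : timeIdx φ.cmp k with _ | j
  · rw [tvar_of_none id h, map_zero, smul_zero]
    split_ifs with hk
    · have : tcmp i ≠ φ.cmp := fun hc => by
        rw [(timeIdx_eq_some _ _ i).2 ⟨hc, hk.symm⟩] at h; simp at h
      simp [tsgn, this]
    · rfl
  · rw [tvar_of_some id h]
    obtain ⟨h1, h2⟩ := (timeIdx_eq_some _ _ _).1 h
    by_cases hij : j = i
    · subst hij
      rw [id, MvPowerSeries.pderiv_X_self, if_pos h2.symm, tsgn, if_pos h1,
        MvPowerSeries.smul_eq_C_mul, mul_one]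
    · rw [id, MvPowerSeries.pderiv_X_of_ne hij, smul_zero]
      split_ifs with hk
      · have : tcmp i ≠ φ.cmp := fun hc => hij <| by
          have := (timeIdx_eq_some _ _ i).2 ⟨hc, hk.symm⟩
          rw [h] at this
          exact Option.some_injective _ this
        simp [tsgn, this]
      · rfl

lemma sum_antidiagonal_ite {M : Type*} [AddCommMonoid M] (n d : ℕ) (F : ℕ → M) :
    ∑ p ∈ Finset.HasAntidiagonal.antidiagonal n, (if p.1 = d then F p.2 else 0) =
      if d ≤ n then F (n - d) else 0 := by
  split_ifs with h
  · rw [Finset.sum_eq_single (d, n - d)]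
    · simp
    · rintro ⟨a, b⟩ hab hne
      rw [if_neg]
      rintro rfl
      have := Finset.HasAntidiagonal.mem_antidiagonal.mp hab
      exact hne (by simp only [Prod.mk.injEq, true_and]; omega)
    · intro hn; exact absurd (Finset.HasAntidiagonal.mem_antidiagonal.mpr (by simp; omega)) hn
  · refine Finset.sum_eq_zero fun p hp => if_neg ?_
    have := Finset.HasAntidiagonal.mem_antidiagonal.mp hp
    omega

lemma isCoeffDeriv_pderiv {V : Type} (i : V) :
    IsCoeffDeriv fun _ => (MvPowerSeries.pderiv ℂ i).toLinearMap := by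
  intro _ _ a b
  simp only [Derivation.coeFn_coe, Derivation.leibniz, smul_eq_mul]
  ring

lemma pderiv_Hc (φ : Fld s r) (i : Time s r) (p : ℕ) :
    MvPowerSeries.pderiv ℂ i (Hc φ p) =
      if tdeg i ≤ p then tsgn φ i • Hc φ (p - tdeg i) else 0 := by
  have h := congrArg (PowerSeries.coeff p) ((isCoeffDeriv_pderiv i).pexp
    (f := PowerSeries.mk fun k => φ.sgn • tvar id φ.cmp k)
    (by rw [PowerSeries.coeff_mk, tvar_zero, smul_zero]) (fun _ _ => Commute.all _ _))
  rw [coeff_coeffMap, PowerSeries.coeff_mul] at h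
  simp only [coeff_coeffMap, PowerSeries.coeff_mk, 
    Derivation.coeFn_coe, pderiv_expT_exponent, ite_mul, zero_mul] at h
  rw [sum_antidiagonal_ite p (tdeg i) fun l => MvPowerSeries.C (tsgn φ i) * PowerSeries.coeff l
    (pexp (PowerSeries.mk fun k => φ.sgn • tvar id φ.cmp k))] at h
  simp only [MvPowerSeries.smul_eq_C_mul]
  exact h

lemma dvar_X (b : Cmp s r) (k : ℕ) (i : Time s r) (u : TSer s r) :
    dvar id b k (MvPowerSeries.X i * u) =
      MvPowerSeries.X i * dvar id b k u + if tcmp i = b ∧ tdeg i = k then u else 0 := by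
  rcases h : timeIdx b k with _ | j
  · rw [dvar_of_none id h, if_neg]
    · simp
    · rw [← timeIdx_eq_some, h]; simp
  · rw [dvar_of_some id h]
    change MvPowerSeries.pderiv ℂ j _ = _ * MvPowerSeries.pderiv ℂ j _ + _
    rw [Derivation.leibniz]
    have e := timeIdx_eq_some b k i
    rw [h] at e
    by_cases hij : i = j
    · subst hij
      rw [if_pos (e.1 rfl)]
      simp
    · rw [MvPowerSeries.pderiv_X_of_ne hij, if_neg fun h => hij
        (Option.some_injective _ (e.2 h)).symm]
      simp

/-- Multiplication by a power series. -/
def mulOp {V : Type} (f : MvPowerSeries V ℂ) : Module.End ℂ (MvPowerSeries V ℂ) :=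
  LinearMap.mulLeft ℂ f

@[simp] lemma mulOp_apply {V : Type} (f u : MvPowerSeries V ℂ) : mulOp f u = f * u := rfl

lemma Dc_X (φ : Fld s r) (i : Time s r) (q : ℕ) (u : TSer s r) :
    Dc φ q (MvPowerSeries.X i * u) = MvPowerSeries.X i * Dc φ q u +
      if tdeg i ≤ q then dsgn φ i • Dc φ (q - tdeg i) u else 0 := by
  let t : Module.End ℂ (TSer s r) := mulOp (MvPowerSeries.X i)
  have hθ : IsCoeffDeriv (E := Module.End ℂ (TSer s r)) fun _ =>
      (LinearMap.mulRight ℂ t - LinearMap.mulLeft ℂ t) := by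
    intro _ _ a b
    simp only [LinearMap.sub_apply, LinearMap.mulRight_apply, LinearMap.mulLeft_apply, sub_mul,
      mul_sub, mul_assoc]
    abel
  have hf : ∀ k, (LinearMap.mulRight ℂ t - LinearMap.mulLeft ℂ t)
      ((φ.sgn * dfac φ.cmp k) • dvar id φ.cmp k) = if k = tdeg i then dsgn φ i • 1 else 0 := by
    intro k
    refine LinearMap.ext fun u => ?_
    change (φ.sgn * dfac φ.cmp k) • dvar id φ.cmp k (MvPowerSeries.X i * u) -
      MvPowerSeries.X i * ((φ.sgn * dfac φ.cmp k) • dvar id φ.cmp k u) = _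
    rw [dvar_X, mul_smul_comm, smul_add, add_sub_cancel_left, dsgn, tsgn]
    by_cases h1 : tcmp i = φ.cmp <;> by_cases h2 : k = tdeg i
    · simp [h1, h2]
    · simp [h1, h2, Ne.symm h2]
    · simp [h1]
    · simp [h1]
  have h := congrArg (PowerSeries.coeff q) (hθ.pexp
    (f := PowerSeries.mk fun k => (φ.sgn * dfac φ.cmp k) • dvar id φ.cmp k)
    (by simp [dvar_zero]) (fun i j => by
      rw [PowerSeries.coeff_mk, PowerSeries.coeff_mk, hf]
      split_ifs
      · exact (Commute.one_right _).smul_right _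
      · exact Commute.zero_right _))
  rw [coeff_coeffMap, PowerSeries.coeff_mul] at h
  simp only [coeff_coeffMap, PowerSeries.coeff_mk, hf, ite_mul, zero_mul, smul_mul_assoc,
    one_mul] at h
  rw [sum_antidiagonal_ite q (tdeg i) fun l => dsgn φ i • PowerSeries.coeff l (pexp _)] at h
  have h' := LinearMap.congr_fun h u
  change Dc φ q (MvPowerSeries.X i * u) - MvPowerSeries.X i * Dc φ q u = _ at h'
  rw [← sub_eq_iff_eq_add', h']
  split_ifs <;> rfl

lemma Hc_recursion (φ : Fld s r) (n : ℕ) : (n : ℂ) • Hc φ n =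
    ∑ p ∈ Finset.HasAntidiagonal.antidiagonal n,
      (p.1 : ℂ) • (φ.sgn • tvar id φ.cmp p.1 * Hc φ p.2) :=
  pexp_recursion (by simp [tvar_zero]) (fun _ _ => Commute.all _ _) n

lemma Dc_recursion (φ : Fld s r) (n : ℕ) : (n : ℂ) • Dc φ n =
    ∑ p ∈ Finset.HasAntidiagonal.antidiagonal n,
      (p.1 : ℂ) • ((φ.sgn * dfac φ.cmp p.1) • dvar id φ.cmp p.1 * Dc φ p.2) :=
  pexp_recursion (by simp [dvar_zero])
    (fun _ _ => ((dvar_commute id _ _ _ _).smul_right _).smul_left _) n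

/-- The induction principle that comes from the recursion of an exponential. -/
lemma recursion_induction {M : Type*} [AddCommGroup M] [Module ℂ M] {f : ℕ → M} {F : ℕ → ℕ → M}
    (hf : ∀ n : ℕ, (n : ℂ) • f n = ∑ p ∈ Finset.HasAntidiagonal.antidiagonal n,
      (p.1 : ℂ) • F p.1 p.2) (n : ℕ) (hn : 0 < n) :
    f n = ∑ p ∈ Finset.HasAntidiagonal.antidiagonal n, ((n : ℂ)⁻¹ * p.1) • F p.1 p.2 := by
  have hn' : (n : ℂ) ≠ 0 := by exact_mod_cast hn.ne'
  rw [← inv_smul_smul₀ hn' (f n), hf, Finset.smul_sum]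
  simp only [smul_smul]

lemma Dc_commute_pderiv (φ : Fld s r) (i : Time s r) (n : ℕ) :
    Commute (Dc φ n) (MvPowerSeries.pderiv ℂ i).toLinearMap := by
  induction n using Nat.strong_induction_on with
  | _ n ih =>
    rcases Nat.eq_zero_or_pos n with rfl | hn
    · rw [Dc_zero]; exact Commute.one_left _
    rw [recursion_induction (F := fun a b => (φ.sgn * dfac φ.cmp a) • dvar id φ.cmp a * Dc φ b)
      (Dc_recursion φ) n hn]
    refine Commute.sum_left _ _ _ fun p hp => ?_
    have := Finset.HasAntidiagonal.mem_antidiagonal.mp hp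
    by_cases h0 : p.1 = 0
    · simp [h0]
    · exact ((((dvar_commute_pderiv id _ _ _).smul_left _).mul_left
        (ih p.2 (by omega)))).smul_left _

lemma pderiv_Dc (φ : Fld s r) (i : Time s r) (n : ℕ) (u : TSer s r) :
    MvPowerSeries.pderiv ℂ i (Dc φ n u) = Dc φ n (MvPowerSeries.pderiv ℂ i u) :=
  (LinearMap.congr_fun (Dc_commute_pderiv φ i n).eq u).symm

/-- The weighted degree of a monomial in the times. -/
abbrev wt (m : Time s r →₀ ℕ) : ℕ := Finsupp.weight (tdeg (s := s) (r := r)) m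

lemma wt_add_single (m : Time s r →₀ ℕ) (i : Time s r) :
    wt (m + Finsupp.single i 1) = wt m + tdeg i := by
  rw [wt, map_add, Finsupp.weight_single, one_smul]

lemma coeff_X_mul_ne_zero {V : Type} {i : V} {u : MvPowerSeries V ℂ} {m : V →₀ ℕ}
    (h : MvPowerSeries.coeff m (MvPowerSeries.X i * u) ≠ 0) :
    ∃ m', m = m' + Finsupp.single i 1 ∧ MvPowerSeries.coeff m' u ≠ 0 := by
  classical
  rw [MvPowerSeries.X, MvPowerSeries.coeff_monomial_mul] at h
  split_ifs at h with h1
  · refine ⟨m - Finsupp.single i 1, (tsub_add_cancel_of_le h1).symm, by simpa using h⟩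
  · exact absurd rfl h

lemma coeff_Hc_ne_zero (φ : Fld s r) (n : ℕ) : ∀ m,
    MvPowerSeries.coeff m (Hc φ n) ≠ 0 → wt m = n := by
  classical
  induction n using Nat.strong_induction_on with
  | _ n ih =>
    intro m hm
    rcases Nat.eq_zero_or_pos n with rfl | hn
    · rw [Hc_zero, MvPowerSeries.coeff_one] at hm
      have : m = 0 := by by_contra h; simp [h] at hm
      simp [this]
    rw [recursion_induction (F := fun a b => φ.sgn • tvar id φ.cmp a * Hc φ b)
      (Hc_recursion φ) n hn, map_sum] at hm
    obtain ⟨p, hp, h⟩ := Finset.exists_ne_zero_of_sum_ne_zero hm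
    have hp' := Finset.HasAntidiagonal.mem_antidiagonal.mp hp
    rw [MvPowerSeries.coeff_smul, smul_mul_assoc, MvPowerSeries.coeff_smul] at h
    have h := right_ne_zero_of_mul (right_ne_zero_of_mul h)
    rcases hi : timeIdx φ.cmp p.1 with _ | i
    · rw [tvar_of_none id hi, zero_mul] at h; simp at h
    rw [tvar_of_some id hi] at h
    obtain ⟨m', rfl, hm'⟩ := coeff_X_mul_ne_zero h
    have hd := ((timeIdx_eq_some _ _ _).1 hi).2
    have := tdeg_pos i
    have := ih p.2 (by omega) m' hm'
    simp only [id] at *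
    rw [wt_add_single]
    omega

lemma coeff_Hc_mul_ne_zero {φ : Fld s r} {n : ℕ} {u : TSer s r} {m : Time s r →₀ ℕ}
    (h : MvPowerSeries.coeff m (Hc φ n * u) ≠ 0) :
    ∃ m', wt m = n + wt m' ∧ MvPowerSeries.coeff m' u ≠ 0 := by
  classical
  rw [MvPowerSeries.coeff_mul] at h
  obtain ⟨p, hp, h⟩ := Finset.exists_ne_zero_of_sum_ne_zero h
  refine ⟨p.2, ?_, right_ne_zero_of_mul h⟩
  rw [← Finset.HasAntidiagonal.mem_antidiagonal.mp hp, wt, map_add,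
    ← coeff_Hc_ne_zero φ n _ (left_ne_zero_of_mul h)]

lemma coeff_Dc_ne_zero (φ : Fld s r) (n : ℕ) (u : TSer s r) : ∀ m,
    MvPowerSeries.coeff m (Dc φ n u) ≠ 0 →
      ∃ m', wt m' = wt m + n ∧ MvPowerSeries.coeff m' u ≠ 0 := by
  induction n using Nat.strong_induction_on with
  | _ n ih =>
    intro m hm
    rcases Nat.eq_zero_or_pos n with rfl | hn
    · exact ⟨m, by simp, by simpa using hm⟩
    rw [recursion_induction (F := fun a b => (φ.sgn * dfac φ.cmp a) • dvar id φ.cmp a * Dc φ b)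
      (Dc_recursion φ) n hn, LinearMap.sum_apply, map_sum] at hm
    obtain ⟨p, hp, h⟩ := Finset.exists_ne_zero_of_sum_ne_zero hm
    have hp' := Finset.HasAntidiagonal.mem_antidiagonal.mp hp
    rw [LinearMap.smul_apply, MvPowerSeries.coeff_smul, smul_mul_assoc, LinearMap.smul_apply,
      MvPowerSeries.coeff_smul] at h
    have h := right_ne_zero_of_mul (right_ne_zero_of_mul h)
    rcases hi : timeIdx φ.cmp p.1 with _ | i
    · rw [dvar_of_none id hi, zero_mul] at h; simp at h
    rw [dvar_of_some id hi] at h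
    change MvPowerSeries.coeff m (MvPowerSeries.pderiv ℂ i (Dc φ p.2 u)) ≠ 0 at h
    rw [MvPowerSeries.coeff_pderiv] at h
    have hd := ((timeIdx_eq_some _ _ _).1 hi).2
    have := tdeg_pos i
    obtain ⟨m', h1, h2⟩ := ih p.2 (by omega) _ (left_ne_zero_of_mul h)
    refine ⟨m', ?_, h2⟩
    rw [h1, wt_add_single]
    omega

/-! ## Contractions -/

/-- The coefficients of the contraction of two fields. -/
def kap (φ ψ : Fld s r) (n : ℕ) : ℂ :=
  if φ.cmp = ψ.cmp then
    match φ with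
    | Sum.inl _ => if φ.sgn = ψ.sgn then 1 else if n = 0 then 1 else if n = 1 then -1 else 0
    | Sum.inr _ => if n = 0 then 1 else 2
  else if n = 0 then 1 else 0

/-- The logarithmic coefficients of the contraction of two fields. -/
def rap (φ ψ : Fld s r) (k : ℕ) : ℂ :=
  match timeIdx φ.cmp k with
  | none => 0
  | some i => k * (φ.sgn * dfac φ.cmp k) * tsgn ψ i

lemma sg_eq (δ δ' : Bool) : sg δ * sg δ' = if sg δ = sg δ' then 1 else -1 := by
  rcases δ with _ | _ <;> rcases δ' with _ | _ <;> norm_num [sg]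

lemma rap_of_ne {φ ψ : Fld s r} (h : φ.cmp ≠ ψ.cmp) (k : ℕ) : rap φ ψ k = 0 := by
  unfold rap
  rcases hi : timeIdx φ.cmp k with _ | i
  · rfl
  · have := ((timeIdx_eq_some _ _ _).1 hi).1
    simp [tsgn, this, h]

lemma rap_inl {a : Fin s} {δ : Bool} {ψ : Fld s r} (h : Sum.inl a = ψ.cmp) (k : ℕ) :
    rap (Sum.inl (a, δ)) ψ k = if k = 0 then 0 else sg δ * ψ.sgn := by
  rcases k with _ | k
  · simp [rap, timeIdx_zero]
  · have hk : (k : ℂ) + 1 ≠ 0 := by exact_mod_cast k.succ_ne_zero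
    have e : rap (Sum.inl (a, δ)) ψ (k + 1) =
        ((k + 1 : ℕ) : ℂ) * (sg δ * (1 / ((k + 1 : ℕ) : ℂ))) *
          (if Sum.inl a = ψ.cmp then ψ.sgn else 0) := rfl
    rw [e, if_pos h, if_neg k.succ_ne_zero]
    push_cast
    field_simp

lemma rap_inr {c : Fin r} {ψ : Fld s r} (h : Sum.inr c = ψ.cmp) (k : ℕ) :
    rap (Sum.inr c) ψ k = if k % 2 = 1 then 2 * ψ.sgn else 0 := by
  by_cases hk : k % 2 = 1
  · have hk0 : (k : ℂ) ≠ 0 := by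
      have : k ≠ 0 := by rintro rfl; simp at hk
      exact_mod_cast this
    have e : timeIdx (Fld.cmp (Sum.inr c : Fld s r)) k = some (Sum.inr (c, k / 2)) := by
      simp [Fld.cmp, timeIdx, hk]
    rw [rap, e, if_pos hk]
    change (k : ℂ) * (1 * (2 / k)) * (if Sum.inr c = ψ.cmp then ψ.sgn else 0) = _
    rw [if_pos h]
    field_simp
  · have e : timeIdx (Fld.cmp (Sum.inr c : Fld s r)) k = none := by
      simp [Fld.cmp, timeIdx, hk]
    rw [rap, e, if_neg hk]

lemma kap_recursion (φ ψ : Fld s r) (n : ℕ) :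
    (n : ℂ) * kap φ ψ n = ∑ p ∈ Finset.HasAntidiagonal.antidiagonal n,
      rap φ ψ p.1 * kap φ ψ p.2 := by
  by_cases h : φ.cmp = ψ.cmp
  swap
  · simp only [rap_of_ne h, zero_mul, Finset.sum_const_zero, kap, if_neg h]
    split_ifs with hn <;> simp [hn]
  rw [Finset.Nat.sum_antidiagonal_eq_sum_range_succ (fun i j => rap φ ψ i * kap φ ψ j),
    ← Finset.sum_range_reflect]
  rcases φ with ⟨a, δ⟩ | c
  · rcases ψ with ⟨b, δ'⟩ | c'
    swap
    · simp [Fld.cmp] at h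
    have hr := rap_inl (δ := δ) (show Sum.inl a = Fld.cmp (Sum.inl (b, δ')) from h)
    rw [Finset.sum_range_succ]
    simp only [hr, kap, h, if_true, Fld.sgn, sg_eq]
    have e : ∀ x ∈ Finset.range n, n + 1 - 1 - x ≠ 0 ∧ n - (n + 1 - 1 - x) = x := by
      intro x hx; have := Finset.mem_range.mp hx; omega
    rw [Finset.sum_congr rfl fun x hx => by rw [if_neg (e x hx).1, (e x hx).2]]
    by_cases hs : sg δ = sg δ'
    · simp [hs]
    · simp only [hs, if_false]
      rcases n with _ | _ | n
      · simp
      · simp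
      · rw [Finset.sum_range_succ', Finset.sum_range_succ']
        simp
  · rcases ψ with ⟨b, δ'⟩ | c'
    · simp [Fld.cmp] at h
    have hr := rap_inr (show Sum.inr c = Fld.cmp (Sum.inr c' : Fld s r) from h)
    simp only [hr, kap, h, if_true, Fld.sgn, mul_one]
    have e : ∀ n : ℕ, ∑ j ∈ Finset.range (n + 1),
        ((if (n + 1 - 1 - j) % 2 = 1 then (2 : ℂ) else 0) *
          if n - (n + 1 - 1 - j) = 0 then 1 else 2) =
        ∑ j ∈ Finset.range (n + 1),
        ((if (n - j) % 2 = 1 then (2 : ℂ) else 0) * if j = 0 then 1 else 2) := by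
      intro n
      refine Finset.sum_congr rfl fun j hj => ?_
      have := Finset.mem_range.mp hj
      rw [show n - (n + 1 - 1 - j) = j by omega, Nat.add_sub_cancel]
    rw [e]
    clear hr h e
    induction n using Nat.twoStepInduction with
    | zero => simp
    | one => simp [Finset.sum_range_succ]
    | more n ih _ =>
      rw [Finset.sum_range_succ, Finset.sum_range_succ]
      have e2 : ∀ j ∈ Finset.range (n + 1), (n + 2 - j) % 2 = (n - j) % 2 := by
        intro j hj; have := Finset.mem_range.mp hj; omega
      rw [Finset.sum_congr rfl fun j hj => by rw [e2 j hj], ← ih]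
      rcases n with _ | n
      · norm_num
      · have e3 : (n + 1 + 2 - (n + 1 + 1)) % 2 = 1 := by omega
        have e4 : (n + 1 + 2 - (n + 1 + 1 + 1)) % 2 = 0 := by omega
        rw [e3, e4]
        norm_num
        ring

lemma constantCoeff_Hc (φ : Fld s r) (p : ℕ) :
    MvPowerSeries.constantCoeff (Hc φ p) = if p = 0 then 1 else 0 := by
  split_ifs with h
  · simp [h]
  · by_contra hne
    have := coeff_Hc_ne_zero φ p 0 (by rwa [MvPowerSeries.coeff_zero_eq_constantCoeff])
    simp at this
    exact h this.symm

lemma constantCoeff_Dc_Hc (φ ψ : Fld s r) (n p : ℕ) :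
    MvPowerSeries.constantCoeff (Dc φ n (Hc ψ p)) = if n = p then kap φ ψ n else 0 := by
  induction n using Nat.strong_induction_on generalizing p with
  | _ n ih =>
    rcases Nat.eq_zero_or_pos n with rfl | hn
    · rw [Dc_zero, Module.End.one_apply, constantCoeff_Hc]
      have : kap φ ψ 0 = 1 := by
        unfold kap
        rcases φ with _ | _ <;> simp
      simp [this, eq_comm]
    have hn' : (n : ℂ) ≠ 0 := by exact_mod_cast hn.ne'
    refine mul_left_cancel₀ hn' ?_
    have h1 := congrArg (fun A => MvPowerSeries.constantCoeff (A (Hc ψ p))) (Dc_recursion φ n)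
    simp only [LinearMap.smul_apply, LinearMap.sum_apply, map_sum] at h1
    rw [← MvPowerSeries.coeff_zero_eq_constantCoeff_apply, MvPowerSeries.coeff_smul] at h1
    rw [← MvPowerSeries.coeff_zero_eq_constantCoeff_apply, h1]
    have key : ∀ x ∈ Finset.HasAntidiagonal.antidiagonal n,
        MvPowerSeries.constantCoeff ((x.1 : ℂ) • (((φ.sgn * dfac φ.cmp x.1) •
          dvar id φ.cmp x.1 * Dc φ x.2) (Hc ψ p))) =
        if n = p then rap φ ψ x.1 * kap φ ψ x.2 else 0 := by
      intro x hx
      have hx' := Finset.HasAntidiagonal.mem_antidiagonal.mp hx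
      rw [← MvPowerSeries.coeff_zero_eq_constantCoeff_apply, MvPowerSeries.coeff_smul,
        smul_mul_assoc, LinearMap.smul_apply, MvPowerSeries.coeff_smul]
      unfold rap
      rcases hi : timeIdx φ.cmp x.1 with _ | i
      · rw [dvar_of_none id hi]
        simp
      · rw [dvar_of_some id hi]
        change _ * (_ * MvPowerSeries.coeff 0 (MvPowerSeries.pderiv ℂ i (Dc φ x.2 (Hc ψ p)))) = _
        have hd := ((timeIdx_eq_some _ _ _).1 hi).2
        have := tdeg_pos i
        rw [pderiv_Dc, pderiv_Hc, hd]
        split_ifs with h1 h2 h2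
        · rw [map_smul, MvPowerSeries.coeff_smul, MvPowerSeries.coeff_zero_eq_constantCoeff_apply,
            ih x.2 (by omega), if_pos (by omega)]
          ring
        · rw [map_smul, MvPowerSeries.coeff_smul, MvPowerSeries.coeff_zero_eq_constantCoeff_apply,
            ih x.2 (by omega), if_neg (by omega)]
          ring
        · omega
        · simp
    rw [Finset.sum_congr rfl key]
    split_ifs
    · rw [kap_recursion]
    · simp

end MCKP
end

noncomputable section
namespace MCKP

variable {s r : ℕ}

/-! ## The Grassmann modes -/

lemma Xi.ext_cmp_pos {ξ η : Xi s r} (h : ξ.cmp = η.cmp) (h' : ξ.pos = η.pos) : ξ = η := by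
  rcases ξ with ⟨a, k, hk⟩ | ⟨c, n⟩ <;> rcases η with ⟨b, l, hl⟩ | ⟨d, m⟩ <;>
    simp_all [Xi.cmp, Xi.pos]

@[simp] lemma xi_cmp (a : Fin s) (δ : Bool) (n : ℕ) : (xi a δ n : Xi s r).cmp = Sum.inl a := rfl

lemma xi_pos (a : Fin s) (δ : Bool) (n : ℕ) :
    (xi a δ n : Xi s r).pos = (if δ then 1 else -1) * ((n : ℤ) + 1) := rfl

lemma xi_inj {a b : Fin s} {δ δ' : Bool} {n m : ℕ} :
    (xi a δ n : Xi s r) = xi b δ' m ↔ a = b ∧ δ = δ' ∧ n = m := by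
  constructor
  · intro h
    have h1 : a = b := by simpa using congrArg Xi.cmp h
    have h2 := congrArg Xi.pos h
    rw [xi_pos, xi_pos] at h2
    refine ⟨h1, ?_⟩
    cases δ <;> cases δ' <;> simp at h2 ⊢ <;> omega
  · rintro ⟨rfl, rfl, rfl⟩; rfl

open Classical in
/-- The set `w` with `ξ` added or removed. -/
def tog (w : Finset (Xi s r)) (ξ : Xi s r) : Finset (Xi s r) :=
  if ξ ∈ w then w.erase ξ else insert ξ w

open Classical in
lemma mem_tog {w : Finset (Xi s r)} {ξ η : Xi s r} :
    η ∈ tog w ξ ↔ if η = ξ then η ∉ w else η ∈ w := by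
  unfold tog
  split_ifs with h1 h2 h2 <;> simp_all

lemma tog_tog_self (w : Finset (Xi s r)) (ξ : Xi s r) : tog (tog w ξ) ξ = w := by
  ext η
  rw [mem_tog, mem_tog]
  split_ifs <;> simp

lemma tog_comm (w : Finset (Xi s r)) (ξ η : Xi s r) : tog (tog w ξ) η = tog (tog w η) ξ := by
  ext ζ
  simp only [mem_tog]
  split_ifs <;> simp

/-- The sign of the interchange of `η` with a later variable `ξ` of the same component. -/
def flipSign (η ξ : Xi s r) : ℂ :=
  open Classical in if η.cmp = ξ.cmp ∧ η.pos < ξ.pos then -1 else 1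

open Classical in
lemma neg_one_pow_filter_tog (w : Finset (Xi s r)) (η : Xi s r) (p : Xi s r → Prop) :
    (-1 : ℂ) ^ ((tog w η).filter p).card =
      (if p η then -1 else 1) * (-1 : ℂ) ^ (w.filter p).card := by
  unfold tog
  by_cases hp : p η
  · rw [if_pos hp]
    split_ifs with h
    · have hm : η ∈ w.filter p := by simp [h, hp]
      rw [Finset.filter_erase, ← Finset.card_erase_add_one hm, pow_succ]
      ring
    · rw [Finset.filter_insert, if_pos hp, Finset.card_insert_of_notMem (by simp [h]), pow_succ]
      ring
  · rw [if_neg hp, one_mul]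
    congr 2
    split_ifs with h
    · rw [Finset.filter_erase, Finset.erase_eq_of_notMem (by simp [hp])]
    · rw [Finset.filter_insert, if_neg hp]

lemma Nsign_tog (w : Finset (Xi s r)) (ξ η : Xi s r) :
    Nsign (tog w η) ξ = flipSign η ξ * Nsign w ξ := by
  classical
  unfold Nsign flipSign
  convert neg_one_pow_filter_tog w η fun η => η.cmp = ξ.cmp ∧ η.pos < ξ.pos

lemma Nsign_mul_self (w : Finset (Xi s r)) (ξ : Xi s r) : Nsign w ξ * Nsign w ξ = 1 := by
  rw [Nsign, ← pow_add, ← two_mul, pow_mul]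
  norm_num

lemma flipSign_self (ξ : Xi s r) : flipSign ξ ξ = 1 := by simp [flipSign]

lemma flipSign_of_ne {ξ η : Xi s r} (h : ξ.cmp ≠ η.cmp) : flipSign ξ η = 1 := by
  simp [flipSign, h]

lemma flipSign_anti {ξ η : Xi s r} (h : ξ.cmp = η.cmp) (hne : ξ ≠ η) :
    flipSign ξ η = -flipSign η ξ := by
  have : ξ.pos ≠ η.pos := fun h' => hne (Xi.ext_cmp_pos h h')
  unfold flipSign
  rcases lt_or_gt_of_ne this with h1 | h1
  · rw [if_pos ⟨h, h1⟩, if_neg (by simp [h1.le])]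
  · rw [if_neg (by simp [h1.le]), if_pos ⟨h.symm, h1⟩, neg_neg]

open Classical in
/-- Left multiplication by `ξ` (for `b = true`) or the left derivative `∂/∂ξ` (for `b = false`),
with the sign that only counts the variables in the component of `ξ`. -/
def tg (b : Bool) (ξ : Xi s r) : Module.End ℂ (BFock s r) where
  toFun τ w := if decide (ξ ∈ w) = b then Nsign w ξ • τ (tog w ξ) else 0
  map_add' τ τ' := by
    ext1 w
    simp only [Pi.add_apply]
    split_ifs
    · rw [smul_add]
    · rw [add_zero]
  map_smul' c τ := by
    ext1 w
    simp only [Pi.smul_apply, RingHom.id_apply]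
    split_ifs
    · rw [smul_comm]
    · rw [smul_zero]

open Classical in
lemma tg_apply (b : Bool) (ξ : Xi s r) (τ : BFock s r) (w : Finset (Xi s r)) :
    tg b ξ τ w = if decide (ξ ∈ w) = b then Nsign w ξ • τ (tog w ξ) else 0 := rfl

lemma tg_tg_self (b : Bool) (ξ : Xi s r) (τ : BFock s r) : tg b ξ (tg b ξ τ) = 0 := by
  classical
  ext1 w
  rw [tg_apply]
  split_ifs with h
  · rw [tg_apply, if_neg, smul_zero]
    · rfl
    · have : ξ ∈ tog w ξ ↔ ξ ∉ w := by rw [mem_tog, if_pos rfl]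
      rw [← h]
      by_cases hw : ξ ∈ w <;> simp [this, hw]
  · rfl

lemma tg_anticomm_self (b : Bool) (ξ : Xi s r) (τ : BFock s r) :
    tg b ξ (tg (!b) ξ τ) + tg (!b) ξ (tg b ξ τ) = τ := by
  classical
  ext1 w
  have hm : ξ ∈ tog w ξ ↔ ξ ∉ w := by rw [mem_tog, if_pos rfl]
  simp only [Pi.add_apply, tg_apply, Nsign_tog, flipSign_self, one_mul, tog_tog_self]
  by_cases hw : ξ ∈ w <;> cases b <;> simp [hm, hw, smul_smul, Nsign_mul_self]

lemma tg_tg (b c : Bool) {ξ η : Xi s r} (hne : ξ ≠ η) (τ : BFock s r) (w : Finset (Xi s r)) :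
    flipSign η ξ • tg b ξ (tg c η τ) w = flipSign ξ η • tg c η (tg b ξ τ) w := by
  classical
  have h1 : η ∈ tog w ξ ↔ η ∈ w := by rw [mem_tog, if_neg hne.symm]
  have h2 : ξ ∈ tog w η ↔ ξ ∈ w := by rw [mem_tog, if_neg hne]
  simp only [tg_apply, Nsign_tog, h1, h2, tog_comm w η ξ]
  split_ifs
  · rw [smul_smul, smul_smul, smul_smul, smul_smul]
    congr 1
    ring
  all_goals simp

lemma tg_anticomm (b c : Bool) {ξ η : Xi s r} (hne : ξ ≠ η) (h : ξ.cmp = η.cmp) (τ : BFock s r) :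
    tg b ξ (tg c η τ) + tg c η (tg b ξ τ) = 0 := by
  ext1 w
  have h1 := tg_tg b c hne τ w
  rw [flipSign_anti h hne, neg_smul, ← smul_neg] at h1
  have h2 : flipSign η ξ ≠ 0 := by unfold flipSign; split_ifs <;> simp
  have h3 := smul_right_injective _ h2 h1
  rw [Pi.add_apply, h3]
  simp

lemma tg_comm (b c : Bool) {ξ η : Xi s r} (h : ξ.cmp ≠ η.cmp) (τ : BFock s r) :
    tg b ξ (tg c η τ) = tg c η (tg b ξ τ) := by
  ext1 w
  have h1 := tg_tg b c (fun h' => h (congrArg Xi.cmp h')) τ w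
  rwa [flipSign_of_ne h, flipSign_of_ne h.symm, one_smul, one_smul] at h1

/-- The Grassmann variable in the coefficient of `z ^ k` in the bracket of a field. -/
def mvar : Fld s r → ℤ → Xi s r
  | Sum.inl (a, δ), Int.ofNat n => xi a δ (n - 1)
  | Sum.inl (a, δ), Int.negSucc n => xi a (!δ) n
  | Sum.inr c, Int.ofNat n => Sum.inr (c, n)
  | Sum.inr c, Int.negSucc n => Sum.inr (c, n)

/-- The scalar in the coefficient of `z ^ k` in the bracket of a field. -/
def mcoef : Fld s r → ℤ → ℂ
  | Sum.inl (_, δ), Int.ofNat n => -(sg δ * n)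
  | Sum.inl _, Int.negSucc _ => 1
  | Sum.inr _, Int.ofNat n => (-1) ^ n * (2 * n + 1)
  | Sum.inr _, Int.negSucc _ => 1

/-- Whether the coefficient of `z ^ k` in the bracket of a field is a multiplication. -/
def mb : ℤ → Bool
  | Int.ofNat _ => true
  | Int.negSucc _ => false

@[simp] lemma mb_ofNat (n : ℕ) : mb (Int.ofNat n) = true := rfl
@[simp] lemma mb_natCast (n : ℕ) : mb (n : ℤ) = true := rfl
@[simp] lemma mb_natCast_succ (n : ℕ) : mb ((n : ℤ) + 1) = true := rfl
@[simp] lemma mb_negSucc (n : ℕ) : mb (Int.negSucc n) = false := rfl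

/-- The coefficient of `z ^ k` in the bracket of a field, as an operator. -/
def Bm (φ : Fld s r) (k : ℤ) : Module.End ℂ (BFock s r) := mcoef φ k • tg (mb k) (mvar φ k)

lemma Bm_apply (φ : Fld s r) (k : ℤ) (τ : BFock s r) (w : Finset (Xi s r)) :
    Bm φ k τ w = mcoef φ k • tg (mb k) (mvar φ k) τ w := rfl

lemma mvar_cmp (φ : Fld s r) (k : ℤ) : (mvar φ k).cmp = φ.cmp := by
  rcases φ with ⟨a, δ⟩ | c <;> rcases k with n | n <;> rfl

lemma bracket_eq (φ : Fld s r) (τ : BFock s r) (w : Finset (Xi s r)) (k : ℤ) :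
    bracket φ τ w k = Bm φ k τ w := by
  classical
  rw [Bm_apply, tg_apply]
  rcases φ with ⟨a, δ⟩ | c
  · rcases k with n | n
    · rcases n with _ | n
      · simp [bracket, mcoef]
      · simp only [bracket, mcoef, mvar, mb, tog, Nat.add_sub_cancel]
        by_cases h : xi a δ n ∈ w
        · simp [h, smul_smul]
        · simp [h]
    · simp only [bracket, mcoef, mvar, mb, tog]
      by_cases h : xi a (!δ) n ∈ w <;> simp [h]
  · rcases k with n | n
    · simp only [bracket, mcoef, mvar, mb, tog]
      by_cases h : (Sum.inr (c, n) : Xi s r) ∈ w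
      · simp only [h, if_true, decide_true, ← neg_smul, pow_succ]
        rw [smul_smul]
        congr 1
        ring
      · simp [h]
    · simp only [bracket, mcoef, mvar, mb, tog]
      by_cases h : (Sum.inr (c, n) : Xi s r) ∈ w <;> simp [h]

/-- The anticommutators of the modes of two fields of the same component. -/
def acoef (φ ψ : Fld s r) (k l : ℤ) : ℂ :=
  match φ with
  | Sum.inl (_, δ) => if φ.sgn = ψ.sgn then 0 else if k + l = 0 then -(sg δ * k) else 0
  | Sum.inr _ => if k + l = -1 then (-1) ^ k * (2 * k + 1) else 0

lemma Bm_comm {φ ψ : Fld s r} (h : φ.cmp ≠ ψ.cmp) (k l : ℤ) (τ : BFock s r) :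
    Bm φ k (Bm ψ l τ) = Bm ψ l (Bm φ k τ) := by
  simp only [Bm, LinearMap.smul_apply, map_smul]
  rw [tg_comm _ _ (by rwa [mvar_cmp, mvar_cmp]), smul_comm]

lemma Bm_anticomm_aux {φ ψ : Fld s r} (h : φ.cmp = ψ.cmp) (k l : ℤ) (τ : BFock s r) :
    Bm φ k (Bm ψ l τ) + Bm ψ l (Bm φ k τ) =
      (open Classical in if mvar φ k = mvar ψ l ∧ mb k ≠ mb l then mcoef φ k * mcoef ψ l else 0) • τ := by
  simp only [Bm, LinearMap.smul_apply, map_smul]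
  rw [smul_comm (mcoef ψ l), ← smul_add, ← smul_add, smul_smul]
  split_ifs with h1
  · have : mb l = !(mb k) := by
      have := h1.2
      revert this
      cases mb k <;> cases mb l <;> simp
    rw [h1.1, this, tg_anticomm_self]
  · rw [zero_smul]
    by_cases h2 : mvar φ k = mvar ψ l
    · have : mb k = mb l := by by_contra h3; exact h1 ⟨h2, h3⟩
      rw [h2, this, tg_tg_self, add_zero, smul_zero]
    · rw [tg_anticomm _ _ h2 (by rw [mvar_cmp, mvar_cmp, h]), smul_zero]

lemma sg_not (δ : Bool) : sg (!δ) = -sg δ := by cases δ <;> simp [sg]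

lemma sg_inj {δ δ' : Bool} : sg δ = sg δ' ↔ δ = δ' := by
  cases δ <;> cases δ' <;> norm_num [sg]

lemma Bm_anticomm {φ ψ : Fld s r} (h : φ.cmp = ψ.cmp) (k l : ℤ) (τ : BFock s r) :
    Bm φ k (Bm ψ l τ) + Bm ψ l (Bm φ k τ) = acoef φ ψ k l • τ := by
  rw [Bm_anticomm_aux h]
  congr 1
  rcases φ with ⟨a, δ⟩ | c <;> rcases ψ with ⟨b, δ'⟩ | c' <;> simp only [Fld.cmp, Sum.inl.injEq,
    Sum.inr.injEq, reduceCtorEq] at h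
  · subst h
    by_cases hd : δ = δ'
    · subst hd
      rcases k with n | n <;> rcases l with m | m <;>
        simp [acoef, mvar, mb, xi_inj]
    · have hd' : δ' = !δ := by cases δ <;> cases δ' <;> simp_all
      subst hd'
      have e : ¬ (Fld.sgn (Sum.inl (a, δ) : Fld s r) = Fld.sgn (Sum.inl (a, !δ) : Fld s r)) := by
        change ¬ sg δ = sg (!δ)
        rw [sg_inj]; simp
      simp only [acoef, e, if_false]
      rcases k with n | n <;> rcases l with m | m
      · rw [if_neg fun h => h.2 rfl]
        split_ifs with h1
        · have : n = 0 := by have : (n : ℤ) + m = 0 := h1; omega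
          simp [this]
        · rfl
      · simp only [mvar, mcoef, xi_inj]
        by_cases h1 : n = m + 1
        · subst h1
          rw [if_pos (by simp), if_pos (by rw [Int.negSucc_eq]; simp)]
          simp
        · rw [if_neg (c := _ + _ = (0 : ℤ)) (by rw [Int.negSucc_eq]; simp; omega)]
          split_ifs with h2
          · have : n = 0 := by omega
            simp [this]
          · rfl
      · simp only [mvar, mcoef, xi_inj]
        by_cases h1 : m = n + 1
        · subst h1
          rw [if_pos (by simp), if_pos (by rw [Int.negSucc_eq]; simp)]
          simp [sg_not, Int.cast_negSucc]
          ring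
        · rw [if_neg (c := _ + _ = (0 : ℤ)) (by rw [Int.negSucc_eq]; simp; omega)]
          split_ifs with h2
          · have : m = 0 := by omega
            simp [this]
          · rfl
      · rw [if_neg fun h => h.2 rfl, if_neg]
        omega
  · subst h
    simp only [acoef]
    have hv : ∀ n m : ℕ, (Sum.inr (c, n) : Xi s r) = Sum.inr (c, m) ↔ n = m := by simp
    rcases k with n | n <;> rcases l with m | m
    · rw [if_neg fun h => h.2 rfl, if_neg]
      intro h
      have : (n : ℤ) + m = -1 := h
      omega
    · by_cases h1 : n = m
      · subst h1
        rw [if_pos ⟨rfl, by simp⟩, if_pos (by rw [Int.negSucc_eq]; simp)]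
        simp [mcoef]
      · rw [if_neg fun h => h1 ((hv _ _).1 h.1), if_neg (by rw [Int.negSucc_eq]; simp; omega)]
    · by_cases h1 : n = m
      · subst h1
        rw [if_pos ⟨rfl, by simp⟩, if_pos (by rw [Int.negSucc_eq]; simp)]
        rw [zpow_negSucc, Int.cast_negSucc, pow_succ, mul_inv, ← inv_pow]
        simp only [mcoef]
        norm_num
        ring
      · rw [if_neg fun h => h1 ((hv _ _).1 h.1), if_neg (by rw [Int.negSucc_eq]; simp; omega)]
    · rw [if_neg fun h => h.2 rfl, if_neg]
      omega

/-! ## Charges -/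

/-- The exponent of `z` that comes from the charge of the monomial `w`. -/
def chg (φ : Fld s r) (w : Finset (Xi s r)) : ℤ :=
  match φ with
  | Sum.inl (a, δ) => (if δ then 1 else -1) * ((iNum a w : ℤ) - jNum a w)
  | Sum.inr _ => 0

/-- The change of the exponent `chg ψ` under a mode of `φ`. -/
def dchg (ψ φ : Fld s r) : ℤ :=
  match ψ, φ with
  | Sum.inl (a, δ), Sum.inl (b, δ') => if a = b then (if δ = δ' then 1 else -1) else 0
  | _, _ => 0

open Classical in
lemma card_filter_tog (w : Finset (Xi s r)) (η : Xi s r) (p : Xi s r → Prop) :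
    (((tog w η).filter p).card : ℤ) =
      (w.filter p).card + if p η then (if η ∈ w then -1 else 1) else 0 := by
  unfold tog
  by_cases hp : p η
  · rw [if_pos hp]
    split_ifs with h
    · have hm : η ∈ w.filter p := by simp [h, hp]
      rw [Finset.filter_erase, ← Finset.card_erase_add_one hm]
      push_cast
      ring
    · rw [Finset.filter_insert, if_pos hp, Finset.card_insert_of_notMem (by simp [h])]
      push_cast
      ring
  · rw [if_neg hp, add_zero]
    congr 2
    split_ifs with h
    · rw [Finset.filter_erase, Finset.erase_eq_of_notMem (by simp [hp])]
    · rw [Finset.filter_insert, if_neg hp]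

open Classical in
lemma iNum_sub_jNum_tog (a : Fin s) (w : Finset (Xi s r)) (η : Xi s r) :
    (iNum a (tog w η) : ℤ) - jNum a (tog w η) = iNum a w - jNum a w +
      if η.cmp = Sum.inl a then (if η.pos < 0 then 1 else -1) * (if η ∈ w then -1 else 1)
      else 0 := by
  have e1 : (iNum a (tog w η) : ℤ) = iNum a w +
      if η.cmp = Sum.inl a ∧ η.pos < 0 then (if η ∈ w then -1 else 1) else 0 := by
    unfold iNum; convert card_filter_tog w η fun η => η.cmp = Sum.inl a ∧ η.pos < 0
  have e2 : (jNum a (tog w η) : ℤ) = jNum a w +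
      if η.cmp = Sum.inl a ∧ 0 < η.pos then (if η ∈ w then -1 else 1) else 0 := by
    unfold jNum; convert card_filter_tog w η fun η => η.cmp = Sum.inl a ∧ 0 < η.pos
  rw [e1, e2]
  by_cases hc : η.cmp = Sum.inl a
  · have hp : η.pos ≠ 0 := by
      rcases η with ⟨b, k, hk⟩ | ⟨c, n⟩
      · exact hk
      · simp [Xi.cmp] at hc
    by_cases hn : η.pos < 0
    · simp only [hc, hn, hn.le.not_gt, true_and, if_true, if_false]
      ring
    · have : 0 < η.pos := by omega
      simp only [hc, hn, this, true_and, if_true, if_false]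
      ring
  · simp [hc]

open Classical in
lemma chg_tog (ψ φ : Fld s r) (k : ℤ) (w : Finset (Xi s r))
    (h : decide (mvar φ k ∈ w) = mb k) : chg ψ (tog w (mvar φ k)) = chg ψ w + dchg ψ φ := by
  rcases ψ with ⟨a, δ⟩ | c
  swap
  · simp [chg, dchg]
  simp only [chg, iNum_sub_jNum_tog, mvar_cmp]
  rcases φ with ⟨b, δ'⟩ | d
  swap
  · simp [Fld.cmp, dchg]
  by_cases hab : a = b
  swap
  · simp [Fld.cmp, dchg, hab, Ne.symm hab]
  subst hab
  simp only [Fld.cmp, dchg, if_true]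
  have hm : ((mvar (Sum.inl (a, δ') : Fld s r) k ∈ w) ↔ mb k = true) := by rw [← h]; simp
  simp only [hm]
  rcases k with n | n
  · have h1 : (-1 : ℤ) + -((n - 1 : ℕ) : ℤ) < 0 := by omega
    have h2 : ¬ ((n - 1 : ℕ) : ℤ) + 1 < 0 := by omega
    cases δ <;> cases δ' <;> simp [mvar, xi_pos, h1, h2] <;> omega
  · have h1 : (-1 : ℤ) + -(n : ℤ) < 0 := by omega
    have h2 : ¬ (n : ℤ) + 1 < 0 := by omega
    cases δ <;> cases δ' <;> simp [mvar, xi_pos, h1, h2] <;> omega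

open Classical in
lemma lexSign_mul (w : Finset (Xi s r)) (ξ : Xi s r) :
    lexSign w ξ * (-1 : ℂ) ^ ((tog w ξ).filter fun η => cmpNum η.cmp < cmpNum ξ.cmp).card =
      Nsign w ξ := by
  have h0 := neg_one_pow_filter_tog w ξ fun η => cmpNum η.cmp < cmpNum ξ.cmp
  rw [if_neg (lt_irrefl _), one_mul] at h0
  have h0' : (-1 : ℂ) ^ ((tog w ξ).filter fun η => cmpNum η.cmp < cmpNum ξ.cmp).card =
      (-1 : ℂ) ^ (w.filter fun η => cmpNum η.cmp < cmpNum ξ.cmp).card := by convert h0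
  rw [h0']
  unfold lexSign Nsign
  have : (w.filter fun η => η.Before ξ).card =
      (w.filter fun η => cmpNum η.cmp < cmpNum ξ.cmp).card +
      (w.filter fun η => η.cmp = ξ.cmp ∧ η.pos < ξ.pos).card := by
    rw [← Finset.card_union_of_disjoint, ← Finset.filter_or]
    · congr 1
      ext η
      rw [Finset.mem_filter, Finset.mem_filter]
      exact Iff.rfl
    · rw [Finset.disjoint_filter]
      intro η _ h1 h2
      rw [h2.1] at h1
      exact lt_irrefl _ h1
  have e : ∀ n : ℕ, (-1 : ℂ) ^ n * (-1) ^ n = 1 := fun n => by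
    rw [← pow_add, ← two_mul, pow_mul]; norm_num
  have h2 : (w.filter fun η => η.Before ξ).card = _ := this
  rw [h2, pow_add, mul_right_comm, e, one_mul]

lemma XiMode_inl_ofNat (a : Fin s) (δ : Bool) (n : ℕ) (τ : BFock s r) :
    XiMode (Sum.inl (a, δ)) (Int.ofNat n) τ = (-(sg δ) * ((n : ℂ) + 1)) • gmul (xi a δ n) τ := rfl

lemma XiMode_inl_neg_one (a : Fin s) (δ : Bool) (τ : BFock s r) :
    XiMode (Sum.inl (a, δ)) (Int.negSucc 0) τ = 0 := rfl

lemma XiMode_inl_negSucc (a : Fin s) (δ : Bool) (n : ℕ) (τ : BFock s r) :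
    XiMode (Sum.inl (a, δ)) (Int.negSucc (n + 1)) τ = gder (xi a (!δ) n) τ := rfl

lemma XiMode_inr_ofNat (c : Fin r) (n : ℕ) (τ : BFock s r) :
    XiMode (Sum.inr c) (Int.ofNat n) τ =
      ((-1 : ℂ) ^ n * (2 * n + 1)) • gmul (Sum.inr (c, n)) τ := rfl

lemma XiMode_inr_negSucc (c : Fin r) (n : ℕ) (τ : BFock s r) :
    XiMode (Sum.inr c) (Int.negSucc n) τ = gder (Sum.inr (c, n)) τ := rfl

open Classical in
lemma XiMode_gS (φ : Fld s r) (k : ℤ) (τ : BFock s r) (w : Finset (Xi s r)) (P : Finset (Xi s r) → Prop) :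
    XiMode φ (match φ with | Sum.inl _ => k - 1 | Sum.inr _ => k)
      (fun w' => if P w' then gS φ.cmp τ w' else 0) w =
      if P (tog w (mvar φ k)) then Bm φ k τ w else 0 := by
  have key : ∀ ξ : Xi s r, ξ.cmp = φ.cmp →
      lexSign w ξ • (if P (tog w ξ) then gS φ.cmp τ (tog w ξ) else 0) =
        if P (tog w ξ) then Nsign w ξ • τ (tog w ξ) else 0 := by
    intro ξ hξ
    split_ifs
    · rw [← hξ, gS, smul_smul]
      congr 1
      convert lexSign_mul w ξ
    · rw [smul_zero]
  rw [Bm_apply, tg_apply]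
  have hc := mvar_cmp φ k
  rcases φ with ⟨a, δ⟩ | c
  · rcases k with n | n
    · rcases n with _ | n
      · have e : Int.ofNat 0 - 1 = Int.negSucc 0 := rfl
        simp only [e, XiMode_inl_neg_one]
        simp [mcoef]
      · have e : Int.ofNat (n + 1) - 1 = Int.ofNat n := by simp
        simp only [e]
        rw [XiMode_inl_ofNat, Pi.smul_apply]
        have hv : mvar (Sum.inl (a, δ) : Fld s r) (Int.ofNat (n + 1)) = xi a δ n := rfl
        rw [hv] at hc ⊢
        have hk := key _ hc
        by_cases h : xi a δ n ∈ w
        · have ht : tog w (xi a δ n) = w.erase (xi a δ n) := by simp [tog, h]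
          rw [ht] at hk ⊢
          simp only [gmul, h, if_true, decide_true, mb_ofNat, hk, mcoef, smul_ite, smul_zero]
          push_cast
          simp
        · simp [gmul, h, -Int.ofNat_eq_natCast]
    · have e : Int.negSucc n - 1 = Int.negSucc (n + 1) := by
        rw [Int.negSucc_eq, Int.negSucc_eq]; push_cast; ring
      simp only [e]
      rw [XiMode_inl_negSucc]
      have hv : mvar (Sum.inl (a, δ) : Fld s r) (Int.negSucc n) = xi a (!δ) n := rfl
      rw [hv] at hc ⊢
      have hk := key _ hc
      by_cases h : xi a (!δ) n ∈ w
      · simp [gder, h]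
      · have ht : tog w (xi a (!δ) n) = insert (xi a (!δ) n) w := by simp [tog, h]
        rw [ht] at hk ⊢
        simp only [gder, h, if_false, hk, decide_false, mb_negSucc, if_true, mcoef, one_smul]
  · rcases k with n | n
    · simp only [XiMode_inr_ofNat, Pi.smul_apply]
      have hv : mvar (Sum.inr c : Fld s r) (Int.ofNat n) = Sum.inr (c, n) := rfl
      rw [hv] at hc ⊢
      have hk := key _ hc
      by_cases h : (Sum.inr (c, n) : Xi s r) ∈ w
      · have ht : tog w (Sum.inr (c, n)) = w.erase (Sum.inr (c, n)) := by simp [tog, h]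
        rw [ht] at hk ⊢
        simp only [gmul, h, if_true, decide_true, mb_ofNat, hk, mcoef, smul_ite, smul_zero]
      · simp [gmul, h, -Int.ofNat_eq_natCast]
    · simp only [XiMode_inr_negSucc]
      have hv : mvar (Sum.inr c : Fld s r) (Int.negSucc n) = Sum.inr (c, n) := rfl
      rw [hv] at hc ⊢
      have hk := key _ hc
      by_cases h : (Sum.inr (c, n) : Xi s r) ∈ w
      · simp [gder, h]
      · have ht : tog w (Sum.inr (c, n)) = insert (Sum.inr (c, n)) w := by simp [tog, h]
        rw [ht] at hk ⊢
        simp only [gder, h, if_false, hk, decide_false, mb_negSucc, if_true, mcoef, one_smul]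

lemma grass_eq (φ : Fld s r) (τ : BFock s r) (g : ℤ) (w : Finset (Xi s r)) :
    grass φ τ g w = Bm φ (g - chg φ w) τ w := by
  classical
  have h := fun P k => XiMode_gS φ k τ w P
  rcases φ with ⟨a, δ⟩ | c
  · simp only [grass]
    have hh : ∀ h0 : ℤ, XiMode (Sum.inl (a, δ)) h0
        (chargeProj a ((if δ then 1 else -1) * (g - h0)) (gS (Sum.inl a) τ)) w =
        if h0 = g - chg (Sum.inl (a, δ) : Fld s r) w - 1 then
          Bm (Sum.inl (a, δ)) (g - chg (Sum.inl (a, δ) : Fld s r) w) τ w else 0 := by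
      intro h0
      have h1 := h (fun w' => (iNum a w' : ℤ) - jNum a w' =
        (if δ then 1 else -1) * (g - h0)) (h0 + 1)
      simp only [add_sub_cancel_right] at h1
      have h2 : chargeProj a ((if δ then 1 else -1) * (g - h0)) (gS (Sum.inl a) τ) =
          fun w' => if (iNum a w' : ℤ) - jNum a w' = (if δ then 1 else -1) * (g - h0) then
            gS (Fld.cmp (Sum.inl (a, δ))) τ w' else 0 := by
        ext1 w'
        unfold chargeProj
        congr 1
      refine Eq.trans (by rw [h2]; congr!) (Eq.trans h1 ?_)
      by_cases hm : decide (mvar (Sum.inl (a, δ) : Fld s r) (h0 + 1) ∈ w) = mb (h0 + 1)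
      · have h3 := chg_tog (Sum.inl (a, δ)) _ _ w hm
        have h4 : ((iNum a (tog w (mvar (Sum.inl (a, δ) : Fld s r) (h0 + 1))) : ℤ) -
            jNum a (tog w (mvar (Sum.inl (a, δ) : Fld s r) (h0 + 1))) =
            (if δ then 1 else -1) * (g - h0)) ↔ h0 = g - chg (Sum.inl (a, δ) : Fld s r) w - 1 := by
          generalize chg (Sum.inl (a, δ) : Fld s r) w = c at *
          simp only [chg, dchg, if_true] at h3
          cases δ <;> simp at h3 ⊢ <;> omega
        simp only [h4]
        split_ifs with h5
        · rw [h5, sub_add_cancel]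
        · rfl
      · have h5 : Bm (Sum.inl (a, δ)) (h0 + 1) τ w = 0 := by
          rw [Bm_apply, tg_apply, if_neg hm, smul_zero]
        rw [h5, ite_self]
        split_ifs with h6
        · rw [h6, sub_add_cancel] at h5
          exact h5.symm
        · rfl
    simp only [hh]
    rw [finsum_eq_single _ (g - chg (Sum.inl (a, δ) : Fld s r) w - 1)
      (fun x hx => if_neg hx), if_pos rfl]
  · have := h (fun _ => True) g
    simp only [if_true] at this
    simp only [grass, chg, sub_zero]
    exact this

end MCKP
end

noncomputable section
namespace MCKP

variable {s r : ℕ}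

/-- The coefficient of `z ^ g` in `Ξ(z) z^T S`, for a field, as an operator. -/
def Xm (φ : Fld s r) (g : ℤ) : Module.End ℂ (BFock s r) where
  toFun τ w := Bm φ (g - chg φ w) τ w
  map_add' τ τ' := by ext1 w; simp
  map_smul' c τ := by ext1 w; simp

lemma Xm_apply (φ : Fld s r) (g : ℤ) (τ : BFock s r) (w : Finset (Xi s r)) :
    Xm φ g τ w = Bm φ (g - chg φ w) τ w := rfl

lemma Bm_congr (φ : Fld s r) (k : ℤ) {τ τ' : BFock s r} {w : Finset (Xi s r)}
    (h : decide (mvar φ k ∈ w) = mb k → τ (tog w (mvar φ k)) = τ' (tog w (mvar φ k))) :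
    Bm φ k τ w = Bm φ k τ' w := by
  classical
  rw [Bm_apply, Bm_apply, tg_apply, tg_apply]
  split_ifs with h1
  · rw [h (by convert h1)]
  · rfl

lemma Xm_Xm (φ ψ : Fld s r) (g h : ℤ) (τ : BFock s r) (w : Finset (Xi s r)) :
    Xm φ g (Xm ψ h τ) w =
      Bm φ (g - chg φ w) (Bm ψ (h - chg ψ w - dchg ψ φ) τ) w := by
  classical
  rw [Xm_apply]
  refine Bm_congr _ _ fun hm => ?_
  rw [Xm_apply, chg_tog ψ φ _ w (by convert hm), sub_add_eq_sub_sub]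

/-- A bound for the positions of the variables in a monomial. -/
def bnd (w : Finset (Xi s r)) : ℕ := w.sup (fun ξ => ξ.pos.natAbs) + 1

lemma mvar_notMem {φ : Fld s r} {k : ℤ} {w : Finset (Xi s r)} (h : (bnd w : ℤ) < k) :
    mvar φ k ∉ w := by
  intro hm
  have h1 := Finset.le_sup (f := fun ξ : Xi s r => ξ.pos.natAbs) hm
  unfold bnd at h
  rcases k with n | n
  swap
  · have := Int.negSucc_lt_zero n; omega
  have h2 : ((mvar φ (Int.ofNat n)).pos.natAbs : ℤ) = n := by
    rcases φ with ⟨a, δ⟩ | c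
    · have h3 : (mvar (Sum.inl (a, δ) : Fld s r) (Int.ofNat n)).pos =
        (if δ then 1 else -1) * (((n - 1 : ℕ) : ℤ) + 1) := rfl
      rw [h3]
      rw [Int.ofNat_eq_natCast] at h
      rcases δ
      · rw [if_neg (by simp)]; omega
      · rw [if_pos rfl]; omega
    · have h3 : (mvar (Sum.inr c : Fld s r) (Int.ofNat n)).pos = n := rfl
      rw [h3]; simp
  simp at h
  omega

lemma Bm_eq_zero (φ : Fld s r) {k : ℤ} {w : Finset (Xi s r)} (h : (bnd w : ℤ) < k)
    (τ : BFock s r) : Bm φ k τ w = 0 := by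
  classical
  rw [Bm_apply, tg_apply, if_neg, smul_zero]
  have h1 := mvar_notMem (φ := φ) h
  have h2 : mb k = true := by
    rcases k with n | n
    · rfl
    · have := Int.negSucc_lt_zero n; omega
  simp [h1, h2]

/-- The highest power of `z` that occurs in the Grassmann part of a field. -/
def gtop (φ : Fld s r) (w : Finset (Xi s r)) : ℤ := bnd w + chg φ w

lemma Xm_eq_zero (φ : Fld s r) {g : ℤ} {w : Finset (Xi s r)} (h : gtop φ w < g)
    (τ : BFock s r) : Xm φ g τ w = 0 :=
  Bm_eq_zero φ (by unfold gtop at h; omega) τ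

section tails

variable {M : Type*} [AddCommGroup M]

/-- The sum of the values of `P` at the integers from `x` to `U`. -/
def tailSum (P : ℤ → M) (U x : ℤ) : M := ∑ k ∈ Finset.range (U + 1 - x).toNat, P (x + k)

lemma sum_range_eq_tailSum {P : ℤ → M} {U : ℤ} (hP : ∀ u, U < u → P u = 0) (x : ℤ) {N : ℕ}
    (hN : U + 1 - x ≤ N) : ∑ k ∈ Finset.range N, P (x + k) = tailSum P U x := by
  symm
  refine Finset.sum_subset (Finset.range_mono (by omega)) fun k _ hk => hP _ ?_
  simp only [Finset.mem_range, not_lt] at hk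
  omega

lemma tailSum_succ {P : ℤ → M} {U : ℤ} (hP : ∀ u, U < u → P u = 0) (x : ℤ) :
    tailSum P U x = P x + tailSum P U (x + 1) := by
  rw [← sum_range_eq_tailSum hP x (N := (U + 1 - x).toNat + 1) (by omega),
    ← sum_range_eq_tailSum hP (x + 1) (N := (U + 1 - x).toNat) (by omega),
    Finset.sum_range_succ', add_comm]
  congr 1
  · simp
  · refine Finset.sum_congr rfl fun k _ => ?_
    push_cast
    congr 1
    ring

lemma eq_zero_of_const_of_anti [Module ℂ M] {f : ℤ → M} (m : ℤ) (h1 : ∀ g, f (g + 1) = f g)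
    (h2 : ∀ g, f (m - g) = -f g) (g : ℤ) : f g = 0 := by
  have hc : ∀ g, f g = f 0 := by
    intro g
    induction g using Int.induction_on with
    | zero => rfl
    | succ n ih => rw [h1, ih]
    | pred n ih => rw [← h1, sub_add_cancel, ih]
  have h3 := h2 g
  rw [hc (m - g), ← hc g] at h3
  have h4 : (2 : ℂ) • f g = 0 := by rw [two_smul]; nth_rewrite 1 [h3]; simp
  simpa using h4

end tails

/-- The commutator of the coefficients of `z ^ g` and `w ^ h` of two fields. -/
def ccom (φ ψ : Fld s r) (g h : ℤ) : ℂ :=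
  open Classical in
  if g + h = -1 ∧ ψ = φ.conj then
    match φ with
    | Sum.inl (_, δ) => sg δ
    | Sum.inr _ => -(-1) ^ g
  else 0

/-- The coefficient of `z ^ g w ^ h` in the product of the Grassmann parts of two fields and their
contraction, up to the order `N` in the contraction. -/
def Fsum (φ ψ : Fld s r) (g h : ℤ) (N : ℕ) (τ : BFock s r) (w : Finset (Xi s r)) : TSer s r :=
  ∑ k ∈ Finset.range N, kap φ ψ k • Xm φ (g + k) (Xm ψ (h - k) τ) w

lemma dchg_of_ne {φ ψ : Fld s r} (h : φ.cmp ≠ ψ.cmp) : dchg ψ φ = 0 := by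
  rcases φ with ⟨a, δ⟩ | c <;> rcases ψ with ⟨b, δ'⟩ | d <;> simp_all [Fld.cmp, dchg]
  intro h'; exact absurd h'.symm h

lemma conj_cmp (φ : Fld s r) : φ.conj.cmp = φ.cmp := by
  rcases φ with ⟨a, δ⟩ | c <;> rfl

lemma sum_range_kap_ne {φ ψ : Fld s r} (h : φ.cmp ≠ ψ.cmp) {N : ℕ} (hN : 1 ≤ N)
    {M : Type*} [AddCommGroup M] [Module ℂ M] (f : ℕ → M) :
    ∑ k ∈ Finset.range N, kap φ ψ k • f k = f 0 := by
  rw [Finset.sum_eq_single 0]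
  · simp [kap, h]
  · intro k _ hk; simp [kap, h, hk]
  · intro h0; simp at h0; omega

lemma Fsum_comm_of_ne {φ ψ : Fld s r} (hne : φ.cmp ≠ ψ.cmp) (g h : ℤ) {N : ℕ} (hN : 1 ≤ N)
    (τ : BFock s r) (w : Finset (Xi s r)) :
    Fsum φ ψ g h N τ w - Fsum ψ φ h g N τ w = ccom φ ψ g h • τ w := by
  have h1 : ¬ (g + h = -1 ∧ ψ = φ.conj) := fun h' => hne (by rw [h'.2, conj_cmp])
  have h2 : ccom φ ψ g h = 0 := by rw [ccom.eq_def]; exact if_neg h1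
  rw [h2, zero_smul, Fsum, Fsum, sum_range_kap_ne hne hN,
    sum_range_kap_ne hne.symm hN, Xm_Xm, Xm_Xm, dchg_of_ne hne, dchg_of_ne hne.symm]
  rw [Bm_comm hne]
  simp

lemma Fsum_comm_same (a : Fin s) (δ : Bool) (g h : ℤ) (τ : BFock s r) (w : Finset (Xi s r))
    {N : ℕ} (hN : gtop (Sum.inl (a, δ)) w + 1 - g ≤ N)
    (hN' : gtop (Sum.inl (a, δ)) w + 1 - h ≤ N) :
    Fsum (Sum.inl (a, δ)) (Sum.inl (a, δ)) g h N τ w -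
      Fsum (Sum.inl (a, δ)) (Sum.inl (a, δ)) h g N τ w = 0 := by
  set φ : Fld s r := Sum.inl (a, δ) with hφ
  set U := gtop φ w
  let P : ℤ → TSer s r := fun u => Xm φ u (Xm φ (g + h - u) τ) w
  have hP : ∀ u, U < u → P u = 0 := fun u hu => Xm_eq_zero φ hu _
  have hk : ∀ k, kap φ φ k = 1 := by intro k; simp [kap, hφ]
  have h1 : ∀ u, P (g + h - 1 - u) = -P u := by
    intro u
    simp only [P]
    rw [Xm_Xm, Xm_Xm]
    have hd : dchg φ φ = 1 := by simp [hφ, dchg]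
    have := Bm_anticomm (rfl : φ.cmp = φ.cmp) (u - chg φ w) (g + h - u - chg φ w - 1) τ
    have ha : acoef φ φ (u - chg φ w) (g + h - u - chg φ w - 1) = 0 := by simp [acoef, hφ]
    rw [ha, zero_smul] at this
    have h2 := congrFun (eq_neg_of_add_eq_zero_right this) w
    rw [hd]
    rw [show g + h - 1 - u - chg φ w = g + h - u - chg φ w - 1 by ring,
      show g + h - (g + h - 1 - u) - chg φ w - 1 = u - chg φ w by ring, h2]
    rfl
  have e : ∀ x y : ℤ, x + y = g + h → U + 1 - x ≤ N → Fsum φ φ x y N τ w = tailSum P U x := by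
    intro x y hxy hx
    rw [← sum_range_eq_tailSum hP x hx, Fsum]
    refine Finset.sum_congr rfl fun k _ => ?_
    rw [hk, one_smul]
    simp only [P]
    rw [show y - (k : ℤ) = g + h - (x + k) by omega]
  rw [e g h rfl hN, e h g (add_comm _ _) hN']
  have := eq_zero_of_const_of_anti (f := fun x => tailSum P U x - tailSum P U (g + h - x)) (g + h)
    (fun x => by
      rw [tailSum_succ hP x, tailSum_succ hP (g + h - (x + 1)),
        show g + h - (x + 1) = g + h - 1 - x by ring, h1,
        show g + h - 1 - x + 1 = g + h - x by ring]
      abel) (fun x => by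
      rw [show g + h - (g + h - x) = x by ring]; abel) g
  simpa using this

lemma sg_mul_self (δ : Bool) : sg δ * sg δ = 1 := by cases δ <;> simp [sg]

lemma Fsum_comm_opp (a : Fin s) (δ : Bool) (g h : ℤ) (τ : BFock s r) (w : Finset (Xi s r))
    {N : ℕ} (hN : 2 ≤ N) :
    Fsum (Sum.inl (a, δ)) (Sum.inl (a, !δ)) g h N τ w -
      Fsum (Sum.inl (a, !δ)) (Sum.inl (a, δ)) h g N τ w =
      (if g + h = -1 then sg δ else 0) • τ w := by
  have hk : ∀ δ', Fld.sgn (Sum.inl (a, δ') : Fld s r) ≠ Fld.sgn (Sum.inl (a, !δ') : Fld s r) := by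
    intro δ'
    change ¬ sg δ' = sg (!δ')
    rw [sg_inj]; simp
  have key : ∀ (δ' : Bool) (x y : ℤ),
      Fsum (Sum.inl (a, δ')) (Sum.inl (a, !δ')) x y N τ w =
      Xm (Sum.inl (a, δ')) x (Xm (Sum.inl (a, !δ')) y τ) w -
      Xm (Sum.inl (a, δ')) (x + 1) (Xm (Sum.inl (a, !δ')) (y - 1) τ) w := by
    intro δ' x y
    obtain ⟨N, rfl⟩ := Nat.exists_eq_add_of_le' hN
    rw [Fsum, Finset.sum_range_succ', Finset.sum_range_succ', Finset.sum_eq_zero]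
    · simp [kap, hk δ', Fld.cmp]
      abel
    · intro k _
      simp [kap, hk δ', Fld.cmp]
  have k1 := key δ g h
  have k2 := key (!δ) h g
  rw [Bool.not_not] at k2
  rw [k1, k2]
  simp only [Xm_Xm]
  have hd : dchg (Sum.inl (a, !δ) : Fld s r) (Sum.inl (a, δ)) = -1 := by simp [dchg]
  have hd' : dchg (Sum.inl (a, δ) : Fld s r) (Sum.inl (a, !δ)) = -1 := by simp [dchg]
  have hc : chg (Sum.inl (a, !δ) : Fld s r) w = -chg (Sum.inl (a, δ) : Fld s r) w := by
    cases δ <;> simp [chg]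
  rw [hd, hd', hc]
  set c := chg (Sum.inl (a, δ) : Fld s r) w
  have ac := fun k l => congrFun (Bm_anticomm
    (show Fld.cmp (Sum.inl (a, δ) : Fld s r) = Fld.cmp (Sum.inl (a, !δ)) from rfl) k l τ) w
  have a1 := ac (g - c) (h + c + 1)
  have a2 := ac (g + 1 - c) (h + c)
  simp only [acoef, hk, if_false] at a1 a2
  rw [show h - -c - -1 = h + c + 1 by ring, show h - 1 - -c - -1 = h + c by ring,
    show h - -c = h + c by ring, show g - c - -1 = g + 1 - c by ring,
    show h + 1 - -c = h + c + 1 by ring, show g - 1 - c - -1 = g - c by ring]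
  have e1 : (g - c + (h + c + 1) = 0) ↔ g + h = -1 := by constructor <;> intro h <;> omega
  have e2 : (g + 1 - c + (h + c) = 0) ↔ g + h = -1 := by constructor <;> intro h <;> omega
  simp only [e1] at a1
  simp only [e2] at a2
  have h3 : ∀ A B C D : TSer s r, A - B - (C - D) = (A + D) - (B + C) := by intros; abel
  rw [h3]
  refine (congrArg₂ (· - ·) a1 a2).trans ?_
  simp only [Pi.smul_apply]
  rw [← sub_smul]
  congr 1
  split_ifs
  · push_cast; ring
  · ring

lemma Fsum_comm_inr (c : Fin r) (g h : ℤ) (τ : BFock s r) (w : Finset (Xi s r))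
    {N : ℕ} (hN : gtop (Sum.inr c) w + 1 - g ≤ N) (hN' : gtop (Sum.inr c) w + 1 - h ≤ N)
    (h1N : 1 ≤ N) :
    Fsum (Sum.inr c) (Sum.inr c) g h N τ w - Fsum (Sum.inr c) (Sum.inr c) h g N τ w =
      (if g + h = -1 then -(-1) ^ g else 0 : ℂ) • τ w := by
  set φ : Fld s r := Sum.inr c with hφ
  set U := gtop φ w
  let P : ℤ → TSer s r := fun u => Xm φ u (Xm φ (g + h - u) τ) w
  have hP : ∀ u, U < u → P u = 0 := fun u hu => Xm_eq_zero φ hu _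
  have h1 : ∀ u, P u + P (g + h - u) =
      (if g + h = -1 then (-1) ^ u * (2 * u + 1) else 0 : ℂ) • τ w := by
    intro u
    simp only [P]
    rw [Xm_Xm, Xm_Xm]
    have hd : dchg φ φ = 0 := by simp [hφ, dchg]
    have hc : chg φ w = 0 := by simp [hφ, chg]
    have := congrFun (Bm_anticomm (rfl : φ.cmp = φ.cmp) u (g + h - u) τ) w
    rw [hd, hc]
    simp only [sub_zero, sub_sub_cancel]
    refine this.trans ?_
    simp only [acoef, hφ, add_sub_cancel]
    rfl
  have e : ∀ x y : ℤ, x + y = g + h → U + 1 - x ≤ N → Fsum φ φ x y N τ w =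
      tailSum P U x + tailSum P U (x + 1) := by
    intro x y hxy hx
    obtain ⟨N, rfl⟩ := Nat.exists_eq_add_of_le' h1N
    have e2 : ∀ k ∈ Finset.range (N + 1), kap φ φ k • Xm φ (x + k) (Xm φ (y - k) τ) w =
        (if k = 0 then (1 : ℂ) else 2) • P (x + k) := by
      intro k _
      simp only [P]
      rw [show y - (k : ℤ) = g + h - (x + k) by omega]
      simp [kap, hφ]
    rw [Fsum, Finset.sum_congr rfl e2, ← sum_range_eq_tailSum hP x hx,
      ← sum_range_eq_tailSum hP (x + 1) (N := N) (by push_cast at hx; omega),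
      Finset.sum_range_succ', Finset.sum_range_succ']
    simp only [Nat.succ_ne_zero, if_false, if_true, one_smul, two_smul, Finset.sum_add_distrib]
    have e3 : ∑ k ∈ Finset.range N, P (x + 1 + k) = ∑ k ∈ Finset.range N, P (x + (k + 1 : ℕ)) := by
      refine Finset.sum_congr rfl fun k _ => ?_
      congr 1; push_cast; ring
    rw [e3]
    abel
  rw [e g h rfl hN, e h g (add_comm _ _) hN']
  set C : ℤ → ℂ := fun u => if g + h = -1 then -(-1) ^ u else 0
  have hC : ∀ u, C (u + 1) = -C u := by
    intro u
    simp only [C]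
    split_ifs
    · rw [zpow_add₀ (by norm_num)]; simp
    · simp
  have := eq_zero_of_const_of_anti (f := fun x => tailSum P U x + tailSum P U (x + 1) -
    (tailSum P U (g + h - x) + tailSum P U (g + h - x + 1)) - C x • τ w) (g + h)
    (fun x => by
      have t1 := tailSum_succ hP x
      have t2 := tailSum_succ hP (x + 1)
      have t3 := tailSum_succ hP (g + h - (x + 1))
      have t4 := tailSum_succ hP (g + h - x)
      rw [show g + h - (x + 1) + 1 = g + h - x by ring] at t3 ⊢
      have p1 := h1 x
      have p2 := h1 (x + 1)
      have hcc : C (x + 1) = C x + ((if g + h = -1 then (-1) ^ x * (2 * x + 1) else 0 : ℂ) +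
        (if g + h = -1 then (-1) ^ (x + 1) * (2 * (x + 1 : ℤ) + 1) else 0 : ℂ)) * (-1) := by
        simp only [C]
        split_ifs
        · rw [zpow_add₀ (by norm_num)]; push_cast; ring
        · ring
      rw [hcc, add_smul, mul_neg_one, neg_smul, add_smul, ← p1, ← p2, t1, t2, t3, t4]
      abel) (fun x => by
      have : C (g + h - x) = - C x := by
        simp only [C]
        split_ifs with hgh
        · rw [hgh, zpow_sub₀ (by norm_num), zpow_neg_one]
          rcases Int.even_or_odd x with hx | hx
          · rw [hx.neg_one_zpow]; norm_num
          · rw [hx.neg_one_zpow]; norm_num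
        · simp
      rw [this, show g + h - (g + h - x) = x by ring, neg_smul]
      abel) g
  rw [show g + h - g = h by ring] at this
  exact sub_eq_zero.1 this

/-- The commutation relation of the Grassmann parts of two fields, with contractions. -/
lemma Fsum_comm (φ ψ : Fld s r) (g h : ℤ) (τ : BFock s r) (w : Finset (Xi s r)) {N : ℕ}
    (h2 : 2 ≤ N) (hN : gtop φ w + 1 - g ≤ N) (hN' : gtop ψ w + 1 - h ≤ N) :
    Fsum φ ψ g h N τ w - Fsum ψ φ h g N τ w = ccom φ ψ g h • τ w := by
  by_cases hne : φ.cmp = ψ.cmp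
  swap
  · exact Fsum_comm_of_ne hne g h (by omega) τ w
  rcases φ with ⟨a, δ⟩ | c <;> rcases ψ with ⟨b, δ'⟩ | d <;> simp only [Fld.cmp, Sum.inl.injEq,
    Sum.inr.injEq, reduceCtorEq] at hne
  · subst hne
    by_cases hd : δ = δ'
    · subst hd
      rw [Fsum_comm_same a δ g h τ w hN hN', ccom, if_neg, zero_smul]
      simp [Fld.conj]
    · have : δ' = !δ := by cases δ <;> cases δ' <;> simp_all
      subst this
      rw [Fsum_comm_opp a δ g h τ w h2, ccom]
      simp [Fld.conj]
  · subst hne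
    rw [Fsum_comm_inr c g h τ w hN hN' (by omega), ccom]
    simp [Fld.conj]

end MCKP
end

noncomputable section
namespace MCKP

variable {s r : ℕ}

/-- A truncation of the mode `bB φ j`. -/
def bBt (φ : Fld s r) (j : ℤ) (P N : ℕ) (τ : BFock s r) (w : Finset (Xi s r)) : TSer s r :=
  ∑ p ∈ Finset.range P, ∑ q ∈ Finset.range N, Hc φ p * Dc φ q (Xm φ (-j - 1 - p + q) τ w)

lemma coeff_Hc_mul_eq_zero {φ : Fld s r} {p : ℕ} {m : Time s r →₀ ℕ} (h : wt m < p)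
    (u : TSer s r) : MvPowerSeries.coeff m (Hc φ p * u) = 0 := by
  by_contra h0
  obtain ⟨m', h1, -⟩ := coeff_Hc_mul_ne_zero h0
  omega

lemma coeff_bB (φ : Fld s r) (j : ℤ) {P N : ℕ} (τ : BFock s r) (w : Finset (Xi s r))
    {m : Time s r →₀ ℕ} (hP : wt m < P) (hN : gtop φ w + j + 1 + wt m < N) :
    MvPowerSeries.coeff m (bB φ j τ w) = MvPowerSeries.coeff m (bBt φ j P N τ w) := by
  change (∑ᶠ p : ℕ, MvPowerSeries.coeff m
    (Hc φ p * ∑ᶠ q : ℕ, Dc φ q (grass φ τ (-j - 1 - p + q) w))) = _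
  rw [finsum_eq_sum_of_support_subset _ (s := Finset.range P), bBt, map_sum]
  · refine Finset.sum_congr rfl fun p _ => ?_
    by_cases hp : wt m < p
    · rw [← Finset.mul_sum, coeff_Hc_mul_eq_zero hp, coeff_Hc_mul_eq_zero hp]
    · rw [finsum_eq_sum_of_support_subset _ (s := Finset.range N), Finset.mul_sum]
      · simp only [grass_eq, Xm_apply]
      · intro q hq
        by_contra hq'
        refine hq ?_
        simp only [Finset.coe_range, Set.mem_Iio, not_lt] at hq'
        change Dc φ q (grass φ τ (-j - 1 - p + q) w) = 0
        rw [grass_eq, ← Xm_apply, Xm_eq_zero φ (by omega), map_zero]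
  · intro p hp
    by_contra hp'
    simp only [Finset.coe_range, Set.mem_Iio, not_lt] at hp'
    exact hp (coeff_Hc_mul_eq_zero (by omega) _)

lemma exists_coeff_bB (φ : Fld s r) (j : ℤ) (w : Finset (Xi s r)) (m : Time s r →₀ ℕ) :
    ∃ P N : ℕ, ∀ τ, MvPowerSeries.coeff m (bB φ j τ w) = MvPowerSeries.coeff m (bBt φ j P N τ w) :=
  ⟨wt m + 1, (gtop φ w + j + 1 + wt m).toNat + 1,
    fun τ => coeff_bB φ j τ w (by omega) (by omega)⟩

/-- The mode `bB φ j` as a linear operator. -/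
def bL (φ : Fld s r) (j : ℤ) : Module.End ℂ (BFock s r) where
  toFun := bB φ j
  map_add' τ τ' := by
    ext1 w
    ext m
    obtain ⟨P, N, h⟩ := exists_coeff_bB φ j w m
    rw [h, Pi.add_apply, map_add, h, h, ← map_add]
    congr 1
    simp only [bBt, map_add, Pi.add_apply, mul_add, Finset.sum_add_distrib]
  map_smul' c τ := by
    ext1 w
    ext m
    obtain ⟨P, N, h⟩ := exists_coeff_bB φ j w m
    rw [h, Pi.smul_apply, map_smul, h, ← map_smul]
    congr 1
    simp only [bBt, map_smul, Pi.smul_apply, mul_smul_comm, Finset.smul_sum, RingHom.id_apply]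

@[simp] lemma bL_apply (φ : Fld s r) (j : ℤ) (τ : BFock s r) : bL φ j τ = bB φ j τ := rfl

/-- The derivative with respect to a time. -/
def dB (i : Time s r) : Module.End ℂ (BFock s r) where
  toFun τ w := MvPowerSeries.pderiv ℂ i (τ w)
  map_add' τ τ' := by ext1 w; simp
  map_smul' c τ := by ext1 w; simp [Derivation.map_smul]

/-- The multiplication by a time. -/
def tB (i : Time s r) : Module.End ℂ (BFock s r) where
  toFun τ w := MvPowerSeries.X i * τ w
  map_add' τ τ' := by ext1 w; simp [mul_add]
  map_smul' c τ := by ext1 w; simp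

lemma dB_apply (i : Time s r) (τ : BFock s r) (w : Finset (Xi s r)) :
    dB i τ w = MvPowerSeries.pderiv ℂ i (τ w) := rfl

lemma tB_apply (i : Time s r) (τ : BFock s r) (w : Finset (Xi s r)) :
    tB i τ w = MvPowerSeries.X i * τ w := rfl

lemma Bm_map (φ : Fld s r) (k : ℤ) (f : Module.End ℂ (TSer s r)) (τ : BFock s r)
    (w : Finset (Xi s r)) : Bm φ k (fun w => f (τ w)) w = f (Bm φ k τ w) := by
  rw [Bm_apply, Bm_apply, tg_apply, tg_apply, map_smul]
  split_ifs
  · rw [map_smul]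
  · rw [map_zero]

lemma Xm_map (φ : Fld s r) (g : ℤ) (f : Module.End ℂ (TSer s r)) (τ : BFock s r)
    (w : Finset (Xi s r)) : Xm φ g (fun w => f (τ w)) w = f (Xm φ g τ w) := Bm_map _ _ _ _ _

lemma Xm_dB (φ : Fld s r) (g : ℤ) (i : Time s r) (τ : BFock s r) (w : Finset (Xi s r)) :
    Xm φ g (dB i τ) w = MvPowerSeries.pderiv ℂ i (Xm φ g τ w) :=
  Xm_map φ g (MvPowerSeries.pderiv ℂ i).toLinearMap τ w

lemma Xm_tB (φ : Fld s r) (g : ℤ) (i : Time s r) (τ : BFock s r) (w : Finset (Xi s r)) :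
    Xm φ g (tB i τ) w = MvPowerSeries.X i * Xm φ g τ w :=
  Xm_map φ g (mulOp (MvPowerSeries.X i)) τ w

lemma sum_range_ite_le {M : Type*} [AddCommMonoid M] (k N : ℕ) (f : ℕ → M) :
    ∑ p ∈ Finset.range (N + k), (if k ≤ p then f (p - k) else 0) = ∑ p ∈ Finset.range N, f p := by
  rw [add_comm, Finset.sum_range_add, Finset.sum_eq_zero, zero_add]
  · refine Finset.sum_congr rfl fun p _ => ?_
    rw [if_pos (by omega), Nat.add_sub_cancel_left]
  · intro p hp
    rw [if_neg (by simpa using hp)]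

lemma pderiv_bBt (φ : Fld s r) (j : ℤ) (i : Time s r) (P N : ℕ) (τ : BFock s r)
    (w : Finset (Xi s r)) :
    MvPowerSeries.pderiv ℂ i (bBt φ j (P + tdeg i) N τ w) =
      tsgn φ i • bBt φ (j + tdeg i) P N τ w + bBt φ j (P + tdeg i) N (dB i τ) w := by
  have h : ∀ p : ℕ, ∑ q ∈ Finset.range N,
      MvPowerSeries.pderiv ℂ i (Hc φ p * Dc φ q (Xm φ (-j - 1 - p + q) τ w)) =
      (if tdeg i ≤ p then tsgn φ i • ∑ q ∈ Finset.range N, Hc φ (p - tdeg i) *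
        Dc φ q (Xm φ (-(j + tdeg i) - 1 - (p - tdeg i : ℕ) + q) τ w) else 0) +
      ∑ q ∈ Finset.range N, Hc φ p * Dc φ q (Xm φ (-j - 1 - p + q) (dB i τ) w) := by
    intro p
    simp only [Derivation.leibniz, smul_eq_mul, pderiv_Dc, Xm_dB, Finset.sum_add_distrib,
      pderiv_Hc]
    rw [add_comm]
    congr 1
    split_ifs with hp
    · rw [Finset.smul_sum]
      refine Finset.sum_congr rfl fun q _ => ?_
      rw [show (-(j + tdeg i) - 1 - (p - tdeg i : ℕ) + q : ℤ) = -j - 1 - p + q by omega,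
        mul_smul_comm, mul_comm]
    · simp
  unfold bBt
  simp only [map_sum]
  simp only [h, Finset.sum_add_distrib]
  rw [sum_range_ite_le (tdeg i) P fun p => tsgn φ i • ∑ q ∈ Finset.range N, Hc φ p *
        Dc φ q (Xm φ (-(j + tdeg i) - 1 - p + q) τ w), Finset.smul_sum]

lemma bBt_tB (φ : Fld s r) (j : ℤ) (i : Time s r) (P N : ℕ) (τ : BFock s r)
    (w : Finset (Xi s r)) :
    bBt φ j P (N + tdeg i) (tB i τ) w =
      dsgn φ i • bBt φ (j - tdeg i) P N τ w + MvPowerSeries.X i * bBt φ j P (N + tdeg i) τ w := by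
  unfold bBt
  rw [Finset.smul_sum, Finset.mul_sum, ← Finset.sum_add_distrib]
  refine Finset.sum_congr rfl fun p _ => ?_
  rw [Finset.smul_sum, Finset.mul_sum, ← sum_range_ite_le (tdeg i) N fun q =>
    dsgn φ i • (Hc φ p * Dc φ q (Xm φ (-(j - tdeg i) - 1 - p + q) τ w)),
    ← Finset.sum_add_distrib]
  refine Finset.sum_congr rfl fun q _ => ?_
  rw [Xm_tB, Dc_X, mul_add, add_comm]
  congr 1
  · split_ifs with hq
    · rw [show (-(j - tdeg i) - 1 - p + (q - tdeg i : ℕ) : ℤ) = -j - 1 - p + q by omega,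
        mul_smul_comm]
    · simp
  · ring

lemma dB_bB (φ : Fld s r) (j : ℤ) (i : Time s r) (τ : BFock s r) :
    dB i (bB φ j τ) = tsgn φ i • bB φ (j + tdeg i) τ + bB φ j (dB i τ) := by
  ext1 w
  ext m
  set M := m + Finsupp.single i 1
  have hw : wt M = wt m + tdeg i := wt_add_single m i
  have hi := tdeg_pos i
  let P := wt m + 1
  let N := (gtop φ w + j + 1 + wt M).toNat + 1
  have e1 := coeff_bB φ j (P := P + tdeg i) (N := N) τ w (m := M) (by omega) (by omega)
  have e2 := coeff_bB φ j (P := P + tdeg i) (N := N) (dB i τ) w (m := m) (by omega) (by omega)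
  have e3 := coeff_bB φ (j + tdeg i) (P := P) (N := N) τ w (m := m) (by omega) (by omega)
  rw [dB_apply, Pi.add_apply, map_add, Pi.smul_apply, map_smul, e2, e3,
    MvPowerSeries.coeff_pderiv, e1, ← map_smul, ← map_add, ← pderiv_bBt,
    MvPowerSeries.coeff_pderiv]

lemma bB_tB (φ : Fld s r) (j : ℤ) (i : Time s r) (τ : BFock s r) :
    bB φ j (tB i τ) = dsgn φ i • bB φ (j - tdeg i) τ + tB i (bB φ j τ) := by
  classical
  ext1 w
  ext m
  let P := wt m + 1
  let N := (gtop φ w + j + 1 + wt m).toNat + 1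
  have e1 := coeff_bB φ j (P := P) (N := N + tdeg i) (tB i τ) w (m := m) (by omega)
    (by push_cast; omega)
  have e3 := coeff_bB φ (j - tdeg i) (P := P) (N := N) τ w (m := m) (by omega) (by omega)
  rw [e1, bBt_tB, Pi.add_apply, map_add, map_add, Pi.smul_apply, map_smul, map_smul, e3]
  congr 1
  rw [tB_apply, MvPowerSeries.X, MvPowerSeries.coeff_monomial_mul,
    MvPowerSeries.coeff_monomial_mul]
  split_ifs with h
  · congr 1
    symm
    have hw : wt (m - Finsupp.single i 1) ≤ wt m := by
      have := congrArg wt (tsub_add_cancel_of_le h)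
      rw [wt_add_single] at this
      omega
    exact coeff_bB φ j τ w (by omega) (by push_cast; omega)
  · rfl

end MCKP
end

noncomputable section
namespace MCKP

variable {s r : ℕ}

lemma ccom_shift (φ ψ : Fld s r) (g h : ℤ) (i : Time s r) {k : ℤ} (hk : Odd k ↔ Odd (tdeg i)) :
    tsgn φ i * ccom φ ψ (g + k) h + tsgn ψ i * ccom φ ψ g (h + k) = 0 := by
  classical
  by_cases h1 : g + (h + k) = -1 ∧ ψ = φ.conj
  swap
  · have e1 : ccom φ ψ (g + k) h = 0 := by
      rw [ccom.eq_def]; exact if_neg (by rwa [show g + k + h = g + (h + k) by ring])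
    have e2 : ccom φ ψ g (h + k) = 0 := by rw [ccom.eq_def]; exact if_neg h1
    rw [e1, e2]; ring
  obtain ⟨h1, rfl⟩ := h1
  by_cases hc : tcmp i = φ.cmp
  swap
  · rw [tsgn, tsgn, conj_cmp, if_neg hc, if_neg hc]; ring
  rw [tsgn, tsgn, conj_cmp, if_pos hc, if_pos hc, ccom.eq_def, ccom.eq_def,
    if_pos ⟨by rw [← h1]; ring, rfl⟩, if_pos ⟨h1, rfl⟩]
  rcases φ with ⟨a, δ⟩ | c
  · simp only [Fld.conj, Fld.sgn, sg_not]
    ring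
  · simp only [Fld.conj, Fld.sgn]
    have : Odd k := hk.2 (tdeg_odd hc)
    rw [zpow_add₀ (by norm_num), this.neg_one_zpow]; ring

/-- The defect of the commutation relation of two modes. -/
def defect (φ ψ : Fld s r) (i j : ℤ) : Module.End ℂ (BFock s r) :=
  bL φ i * bL ψ j - bL ψ j * bL φ i - ccom φ ψ (-i - 1) (-j - 1) • 1

lemma defect_apply (φ ψ : Fld s r) (i j : ℤ) (τ : BFock s r) : defect φ ψ i j τ =
    bB φ i (bB ψ j τ) - bB ψ j (bB φ i τ) - ccom φ ψ (-i - 1) (-j - 1) • τ := rfl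

lemma bB_add (φ : Fld s r) (j : ℤ) (τ τ' : BFock s r) :
    bB φ j (τ + τ') = bB φ j τ + bB φ j τ' := map_add (bL φ j) τ τ'

lemma bB_smul (φ : Fld s r) (j : ℤ) (c : ℂ) (τ : BFock s r) :
    bB φ j (c • τ) = c • bB φ j τ := map_smul (bL φ j) c τ

lemma dB_defect (φ ψ : Fld s r) (i j : ℤ) (n : Time s r) (τ : BFock s r) :
    dB n (defect φ ψ i j τ) = defect φ ψ i j (dB n τ) +
      tsgn φ n • defect φ ψ (i + tdeg n) j τ + tsgn ψ n • defect φ ψ i (j + tdeg n) τ := by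
  have h := ccom_shift φ ψ (-i - 1) (-j - 1) n (k := -(tdeg n : ℤ)) (by simp [← Int.not_even_iff_odd, ← Nat.not_even_iff_odd])
  simp only [defect_apply, map_sub, map_smul, dB_bB, bB_add, bB_smul]
  rw [show -(i + tdeg n) - 1 = -i - 1 + -(tdeg n : ℤ) by ring,
    show -(j + tdeg n) - 1 = -j - 1 + -(tdeg n : ℤ) by ring]
  have h' : (tsgn φ n * ccom φ ψ (-i - 1 + -(tdeg n : ℤ)) (-j - 1)) • τ =
      -((tsgn ψ n * ccom φ ψ (-i - 1) (-j - 1 + -(tdeg n : ℤ))) • τ) := by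
    rw [eq_neg_of_add_eq_zero_left h, neg_smul]
  simp only [smul_sub, smul_smul]
  rw [h']
  abel

lemma defect_tB (φ ψ : Fld s r) (i j : ℤ) (n : Time s r) (τ : BFock s r) :
    defect φ ψ i j (tB n τ) = tB n (defect φ ψ i j τ) +
      dsgn φ n • defect φ ψ (i - tdeg n) j τ + dsgn ψ n • defect φ ψ i (j - tdeg n) τ := by
  have h : dsgn φ n * ccom φ ψ (-i - 1 + tdeg n) (-j - 1) +
      dsgn ψ n * ccom φ ψ (-i - 1) (-j - 1 + tdeg n) = 0 := by
    have h0 := ccom_shift φ ψ (-i - 1) (-j - 1) n (k := (tdeg n : ℤ)) (by simp)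
    unfold dsgn
    by_cases hc : ψ = φ.conj
    · have : ψ.cmp = φ.cmp := by rw [hc, conj_cmp]
      rw [this]
      linear_combination dfac φ.cmp (tdeg n) * h0
    · have : ∀ g h, ccom φ ψ g h = 0 := by
        intro g h; rw [ccom.eq_def]; exact if_neg fun h' => hc h'.2
      simp [this]
  simp only [defect_apply, map_sub, map_smul, bB_tB, bB_add, bB_smul]
  rw [show -(i - tdeg n) - 1 = -i - 1 + (tdeg n : ℤ) by ring,
    show -(j - tdeg n) - 1 = -j - 1 + (tdeg n : ℤ) by ring]
  have h' : (dsgn φ n * ccom φ ψ (-i - 1 + (tdeg n : ℤ)) (-j - 1)) • τ =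
      -((dsgn ψ n * ccom φ ψ (-i - 1) (-j - 1 + (tdeg n : ℤ))) • τ) := by
    rw [eq_neg_of_add_eq_zero_left h, neg_smul]
  simp only [smul_sub, smul_smul]
  rw [h']
  abel

lemma Dc_C (φ : Fld s r) (q : ℕ) (a : ℂ) :
    Dc φ q (MvPowerSeries.C a) = if q = 0 then MvPowerSeries.C a else 0 := by
  classical
  split_ifs with h
  · subst h; simp
  · ext m
    by_contra h0
    obtain ⟨m', h1, h2⟩ := coeff_Dc_ne_zero φ q _ m h0
    rw [MvPowerSeries.coeff_C] at h2
    have : m' = 0 := by by_contra h3; simp [h3] at h2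
    subst this
    simp at h1
    omega

open Classical in
/-- A monomial in the Grassmann variables. -/
def bvec (u : Finset (Xi s r)) : BFock s r := Pi.single u 1

/-- The coefficients that do not depend on the times. -/
def tconst : Module.End ℂ (TSer s r) where
  toFun f := MvPowerSeries.C (MvPowerSeries.constantCoeff f)
  map_add' := by intros; simp
  map_smul' := by
    intros
    simp only [MvPowerSeries.constantCoeff_smul, smul_eq_mul, map_mul, RingHom.id_apply]
    rw [MvPowerSeries.smul_eq_C_mul]

lemma tconst_bvec (u : Finset (Xi s r)) : (fun w => tconst (bvec u w)) = bvec u := by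
  classical
  ext1 w
  by_cases h : w = u
  · subst h; simp [bvec, tconst]
  · simp [bvec, tconst, h]

lemma Xm_bvec (φ : Fld s r) (g : ℤ) (u w : Finset (Xi s r)) :
    Xm φ g (bvec u) w = MvPowerSeries.C (MvPowerSeries.constantCoeff (Xm φ g (bvec u) w)) := by
  have := Xm_map φ g tconst (bvec u) w
  rw [tconst_bvec] at this
  exact this

lemma constantCoeff_Dc_bB (φ ψ : Fld s r) (q : ℕ) (j : ℤ) (u w : Finset (Xi s r)) :
    MvPowerSeries.constantCoeff (Dc φ q (bB ψ j (bvec u) w)) =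
      kap φ ψ q * MvPowerSeries.constantCoeff (Xm ψ (-j - 1 - q) (bvec u) w) := by
  set N := (gtop ψ w + j + 1 + q).toNat + 1 with hN
  have h1 : MvPowerSeries.constantCoeff (Dc φ q (bB ψ j (bvec u) w)) =
      MvPowerSeries.constantCoeff (Dc φ q (bBt ψ j (q + 1) N (bvec u) w)) := by
    rw [← sub_eq_zero, ← map_sub, ← map_sub]
    by_contra h
    obtain ⟨m', h2, h3⟩ := coeff_Dc_ne_zero φ q _ 0 h
    simp at h2
    rw [map_sub, coeff_bB ψ j (P := q + 1) (N := N) (bvec u) w (by omega) (by omega), sub_self]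
      at h3
    exact h3 rfl
  have h2 : bBt ψ j (q + 1) N (bvec u) w = ∑ p ∈ Finset.range (q + 1),
      MvPowerSeries.constantCoeff (Xm ψ (-j - 1 - p) (bvec u) w) • Hc ψ p := by
    refine Finset.sum_congr rfl fun p _ => ?_
    rw [Finset.sum_eq_single 0]
    · rw [Dc_zero, Xm_bvec, Module.End.one_apply, mul_comm, MvPowerSeries.smul_eq_C_mul]
      simp
    · intro k _ hk
      rw [Xm_bvec, Dc_C, if_neg hk, mul_zero]
    · intro h; simp [hN] at h
  rw [h1, h2, map_sum, map_sum, Finset.sum_eq_single q]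
  · rw [map_smul, MvPowerSeries.constantCoeff_smul, constantCoeff_Dc_Hc, if_pos rfl, smul_eq_mul, mul_comm]
  · intro p _ hp
    rw [map_smul, MvPowerSeries.constantCoeff_smul, constantCoeff_Dc_Hc, if_neg hp.symm, smul_zero]
  · simp

lemma constantCoeff_bB_bB (φ ψ : Fld s r) (i j : ℤ) {N : ℕ} (u w : Finset (Xi s r))
    (hN : gtop φ w + i + 1 < N) :
    MvPowerSeries.constantCoeff (bB φ i (bB ψ j (bvec u)) w) =
      MvPowerSeries.constantCoeff (Fsum φ ψ (-i - 1) (-j - 1) N (bvec u) w) := by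
  have h1 := coeff_bB φ i (P := 1) (N := N) (bB ψ j (bvec u)) w (m := 0) (by simp) (by simpa)
  rw [MvPowerSeries.coeff_zero_eq_constantCoeff_apply,
    MvPowerSeries.coeff_zero_eq_constantCoeff_apply] at h1
  rw [h1, bBt, Fsum, Finset.sum_range_one, map_sum, map_sum]
  refine Finset.sum_congr rfl fun q _ => ?_
  rw [Hc_zero, one_mul, Nat.cast_zero, sub_zero]
  have h2 : (fun w' => (tconst ∘ₗ Dc φ q) (bB ψ j (bvec u) w')) =
      kap φ ψ q • Xm ψ (-j - 1 - q) (bvec u) := by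
    ext1 w'
    simp only [LinearMap.comp_apply, Pi.smul_apply]
    rw [Xm_bvec]
    simp only [tconst, LinearMap.coe_mk, AddHom.coe_mk, constantCoeff_Dc_bB, map_mul]
    rw [MvPowerSeries.smul_eq_C_mul]
  have h3 := Xm_map φ (-i - 1 + q) (tconst ∘ₗ Dc φ q) (bB ψ j (bvec u)) w
  rw [h2, map_smul] at h3
  have h4 := congrArg MvPowerSeries.constantCoeff h3
  simp only [tconst, LinearMap.comp_apply, LinearMap.coe_mk, AddHom.coe_mk,
    MvPowerSeries.constantCoeff_C, Pi.smul_apply] at h4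
  exact h4.symm

lemma constantCoeff_defect (φ ψ : Fld s r) (i j : ℤ) (u w : Finset (Xi s r)) :
    MvPowerSeries.constantCoeff (defect φ ψ i j (bvec u) w) = 0 := by
  set N := (gtop φ w + i + 1).toNat + (gtop ψ w + j + 1).toNat + 2
  rw [defect_apply, Pi.sub_apply, Pi.sub_apply, map_sub, map_sub,
    constantCoeff_bB_bB φ ψ i j (N := N) u w (by omega),
    constantCoeff_bB_bB ψ φ j i (N := N) u w (by omega), ← map_sub,
    Fsum_comm φ ψ _ _ _ _ (by omega) (by omega) (by omega), ← map_sub]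
  simp

lemma dB_bvec (n : Time s r) (u : Finset (Xi s r)) : dB n (bvec u) = 0 := by
  classical
  ext1 w
  rw [dB_apply]
  by_cases h : w = u
  · subst h; simp [bvec]
  · simp [bvec, h]

lemma finsupp_induction_single {σ : Type*} {P : (σ →₀ ℕ) → Prop} (h0 : P 0)
    (h1 : ∀ m i, P m → P (m + Finsupp.single i 1)) (m : σ →₀ ℕ) : P m := by
  induction m using Finsupp.induction with
  | zero => exact h0
  | single_add i n f _ hn hf =>
    clear hn
    induction n with
    | zero => simpa using hf
    | succ n ih =>
      rw [Finsupp.single_add, add_right_comm]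
      exact h1 _ _ ih

lemma defect_bvec (φ ψ : Fld s r) (i j : ℤ) (u : Finset (Xi s r)) :
    defect φ ψ i j (bvec u) = 0 := by
  ext1 w
  ext m
  rw [Pi.zero_apply, map_zero]
  induction m using finsupp_induction_single generalizing i j with
  | h0 => exact constantCoeff_defect φ ψ i j u w
  | h1 m n ih =>
    have h := congrArg (MvPowerSeries.coeff m) (congrFun (dB_defect φ ψ i j n (bvec u)) w)
    rw [dB_bvec, map_zero, zero_add, dB_apply, MvPowerSeries.coeff_pderiv, Pi.add_apply, map_add,
      Pi.smul_apply, Pi.smul_apply, map_smul, map_smul, ih, ih] at h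
    simp only [smul_zero, add_zero] at h
    exact (mul_eq_zero.1 h).resolve_right (by exact_mod_cast (m n).succ_ne_zero)

/-- A monomial. -/
def bmon (u : Finset (Xi s r)) (m : Time s r →₀ ℕ) : BFock s r :=
  open Classical in Pi.single u (MvPowerSeries.monomial m 1)

lemma bmon_zero (u : Finset (Xi s r)) : bmon u 0 = bvec u := rfl

lemma tB_bmon (u : Finset (Xi s r)) (m : Time s r →₀ ℕ) (n : Time s r) :
    tB n (bmon u m) = bmon u (m + Finsupp.single n 1) := by
  classical
  ext1 w
  rw [tB_apply]
  by_cases h : w = u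
  · subst h
    simp [bmon, MvPowerSeries.X, MvPowerSeries.monomial_mul_monomial, add_comm]
  · simp [bmon, h]

lemma defect_bmon (φ ψ : Fld s r) (i j : ℤ) (u : Finset (Xi s r)) (m : Time s r →₀ ℕ) :
    defect φ ψ i j (bmon u m) = 0 := by
  induction m using finsupp_induction_single generalizing i j with
  | h0 => exact defect_bvec φ ψ i j u
  | h1 m n ih => rw [← tB_bmon, defect_tB, ih, ih, ih]; simp

lemma finite_weight_le {σ : Type*} (w : σ → ℕ) (hw : ∀ i, 0 < w i) (h : ∀ n, {i | w i ≤ n}.Finite)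
    (n : ℕ) : {m : σ →₀ ℕ | Finsupp.weight w m ≤ n}.Finite := by
  classical
  refine (Set.finite_Iic (∑ i ∈ (h n).toFinset, Finsupp.single i n)).subset fun m hm i => ?_
  by_cases hi : m i = 0
  · simp [hi]
  have h1 : m i * w i ≤ n := by
    rw [Set.mem_ofPred_eq, Finsupp.weight_apply] at hm
    refine le_trans ?_ hm
    rw [Finsupp.sum]
    exact Finset.single_le_sum (f := fun i => m i • w i) (fun _ _ => Nat.zero_le _)
      (Finsupp.mem_support_iff.2 hi)
  have h2 : w i ≤ n := le_trans (Nat.le_mul_of_pos_left _ (Nat.pos_of_ne_zero hi)) h1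
  have h3 : m i ≤ n := le_trans (Nat.le_mul_of_pos_right _ (hw i)) h1
  rw [Finsupp.finsetSum_apply, Finset.sum_eq_single i]
  · simpa using h3
  · intro b _ hb; simp [hb]
  · intro h0; exact absurd ((h n).mem_toFinset.2 h2) h0

lemma finite_tdeg_le (n : ℕ) : {i : Time s r | tdeg i ≤ n}.Finite := by
  have h1 : (Set.univ ×ˢ Set.Iic n : Set (Fin s × ℕ)).Finite :=
    Set.finite_univ.prod (Set.finite_Iic n)
  have h2 : (Set.univ ×ˢ Set.Iic n : Set (Fin r × ℕ)).Finite :=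
    Set.finite_univ.prod (Set.finite_Iic n)
  refine ((h1.image Sum.inl).union (h2.image Sum.inr)).subset ?_
  rintro (⟨a, k⟩ | ⟨c, k⟩) hi <;> simp [tdeg] at hi
  · exact Or.inl ⟨(a, k), by simp; omega, rfl⟩
  · exact Or.inr ⟨(c, k), by simp; omega, rfl⟩

lemma finite_wt_le (n : ℕ) : {m : Time s r →₀ ℕ | wt m ≤ n}.Finite :=
  finite_weight_le tdeg tdeg_pos finite_tdeg_le n

lemma Xm_ne_zero {φ : Fld s r} {g : ℤ} {τ : BFock s r} {w : Finset (Xi s r)}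
    {m : Time s r →₀ ℕ} (h : MvPowerSeries.coeff m (Xm φ g τ w) ≠ 0) :
    decide (mvar φ (g - chg φ w) ∈ w) = mb (g - chg φ w) ∧ mcoef φ (g - chg φ w) ≠ 0 ∧
      MvPowerSeries.coeff m (τ (tog w (mvar φ (g - chg φ w)))) ≠ 0 := by
  classical
  rw [Xm_apply, Bm_apply, tg_apply] at h
  split_ifs at h with h1
  · rw [map_smul, map_smul, smul_eq_mul, smul_eq_mul] at h
    exact ⟨by convert h1, left_ne_zero_of_mul h, right_ne_zero_of_mul (right_ne_zero_of_mul h)⟩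
  · simp at h

lemma bB_ne_zero {φ : Fld s r} {j : ℤ} {τ : BFock s r} {w : Finset (Xi s r)}
    {m : Time s r →₀ ℕ} (h : MvPowerSeries.coeff m (bB φ j τ w) ≠ 0) :
    ∃ (k : ℤ) (m' : Time s r →₀ ℕ), k ≤ bnd w ∧ decide (mvar φ k ∈ w) = mb k ∧ mcoef φ k ≠ 0 ∧
      MvPowerSeries.coeff m' (τ (tog w (mvar φ k))) ≠ 0 ∧
      (wt m' : ℤ) = wt m + k + chg φ w + j + 1 := by
  obtain ⟨P, N, hPN⟩ := exists_coeff_bB φ j w m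
  rw [hPN, bBt, map_sum] at h
  obtain ⟨p, -, hp⟩ := Finset.exists_ne_zero_of_sum_ne_zero h
  rw [map_sum] at hp
  obtain ⟨q, -, hq⟩ := Finset.exists_ne_zero_of_sum_ne_zero hp
  obtain ⟨m1, h1, h2⟩ := coeff_Hc_mul_ne_zero hq
  obtain ⟨m2, h3, h4⟩ := coeff_Dc_ne_zero φ q _ _ h2
  obtain ⟨h5, h6, h7⟩ := Xm_ne_zero h4
  refine ⟨_, m2, ?_, h5, h6, h7, by omega⟩
  by_contra hk
  rw [Xm_apply, Bm_eq_zero φ (by omega)] at h4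
  simp at h4

/-- A functional depends only on finitely many coefficients. -/
def FinDep (L : Module.Dual ℂ (BFock s r)) : Prop :=
  ∃ S : Finset (Finset (Xi s r) × (Time s r →₀ ℕ)), ∀ τ : BFock s r,
    (∀ x ∈ S, MvPowerSeries.coeff x.2 (τ x.1) = 0) → L τ = 0

/-- The coefficient of a monomial. -/
def crd (w : Finset (Xi s r)) (m : Time s r →₀ ℕ) : Module.Dual ℂ (BFock s r) :=
  MvPowerSeries.coeff m ∘ₗ LinearMap.proj w

lemma crd_apply (w : Finset (Xi s r)) (m : Time s r →₀ ℕ) (τ : BFock s r) :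
    crd w m τ = MvPowerSeries.coeff m (τ w) := rfl

lemma finDep_crd (w : Finset (Xi s r)) (m : Time s r →₀ ℕ) : FinDep (crd w m) :=
  ⟨{(w, m)}, fun τ h => h _ (Finset.mem_singleton_self _)⟩

lemma FinDep.smul {L : Module.Dual ℂ (BFock s r)} (h : FinDep L) (c : ℂ) : FinDep (c • L) := by
  obtain ⟨S, hS⟩ := h
  exact ⟨S, fun τ hτ => by simp [hS τ hτ]⟩

lemma FinDep.sub {L L' : Module.Dual ℂ (BFock s r)} (h : FinDep L) (h' : FinDep L') :
    FinDep (L - L') := by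
  classical
  obtain ⟨S, hS⟩ := h
  obtain ⟨S', hS'⟩ := h'
  refine ⟨S ∪ S', fun τ hτ => ?_⟩
  rw [LinearMap.sub_apply, hS τ fun x hx => hτ x (Finset.mem_union_left _ hx),
    hS' τ fun x hx => hτ x (Finset.mem_union_right _ hx), sub_zero]

lemma finDep_crd_comp_bL (φ : Fld s r) (j : ℤ) (w : Finset (Xi s r)) (m : Time s r →₀ ℕ) :
    FinDep (crd w m ∘ₗ bL φ j) := by
  classical
  let lo : ℤ := -(wt m + chg φ w + j + 1)
  let hi : ℤ := bnd w
  refine ⟨(Finset.Icc lo hi).image (fun k => tog w (mvar φ k)) ×ˢ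
    (finite_wt_le (hi - lo).toNat).toFinset, fun τ hτ => ?_⟩
  by_contra h
  obtain ⟨k, m', h1, -, -, h2, h3⟩ := bB_ne_zero h
  refine h2 (hτ (_, m') ?_)
  simp only [Finset.mem_product, Finset.mem_image, Finset.mem_Icc, Set.Finite.mem_toFinset,
    Set.mem_ofPred_eq]
  exact ⟨⟨k, ⟨by omega, h1⟩, rfl⟩, by omega⟩

lemma FinDep.comp {L : Module.Dual ℂ (BFock s r)} {T : Module.End ℂ (BFock s r)} (h : FinDep L)
    (hT : ∀ w m, FinDep (crd w m ∘ₗ T)) : FinDep (L ∘ₗ T) := by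
  classical
  obtain ⟨S, hS⟩ := h
  choose F hF using hT
  refine ⟨S.biUnion fun x => F x.1 x.2, fun τ hτ => hS _ fun x hx => ?_⟩
  exact hF x.1 x.2 τ fun y hy => hτ y (Finset.mem_biUnion.2 ⟨x, hx, hy⟩)

/-- The space of polynomials. -/
def polyB (s r : ℕ) : Submodule ℂ (BFock s r) :=
  Submodule.span ℂ (Set.range fun x : Finset (Xi s r) × (Time s r →₀ ℕ) => bmon x.1 x.2)

lemma bmon_mem (u : Finset (Xi s r)) (m : Time s r →₀ ℕ) : bmon u m ∈ polyB s r :=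
  Submodule.subset_span ⟨(u, m), rfl⟩

open Classical in
lemma crd_bmon (u w : Finset (Xi s r)) (m n : Time s r →₀ ℕ) :
    crd w m (bmon u n) = if w = u ∧ m = n then 1 else 0 := by
  rw [crd_apply, bmon]
  by_cases h : w = u
  · subst h
    rw [Pi.single_eq_same, MvPowerSeries.coeff_monomial]
    simp
  · simp [h]

lemma exists_polyB_approx (S : Finset (Finset (Xi s r) × (Time s r →₀ ℕ))) (τ : BFock s r) :
    ∃ τ' ∈ polyB s r, ∀ x ∈ S, crd x.1 x.2 (τ - τ') = 0 := by
  classical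
  refine ⟨∑ x ∈ S, crd x.1 x.2 τ • bmon x.1 x.2,
    Submodule.sum_mem _ fun x _ => Submodule.smul_mem _ _ (bmon_mem _ _), fun x hx => ?_⟩
  rw [map_sub, map_sum, Finset.sum_eq_single x]
  · rw [map_smul, crd_bmon, if_pos ⟨rfl, rfl⟩, smul_eq_mul, mul_one, sub_self]
  · intro y _ hy
    rw [map_smul, crd_bmon, if_neg, smul_zero]
    rintro ⟨h1, h2⟩
    exact hy (Prod.ext h1 h2).symm
  · exact fun h => absurd hx h

lemma FinDep.eq_zero {L : Module.Dual ℂ (BFock s r)} (h : FinDep L)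
    (h0 : ∀ u m, L (bmon u m) = 0) : L = 0 := by
  obtain ⟨S, hS⟩ := h
  ext1 τ
  obtain ⟨τ', h1, h2⟩ := exists_polyB_approx S τ
  have h3 : L τ' = 0 := by
    have : polyB s r ≤ LinearMap.ker L := by
      refine Submodule.span_le.2 ?_
      rintro _ ⟨x, rfl⟩
      exact h0 _ _
    exact this h1
  have h4 := hS (τ - τ') h2
  rwa [map_sub, h3, sub_zero] at h4

/-- The commutation relations of the modes. -/
lemma bB_comm (φ ψ : Fld s r) (i j : ℤ) (τ : BFock s r) :
    bB φ i (bB ψ j τ) = bB ψ j (bB φ i τ) + ccom φ ψ (-i - 1) (-j - 1) • τ := by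
  have key : defect φ ψ i j τ = 0 := by
    ext1 w
    ext m
    have h : FinDep (crd w m ∘ₗ defect φ ψ i j) := by
      have h1 : FinDep ((crd w m ∘ₗ bL φ i) ∘ₗ bL ψ j) :=
        (finDep_crd_comp_bL φ i w m).comp (finDep_crd_comp_bL ψ j)
      have h2 : FinDep ((crd w m ∘ₗ bL ψ j) ∘ₗ bL φ i) :=
        (finDep_crd_comp_bL ψ j w m).comp (finDep_crd_comp_bL φ i)
      exact (h1.sub h2).sub ((finDep_crd w m).smul _)
    have h3 := h.eq_zero fun u n => by rw [LinearMap.comp_apply, defect_bmon, map_zero]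
    exact LinearMap.congr_fun h3 τ
  rw [defect_apply, sub_eq_zero, sub_eq_iff_eq_add'] at key
  exact key

end MCKP
end

noncomputable section
namespace MCKP

variable {s r : ℕ}

lemma bvac_eq : (bvac : BFock s r) = bvec ∅ := by
  unfold bvac bvec
  congr!

/-- The creation operators. -/
def creat (x : Fld s r × ℕ) : Module.End ℂ (BFock s r) := bL x.1 (Int.negSucc x.2)

lemma creat_comm (x y : Fld s r × ℕ) : creat x * creat y = creat y * creat x := by
  ext1 τ
  change bB _ _ (bB _ _ τ) = bB _ _ (bB _ _ τ)
  have h : ccom x.1 y.1 (-Int.negSucc x.2 - 1) (-Int.negSucc y.2 - 1) = 0 := by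
    rw [ccom.eq_def]
    refine if_neg fun h => ?_
    have := h.1
    omega
  rw [bB_comm, h, zero_smul, add_zero]

open scoped IsMulCommutative in
lemma exists_fockMap (s r : ℕ) : ∃ Φ : MvPolynomial (Fld s r × ℕ) ℂ →ₗ[ℂ] BFock s r, Φ 1 = bvac ∧
    ∀ x f, Φ (MvPolynomial.X x * f) = creat x (Φ f) := by
  have hc : ∀ a ∈ Set.range (creat (s := s) (r := r)), ∀ b ∈ Set.range (creat (s := s) (r := r)),
      a * b = b * a := by
    rintro _ ⟨x, rfl⟩ _ ⟨y, rfl⟩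
    exact creat_comm x y
  have := Algebra.isMulCommutative_adjoin ℂ hc
  let Ψ : MvPolynomial (Fld s r × ℕ) ℂ →ₐ[ℂ] Algebra.adjoin ℂ (Set.range (creat (s := s) (r := r))) :=
    MvPolynomial.aeval fun x => ⟨creat x, Algebra.subset_adjoin ⟨x, rfl⟩⟩
  refine ⟨(LinearMap.applyₗ bvac) ∘ₗ (Algebra.adjoin ℂ (Set.range (creat (s := s) (r := r)))).val.toLinearMap
    ∘ₗ Ψ.toLinearMap, ?_, fun x f => ?_⟩
  · simp
  · simp only [LinearMap.comp_apply, AlgHom.toLinearMap_apply, map_mul]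
    have : Ψ (MvPolynomial.X x) = ⟨creat x, Algebra.subset_adjoin ⟨x, rfl⟩⟩ := by
      simp [Ψ]
    rw [this]
    rfl

/-- The bosonization of the polynomial module. -/
def fockMap (s r : ℕ) : MvPolynomial (Fld s r × ℕ) ℂ →ₗ[ℂ] BFock s r := (exists_fockMap s r).choose

lemma fockMap_one : fockMap s r 1 = bvac := (exists_fockMap s r).choose_spec.1

lemma fockMap_X (x : Fld s r × ℕ) (f : MvPolynomial (Fld s r × ℕ) ℂ) :
    fockMap s r (MvPolynomial.X x * f) = creat x (fockMap s r f) :=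
  (exists_fockMap s r).choose_spec.2 x f

lemma crd_bvac (w : Finset (Xi s r)) (m : Time s r →₀ ℕ) (h : crd w m bvac ≠ 0) :
    w = ∅ ∧ m = 0 := by
  classical
  rw [bvac_eq, ← bmon_zero, crd_bmon] at h
  by_contra h'
  simp [h'] at h

lemma crd_empty_bvac : crd ∅ 0 (bvac : BFock s r) = 1 := by
  classical
  rw [bvac_eq, ← bmon_zero, crd_bmon]
  simp

lemma bB_ofNat_bvac (φ : Fld s r) (n : ℕ) : bB φ (Int.ofNat n) bvac = 0 := by
  classical
  ext1 w
  ext m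
  by_contra h
  obtain ⟨k, m', -, h1, h2, h3, h4⟩ := bB_ne_zero h
  obtain ⟨h5, h6⟩ := crd_bvac _ _ h3
  have h7 := chg_tog φ φ k w h1
  have h8 : mvar φ k ∈ w := by
    by_contra h8
    have : mvar φ k ∈ tog w (mvar φ k) := by rw [mem_tog, if_pos rfl]; exact h8
    rw [h5] at this
    simp at this
  rw [h6] at h4
  rw [h5] at h7
  rcases k with k | k
  · rw [Int.ofNat_eq_natCast] at h4
    simp only [map_zero, Nat.cast_zero] at h4
    rcases φ with ⟨a, δ⟩ | c
    · have hk : k ≠ 0 := by rintro rfl; simp [mcoef] at h2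
      have hd : dchg (Sum.inl (a, δ) : Fld s r) (Sum.inl (a, δ)) = 1 := by simp [dchg]
      have he : chg (Sum.inl (a, δ) : Fld s r) ∅ = 0 := by simp [chg, iNum, jNum]
      simp at h4
      omega
    · simp [chg] at h4
      omega
  · simp [h8, mb] at h1

lemma crd_empty_creat (x : Fld s r × ℕ) (τ : BFock s r) : crd ∅ 0 (creat x τ) = 0 := by
  by_contra h
  obtain ⟨k, m', -, h1, h2, h3, h4⟩ := bB_ne_zero h
  have he : chg x.1 ∅ = 0 := by
    rcases x with ⟨⟨a, δ⟩ | c, n⟩ <;> simp [chg, iNum, jNum]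
  rcases k with k | k
  · simp [mb] at h1
  · simp [he] at h4
    omega

lemma ccom_comm (φ ψ : Fld s r) (n k : ℕ) :
    ccom φ ψ (-Int.ofNat n - 1) (-Int.negSucc k - 1) =
      open Classical in if (ψ, k) = (φ.conj, n) then φ.comm n else 0 := by
  classical
  rw [ccom.eq_def]
  have e : (-Int.ofNat n - 1 + (-Int.negSucc k - 1) = -1 ∧ ψ = φ.conj) ↔
      (ψ, k) = (φ.conj, n) := by
    rw [Prod.mk.injEq, Int.ofNat_eq_natCast]
    constructor
    · rintro ⟨h1, h2⟩; exact ⟨h2, by omega⟩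
    · rintro ⟨h1, h2⟩; exact ⟨by omega, h1⟩
  simp only [e]
  split_ifs with h
  · rcases φ with ⟨a, δ⟩ | c
    · rfl
    · simp only [Fld.comm]
      rw [show -Int.ofNat n - 1 = -((n + 1 : ℕ) : ℤ) by push_cast; simp; ring, zpow_neg,
        zpow_natCast, pow_succ]
      rcases Nat.even_or_odd n with hn | hn <;> simp [hn.neg_one_pow]
  · rfl

lemma fockMap_pderiv (φ : Fld s r) (n : ℕ) (f : MvPolynomial (Fld s r × ℕ) ℂ) :
    bB φ (Int.ofNat n) (fockMap s r f) =
      fockMap s r (φ.comm n • MvPolynomial.pderiv (φ.conj, n) f) := by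
  classical
  induction f using MvPolynomial.induction_on with
  | C a =>
    rw [MvPolynomial.pderiv_C, smul_zero, map_zero, ← mul_one (MvPolynomial.C a),
      ← MvPolynomial.smul_eq_C_mul, map_smul, fockMap_one, bB_smul, bB_ofNat_bvac, smul_zero]
  | add f g hf hg => rw [map_add, bB_add, hf, hg, ← map_add, ← smul_add, map_add]
  | mul_X f x hf =>
    rw [mul_comm, fockMap_X]
    have h1 : bB φ (Int.ofNat n) (creat x (fockMap s r f)) =
        creat x (bB φ (Int.ofNat n) (fockMap s r f)) +
          ccom φ x.1 (-Int.ofNat n - 1) (-Int.negSucc x.2 - 1) • fockMap s r f := bB_comm _ _ _ _ _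
    rw [h1, hf, ← fockMap_X, ccom_comm, ← LinearMap.map_smul, ← map_add]
    congr 1
    rw [Derivation.leibniz, MvPolynomial.pderiv_X, smul_eq_mul, smul_eq_mul, smul_add, mul_smul_comm]
    congr 1
    by_cases h : x = (φ.conj, n)
    · subst h
      rw [if_pos rfl]
      simp
    · rw [if_neg h, Pi.single_eq_of_ne h]
      simp

lemma crd_empty_fockMap (f : MvPolynomial (Fld s r × ℕ) ℂ) :
    crd ∅ 0 (fockMap s r f) = MvPolynomial.constantCoeff f := by
  induction f using MvPolynomial.induction_on with
  | C a =>
    rw [← mul_one (MvPolynomial.C a), ← MvPolynomial.smul_eq_C_mul, map_smul, fockMap_one, map_smul,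
      crd_empty_bvac]
    simp
  | add f g hf hg => rw [map_add, map_add, hf, hg, map_add]
  | mul_X f x hf => rw [mul_comm, fockMap_X, crd_empty_creat]; simp

lemma Fld.comm_ne_zero (φ : Fld s r) (n : ℕ) : φ.comm n ≠ 0 := by
  rcases φ with ⟨a, δ⟩ | c
  · cases δ <;> simp [Fld.comm, sg]
  · simp [Fld.comm]

lemma Fld.conj_conj (φ : Fld s r) : φ.conj.conj = φ := by
  rcases φ with ⟨a, δ⟩ | c <;> simp [Fld.conj]

lemma fockMap_injective : Function.Injective (fockMap s r) := by
  rw [injective_iff_map_eq_zero]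
  intro f hf
  ext μ
  rw [MvPolynomial.coeff_zero]
  induction μ using finsupp_induction_single generalizing f with
  | h0 =>
    have := crd_empty_fockMap f
    rw [hf, map_zero] at this
    exact this.symm
  | h1 μ x ih =>
    have h := fockMap_pderiv x.1.conj x.2 f
    rw [hf, Fld.conj_conj, map_smul] at h
    have h1 : bB x.1.conj (Int.ofNat x.2) (0 : BFock s r) = 0 := map_zero (bL _ _)
    rw [h1] at h
    have h2 := ih _ ((smul_eq_zero.1 h.symm).resolve_left (Fld.comm_ne_zero _ _))
    rw [MvPolynomial.coeff_pderiv] at h2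
    exact (mul_eq_zero.1 h2).resolve_right (by exact_mod_cast (μ x).succ_ne_zero)

end MCKP
end

noncomputable section
namespace MCKP

variable {s r : ℕ}

/-- The image of the polynomial module under the bosonization. -/
def fockRange (s r : ℕ) : Submodule ℂ (BFock s r) := LinearMap.range (fockMap s r)

lemma bvac_mem_fockRange : bvac ∈ fockRange s r := ⟨1, fockMap_one⟩

lemma bB_mem_fockRange (φ : Fld s r) (j : ℤ) {τ : BFock s r} (h : τ ∈ fockRange s r) :
    bB φ j τ ∈ fockRange s r := by
  obtain ⟨f, rfl⟩ := h
  rcases j with n | n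
  · exact ⟨_, (fockMap_pderiv φ n f).symm⟩
  · exact ⟨_, fockMap_X (φ, n) f⟩

lemma fockRange_le {p : Submodule ℂ (BFock s r)} (h0 : bvac ∈ p)
    (h1 : ∀ x, ∀ τ ∈ p, creat x τ ∈ p) : fockRange s r ≤ p := by
  rintro _ ⟨f, rfl⟩
  induction f using MvPolynomial.induction_on with
  | C a =>
    rw [← mul_one (MvPolynomial.C a), ← MvPolynomial.smul_eq_C_mul, map_smul, fockMap_one]
    exact p.smul_mem _ h0
  | add f g hf hg => rw [map_add]; exact p.add_mem hf hg
  | mul_X f x hf => rw [mul_comm, fockMap_X]; exact h1 _ _ hf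

lemma dB_bvac (i : Time s r) : dB i bvac = 0 := by rw [bvac_eq, dB_bvec]

lemma dB_mem_fockRange (i : Time s r) {τ : BFock s r} (h : τ ∈ fockRange s r) :
    dB i τ ∈ fockRange s r := by
  have : fockRange s r ≤ fockRange s r ⊓ (fockRange s r).comap (dB i) := by
    refine fockRange_le ⟨bvac_mem_fockRange, ?_⟩ fun x τ hτ => ⟨bB_mem_fockRange _ _ hτ.1, ?_⟩
    · change dB i bvac ∈ fockRange s r
      rw [dB_bvac]; exact zero_mem _
    · change dB i (bB x.1 (Int.negSucc x.2) τ) ∈ fockRange s r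
      rw [dB_bB]
      exact add_mem (Submodule.smul_mem _ _ (bB_mem_fockRange _ _ hτ.1))
        (bB_mem_fockRange _ _ hτ.2)
  exact (this h).2

lemma tB_mem_fockRange_of (i : Time s r) (h0 : tB i bvac ∈ fockRange s r) {τ : BFock s r}
    (h : τ ∈ fockRange s r) : tB i τ ∈ fockRange s r := by
  have : fockRange s r ≤ fockRange s r ⊓ (fockRange s r).comap (tB i) := by
    refine fockRange_le ⟨bvac_mem_fockRange, h0⟩ fun x τ hτ => ⟨bB_mem_fockRange _ _ hτ.1, ?_⟩
    change tB i (bB x.1 (Int.negSucc x.2) τ) ∈ fockRange s r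
    rw [← sub_eq_of_eq_add' (bB_tB _ _ _ _)]
    exact sub_mem (bB_mem_fockRange _ _ hτ.2)
      (Submodule.smul_mem _ _ (bB_mem_fockRange _ _ hτ.1))
  exact (this h).2

lemma chg_empty (φ : Fld s r) : chg φ ∅ = 0 := by
  rcases φ with ⟨a, δ⟩ | c <;> simp [chg, iNum, jNum]

lemma Xm_bvac (φ : Fld s r) {g : ℤ} (hg : g < 0) : Xm φ g bvac = 0 := by
  classical
  ext1 w
  ext m
  by_contra h
  obtain ⟨h1, h2, h3⟩ := Xm_ne_zero h
  obtain ⟨h5, h6⟩ := crd_bvac _ _ h3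
  set k := g - chg φ w with hk
  have h7 := chg_tog φ φ k w h1
  rw [h5, chg_empty] at h7
  have h8 : mvar φ k ∈ w := by
    by_contra h8
    have : mvar φ k ∈ tog w (mvar φ k) := by rw [mem_tog, if_pos rfl]; exact h8
    rw [h5] at this
    simp at this
  rcases hk' : k with n | n
  · rw [hk', Int.ofNat_eq_natCast] at hk
    rcases φ with ⟨a, δ⟩ | c
    · have hn : n ≠ 0 := by rintro rfl; rw [hk'] at h2; simp [mcoef] at h2
      simp [dchg] at h7
      omega
    · simp [chg] at hk
      omega
  · rw [hk'] at h8 h1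
    simp [h8, mb] at h1

lemma Xm_zero_Xm_bvac (a : Fin s) (δ : Bool) (g : ℤ) (w : Finset (Xi s r)) :
    Xm (Sum.inl (a, δ)) 0 (Xm (Sum.inl (a, !δ)) g bvac) w = 0 := by
  ext m
  by_contra h
  obtain ⟨h1, h2, h3⟩ := Xm_ne_zero h
  obtain ⟨h4, -, h6⟩ := Xm_ne_zero h3
  obtain ⟨h5, -⟩ := crd_bvac _ _ h6
  have h7 := chg_tog (Sum.inl (a, δ)) _ _ _ h1
  have h8 := chg_tog (Sum.inl (a, δ)) _ _ _ h4
  rw [h5, chg_empty, h7] at h8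
  simp [dchg] at h8
  rw [← h8] at h2
  simp [mcoef] at h2

/-- A product of two modes, applied to the vacuum. -/
def pairVac (φ : Fld s r) (x y : ℤ) : BFock s r := bB φ (-x - 1) (bB φ.conj (-y - 1) bvac)

lemma bB_bvac (φ : Fld s r) {j : ℤ} (hj : 0 ≤ j) : bB φ j bvac = 0 := by
  obtain ⟨n, rfl⟩ := Int.eq_ofNat_of_zero_le hj
  exact bB_ofNat_bvac φ n

lemma bB_zero (φ : Fld s r) (j : ℤ) : bB φ j (0 : BFock s r) = 0 := map_zero (bL φ j)

lemma pairVac_of_neg_right (φ : Fld s r) (x : ℤ) {y : ℤ} (hy : y < 0) : pairVac φ x y = 0 := by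
  rw [pairVac, bB_bvac _ (by omega), bB_zero]

lemma pairVac_of_neg_left (φ : Fld s r) {x : ℤ} (hx : x < 0) (y : ℤ) :
    pairVac φ x y = ccom φ φ.conj x y • bvac := by
  rw [pairVac, bB_comm, bB_bvac φ (by omega), bB_zero, zero_add]
  congr 2 <;> ring

/-- The sign `1` for charged and `-1` for neutral fields. -/
def Fld.par : Fld s r → ℂ
  | Sum.inl _ => 1
  | Sum.inr _ => -1

lemma Fld.sgn_conj (φ : Fld s r) {k : ℕ} (hk : ∀ c, φ = Sum.inr c → Odd k) :
    φ.conj.sgn = -(φ.par ^ k * φ.sgn) := by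
  rcases φ with ⟨a, δ⟩ | c
  · simp [Fld.conj, Fld.sgn, Fld.par, sg_not]
  · simp [Fld.conj, Fld.sgn, Fld.par, (hk c rfl).neg_one_pow]

lemma Fld.sgn_mul_self (φ : Fld s r) : φ.sgn * φ.sgn = 1 := by
  rcases φ with ⟨a, δ⟩ | c
  · exact sg_mul_self δ
  · simp [Fld.sgn]

lemma par_mul_ccom (φ : Fld s r) {k : ℕ} (hk : ∀ c, φ = Sum.inr c → Odd k) {x y : ℤ}
    (h : x + y = -1) : φ.par ^ (x + k) * ccom φ φ.conj x y = φ.sgn := by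
  rw [ccom.eq_def, if_pos ⟨h, rfl⟩]
  rcases φ with ⟨a, δ⟩ | c
  · simp [Fld.sgn, Fld.par]
  · have h1 : Odd (k : ℤ) := by exact_mod_cast hk c rfl
    simp only [Fld.sgn, Fld.par]
    rw [zpow_add₀ (by norm_num), h1.neg_one_zpow]
    rcases Int.even_or_odd x with hx | hx
    · rw [hx.neg_one_zpow]; norm_num
    · rw [hx.neg_one_zpow]; norm_num

lemma tailSum_add {M : Type*} [AddCommGroup M] {P : ℤ → M} {U : ℤ} (hP : ∀ u, U < u → P u = 0)
    (x : ℤ) (k : ℕ) :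
    tailSum P U x = ∑ i ∈ Finset.range k, P (x + i) + tailSum P U (x + k) := by
  induction k with
  | zero => simp
  | succ k ih =>
    rw [ih, Finset.sum_range_succ, tailSum_succ hP (x + k), add_assoc]
    push_cast
    rw [add_assoc]

/-- The image of a time under the bosonization. -/
def timeVac (φ : Fld s r) (n : ℕ) : BFock s r :=
  ∑ g ∈ Finset.range n, φ.par ^ g • pairVac φ g (n - 1 - g)

lemma timeVac_mem (φ : Fld s r) (n : ℕ) : timeVac φ n ∈ fockRange s r :=
  Submodule.sum_mem _ fun _ _ => Submodule.smul_mem _ _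
    (bB_mem_fockRange _ _ (bB_mem_fockRange _ _ bvac_mem_fockRange))

lemma dB_pairVac (φ : Fld s r) (x y : ℤ) (i : Time s r) :
    dB i (pairVac φ x y) = tsgn φ i • pairVac φ (x - tdeg i) y +
      tsgn φ.conj i • pairVac φ x (y - tdeg i) := by
  unfold pairVac
  rw [dB_bB, dB_bB, dB_bvac, bB_zero, add_zero, bB_smul]
  rw [show -(x - tdeg i : ℤ) - 1 = -x - 1 + tdeg i by ring,
    show -(y - tdeg i : ℤ) - 1 = -y - 1 + tdeg i by ring]

lemma dB_timeVac (φ : Fld s r) (n : ℕ) (i : Time s r) :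
    dB i (timeVac φ n) = if tcmp i = φ.cmp ∧ tdeg i = n then (n : ℂ) • bvac else 0 := by
  by_cases hc : tcmp i = φ.cmp
  swap
  · rw [if_neg fun h => hc h.1, timeVac, map_sum]
    refine Finset.sum_eq_zero fun g _ => ?_
    rw [map_smul, dB_pairVac, tsgn, tsgn, conj_cmp, if_neg hc, if_neg hc]
    simp
  set k := tdeg i with hkdef
  have hk : ∀ c, φ = Sum.inr c → Odd k := by
    rintro c rfl; exact tdeg_odd hc
  let A : ℤ → BFock s r := fun x => φ.par ^ (x + k) • pairVac φ x (n - 1 - k - x)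
  have hA : ∀ u, (n : ℤ) - 1 - k < u → A u = 0 := by
    intro u hu
    simp only [A]
    rw [pairVac_of_neg_right _ _ (by omega), smul_zero]
  have h1 : dB i (timeVac φ n) = φ.sgn • (∑ g ∈ Finset.range n, A (-k + g) -
      ∑ g ∈ Finset.range n, A (0 + g)) := by
    rw [timeVac, map_sum, ← Finset.sum_sub_distrib, Finset.smul_sum]
    refine Finset.sum_congr rfl fun g _ => ?_
    rw [map_smul, dB_pairVac, tsgn, tsgn, conj_cmp, if_pos hc, if_pos hc, φ.sgn_conj hk]
    simp only [A]
    rw [show (-k + g + k : ℤ) = g by ring, show (n - 1 - k - (-k + g) : ℤ) = n - 1 - g by ring,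
      show (0 + g + k : ℤ) = ((g + k : ℕ) : ℤ) by push_cast; ring,
      show (n - 1 - k - (0 + g) : ℤ) = n - 1 - g - k by ring, zero_add, ← hkdef,
      show (g - k : ℤ) = -k + g by ring, zpow_natCast, zpow_natCast, pow_add, neg_smul, smul_add,
      smul_sub, smul_neg, sub_eq_add_neg]
    simp only [smul_smul]
    ring_nf
  rw [h1, sum_range_eq_tailSum hA _ (by omega), sum_range_eq_tailSum hA _ (by omega),
    tailSum_add hA (-k : ℤ) k, neg_add_cancel, add_sub_cancel_right]
  split_ifs with h
  · obtain ⟨-, h⟩ := h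
    rw [Finset.sum_congr rfl (g := fun _ => φ.sgn • (bvac : BFock s r)), Finset.sum_const,
      Finset.card_range, smul_comm, smul_smul, φ.sgn_mul_self, one_smul, h,
      ← Nat.cast_smul_eq_nsmul ℂ]
    intro x hx
    simp only [Finset.mem_range] at hx
    simp only [A]
    rw [pairVac_of_neg_left _ (by omega), smul_smul, par_mul_ccom φ hk (by omega)]
  · rw [Finset.sum_eq_zero, smul_zero]
    intro x hx
    simp only [Finset.mem_range] at hx
    simp only [A]
    rw [pairVac_of_neg_left _ (by omega), ccom.eq_def, if_neg, zero_smul, smul_zero]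
    rintro ⟨h2, -⟩
    exact h ⟨hc, by omega⟩

lemma constantCoeff_pairVac (φ : Fld s r) (x y : ℤ) {N : ℕ} (w : Finset (Xi s r))
    (hN : gtop φ w - x < N) :
    MvPowerSeries.constantCoeff (pairVac φ x y w) =
      MvPowerSeries.constantCoeff (Fsum φ φ.conj x y N bvac w) := by
  rw [pairVac, bvac_eq, constantCoeff_bB_bB (N := N) _ _ _ _ _ _ (by omega)]
  congr 2 <;> ring

lemma constantCoeff_timeVac_inl (a : Fin s) (δ : Bool) (n : ℕ) (w : Finset (Xi s r)) :
    MvPowerSeries.constantCoeff (timeVac (Sum.inl (a, δ)) n w) = 0 := by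
  set φ : Fld s r := Sum.inl (a, δ) with hφ
  let Y : ℕ → TSer s r := fun u => Xm φ u (Xm φ.conj (n - 1 - u) bvac) w
  have h1 : ∀ g : ℕ, MvPowerSeries.constantCoeff (pairVac φ g (n - 1 - g) w) =
      MvPowerSeries.constantCoeff (Y g) - MvPowerSeries.constantCoeff (Y (g + 1)) := by
    intro g
    rw [constantCoeff_pairVac (N := (gtop φ w - g).toNat + 1 + 1) _ _ _ _ (by push_cast; omega),
      ← map_sub]
    have hk : Fld.sgn φ ≠ Fld.sgn φ.conj := by
      change ¬ sg δ = sg (!δ)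
      rw [sg_inj]; simp
    congr 1
    rw [Fsum, Finset.sum_range_succ', Finset.sum_range_succ', Finset.sum_eq_zero]
    · have k0 : kap φ φ.conj 0 = 1 := by simp [kap, hφ, Fld.conj, Fld.cmp]
      have k1 : kap φ φ.conj 1 = -1 := by
        rw [hφ] at hk ⊢
        simp [kap, hk, conj_cmp]
      simp only [Y, zero_add, k0, k1]
      push_cast
      rw [add_zero, sub_zero, one_smul, neg_one_smul, sub_sub _ (g : ℤ) 1]
      abel
    · intro k _
      have : kap φ φ.conj (k + 1 + 1) = 0 := by
        rw [hφ] at hk ⊢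
        simp [kap, hk, conj_cmp]
      rw [this, zero_smul]
  rw [timeVac, Finset.sum_apply, map_sum]
  have h2 : ∀ g ∈ Finset.range n, MvPowerSeries.constantCoeff
      ((φ.par ^ g • pairVac φ g (n - 1 - g)) w) =
      MvPowerSeries.constantCoeff (Y g) - MvPowerSeries.constantCoeff (Y (g + 1)) := by
    intro g _
    rw [← h1]
    simp [Fld.par, hφ]
  rw [Finset.sum_congr rfl h2, Finset.sum_range_sub']
  have h3 : Y 0 = 0 := Xm_zero_Xm_bvac a δ _ w
  have h4 : Y n = 0 := by
    simp only [Y]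
    rw [Xm_bvac _ (by omega), map_zero]
    rfl
  rw [h3, h4, sub_self]

lemma constantCoeff_timeVac_inr (c : Fin r) (n : ℕ) (w : Finset (Xi s r)) :
    MvPowerSeries.constantCoeff (timeVac (Sum.inr c) n w) = 0 := by
  set φ : Fld s r := Sum.inr c with hφ
  let Y : ℤ → TSer s r := fun u => Xm φ u (Xm φ (n - 1 - u) bvac) w
  have hY : ∀ u : ℤ, (n : ℤ) - 1 < u → Y u = 0 := by
    intro u hu
    simp only [Y]
    rw [Xm_bvac _ (by omega), map_zero]
    rfl
  let T : ℕ → TSer s r := fun g => tailSum Y (n - 1) g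
  have h1 : ∀ g : ℕ, MvPowerSeries.constantCoeff (pairVac φ g (n - 1 - g) w) =
      MvPowerSeries.constantCoeff (T g + T (g + 1)) := by
    intro g
    rw [constantCoeff_pairVac (N := (gtop φ w - g).toNat + n + 1) _ _ _ _ (by push_cast; omega)]
    congr 1
    have e2 : ∀ k ∈ Finset.range ((gtop φ w - g).toNat + n + 1), kap φ φ.conj k •
        Xm φ (g + k) (Xm φ.conj (n - 1 - g - k) bvac) w =
        (if k = 0 then (1 : ℂ) else 2) • Y (g + k) := by
      intro k _
      simp only [Y]
      rw [show (n - 1 - g - k : ℤ) = n - 1 - (g + k) by ring]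
      simp [kap, hφ, Fld.conj]
    rw [Fsum, Finset.sum_congr rfl e2]
    simp only [T]
    rw [← sum_range_eq_tailSum hY g (N := (gtop φ w - g).toNat + n + 1) (by omega),
      ← sum_range_eq_tailSum hY ((g + 1 : ℕ) : ℤ) (N := (gtop φ w - g).toNat + n) (by omega),
      Finset.sum_range_succ', Finset.sum_range_succ']
    simp only [Nat.succ_ne_zero, if_false, if_true, one_smul, two_smul, Finset.sum_add_distrib]
    have e3 : ∀ N, ∑ k ∈ Finset.range N, Y ((g + 1 : ℕ) + k) =
        ∑ k ∈ Finset.range N, Y (g + (k + 1 : ℕ)) := by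
      intro N
      refine Finset.sum_congr rfl fun k _ => ?_
      congr 1; push_cast; ring
    rw [e3]
    abel
  have h2 : ∀ g ∈ Finset.range n, MvPowerSeries.constantCoeff
      ((φ.par ^ g • pairVac φ g (n - 1 - g)) w) =
      MvPowerSeries.constantCoeff ((-1 : ℂ) ^ g • T g) -
        MvPowerSeries.constantCoeff ((-1 : ℂ) ^ (g + 1) • T (g + 1)) := by
    intro g _
    rw [Pi.smul_apply, MvPowerSeries.constantCoeff_smul, h1, ← map_sub, pow_succ,
      mul_neg_one, neg_smul, sub_neg_eq_add, ← smul_add, MvPowerSeries.constantCoeff_smul]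
    rfl
  rw [timeVac, Finset.sum_apply, map_sum, Finset.sum_congr rfl h2, Finset.sum_range_sub']
  have h3 : T n = 0 := by
    simp [T, tailSum]
  have h4 : T 0 = 0 := by
    have e1 : T 0 = ∑ u ∈ Finset.range n, Y u := by
      simp only [T]
      rw [← sum_range_eq_tailSum hY _ (N := n) (by simp)]
      simp
    have e2 : ∀ u ∈ Finset.range n, Y (n - 1 - u : ℕ) = -Y u := by
      intro u hu
      simp only [Finset.mem_range] at hu
      have h5 := congrFun (Bm_anticomm (rfl : φ.cmp = φ.cmp) u (n - 1 - u) (bvac : BFock s r)) w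
      have hd : dchg φ φ = 0 := by simp [hφ, dchg]
      have hc : chg φ w = 0 := by simp [hφ, chg]
      have ha : acoef φ φ u (n - 1 - u) = 0 := by
        simp only [acoef, hφ]
        rw [if_neg (by omega)]
      rw [ha, zero_smul] at h5
      simp only [Y]
      rw [Xm_Xm, Xm_Xm, hd, hc, eq_neg_iff_add_eq_zero, add_comm]
      rw [show ((n - 1 - u : ℕ) : ℤ) = n - 1 - u by omega]
      simp only [sub_zero, sub_sub_cancel]
      exact h5
    have e3 : T 0 = -T 0 := by
      nth_rewrite 1 [e1]
      rw [← Finset.sum_range_reflect, Finset.sum_congr rfl e2, Finset.sum_neg_distrib, e1]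
    have h4 : (2 : ℂ) • T 0 = 0 := by rw [two_smul]; nth_rewrite 1 [e3]; simp
    simpa using h4
  simp [h3, h4]

lemma ext_of_dB {τ τ' : BFock s r} (h : ∀ i, dB i τ = dB i τ')
    (h0 : ∀ w, MvPowerSeries.constantCoeff (τ w) = MvPowerSeries.constantCoeff (τ' w)) :
    τ = τ' := by
  ext1 w
  exact MvPowerSeries.pderiv.ext (fun i => congrFun (h i) w) (h0 w)

lemma tB_bvac_mem (i : Time s r) : tB i bvac ∈ fockRange s r := by
  classical
  have key : ∀ φ : Fld s r, tcmp i = φ.cmp →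
      (∀ w, MvPowerSeries.constantCoeff (timeVac φ (tdeg i) w) = 0) →
      tB i bvac ∈ fockRange s r := by
    intro φ hφ h0
    have h1 : timeVac φ (tdeg i) = (tdeg i : ℂ) • tB i bvac := by
      refine ext_of_dB (fun i' => ?_) fun w => ?_
      · have h2 : dB i' (tB i bvac) = if i' = i then (bvac : BFock s r) else 0 := by
          ext1 w
          rw [dB_apply, tB_apply, Derivation.leibniz, ← dB_apply, dB_bvac,
            MvPowerSeries.pderiv_X]
          by_cases h : i' = i
          · subst h; simp
          · simp [h]
        rw [dB_timeVac, map_smul, h2]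
        by_cases h : i' = i
        · subst h
          rw [if_pos ⟨hφ, rfl⟩, if_pos rfl]
        · rw [if_neg h, if_neg, smul_zero]
          rintro ⟨h3, h4⟩
          have h5 := (timeIdx_eq_some _ _ _).2 ⟨h3, h4⟩
          have h6 := (timeIdx_eq_some _ _ _).2 ⟨hφ, rfl⟩
          rw [h5] at h6
          exact h (Option.some.inj h6)
      · rw [h0]
        simp [tB_apply]
    have h2 : tB i bvac = (tdeg i : ℂ)⁻¹ • timeVac φ (tdeg i) := by
      rw [h1, smul_smul, inv_mul_cancel₀, one_smul]
      exact_mod_cast (tdeg_pos i).ne'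
    rw [h2]
    exact Submodule.smul_mem _ _ (timeVac_mem _ _)
  rcases hi : tcmp i with a | c
  · exact key (Sum.inl (a, true)) hi fun w => constantCoeff_timeVac_inl a true _ w
  · exact key (Sum.inr c) hi fun w => constantCoeff_timeVac_inr c _ w

lemma tB_mem_fockRange (i : Time s r) {τ : BFock s r} (h : τ ∈ fockRange s r) :
    tB i τ ∈ fockRange s r := tB_mem_fockRange_of i (tB_bvac_mem i) h

end MCKP
end

noncomputable section
namespace MCKP

variable {s r : ℕ}

lemma ext_crd {τ τ' : BFock s r} (h : ∀ w m, crd w m τ = crd w m τ') : τ = τ' := by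
  ext1 w
  ext m
  exact h w m

lemma mem_polyB_iff {τ : BFock s r} :
    τ ∈ polyB s r ↔ {x : Finset (Xi s r) × (Time s r →₀ ℕ) | crd x.1 x.2 τ ≠ 0}.Finite := by
  classical
  constructor
  · intro h
    refine Submodule.span_induction (p := fun τ _ =>
      {x : Finset (Xi s r) × (Time s r →₀ ℕ) | crd x.1 x.2 τ ≠ 0}.Finite) ?_ ?_ ?_ ?_ h
    · rintro _ ⟨y, rfl⟩
      refine (Set.finite_singleton y).subset fun x hx => ?_
      by_contra hne
      refine hx ?_
      rw [crd_bmon, if_neg]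
      rintro ⟨h1, h2⟩
      exact hne (Prod.ext h1 h2)
    · simp
    · intro τ τ' _ _ h1 h2
      refine (h1.union h2).subset fun x hx => ?_
      by_contra hne
      simp only [Set.mem_union, Set.mem_ofPred_eq, not_or, not_not] at hne
      exact hx (by rw [map_add, hne.1, hne.2, add_zero])
    · intro c τ _ h1
      refine h1.subset fun x hx hne => hx ?_
      rw [map_smul, hne, smul_zero]
  · intro h
    have : τ = ∑ x ∈ h.toFinset, crd x.1 x.2 τ • bmon x.1 x.2 := by
      refine ext_crd fun w m => ?_
      simp only [map_sum, map_smul, crd_bmon, smul_eq_mul]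
      rw [Finset.sum_eq_single (w, m)]
      · simp
      · intro y _ hy
        rw [if_neg, mul_zero]
        rintro ⟨h1, h2⟩
        exact hy (Prod.ext h1 h2).symm
      · intro h0
        simp only [Set.Finite.mem_toFinset, Set.mem_ofPred_eq, not_not] at h0
        rw [h0, zero_mul]
    rw [this]
    exact Submodule.sum_mem _ fun x _ => Submodule.smul_mem _ _ (bmon_mem _ _)

lemma mvar_notMem_of_lt {φ : Fld s r} {k : ℤ} {w : Finset (Xi s r)} (h : k < -(bnd w : ℤ) - 1) :
    mvar φ k ∉ w := by
  intro hm
  have h1 := Finset.le_sup (f := fun ξ : Xi s r => ξ.pos.natAbs) hm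
  unfold bnd at h
  rcases k with n | n
  · rw [Int.ofNat_eq_natCast] at h; omega
  have h2 : n ≤ (mvar φ (Int.negSucc n)).pos.natAbs := by
    rcases φ with ⟨a, δ⟩ | c
    · have h3 : (mvar (Sum.inl (a, δ) : Fld s r) (Int.negSucc n)).pos =
        (if !δ then 1 else -1) * ((n : ℤ) + 1) := rfl
      rw [h3]
      rcases δ
      · rw [if_pos (by rfl)]; omega
      · rw [if_neg (by simp)]; omega
    · exact le_refl n
  omega

lemma bB_mem_polyB (φ : Fld s r) (j : ℤ) {τ : BFock s r} (h : τ ∈ polyB s r) :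
    bB φ j τ ∈ polyB s r := by
  classical
  have : polyB s r ≤ (polyB s r).comap (bL φ j) := by
    refine Submodule.span_le.2 ?_
    rintro _ ⟨⟨u, n⟩, rfl⟩
    refine mem_polyB_iff.2 ?_
    let lo : ℤ := -(bnd u : ℤ) - 1
    let hi : ℤ := wt n - (chg φ u - dchg φ φ) - j - 1
    refine (((Set.finite_Icc lo hi).image fun k => tog u (mvar φ k)).prod
      (finite_wt_le (hi - lo).toNat)).subset ?_
    rintro ⟨w, m⟩ hx
    obtain ⟨k, m', -, h1, -, h2, h3⟩ := bB_ne_zero hx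
    change crd _ m' (bmon u n) ≠ 0 at h2
    change (wt m' : ℤ) = wt m + k + chg φ w + j + 1 at h3
    rw [crd_bmon] at h2
    obtain ⟨h4, rfl⟩ : tog w (mvar φ k) = u ∧ m' = n := by
      by_contra h; simp [h] at h2
    have h5 := chg_tog φ φ k w h1
    rw [h4] at h5
    have h6 : lo ≤ k := by
      by_contra h6
      have h7 := mvar_notMem_of_lt (φ := φ) (k := k) (w := u) (by omega)
      rw [← h4, mem_tog, if_pos rfl, not_not] at h7
      rcases k with k | k
      · rw [Int.ofNat_eq_natCast] at h6; omega
      · simp [h7, mb] at h1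
    refine ⟨⟨k, ⟨h6, by omega⟩, ?_⟩, ?_⟩
    · change tog u (mvar φ k) = w
      rw [← h4, tog_tog_self]
    · change wt m ≤ _
      omega
  exact this h

lemma bvac_mem_polyB : bvac ∈ polyB s r := by
  rw [bvac_eq, ← bmon_zero]; exact bmon_mem _ _

lemma fockRange_le_polyB : fockRange s r ≤ polyB s r :=
  fockRange_le bvac_mem_polyB fun _ _ h => bB_mem_polyB _ _ h

lemma crd_tB_dB (w : Finset (Xi s r)) (m : Time s r →₀ ℕ) (i : Time s r) (τ : BFock s r) :
    crd w m (tB i (dB i τ)) = m i * crd w m τ := by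
  classical
  rw [crd_apply, tB_apply, dB_apply, MvPowerSeries.X, MvPowerSeries.coeff_monomial_mul]
  split_ifs with h
  · rw [MvPowerSeries.coeff_pderiv, tsub_add_cancel_of_le h, crd_apply, one_mul, mul_comm]
    congr 1
    have h1 : 1 ≤ m i := by simpa using h i
    rw [Finsupp.tsub_apply, Finsupp.single_eq_same]
    push_cast [h1]
    ring
  · have : m i = 0 := by
      by_contra h0
      refine h fun i' => ?_
      by_cases hi : i' = i
      · subst hi; simp; omega
      · simp [hi]
    simp [this]

lemma exists_eigenProj (F : Finset (Time s r)) {τ : BFock s r} (h : τ ∈ fockRange s r) (M : ℕ) :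
    ∃ τ' ∈ fockRange s r, ∀ w m, crd w m τ' =
      (∏ k ∈ Finset.range M, (1 - (k + 1 : ℂ)⁻¹ * ∑ i ∈ F, (m i : ℂ))) * crd w m τ := by
  induction M with
  | zero => exact ⟨τ, h, by simp⟩
  | succ M ih =>
    obtain ⟨τ', h1, h2⟩ := ih
    refine ⟨τ' - (M + 1 : ℂ)⁻¹ • ∑ i ∈ F, tB i (dB i τ'), sub_mem h1 (Submodule.smul_mem _ _
      (Submodule.sum_mem _ fun i _ => tB_mem_fockRange i (dB_mem_fockRange i h1))), fun w m => ?_⟩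
    rw [map_sub, map_smul, map_sum]
    simp only [crd_tB_dB]
    rw [← Finset.sum_mul, h2, Finset.prod_range_succ, smul_eq_mul]
    ring

lemma tconst_mem_fockRange {τ : BFock s r} (h : τ ∈ fockRange s r) :
    (fun w => tconst (τ w)) ∈ fockRange s r := by
  classical
  have hfin := mem_polyB_iff.1 (fockRange_le_polyB h)
  let F : Finset (Time s r) := hfin.toFinset.biUnion fun x => x.2.support
  let M : ℕ := hfin.toFinset.sup fun x => ∑ i ∈ F, x.2 i
  obtain ⟨τ', h1, h2⟩ := exists_eigenProj F h M
  refine (?_ : (fun w => tconst (τ w)) = τ') ▸ h1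
  refine ext_crd fun w m => ?_
  change MvPowerSeries.coeff m (MvPowerSeries.C (crd w 0 τ)) = crd w m τ'
  rw [h2, MvPowerSeries.coeff_C]
  by_cases h0 : crd w m τ = 0
  · rw [h0, mul_zero]
    split_ifs with hm
    · subst hm; exact h0
    · rfl
  split_ifs with hm
  · subst hm; simp
  · have hmem : (w, m) ∈ hfin.toFinset := by simpa using h0
    have hle : ∑ i ∈ F, m i ≤ M := Finset.le_sup (f := fun x : Finset (Xi s r) × (Time s r →₀ ℕ) => ∑ i ∈ F, x.2 i) hmem
    have hpos : 0 < ∑ i ∈ F, m i := by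
      obtain ⟨i, hi⟩ := Finsupp.support_nonempty_iff.2 hm
      refine Finset.sum_pos' (fun _ _ => Nat.zero_le _) ⟨i, Finset.mem_biUnion.2 ⟨_, hmem, hi⟩,
        Nat.pos_of_ne_zero (Finsupp.mem_support_iff.1 hi)⟩
    rw [Finset.prod_eq_zero (i := ∑ i ∈ F, m i - 1) (by simp; omega), zero_mul]
    rw [← Nat.cast_sum, Nat.cast_sub hpos]
    have : ((∑ i ∈ F, m i : ℕ) : ℂ) ≠ 0 := by exact_mod_cast hpos.ne'
    rw [Nat.cast_one, sub_add_cancel, inv_mul_cancel₀ this, sub_self]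

lemma tconst_bB_bvec (φ : Fld s r) (j : ℤ) (u : Finset (Xi s r)) :
    (fun w => tconst (bB φ j (bvec u) w)) = Xm φ (-j - 1) (bvec u) := by
  ext1 w
  rw [Xm_bvec]
  change MvPowerSeries.C _ = _
  congr 1
  have h1 := coeff_bB φ j (P := 1) (N := (gtop φ w + j + 1).toNat + 1) (bvec u) w (m := 0)
    (by simp) (by simp)
  rw [MvPowerSeries.coeff_zero_eq_constantCoeff_apply,
    MvPowerSeries.coeff_zero_eq_constantCoeff_apply] at h1
  rw [h1, bBt, Finset.sum_range_one, Finset.sum_eq_single 0]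
  · simp
  · intro q _ hq
    rw [Xm_bvec, Dc_C, if_neg hq, mul_zero]
  · simp

lemma exists_mvar (ξ : Xi s r) : ∃ (φ : Fld s r) (k : ℤ), mvar φ k = ξ ∧ mb k = true ∧
    mcoef φ k ≠ 0 := by
  rcases ξ with ⟨a, k, hk⟩ | ⟨c, n⟩
  · obtain ⟨δ, n, h⟩ : ∃ (δ : Bool) (n : ℕ), k = (if δ then 1 else -1) * ((n : ℤ) + 1) := by
      rcases lt_or_gt_of_ne hk with h | h
      · exact ⟨false, (-k - 1).toNat, by simp; omega⟩
      · exact ⟨true, (k - 1).toNat, by simp; omega⟩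
    refine ⟨Sum.inl (a, δ), Int.ofNat (n + 1), ?_, rfl, ?_⟩
    · subst h; rfl
    · change -(sg δ * ((n + 1 : ℕ) : ℂ)) ≠ 0
      refine neg_ne_zero.2 (mul_ne_zero ?_ (by exact_mod_cast n.succ_ne_zero))
      cases δ <;> simp [sg]
  · refine ⟨Sum.inr c, Int.ofNat n, rfl, rfl, ?_⟩
    have : 2 * (n : ℂ) + 1 ≠ 0 := by exact_mod_cast (2 * n).succ_ne_zero
    simp [mcoef, this]

lemma bvec_mem_fockRange (u : Finset (Xi s r)) : bvec u ∈ fockRange s r := by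
  classical
  induction u using Finset.induction_on with
  | empty => rw [← bvac_eq]; exact bvac_mem_fockRange
  | insert ξ u hξ ih =>
    obtain ⟨φ, k, h1, h2, h3⟩ := exists_mvar ξ
    set g := k + chg φ u - dchg φ φ with hg
    have ht : tog u ξ = insert ξ u := by unfold tog; rw [if_neg hξ]
    have ht' : tog (insert ξ u) ξ = u := by rw [← ht, tog_tog_self]
    have hd : decide (mvar φ k ∈ insert ξ u) = mb k := by simp [h1, h2]
    have hc := chg_tog φ φ k (insert ξ u) hd
    rw [h1, ht'] at hc
    have hgk : g - chg φ (insert ξ u) = k := by omega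
    have key : Xm φ g (bvec u) =
        (mcoef φ k * Nsign (insert ξ u) ξ) • (bvec (insert ξ u) : BFock s r) := by
      ext1 w
      by_cases hw : w = insert ξ u
      · subst hw
        rw [Xm_apply, hgk, Bm_apply, tg_apply, if_pos (by convert hd), h1, ht', Pi.smul_apply,
          mul_smul]
        simp [bvec]
      · have : (bvec (insert ξ u) : BFock s r) w = 0 := by simp [bvec, hw]
        rw [Pi.smul_apply, this, smul_zero]
        ext m
        by_contra hne
        obtain ⟨e1, -, e3⟩ := Xm_ne_zero hne
        have e4 : tog w (mvar φ (g - chg φ w)) = u := by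
          by_contra h
          rw [bvec, Pi.single_eq_of_ne h, map_zero] at e3
          exact e3 rfl
        have e5 := chg_tog φ φ _ _ e1
        rw [e4] at e5
        rw [show g - chg φ w = k by omega, h1] at e4
        exact hw (by rw [← tog_tog_self w ξ, e4, ht])
    have h4 : mcoef φ k * Nsign (insert ξ u) ξ ≠ 0 :=
      mul_ne_zero h3 (left_ne_zero_of_mul (by rw [Nsign_mul_self]; exact one_ne_zero))
    have h5 := tconst_mem_fockRange (bB_mem_fockRange φ (-g - 1) ih)
    rw [tconst_bB_bvec, show -(-g - 1) - 1 = g by ring, key] at h5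
    have h6 := (fockRange s r).smul_mem (mcoef φ k * Nsign (insert ξ u) ξ)⁻¹ h5
    rwa [smul_smul, inv_mul_cancel₀ h4, one_smul] at h6

lemma fockRange_eq : fockRange s r = polyB s r := by
  refine le_antisymm fockRange_le_polyB (Submodule.span_le.2 ?_)
  rintro _ ⟨⟨u, m⟩, rfl⟩
  change bmon u m ∈ fockRange s r
  induction m using finsupp_induction_single with
  | h0 => exact bvec_mem_fockRange u
  | h1 m i ih => rw [← tB_bmon]; exact tB_mem_fockRange i ih

end MCKP
end

noncomputable section
namespace MCKP

variable {s r : ℕ}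

/-! ## Energy and parity -/

/-- The weights of the creation operators. -/
def fdeg (x : Fld s r × ℕ) : ℕ := 2 * x.2 + 1

/-- The energy of a monomial in the creation operators. -/
abbrev enF (μ : (Fld s r × ℕ) →₀ ℕ) : ℕ := Finsupp.weight (fdeg (s := s) (r := r)) μ

lemma enF_add_single (μ : (Fld s r × ℕ) →₀ ℕ) (x : Fld s r × ℕ) :
    enF (μ + Finsupp.single x 1) = enF μ + fdeg x := by
  rw [enF, map_add, Finsupp.weight_single, one_smul]

lemma finite_enF_le (n : ℕ) : {μ : (Fld s r × ℕ) →₀ ℕ | enF μ ≤ n}.Finite := by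
  refine finite_weight_le fdeg (fun _ => Nat.succ_pos _) (fun N => ?_) n
  refine ((Set.finite_univ (α := Fld s r)).prod (Set.finite_Iic N)).subset ?_
  rintro ⟨φ, k⟩ h
  refine ⟨trivial, ?_⟩
  simp only [fdeg, Set.mem_ofPred_eq] at h
  simp only [Set.mem_Iic]
  omega

lemma finite_enF_eq (E : ℤ) : {μ : (Fld s r × ℕ) →₀ ℕ | (enF μ : ℤ) = E}.Finite :=
  (finite_enF_le E.toNat).subset fun μ h => by
    simp only [Set.mem_ofPred_eq] at h ⊢
    omega

/-- The contribution of a Grassmann variable to the energy. -/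
def epos (ξ : Xi s r) : ℤ :=
  match ξ with
  | Sum.inl (_, k) => |2 * (k : ℤ)|
  | Sum.inr (_, n) => 2 * n + 1

/-- The charge of a monomial. -/
def chgT (a : Fin s) (w : Finset (Xi s r)) : ℤ := chg (Sum.inl (a, true) : Fld s r) w

/-- The energy of a monomial in the Grassmann variables. -/
def egr (w : Finset (Xi s r)) : ℤ := ∑ ξ ∈ w, epos ξ - ∑ a : Fin s, chgT a w ^ 2

/-- The energy of a monomial. -/
def en (w : Finset (Xi s r)) (m : Time s r →₀ ℕ) : ℤ := egr w + 2 * wt m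

lemma epos_mvar (φ : Fld s r) {k : ℤ} (h : mcoef φ k ≠ 0) : epos (mvar φ k) * (if mb k then 1 else -1) =
    match φ with
    | Sum.inl _ => 2 * k
    | Sum.inr _ => 2 * k + 1 := by
  rcases φ with ⟨a, δ⟩ | c
  · rcases k with n | n
    · have hn : n ≠ 0 := by rintro rfl; simp [mcoef] at h
      change |2 * ((if δ then 1 else -1) * (((n - 1 : ℕ) : ℤ) + 1))| * 1 = 2 * (n : ℤ)
      cases δ
      · rw [if_neg (by simp), abs_of_nonpos (by omega)]; omega
      · rw [if_pos rfl, abs_of_nonneg (by omega)]; omega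
    · change |2 * ((if !δ then 1 else -1) * ((n : ℤ) + 1))| * -1 = 2 * (Int.negSucc n)
      cases δ
      · rw [if_pos (by rfl), abs_of_nonneg (by omega)]; omega
      · rw [if_neg (by simp), abs_of_nonpos (by omega)]; omega
  · rcases k with n | n
    · change (2 * (n : ℤ) + 1) * 1 = 2 * (n : ℤ) + 1
      ring
    · change (2 * (n : ℤ) + 1) * -1 = 2 * (Int.negSucc n) + 1
      omega

lemma egr_tog (φ : Fld s r) {k : ℤ} {w : Finset (Xi s r)}
    (h : decide (mvar φ k ∈ w) = mb k) (h' : mcoef φ k ≠ 0) :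
    egr (tog w (mvar φ k)) = egr w - 2 * (k + chg φ w) - 1 := by
  classical
  have h1 : ∑ ξ ∈ tog w (mvar φ k), epos ξ = ∑ ξ ∈ w, epos ξ -
      epos (mvar φ k) * (if mb k then 1 else -1) := by
    rw [← h]
    unfold tog
    by_cases hm : mvar φ k ∈ w
    · rw [if_pos hm, if_pos (by simpa using hm), ← Finset.sum_erase_add _ _ hm]
      ring_nf
    · rw [if_neg hm, if_neg (by simpa using hm)]
      have := Finset.sum_insert (f := epos) hm
      rw [show ∑ ξ ∈ insert (mvar φ k) w, epos ξ = epos (mvar φ k) + ∑ ξ ∈ w, epos ξ by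
        convert this]
      ring
  have h2 : ∀ a, chgT a (tog w (mvar φ k)) = chgT a w + dchg (Sum.inl (a, true)) φ :=
    fun a => chg_tog _ _ _ _ h
  unfold egr
  rw [h1, epos_mvar φ h']
  simp only [h2, add_sq, Finset.sum_add_distrib]
  rcases φ with ⟨a, δ⟩ | c
  · have e1 : ∑ a' : Fin s, 2 * chgT a' w * dchg (Sum.inl (a', true) : Fld s r) (Sum.inl (a, δ)) =
        2 * chg (Sum.inl (a, δ) : Fld s r) w := by
      rw [Finset.sum_eq_single a]
      · cases δ <;> simp [dchg, chgT, chg]; ring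
      · intro b _ hb
        simp [dchg, hb]
      · simp
    have e2 : ∑ a' : Fin s, dchg (Sum.inl (a', true) : Fld s r) (Sum.inl (a, δ)) ^ 2 = 1 := by
      rw [Finset.sum_eq_single a]
      · cases δ <;> simp [dchg]
      · intro b _ hb
        simp [dchg, hb]
      · simp
    rw [e1, e2]
    ring
  · simp [dchg, chg]
    ring

/-- The modes change the energy by a constant. -/
lemma bB_energy {φ : Fld s r} {j : ℤ} {τ : BFock s r} {w : Finset (Xi s r)}
    {m : Time s r →₀ ℕ} (h : crd w m (bB φ j τ) ≠ 0) :
    ∃ ξ m', crd (tog w ξ) m' τ ≠ 0 ∧ en (tog w ξ) m' = en w m + 2 * j + 1 := by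
  obtain ⟨k, m', -, h1, h2, h3, h4⟩ := bB_ne_zero h
  refine ⟨mvar φ k, m', h3, ?_⟩
  unfold en
  rw [egr_tog φ h1 h2, h4]
  ring

lemma odd_card_tog (w : Finset (Xi s r)) (ξ : Xi s r) : Odd (tog w ξ).card ↔ Even w.card := by
  classical
  unfold tog
  split_ifs with h
  · rw [← Finset.card_erase_add_one h, Nat.even_add_one, Nat.not_even_iff_odd]
  · have : (insert ξ w).card = w.card + 1 := Finset.card_insert_of_notMem h
    rw [show (insert ξ w).card = w.card + 1 by convert this, Nat.odd_add_one, Nat.not_odd_iff_even]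

lemma fockMap_monomial (μ : (Fld s r × ℕ) →₀ ℕ) (w : Finset (Xi s r)) (m : Time s r →₀ ℕ)
    (h : crd w m (fockMap s r (MvPolynomial.monomial μ 1)) ≠ 0) :
    en w m = enF μ ∧ (Even w.card ↔ Even μ.degree) := by
  induction μ using finsupp_induction_single generalizing w m with
  | h0 =>
    change crd w m (fockMap s r 1) ≠ 0 at h
    rw [fockMap_one] at h
    obtain ⟨rfl, rfl⟩ := crd_bvac _ _ h
    have h0 : ∀ a : Fin s, chgT a (∅ : Finset (Xi s r)) = 0 := fun a => chg_empty _
    simp [en, egr, h0]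
  | h1 μ x ih =>
    have e : (MvPolynomial.monomial (μ + Finsupp.single x 1)) (1 : ℂ) =
        MvPolynomial.X x * MvPolynomial.monomial μ 1 := by
      rw [MvPolynomial.X, MvPolynomial.monomial_mul, add_comm, one_mul]
    rw [e, fockMap_X] at h
    obtain ⟨ξ, m', h1, h2⟩ := bB_energy h
    obtain ⟨h3, h4⟩ := ih _ _ h1
    refine ⟨?_, ?_⟩
    · rw [enF_add_single, fdeg]
      push_cast
      omega
    · rw [← odd_card_tog w ξ, ← Nat.not_even_iff_odd, h4, map_add, Finsupp.degree_single,
        Nat.even_add_one]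

lemma exists_coeff_ne_zero {p : MvPolynomial (Fld s r × ℕ) ℂ} {w : Finset (Xi s r)}
    {m : Time s r →₀ ℕ} (h : crd w m (fockMap s r p) ≠ 0) :
    ∃ μ, MvPolynomial.coeff μ p ≠ 0 ∧ en w m = enF μ ∧ (Even w.card ↔ Even μ.degree) := by
  rw [p.as_sum, map_sum, map_sum] at h
  obtain ⟨μ, h1, h2⟩ := Finset.exists_ne_zero_of_sum_ne_zero h
  refine ⟨μ, MvPolynomial.mem_support_iff.1 h1, fockMap_monomial μ w m ?_⟩
  rw [← mul_one (MvPolynomial.coeff μ p), ← smul_eq_mul, ← MvPolynomial.smul_monomial, map_smul, map_smul] at h2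
  exact right_ne_zero_of_mul h2

/-! ## The completed bosonization -/

/-- The part of energy `E` of a series. -/
def energyPart (s r : ℕ) (E : ℤ) : FFock s r →ₗ[ℂ] MvPolynomial (Fld s r × ℕ) ℂ :=
  ∑ μ ∈ (finite_enF_eq (s := s) (r := r) E).toFinset,
    MvPolynomial.monomial μ ∘ₗ MvPowerSeries.coeff μ

lemma coeff_energyPart (E : ℤ) (f : FFock s r) (μ : (Fld s r × ℕ) →₀ ℕ) :
    MvPolynomial.coeff μ (energyPart s r E f) =
      if (enF μ : ℤ) = E then MvPowerSeries.coeff μ f else 0 := by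
  classical
  rw [energyPart, LinearMap.sum_apply, MvPolynomial.coeff_sum]
  simp only [LinearMap.comp_apply, MvPolynomial.coeff_monomial]
  rw [Finset.sum_ite_eq']
  simp

lemma crd_fockMap_congr {p q : MvPolynomial (Fld s r × ℕ) ℂ} {w : Finset (Xi s r)}
    {m : Time s r →₀ ℕ}
    (h : ∀ μ, (enF μ : ℤ) = en w m → MvPolynomial.coeff μ p = MvPolynomial.coeff μ q) :
    crd w m (fockMap s r p) = crd w m (fockMap s r q) := by
  rw [← sub_eq_zero, ← map_sub, ← map_sub]
  by_contra h0
  obtain ⟨μ, h1, h2, -⟩ := exists_coeff_ne_zero h0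
  rw [MvPolynomial.coeff_sub, h μ h2.symm, sub_self] at h1
  exact h1 rfl

/-- The bosonization as a function. -/
def bosFun (f : FFock s r) : BFock s r :=
  fun w m => crd w m (fockMap s r (energyPart s r (en w m) f))

lemma crd_bosFun (f : FFock s r) (w : Finset (Xi s r)) (m : Time s r →₀ ℕ) :
    crd w m (bosFun f) = crd w m (fockMap s r (energyPart s r (en w m) f)) := rfl

/-- The bosonization as a linear map. -/
def bosMap (s r : ℕ) : FFock s r →ₗ[ℂ] BFock s r where
  toFun := bosFun
  map_add' f g := ext_crd fun w m => by simp only [map_add, crd_bosFun]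
  map_smul' c f := ext_crd fun w m => by simp only [map_smul, crd_bosFun, RingHom.id_apply]

lemma crd_bosMap (f : FFock s r) (w : Finset (Xi s r)) (m : Time s r →₀ ℕ) :
    crd w m (bosMap s r f) = crd w m (fockMap s r (energyPart s r (en w m) f)) := rfl

lemma crd_bosMap_congr {f : FFock s r} {p : MvPolynomial (Fld s r × ℕ) ℂ} {w : Finset (Xi s r)}
    {m : Time s r →₀ ℕ}
    (h : ∀ μ, (enF μ : ℤ) = en w m → MvPolynomial.coeff μ p = MvPowerSeries.coeff μ f) :
    crd w m (bosMap s r f) = crd w m (fockMap s r p) := by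
  rw [crd_bosMap]
  refine crd_fockMap_congr fun μ hμ => ?_
  rw [coeff_energyPart, if_pos hμ, h μ hμ]

lemma bosMap_coe (p : MvPolynomial (Fld s r × ℕ) ℂ) : bosMap s r p = fockMap s r p :=
  ext_crd fun _ _ => crd_bosMap_congr fun μ _ => (MvPolynomial.coeff_coe p μ).symm

lemma crd_fockMap_energyPart (E : ℤ) (f : FFock s r) (w : Finset (Xi s r)) (m : Time s r →₀ ℕ) :
    crd w m (fockMap s r (energyPart s r E f)) = if en w m = E then crd w m (bosMap s r f) else 0 := by
  split_ifs with h
  · rw [crd_bosMap, h]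
  · by_contra h0
    obtain ⟨μ, h1, h2, -⟩ := exists_coeff_ne_zero h0
    rw [coeff_energyPart, if_neg (by rwa [← h2])] at h1
    exact h1 rfl

lemma bosMap_injective : Function.Injective (bosMap s r) := by
  rw [injective_iff_map_eq_zero]
  intro f hf
  ext μ
  have h1 : fockMap s r (energyPart s r (enF μ) f) = 0 := ext_crd fun w m => by
    rw [crd_fockMap_energyPart, hf, map_zero]; simp
  have h2 : energyPart s r (enF μ) f = 0 := fockMap_injective (by rw [h1, map_zero])
  have h3 := coeff_energyPart (enF μ : ℤ) f μ
  rw [h2, if_pos rfl] at h3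
  simpa using h3.symm

lemma exists_fockMap_eq {τ : BFock s r} (h : τ ∈ polyB s r) : ∃ p, fockMap s r p = τ := by
  rw [← fockRange_eq] at h
  exact h

lemma linearIndependent_bmon : LinearIndependent ℂ
    fun x : Finset (Xi s r) × (Time s r →₀ ℕ) => (bmon x.1 x.2 : BFock s r) := by
  classical
  rw [linearIndependent_iff']
  intro S c h x hx
  have h1 := congrArg (crd x.1 x.2) h
  rw [map_sum, map_zero, Finset.sum_eq_single x] at h1
  · rw [map_smul, crd_bmon, if_pos ⟨rfl, rfl⟩] at h1
    simpa using h1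
  · intro y _ hy
    rw [map_smul, crd_bmon, if_neg, smul_zero]
    rintro ⟨h1, h2⟩
    exact hy (Prod.ext h1 h2).symm
  · exact fun h => absurd hx h

lemma finite_en_eq (E : ℤ) : {x : Finset (Xi s r) × (Time s r →₀ ℕ) | en x.1 x.2 = E}.Finite := by
  classical
  choose p hp using fun x : Finset (Xi s r) × (Time s r →₀ ℕ) =>
    exists_fockMap_eq (bmon_mem x.1 x.2)
  let J := {x : Finset (Xi s r) × (Time s r →₀ ℕ) // en x.1 x.2 = E}
  let I := {μ : (Fld s r × ℕ) →₀ ℕ // (enF μ : ℤ) = E}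
  have hI : Finite I := (finite_enF_eq E).to_subtype
  let v : J → I → ℂ := fun x μ => MvPolynomial.coeff μ.1 (p x.1)
  have hv : LinearIndependent ℂ v := by
    rw [linearIndependent_iff']
    intro S c h x hx
    have h1 : ∑ y ∈ S, c y • (bmon y.1.1 y.1.2 : BFock s r) = 0 := by
      have h2 : ∑ y ∈ S, c y • (bmon y.1.1 y.1.2 : BFock s r) =
          fockMap s r (∑ y ∈ S, c y • p y.1) := by
        rw [map_sum]
        refine Finset.sum_congr rfl fun y _ => ?_
        rw [map_smul, hp]
      refine ext_crd fun w m => ?_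
      by_cases hE : en w m = E
      · rw [h2, map_zero, ← map_zero (crd w m), ← map_zero (fockMap s r)]
        refine crd_fockMap_congr fun μ hμ => ?_
        have h3 := congrFun h ⟨μ, hμ.trans hE⟩
        rw [MvPolynomial.coeff_sum, MvPolynomial.coeff_zero]
        simpa [v] using h3
      · rw [map_sum, map_zero]
        refine Finset.sum_eq_zero fun y _ => ?_
        rw [map_smul, crd_bmon, if_neg, smul_zero]
        rintro ⟨e1, e2⟩
        refine hE ?_
        rw [e1, e2]
        exact y.2
    have h4 := linearIndependent_iff'.1
      (linearIndependent_bmon (s := s) (r := r).comp (Subtype.val : J → _) Subtype.val_injective) S c h1 x hx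
    exact h4
  have : Finite {x : Finset (Xi s r) × (Time s r →₀ ℕ) | en x.1 x.2 = E} :=
    LinearIndependent.finite hv
  exact Set.toFinite {x : Finset (Xi s r) × (Time s r →₀ ℕ) | en x.1 x.2 = E}

lemma bosMap_surjective : Function.Surjective (bosMap s r) := by
  classical
  intro τ
  have h : ∀ E : ℤ, ∃ p, fockMap s r p = ∑ x ∈ (finite_en_eq (s := s) (r := r) E).toFinset,
      crd x.1 x.2 τ • bmon x.1 x.2 := fun E => exists_fockMap_eq
    (Submodule.sum_mem _ fun x _ => Submodule.smul_mem _ _ (bmon_mem _ _))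
  choose p hp using h
  let f : FFock s r := fun μ => MvPolynomial.coeff μ (p (enF μ))
  have hf : ∀ μ, MvPowerSeries.coeff μ f = MvPolynomial.coeff μ (p (enF μ)) := fun _ => rfl
  refine ⟨f, ext_crd fun w m => ?_⟩
  rw [crd_bosMap_congr (p := p (en w m)), hp, map_sum, Finset.sum_eq_single (w, m)]
  · rw [map_smul, crd_bmon, if_pos ⟨rfl, rfl⟩]; simp
  · intro y _ hy
    rw [map_smul, crd_bmon, if_neg, smul_zero]
    rintro ⟨h1, h2⟩
    exact hy (Prod.ext h1 h2).symm
  · intro h0; simp at h0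
  · intro μ hμ
    rw [← hμ, hf]

/-- The bosonization. -/
def bos (s r : ℕ) : FFock s r ≃ₗ[ℂ] BFock s r :=
  LinearEquiv.ofBijective (bosMap s r) ⟨bosMap_injective, bosMap_surjective⟩

lemma bos_apply (f : FFock s r) : bos s r f = bosMap s r f := rfl

/-- The modes of the fields on polynomials. -/
def bP (φ : Fld s r) (j : ℤ) (p : MvPolynomial (Fld s r × ℕ) ℂ) : MvPolynomial (Fld s r × ℕ) ℂ :=
  match j with
  | Int.ofNat n => φ.comm n • MvPolynomial.pderiv (φ.conj, n) p
  | Int.negSucc n => MvPolynomial.X (φ, n) * p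

lemma fockMap_bP (φ : Fld s r) (j : ℤ) (p : MvPolynomial (Fld s r × ℕ) ℂ) :
    fockMap s r (bP φ j p) = bB φ j (fockMap s r p) := by
  rcases j with n | n
  · exact (fockMap_pderiv φ n p).symm
  · exact fockMap_X _ _

lemma bF_coe (φ : Fld s r) (j : ℤ) (p : MvPolynomial (Fld s r × ℕ) ℂ) :
    bF φ j (p : FFock s r) = (bP φ j p : MvPolynomial (Fld s r × ℕ) ℂ) := by
  rcases j with n | n
  · simp only [bF, bP, MvPolynomial.coe_smul, MvPowerSeries.pderiv_coe]
  · simp [bF, bP]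

lemma coeff_bF_congr {φ : Fld s r} {j : ℤ} {f g : FFock s r} {μ : (Fld s r × ℕ) →₀ ℕ}
    (h : ∀ ν, (enF ν : ℤ) = enF μ + 2 * j + 1 → MvPowerSeries.coeff ν f = MvPowerSeries.coeff ν g) :
    MvPowerSeries.coeff μ (bF φ j f) = MvPowerSeries.coeff μ (bF φ j g) := by
  classical
  rcases j with n | n
  · simp only [bF, map_smul, MvPowerSeries.coeff_pderiv]
    rw [h]
    rw [enF_add_single, fdeg]
    simp
    ring
  · simp only [bF, MvPowerSeries.X, MvPowerSeries.coeff_monomial_mul]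
    split_ifs with h1
    · rw [h]
      have h2 := congrArg enF (tsub_add_cancel_of_le h1)
      rw [enF_add_single, fdeg] at h2
      simp only at h2
      omega
    · rfl

lemma crd_bB_congr {φ : Fld s r} {j : ℤ} {τ τ' : BFock s r} {w : Finset (Xi s r)}
    {m : Time s r →₀ ℕ}
    (h : ∀ w' m', en w' m' = en w m + 2 * j + 1 → crd w' m' τ = crd w' m' τ') :
    crd w m (bB φ j τ) = crd w m (bB φ j τ') := by
  rw [← sub_eq_zero, ← map_sub]
  by_contra h0
  rw [← bL_apply, ← bL_apply, ← map_sub, bL_apply] at h0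
  obtain ⟨ξ, m', h1, h2⟩ := bB_energy h0
  rw [map_sub, h _ _ h2, sub_self] at h1
  exact h1 rfl

lemma bosMap_bF (φ : Fld s r) (j : ℤ) (f : FFock s r) :
    bosMap s r (bF φ j f) = bB φ j (bosMap s r f) := by
  refine ext_crd fun w m => ?_
  let p := energyPart s r (en w m + 2 * j + 1) f
  have hp : ∀ μ, (enF μ : ℤ) = en w m + 2 * j + 1 →
      MvPolynomial.coeff μ p = MvPowerSeries.coeff μ f := fun μ hμ => by
    rw [coeff_energyPart, if_pos hμ]
  rw [crd_bosMap_congr (p := bP φ j p), fockMap_bP]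
  · refine crd_bB_congr fun w' m' h => ?_
    rw [crd_bosMap_congr (p := p)]
    intro μ hμ
    exact hp μ (hμ.trans h)
  · intro μ hμ
    rw [← MvPolynomial.coeff_coe, ← bF_coe]
    refine coeff_bF_congr fun ν hν => ?_
    rw [MvPolynomial.coeff_coe]
    exact hp ν (by rw [hν, hμ])

lemma isBosonization_bos : IsBosonization (bos s r) where
  vacuum := by
    have h := bosMap_coe (1 : MvPolynomial (Fld s r × ℕ) ℂ)
    rw [fockMap_one, MvPolynomial.coe_one] at h
    exact h
  intertwines := bosMap_bF
  continuous w m := ⟨(finite_enF_eq (en w m)).toFinset, fun f hf => by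
    have h : crd w m (bosMap s r f) = crd w m (fockMap s r 0) :=
      crd_bosMap_congr fun μ hμ => by
        rw [MvPolynomial.coeff_zero, hf μ (by simpa using hμ)]
    rw [map_zero, map_zero] at h
    exact h⟩

lemma IsBosonization.coe {σ : FFock s r ≃ₗ[ℂ] BFock s r} (h : IsBosonization σ)
    (p : MvPolynomial (Fld s r × ℕ) ℂ) : σ p = fockMap s r p := by
  induction p using MvPolynomial.induction_on with
  | C a =>
    rw [← mul_one (MvPolynomial.C a), ← MvPolynomial.smul_eq_C_mul, MvPolynomial.coe_smul, map_smul,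
      map_smul, MvPolynomial.coe_one, h.vacuum, fockMap_one]
  | add p q hp hq => rw [MvPolynomial.coe_add, map_add, hp, hq, map_add]
  | mul_X p x hp =>
    have h1 := h.intertwines x.1 (Int.negSucc x.2) p
    rw [mul_comm, fockMap_X, ← hp]
    refine Eq.trans ?_ h1
    simp [bF]

lemma IsBosonization.eq_bos {σ : FFock s r ≃ₗ[ℂ] BFock s r} (h : IsBosonization σ) :
    σ = bos s r := by
  classical
  ext1 f
  refine ext_crd fun w m => ?_
  obtain ⟨S, hS⟩ := h.continuous w m
  obtain ⟨S', hS'⟩ := (isBosonization_bos (s := s) (r := r)).continuous w m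
  let p : MvPolynomial (Fld s r × ℕ) ℂ :=
    ∑ μ ∈ S ∪ S', MvPolynomial.monomial μ (MvPowerSeries.coeff μ f)
  have hp : ∀ μ ∈ S ∪ S', MvPowerSeries.coeff μ (f - (p : FFock s r)) = 0 := by
    intro μ hμ
    rw [map_sub, MvPolynomial.coeff_coe, MvPolynomial.coeff_sum]
    simp only [MvPolynomial.coeff_monomial]
    rw [Finset.sum_ite_eq', if_pos hμ, sub_self]
  have h1 := hS (f - (p : FFock s r)) fun μ hμ => hp μ (Finset.mem_union_left _ hμ)
  have h2 := hS' (f - (p : FFock s r)) fun μ hμ => hp μ (Finset.mem_union_right _ hμ)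
  change crd w m (σ (f - (p : FFock s r))) = 0 at h1
  change crd w m (bos s r (f - (p : FFock s r))) = 0 at h2
  rw [map_sub, map_sub, sub_eq_zero, h.coe] at h1
  rw [map_sub, map_sub, sub_eq_zero, isBosonization_bos.coe] at h2
  exact h1.trans h2.symm

theorem existsUnique_bosonization (s r : ℕ) :
    ∃! σ : FFock s r ≃ₗ[ℂ] BFock s r, IsBosonization σ :=
  ⟨bos s r, isBosonization_bos, fun _ h => h.eq_bos⟩

lemma isPolyB_iff {τ : BFock s r} : IsPolyB τ ↔ τ ∈ polyB s r := by
  classical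
  rw [mem_polyB_iff]
  constructor
  · rintro ⟨h1, h2⟩
    choose p hp using h2
    have : {x : Finset (Xi s r) × (Time s r →₀ ℕ) | crd x.1 x.2 τ ≠ 0} ⊆
        ↑(h1.toFinset.biUnion fun w => (p w).support.image fun m => (w, m)) := by
      rintro ⟨w, m⟩ hx
      change crd w m τ ≠ 0 at hx
      rw [crd_apply, ← hp w, MvPolynomial.coeff_coe] at hx
      simp only [Finset.coe_biUnion, Set.mem_iUnion]
      refine ⟨w, ?_, ?_⟩
      · simp only [Set.Finite.coe_toFinset, Set.mem_ofPred_eq]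
        intro h0
        rw [← MvPolynomial.coeff_coe, hp w, h0] at hx
        simp at hx
      · simp only [Finset.coe_image, Set.mem_image]
        exact ⟨m, MvPolynomial.mem_support_iff.2 hx, rfl⟩
    exact (Finset.finite_toSet _).subset this
  · intro h
    refine ⟨(h.image Prod.fst).subset fun w hw => ?_, fun w => ?_⟩
    · by_contra h0
      refine hw (MvPowerSeries.ext fun m => ?_)
      by_contra h1
      exact h0 ⟨(w, m), h1, rfl⟩
    · refine ⟨∑ m ∈ h.toFinset.image Prod.snd, MvPolynomial.monomial m (MvPowerSeries.coeff m (τ w)),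
        MvPowerSeries.ext fun m => ?_⟩
      rw [MvPolynomial.coeff_coe, MvPolynomial.coeff_sum]
      simp only [MvPolynomial.coeff_monomial]
      rw [Finset.sum_ite_eq']
      split_ifs with h1
      · rfl
      · by_contra h2
        refine h1 (Finset.mem_image.2 ⟨(w, m), ?_, rfl⟩)
        rw [Set.Finite.mem_toFinset]
        exact fun h3 => h2 h3.symm

lemma isPolyF_iff (f : FFock s r) : IsPolyF f ↔ IsPolyB (bos s r f) := by
  rw [isPolyB_iff]
  constructor
  · rintro ⟨p, rfl⟩
    rw [isBosonization_bos.coe, ← fockRange_eq]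
    exact ⟨p, rfl⟩
  · intro h
    obtain ⟨p, hp⟩ := exists_fockMap_eq h
    refine ⟨p, (bos s r).injective ?_⟩
    rw [isBosonization_bos.coe, hp]

lemma bos_parity {f : FFock s r} {P : Prop}
    (hf : ∀ μ, MvPowerSeries.coeff μ f ≠ 0 → (Even μ.degree ↔ P)) {w : Finset (Xi s r)}
    (hw : ¬ (Even w.card ↔ P)) : bos s r f w = 0 := by
  refine MvPowerSeries.ext fun m => ?_
  change crd w m (bosMap s r f) = _
  rw [map_zero, crd_bosMap]
  by_contra h
  obtain ⟨μ, h1, -, h2⟩ := exists_coeff_ne_zero h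
  rw [coeff_energyPart] at h1
  split_ifs at h1 with h3
  · exact hw (h2.trans (hf μ h1))
  · exact h1 rfl

lemma isEvenF_iff (f : FFock s r) :
    IsEvenF f ↔ ∀ w : Finset (Xi s r), Odd w.card → bos s r f w = 0 := by
  constructor
  · intro h w hw
    exact bos_parity (P := True) (fun μ hμ => iff_true_intro (h μ hμ))
      (by simpa using hw)
  · intro h
    let g : FFock s r := fun μ => open Classical in if Even μ.degree then 0 else MvPowerSeries.coeff μ f
    have hg : ∀ μ, MvPowerSeries.coeff μ g = open Classical in
      if Even μ.degree then 0 else MvPowerSeries.coeff μ f := fun _ => rfl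
    have h1 : bos s r g = 0 := by
      ext1 w
      by_cases hw : Even w.card
      · refine bos_parity (P := False) (fun μ hμ => iff_false_intro fun h2 => hμ ?_) (by simpa using hw)
        rw [hg, if_pos h2]
      · have h2 : bos s r (f - g) w = 0 := by
          refine bos_parity (P := True) (fun μ hμ => iff_true_intro ?_) (by simpa using hw)
          by_contra h2
          rw [map_sub, hg, if_neg h2, sub_self] at hμ
          exact hμ rfl
        rw [map_sub, Pi.sub_apply, h w (Nat.not_even_iff_odd.1 hw), zero_sub, neg_eq_zero] at h2
        exact h2
    have h2 : g = 0 := (bos s r).injective (by rw [h1, map_zero])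
    intro μ hμ
    by_contra h3
    have h4 := hg μ
    rw [if_neg h3, h2, map_zero] at h4
    exact hμ h4.symm

end MCKP
end

noncomputable section
namespace MCKP

variable {s r : ℕ}

/-! ## Residue pairings -/

section pairing

variable {ι : Type*}

/-- Families of sequences that vanish for large indices. -/
def highSeq (ι : Type*) : Submodule ℂ (ι → ℤ → ℂ) where
  carrier := {a | ∃ N : ℤ, ∀ i n, N < n → a i n = 0}
  zero_mem' := ⟨0, fun _ _ _ => rfl⟩
  add_mem' := by
    rintro a b ⟨N, hN⟩ ⟨N', hN'⟩
    refine ⟨max N N', fun i n hn => ?_⟩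
    rw [Pi.add_apply, Pi.add_apply, hN i n (lt_of_le_of_lt (le_max_left _ _) hn),
      hN' i n (lt_of_le_of_lt (le_max_right _ _) hn), add_zero]
  smul_mem' := by
    rintro c a ⟨N, hN⟩
    exact ⟨N, fun i n hn => by rw [Pi.smul_apply, Pi.smul_apply, hN i n hn, smul_zero]⟩

variable [Fintype ι]

/-- The residue of `∑ i, a_i(z) b_i(z)`, with weights. -/
def pairing (c : ι → ℤ → ℂ) (a b : ι → ℤ → ℂ) : ℂ :=
  ∑ᶠ n : ℤ, ∑ i, c i n * (a i n * b i (-1 - n))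

lemma pairing_support (c : ι → ℤ → ℂ) {a b : ι → ℤ → ℂ} (ha : a ∈ highSeq ι) (hb : b ∈ highSeq ι) :
    (Function.support fun n : ℤ => ∑ i, c i n * (a i n * b i (-1 - n))).Finite := by
  obtain ⟨N, hN⟩ := ha
  obtain ⟨N', hN'⟩ := hb
  refine (Set.finite_Icc (-1 - N') N).subset fun n hn => ?_
  by_contra h
  refine hn (Finset.sum_eq_zero fun i _ => ?_)
  rw [Set.mem_Icc, not_and_or, not_le, not_le] at h
  rcases h with h | h
  · rw [hN' i _ (by omega), mul_zero, mul_zero]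
  · rw [hN i _ h, zero_mul, mul_zero]

lemma pairing_add_left (c : ι → ℤ → ℂ) {a a' b : ι → ℤ → ℂ} (ha : a ∈ highSeq ι)
    (ha' : a' ∈ highSeq ι) (hb : b ∈ highSeq ι) :
    pairing c (a + a') b = pairing c a b + pairing c a' b := by
  unfold pairing
  rw [← finsum_add_distrib (pairing_support c ha hb) (pairing_support c ha' hb)]
  simp only [Pi.add_apply, add_mul, mul_add, Finset.sum_add_distrib]

lemma pairing_add_right (c : ι → ℤ → ℂ) {a b b' : ι → ℤ → ℂ} (ha : a ∈ highSeq ι)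
    (hb : b ∈ highSeq ι) (hb' : b' ∈ highSeq ι) :
    pairing c a (b + b') = pairing c a b + pairing c a b' := by
  unfold pairing
  rw [← finsum_add_distrib (pairing_support c ha hb) (pairing_support c ha hb')]
  simp only [Pi.add_apply, mul_add, Finset.sum_add_distrib]

lemma pairing_smul_left (c : ι → ℤ → ℂ) (k : ℂ) (a b : ι → ℤ → ℂ) :
    pairing c (k • a) b = k * pairing c a b := by
  unfold pairing
  rw [← smul_eq_mul, smul_finsum]
  refine finsum_congr fun n => ?_
  simp only [Pi.smul_apply, smul_eq_mul, Finset.mul_sum]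
  exact Finset.sum_congr rfl fun i _ => by ring

lemma pairing_smul_right (c : ι → ℤ → ℂ) (k : ℂ) (a b : ι → ℤ → ℂ) :
    pairing c a (k • b) = k * pairing c a b := by
  unfold pairing
  rw [← smul_eq_mul, smul_finsum]
  refine finsum_congr fun n => ?_
  simp only [Pi.smul_apply, smul_eq_mul, Finset.mul_sum]
  exact Finset.sum_congr rfl fun i _ => by ring

lemma pairing_zero_left (c : ι → ℤ → ℂ) (b : ι → ℤ → ℂ) : pairing c 0 b = 0 := by
  simp [pairing]

lemma pairing_zero_right (c : ι → ℤ → ℂ) (a : ι → ℤ → ℂ) : pairing c a 0 = 0 := by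
  simp [pairing]

/-- A pairing that vanishes on generators vanishes on their span. -/
lemma pairing_eq_zero_of_mem_span {c : ι → ℤ → ℂ} {S S' : Set (ι → ℤ → ℂ)}
    (hS : S ⊆ highSeq ι) (hS' : S' ⊆ highSeq ι) (h : ∀ a ∈ S, ∀ b ∈ S', pairing c a b = 0)
    {a b : ι → ℤ → ℂ} (ha : a ∈ Submodule.span ℂ S) (hb : b ∈ Submodule.span ℂ S') :
    pairing c a b = 0 := by
  have h1 : ∀ a ∈ S, ∀ b ∈ Submodule.span ℂ S', pairing c a b = 0 := by
    intro a ha b hb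
    induction hb using Submodule.span_induction with
    | mem b hb => exact h a ha b hb
    | zero => exact pairing_zero_right c a
    | add b b' hb hb' h1 h2 =>
      rw [pairing_add_right c (hS ha) (Submodule.span_le.2 hS' hb) (Submodule.span_le.2 hS' hb'),
        h1, h2, add_zero]
    | smul k b _ h1 => rw [pairing_smul_right, h1, mul_zero]
  induction ha using Submodule.span_induction with
  | mem a ha => exact h1 a ha b hb
  | zero => exact pairing_zero_left c b
  | add a a' ha ha' h2 h3 =>
    rw [pairing_add_left c (Submodule.span_le.2 hS ha) (Submodule.span_le.2 hS ha')
      (Submodule.span_le.2 hS' hb), h2, h3, add_zero]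
  | smul k a _ h2 => rw [pairing_smul_left, h2, mul_zero]

end pairing

/-- The signs in the bilinear equation. -/
def ckpSign (φ : Fld s r) (n : ℤ) : ℂ :=
  match φ with
  | Sum.inl (_, δ) => sg δ
  | Sum.inr _ => (-1) ^ (n + 1)

/-- The matrix elements of a field. -/
def fldSeq {V : Type*} [AddCommGroup V] [Module ℂ V] (b : Fld s r → ℤ → V) (L : V →ₗ[ℂ] ℂ) :
    Fld s r → ℤ → ℂ := fun φ n => L (b φ (-n - 1))

/-- The matrix elements of the dual field. -/
def conjSeq {V : Type*} [AddCommGroup V] [Module ℂ V] (b : Fld s r → ℤ → V) (L : V →ₗ[ℂ] ℂ) :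
    Fld s r → ℤ → ℂ := fun φ n => L (b φ.conj (-n - 1))

section transfer

variable {V : Type*} [AddCommGroup V] [Module ℂ V] {b : Fld s r → ℤ → V}

lemma conjSeq_high {L : V →ₗ[ℂ] ℂ} (h : fldSeq b L ∈ highSeq (Fld s r)) :
    conjSeq b L ∈ highSeq (Fld s r) := by
  obtain ⟨N, hN⟩ := h
  exact ⟨N, fun φ n hn => hN φ.conj n hn⟩

/-- The linearity of the bilinear equation in the functionals. -/
lemma pairing_fldSeq_eq_zero {S : Set (V →ₗ[ℂ] ℂ)} (hS : ∀ L ∈ S, fldSeq b L ∈ highSeq (Fld s r))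
    (h : ∀ L ∈ S, ∀ L' ∈ S, pairing ckpSign (fldSeq b L) (conjSeq b L') = 0)
    {L L' : V →ₗ[ℂ] ℂ} (hL : L ∈ Submodule.span ℂ S) (hL' : L' ∈ Submodule.span ℂ S) :
    pairing ckpSign (fldSeq b L) (conjSeq b L') = 0 := by
  let F : (V →ₗ[ℂ] ℂ) →ₗ[ℂ] (Fld s r → ℤ → ℂ) :=
    { toFun := fldSeq b, map_add' := fun _ _ => rfl, map_smul' := fun _ _ => rfl }
  let G : (V →ₗ[ℂ] ℂ) →ₗ[ℂ] (Fld s r → ℤ → ℂ) :=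
    { toFun := conjSeq b, map_add' := fun _ _ => rfl, map_smul' := fun _ _ => rfl }
  refine pairing_eq_zero_of_mem_span (S := F '' S) (S' := G '' S) ?_ ?_ ?_ ?_ ?_
  · rintro _ ⟨L, hL, rfl⟩; exact hS L hL
  · rintro _ ⟨L, hL, rfl⟩; exact conjSeq_high (hS L hL)
  · rintro _ ⟨L, hL, rfl⟩ _ ⟨L', hL', rfl⟩; exact h L hL L' hL'
  · rw [Submodule.span_image]; exact ⟨L, hL, rfl⟩
  · rw [Submodule.span_image]; exact ⟨L', hL', rfl⟩

end transfer

/-- The bilinear equation for the bosonized fields. -/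
def BosonicCKP (τ : BFock s r) : Prop :=
  ∀ w m w' m', pairing ckpSign (fldSeq (fun φ j => bB φ j τ) (crd w m))
    (conjSeq (fun φ j => bB φ j τ) (crd w' m')) = 0

lemma fermionicCKP_iff (f : FFock s r) : FermionicCKP f ↔ ∀ μ μ', pairing ckpSign
    (fldSeq (fun φ j => bF φ j f) (MvPowerSeries.coeff μ))
    (conjSeq (fun φ j => bF φ j f) (MvPowerSeries.coeff μ')) = 0 := by
  refine forall₂_congr fun μ μ' => ?_
  rw [← neg_eq_zero, ← finsum_neg_distrib]
  have : Function.Bijective fun n : ℤ => -n - 1 :=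
    Function.Involutive.bijective fun n => by ring
  rw [← finsum_comp _ this]
  refine Eq.congr (finsum_congr fun n => ?_) rfl
  rw [Fintype.sum_sum_type, Fintype.sum_prod_type]
  simp only [Fintype.sum_bool, ckpSign, fldSeq, conjSeq, Fld.conj, sg, neg_add_rev]
  rw [add_comm, ← Finset.sum_neg_distrib, ← Finset.sum_neg_distrib]
  congr 1
  · refine Finset.sum_congr rfl fun a _ => ?_
    simp only [Bool.not_true, Bool.not_false, if_true]
    rw [show -(-1 - n) - 1 = n by ring, show -(-n - 1) - 1 = n by ring]
    simp
    ring
  · refine Finset.sum_congr rfl fun c _ => ?_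
    rw [show -(-1 - n) - 1 = n by ring, show -(-n - 1) - 1 = n by ring,
      show -n - 1 + 1 = -n by ring, zpow_neg, zpow_add₀ (by norm_num)]
    rcases Int.even_or_odd n with hn | hn
    · rw [hn.neg_one_zpow]; norm_num
    · rw [hn.neg_one_zpow]; norm_num

lemma fldSeq_coeff_high (f : FFock s r) (μ : (Fld s r × ℕ) →₀ ℕ) :
    fldSeq (fun φ j => bF φ j f) (MvPowerSeries.coeff μ) ∈ highSeq (Fld s r) := by
  classical
  refine ⟨enF μ, fun φ n hn => ?_⟩
  obtain ⟨k, rfl⟩ := Int.eq_ofNat_of_zero_le (by omega : 0 ≤ n)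
  change MvPowerSeries.coeff μ (bF φ (-(k : ℤ) - 1) f) = 0
  rw [show -(k : ℤ) - 1 = Int.negSucc k by rw [Int.negSucc_eq]; ring]
  simp only [bF, MvPowerSeries.X, MvPowerSeries.coeff_monomial_mul]
  rw [if_neg]
  intro h
  have h2 := congrArg enF (tsub_add_cancel_of_le h)
  rw [enF_add_single, fdeg] at h2
  simp only at h2
  omega

lemma fldSeq_crd_high (τ : BFock s r) (w : Finset (Xi s r)) (m : Time s r →₀ ℕ) :
    fldSeq (fun φ j => bB φ j τ) (crd w m) ∈ highSeq (Fld s r) := by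
  have h : ∀ φ : Fld s r, ∃ N : ℤ, ∀ n, N < n → crd w m (bB φ (-n - 1) τ) = 0 := by
    intro φ
    refine ⟨wt m + bnd w + chg φ w, fun n hn => ?_⟩
    by_contra h
    obtain ⟨k, m', h1, -, -, -, h2⟩ := bB_ne_zero h
    omega
  choose N hN using h
  obtain ⟨M, hM⟩ := (Set.finite_range N).bddAbove
  exact ⟨M, fun φ n hn => hN φ n (lt_of_le_of_lt (hM ⟨φ, rfl⟩) hn)⟩

lemma mem_span_of_finDep {V ι : Type*} [AddCommGroup V] [Module ℂ V] (e : ι → V →ₗ[ℂ] ℂ)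
    {L : V →ₗ[ℂ] ℂ} (S : Finset ι) (h : ∀ v, (∀ i ∈ S, e i v = 0) → L v = 0) :
    L ∈ Submodule.span ℂ (Set.range e) := by
  have h1 : L ∈ Submodule.span ℂ (Set.range fun i : S => e i) := by
    refine mem_span_of_iInf_ker_le_ker fun v hv => h v fun i hi => ?_
    rw [Submodule.mem_iInf] at hv
    exact hv ⟨i, hi⟩
  exact Submodule.span_mono (by rintro _ ⟨i, rfl⟩; exact ⟨i, rfl⟩) h1

lemma bos_bF (φ : Fld s r) (j : ℤ) (f : FFock s r) : bos s r (bF φ j f) = bB φ j (bos s r f) :=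
  bosMap_bF φ j f

lemma coeff_bos_symm_eq_zero {τ : BFock s r} {μ : (Fld s r × ℕ) →₀ ℕ}
    (h : ∀ w m, en w m = enF μ → crd w m τ = 0) :
    MvPowerSeries.coeff μ ((bos s r).symm τ) = 0 := by
  have h1 : fockMap s r (energyPart s r (enF μ) ((bos s r).symm τ)) = 0 := ext_crd fun w m => by
    rw [crd_fockMap_energyPart, ← bos_apply, LinearEquiv.apply_symm_apply, map_zero]
    split_ifs with hE
    · exact h w m hE
    · rfl
  have h2 := fockMap_injective (h1.trans (map_zero _).symm)
  have h3 := coeff_energyPart (enF μ : ℤ) ((bos s r).symm τ) μ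
  rw [h2, if_pos rfl] at h3
  simpa using h3.symm

lemma fermionicCKP_iff_bosonicCKP (f : FFock s r) : FermionicCKP f ↔ BosonicCKP (bos s r f) := by
  rw [fermionicCKP_iff]
  have hbB : ∀ L : BFock s r →ₗ[ℂ] ℂ, fldSeq (fun φ j => bB φ j (bos s r f)) L =
      fldSeq (fun φ j => bF φ j f) (L ∘ₗ (bos s r).toLinearMap) := by
    intro L; ext φ n; simp only [fldSeq, ← bos_bF]; rfl
  have hbB' : ∀ L : BFock s r →ₗ[ℂ] ℂ, conjSeq (fun φ j => bB φ j (bos s r f)) L =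
      conjSeq (fun φ j => bF φ j f) (L ∘ₗ (bos s r).toLinearMap) := by
    intro L; ext φ n; simp only [conjSeq, ← bos_bF]; rfl
  constructor
  · intro h w m w' m'
    have h1 : ∀ w m, crd w m ∘ₗ (bos s r).toLinearMap ∈
        Submodule.span ℂ (Set.range fun μ => MvPowerSeries.coeff (R := ℂ) (σ := Fld s r × ℕ) μ) := by
      intro w m
      obtain ⟨S, hS⟩ := (isBosonization_bos (s := s) (r := r)).continuous w m
      exact mem_span_of_finDep _ S fun v hv => hS v hv
    rw [hbB, hbB']
    refine pairing_fldSeq_eq_zero ?_ ?_ (h1 w m) (h1 w' m')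
    · rintro _ ⟨μ, rfl⟩; exact fldSeq_coeff_high f μ
    · rintro _ ⟨μ, rfl⟩ _ ⟨μ', rfl⟩; exact h μ μ'
  · intro h μ μ'
    have h1 : ∀ μ, MvPowerSeries.coeff (R := ℂ) μ ∘ₗ (bos s r).symm.toLinearMap ∈
        Submodule.span ℂ (Set.range fun x : Finset (Xi s r) × (Time s r →₀ ℕ) => crd x.1 x.2) := by
      intro μ
      refine mem_span_of_finDep _ (finite_en_eq (enF μ)).toFinset fun v hv => ?_
      refine coeff_bos_symm_eq_zero fun w m hE => hv (w, m) ?_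
      rw [Set.Finite.mem_toFinset]
      exact hE
    have h2 : ∀ μ, MvPowerSeries.coeff (R := ℂ) (σ := Fld s r × ℕ) μ =
        (MvPowerSeries.coeff μ ∘ₗ (bos s r).symm.toLinearMap) ∘ₗ (bos s r).toLinearMap := by
      intro μ; ext1 g; simp
    rw [h2 μ, h2 μ', ← hbB, ← hbB']
    refine pairing_fldSeq_eq_zero ?_ ?_ (h1 μ) (h1 μ')
    · rintro _ ⟨x, rfl⟩; exact fldSeq_crd_high _ _ _
    · rintro _ ⟨x, rfl⟩ _ ⟨y, rfl⟩; exact h _ _ _ _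

end MCKP
end

noncomputable section
namespace MCKP

variable {s r : ℕ}

/-! ## Series in two sets of times -/

/-- The exponents of the times `t`. -/
def expL (M : (Time s r ⊕ Time s r) →₀ ℕ) : Time s r →₀ ℕ :=
  Finsupp.comapDomain Sum.inl M Sum.inl_injective.injOn

/-- The exponents of the times `t̄`. -/
def expR (M : (Time s r ⊕ Time s r) →₀ ℕ) : Time s r →₀ ℕ :=
  Finsupp.comapDomain Sum.inr M Sum.inr_injective.injOn

/-- The monomial with given exponents. -/
def expLR (m m' : Time s r →₀ ℕ) : (Time s r ⊕ Time s r) →₀ ℕ :=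
  m.embDomain Function.Embedding.inl + m'.embDomain Function.Embedding.inr

lemma expL_expLR (m m' : Time s r →₀ ℕ) : expL (expLR m m') = m := by
  ext i
  have h1 := Finsupp.embDomain_apply_self (Function.Embedding.inl : Time s r ↪ Time s r ⊕ Time s r) m i
  have h2 := Finsupp.embDomain_of_notMem_range (Function.Embedding.inr : Time s r ↪ Time s r ⊕ Time s r)
    m' (Sum.inl i) (by simp)
  simp only [expL, expLR, Finsupp.comapDomain_apply, Finsupp.add_apply]
  rw [h2, add_zero]
  exact h1

lemma expR_expLR (m m' : Time s r →₀ ℕ) : expR (expLR m m') = m' := by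
  ext i
  have h1 := Finsupp.embDomain_apply_self (Function.Embedding.inr : Time s r ↪ Time s r ⊕ Time s r) m' i
  have h2 := Finsupp.embDomain_of_notMem_range (Function.Embedding.inl : Time s r ↪ Time s r ⊕ Time s r)
    m (Sum.inr i) (by simp)
  simp only [expR, expLR, Finsupp.comapDomain_apply, Finsupp.add_apply]
  rw [h2, zero_add]
  exact h1

lemma expLR_eq (M : (Time s r ⊕ Time s r) →₀ ℕ) : expLR (expL M) (expR M) = M := by
  ext i
  rcases i with i | i
  · have := DFunLike.congr_fun (expL_expLR (expL M) (expR M)) i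
    exact this
  · have := DFunLike.congr_fun (expR_expLR (expL M) (expR M)) i
    exact this

lemma coeff_inT_mul_inTbar (f g : TSer s r) (M : (Time s r ⊕ Time s r) →₀ ℕ) :
    MvPowerSeries.coeff M (inT f * inTbar g) =
      MvPowerSeries.coeff (expL M) f * MvPowerSeries.coeff (expR M) g := by
  classical
  rw [MvPowerSeries.coeff_mul, Finset.sum_eq_single
    ((expL M).embDomain Function.Embedding.inl, (expR M).embDomain Function.Embedding.inr)]
  · rw [inT, inTbar, MvPowerSeries.coeff_embDomain_rename, MvPowerSeries.coeff_embDomain_rename]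
  · rintro ⟨x, y⟩ hxy hne
    rw [Finset.HasAntidiagonal.mem_antidiagonal] at hxy
    by_cases hx : x ∈ Set.range (Finsupp.mapDomain (M := ℕ) (Function.Embedding.inl : Time s r ↪ Time s r ⊕ Time s r))
    · by_cases hy : y ∈ Set.range (Finsupp.mapDomain (M := ℕ) (Function.Embedding.inr : Time s r ↪ Time s r ⊕ Time s r))
      · obtain ⟨a, rfl⟩ := hx
        obtain ⟨b, rfl⟩ := hy
        rw [← Finsupp.embDomain_eq_mapDomain, ← Finsupp.embDomain_eq_mapDomain] at hne hxy
        have h1 := expL_expLR a b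
        have h2 := expR_expLR a b
        simp only [expLR] at h1 h2
        simp only at hxy
        rw [hxy] at h1 h2
        rw [h1, h2] at hne
        exact absurd rfl hne
      · rw [inTbar, MvPowerSeries.coeff_rename_eq_zero _ _ hy, mul_zero]
    · rw [inT, MvPowerSeries.coeff_rename_eq_zero _ _ hx, zero_mul]
  · intro h
    refine absurd ?_ h
    rw [Finset.HasAntidiagonal.mem_antidiagonal]
    exact expLR_eq M

lemma expL_add_single_inl (M : (Time s r ⊕ Time s r) →₀ ℕ) (i : Time s r) :
    expL (M + Finsupp.single (Sum.inl i) 1) = expL M + Finsupp.single i 1 := by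
  classical
  ext j
  simp [expL, Finsupp.single_apply]

lemma expR_add_single_inl (M : (Time s r ⊕ Time s r) →₀ ℕ) (i : Time s r) :
    expR (M + Finsupp.single (Sum.inl i) 1) = expR M := by
  ext j
  simp [expR]

lemma expR_add_single_inr (M : (Time s r ⊕ Time s r) →₀ ℕ) (i : Time s r) :
    expR (M + Finsupp.single (Sum.inr i) 1) = expR M + Finsupp.single i 1 := by
  classical
  ext j
  simp [expR, Finsupp.single_apply]

lemma expL_add_single_inr (M : (Time s r ⊕ Time s r) →₀ ℕ) (i : Time s r) :
    expL (M + Finsupp.single (Sum.inr i) 1) = expL M := by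
  ext j
  simp [expL]

lemma pderiv_inl (i : Time s r) (f g : TSer s r) :
    MvPowerSeries.pderiv ℂ (Sum.inl i) (inT f * inTbar g) =
      inT (MvPowerSeries.pderiv ℂ i f) * inTbar g := by
  ext M
  rw [MvPowerSeries.coeff_pderiv, coeff_inT_mul_inTbar, coeff_inT_mul_inTbar,
    MvPowerSeries.coeff_pderiv, expL_add_single_inl, expR_add_single_inl]
  have : expL M i = M (Sum.inl i) := rfl
  rw [this]
  ring

lemma pderiv_inr (i : Time s r) (f g : TSer s r) :
    MvPowerSeries.pderiv ℂ (Sum.inr i) (inT f * inTbar g) =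
      inT f * inTbar (MvPowerSeries.pderiv ℂ i g) := by
  ext M
  rw [MvPowerSeries.coeff_pderiv, coeff_inT_mul_inTbar, coeff_inT_mul_inTbar,
    MvPowerSeries.coeff_pderiv, expL_add_single_inr, expR_add_single_inr]
  have : expR M i = M (Sum.inr i) := rfl
  rw [this]
  ring

lemma inT_zero : inT (0 : TSer s r) = 0 := map_zero _
lemma inTbar_zero : inTbar (0 : TSer s r) = 0 := map_zero _

lemma dvar_inl (b : Cmp s r) (k : ℕ) (f g : TSer s r) :
    dvar Sum.inl b k (inT f * inTbar g) = inT (dvar id b k f) * inTbar g := by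
  rcases h : timeIdx b k with _ | i
  · rw [dvar_of_none _ h, dvar_of_none _ h]
    simp [inT_zero]
  · rw [dvar_of_some _ h, dvar_of_some _ h]
    exact pderiv_inl i f g

lemma dvar_inr (b : Cmp s r) (k : ℕ) (f g : TSer s r) :
    dvar Sum.inr b k (inT f * inTbar g) = inT f * inTbar (dvar id b k g) := by
  rcases h : timeIdx b k with _ | i
  · rw [dvar_of_none _ h, dvar_of_none _ h]
    simp [inTbar_zero]
  · rw [dvar_of_some _ h, dvar_of_some _ h]
    exact pderiv_inr i f g

/-- The exponent of the differentiation part of a vertex operator. -/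
def dexp {V : Type} (e : Time s r → V) (φ : Fld s r) :
    PowerSeries (Module.End ℂ (MvPowerSeries V ℂ)) :=
  PowerSeries.mk fun k => (φ.sgn * dfac φ.cmp k) • dvar e φ.cmp k

lemma dexp_recursion {V : Type} (e : Time s r → V) (φ : Fld s r) (n : ℕ) :
    (n : ℂ) • PowerSeries.coeff n (pexp (dexp e φ)) =
    ∑ p ∈ Finset.HasAntidiagonal.antidiagonal n, (p.1 : ℂ) •
      ((φ.sgn * dfac φ.cmp p.1) • dvar e φ.cmp p.1 * PowerSeries.coeff p.2 (pexp (dexp e φ))) :=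
  pexp_recursion (by simp [dvar_zero])
    (fun _ _ => ((dvar_commute e _ _ _ _).smul_right _).smul_left _) n

lemma inT_smul (c : ℂ) (f : TSer s r) : inT (c • f) = c • inT f := map_smul _ _ _
lemma inTbar_smul (c : ℂ) (f : TSer s r) : inTbar (c • f) = c • inTbar f := map_smul _ _ _
lemma inT_sum {ι : Type*} (S : Finset ι) (f : ι → TSer s r) :
    inT (∑ i ∈ S, f i) = ∑ i ∈ S, inT (f i) := map_sum (MvPowerSeries.rename (R := ℂ) _) _ _
lemma inTbar_sum {ι : Type*} (S : Finset ι) (f : ι → TSer s r) :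
    inTbar (∑ i ∈ S, f i) = ∑ i ∈ S, inTbar (f i) := map_sum (MvPowerSeries.rename (R := ℂ) _) _ _

lemma dexp_inl (φ : Fld s r) (q : ℕ) (f g : TSer s r) :
    PowerSeries.coeff q (pexp (dexp Sum.inl φ)) (inT f * inTbar g) =
      inT (Dc φ q f) * inTbar g := by
  induction q using Nat.strong_induction_on with
  | _ q ih =>
    rcases Nat.eq_zero_or_pos q with rfl | hq
    · rw [coeff_zero_pexp, Dc_zero]; rfl
    · rw [recursion_induction (f := fun n => PowerSeries.coeff n (pexp (dexp Sum.inl φ)))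
          (F := fun a b => (φ.sgn * dfac φ.cmp a) • dvar Sum.inl φ.cmp a *
            PowerSeries.coeff b (pexp (dexp Sum.inl φ)))
          (dexp_recursion (Sum.inl : Time s r → Time s r ⊕ Time s r) φ) q hq,
        recursion_induction (F := fun a b => (φ.sgn * dfac φ.cmp a) • dvar id φ.cmp a * Dc φ b)
          (Dc_recursion φ) q hq, LinearMap.sum_apply, LinearMap.sum_apply,
        inT_sum, Finset.sum_mul]
      refine Finset.sum_congr rfl fun p hp => ?_
      rw [Finset.HasAntidiagonal.mem_antidiagonal] at hp
      by_cases h0 : p.1 = 0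
      · simp [h0, inT_zero]
      · simp only [LinearMap.smul_apply, Module.End.mul_apply]
        rw [ih p.2 (by omega), dvar_inl, inT_smul, inT_smul, smul_mul_assoc, smul_mul_assoc]

lemma dexp_inr (φ : Fld s r) (q : ℕ) (f g : TSer s r) :
    PowerSeries.coeff q (pexp (dexp Sum.inr φ)) (inT f * inTbar g) =
      inT f * inTbar (Dc φ q g) := by
  induction q using Nat.strong_induction_on with
  | _ q ih =>
    rcases Nat.eq_zero_or_pos q with rfl | hq
    · rw [coeff_zero_pexp, Dc_zero]; rfl
    · rw [recursion_induction (f := fun n => PowerSeries.coeff n (pexp (dexp Sum.inr φ)))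
          (F := fun a b => (φ.sgn * dfac φ.cmp a) • dvar Sum.inr φ.cmp a *
            PowerSeries.coeff b (pexp (dexp Sum.inr φ)))
          (dexp_recursion (Sum.inr : Time s r → Time s r ⊕ Time s r) φ) q hq,
        recursion_induction (F := fun a b => (φ.sgn * dfac φ.cmp a) • dvar id φ.cmp a * Dc φ b)
          (Dc_recursion φ) q hq, LinearMap.sum_apply, LinearMap.sum_apply,
        inTbar_sum, Finset.mul_sum]
      refine Finset.sum_congr rfl fun p hp => ?_
      rw [Finset.HasAntidiagonal.mem_antidiagonal] at hp
      by_cases h0 : p.1 = 0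
      · simp [h0, inTbar_zero]
      · simp only [LinearMap.smul_apply, Module.End.mul_apply]
        rw [ih p.2 (by omega), dvar_inr, inTbar_smul, inTbar_smul, mul_smul_comm, mul_smul_comm]

/-- The exponent of the multiplication part of a vertex operator. -/
def texp {V : Type} (e : Time s r → V) (φ : Fld s r) : PowerSeries (MvPowerSeries V ℂ) :=
  PowerSeries.mk fun k => φ.sgn • tvar e φ.cmp k

lemma inT_tvar (b : Cmp s r) (k : ℕ) : inT (tvar id b k) = tvar Sum.inl b k := by
  rcases h : timeIdx b k with _ | i
  · rw [tvar_of_none _ h, tvar_of_none _ h, inT_zero]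
  · rw [tvar_of_some _ h, tvar_of_some _ h, inT, MvPowerSeries.rename_X]; rfl

lemma inTbar_tvar (b : Cmp s r) (k : ℕ) : inTbar (tvar id b k) = tvar Sum.inr b k := by
  rcases h : timeIdx b k with _ | i
  · rw [tvar_of_none _ h, tvar_of_none _ h, inTbar_zero]
  · rw [tvar_of_some _ h, tvar_of_some _ h, inTbar, MvPowerSeries.rename_X]; rfl

lemma texp_inl (φ : Fld s r) (p : ℕ) :
    PowerSeries.coeff p (pexp (texp Sum.inl φ)) = inT (Hc φ p) := by
  have h := pexp_map (MvPowerSeries.rename (R := ℂ)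
    (Function.Embedding.inl : Time s r ↪ Time s r ⊕ Time s r))
    (PowerSeries.mk fun k => φ.sgn • tvar id φ.cmp k) p
  refine Eq.trans ?_ h
  congr 2
  ext1 k
  rw [texp, PowerSeries.coeff_mk, PowerSeries.coeff_map, PowerSeries.coeff_mk]
  refine (?_ : _ = inT (φ.sgn • tvar id φ.cmp k))
  rw [inT_smul, inT_tvar]

lemma texp_inr (φ : Fld s r) (p : ℕ) :
    PowerSeries.coeff p (pexp (texp Sum.inr φ)) = inTbar (Hc φ p) := by
  have h := pexp_map (MvPowerSeries.rename (R := ℂ)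
    (Function.Embedding.inr : Time s r ↪ Time s r ⊕ Time s r))
    (PowerSeries.mk fun k => φ.sgn • tvar id φ.cmp k) p
  refine Eq.trans ?_ h
  congr 2
  ext1 k
  rw [texp, PowerSeries.coeff_mk, PowerSeries.coeff_map, PowerSeries.coeff_mk]
  refine (?_ : _ = inTbar (φ.sgn • tvar id φ.cmp k))
  rw [inTbar_smul, inTbar_tvar]

lemma coeff_pexp_rescale_add {E : Type*} [Ring E] [Algebra ℂ E] (η η' : ℂ) (f g : PowerSeries E)
    (hf0 : PowerSeries.coeff 0 f = 0) (hg0 : PowerSeries.coeff 0 g = 0)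
    (hff : ∀ i j, Commute (PowerSeries.coeff i f) (PowerSeries.coeff j f))
    (hgg : ∀ i j, Commute (PowerSeries.coeff i g) (PowerSeries.coeff j g))
    (hfg : ∀ i j, Commute (PowerSeries.coeff i f) (PowerSeries.coeff j g)) (n : ℕ) :
    PowerSeries.coeff n (pexp (PowerSeries.mk fun k =>
      η ^ k • PowerSeries.coeff k f + η' ^ k • PowerSeries.coeff k g)) =
      ∑ p ∈ Finset.HasAntidiagonal.antidiagonal n, (η ^ p.1 * η' ^ p.2) •
        (PowerSeries.coeff p.1 (pexp f) * PowerSeries.coeff p.2 (pexp g)) := by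
  have e : (PowerSeries.mk fun k => η ^ k • PowerSeries.coeff k f + η' ^ k • PowerSeries.coeff k g) =
      (PowerSeries.mk fun k => η ^ k • PowerSeries.coeff k f) +
        PowerSeries.mk fun k => η' ^ k • PowerSeries.coeff k g := by ext k; simp
  rw [e, pexp_add, PowerSeries.coeff_mul]
  · refine Finset.sum_congr rfl fun p _ => ?_
    rw [pexp_rescale, pexp_rescale, smul_mul_smul_comm]
  · simp [hf0]
  · simp [hg0]
  all_goals
    intro i j
    simp only [PowerSeries.coeff_mk]
  · exact ((hff i j).smul_right _).smul_left _
  · exact ((hgg i j).smul_right _).smul_left _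
  · exact ((hfg i j).smul_right _).smul_left _

lemma dvar_commute' {V : Type} (e e' : Time s r → V) (b b' : Cmp s r) (k k' : ℕ) :
    Commute (dvar e b k) (dvar e' b' k') := by
  rcases h : timeIdx b' k' with _ | i'
  · rw [dvar_of_none e' h]; exact Commute.zero_right _
  · rw [dvar_of_some e' h]; exact dvar_commute_pderiv e b k _

/-- The multiplication part of the product of two fields. -/
def expT2 (η η' : ℂ) (φ ψ : Fld s r) : PowerSeries (TSer2 s r) :=
  pexp (PowerSeries.mk fun k => η ^ k • PowerSeries.coeff k (texp Sum.inl φ) +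
    η' ^ k • PowerSeries.coeff k (texp Sum.inr ψ))

/-- The differentiation part of the product of two fields. -/
def expD2 (η η' : ℂ) (φ ψ : Fld s r) : PowerSeries (Module.End ℂ (TSer2 s r)) :=
  pexp (PowerSeries.mk fun k => η ^ k • PowerSeries.coeff k (dexp Sum.inl φ) +
    η' ^ k • PowerSeries.coeff k (dexp Sum.inr ψ))

lemma coeff_expT2 (η η' : ℂ) (φ ψ : Fld s r) (p : ℕ) :
    PowerSeries.coeff p (expT2 η η' φ ψ) =
      ∑ x ∈ Finset.HasAntidiagonal.antidiagonal p, (η ^ x.1 * η' ^ x.2) •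
        (inT (Hc φ x.1) * inTbar (Hc ψ x.2)) := by
  rw [expT2, coeff_pexp_rescale_add _ _ _ _ (by simp [texp, tvar_zero]) (by simp [texp, tvar_zero])
    (fun _ _ => Commute.all _ _) (fun _ _ => Commute.all _ _) (fun _ _ => Commute.all _ _)]
  simp only [texp_inl, texp_inr]

lemma coeff_expD2 (η η' : ℂ) (φ ψ : Fld s r) (q : ℕ) (f g : TSer s r) :
    PowerSeries.coeff q (expD2 η η' φ ψ) (inT f * inTbar g) =
      ∑ x ∈ Finset.HasAntidiagonal.antidiagonal q, (η ^ x.1 * η' ^ x.2) •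
        (inT (Dc φ x.1 f) * inTbar (Dc ψ x.2 g)) := by
  rw [expD2, coeff_pexp_rescale_add, LinearMap.sum_apply]
  · refine Finset.sum_congr rfl fun x _ => ?_
    rw [LinearMap.smul_apply, Module.End.mul_apply, dexp_inr, dexp_inl]
  · simp [dexp, dvar_zero]
  · simp [dexp, dvar_zero]
  all_goals
    intro i j
    simp only [dexp, PowerSeries.coeff_mk]
    exact ((dvar_commute' _ _ _ _ _ _).smul_right _).smul_left _

end MCKP
end

noncomputable section
namespace MCKP

variable {s r : ℕ}

lemma sum_range_antidiagonal {M : Type*} [AddCommMonoid M] (N : ℕ) (F : ℕ → ℕ → M)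
    (h : ∀ x y, N ≤ x + y → F x y = 0) :
    ∑ n ∈ Finset.range N, ∑ x ∈ Finset.HasAntidiagonal.antidiagonal n, F x.1 x.2 =
      ∑ x ∈ Finset.range N, ∑ y ∈ Finset.range N, F x y := by
  classical
  rw [← Finset.sum_product', Finset.sum_sigma']
  refine Finset.sum_bij_ne_zero (fun x _ _ => x.2) ?_ ?_ ?_ ?_
  · rintro ⟨n, x⟩ hx _
    simp only [Finset.mem_sigma, Finset.mem_range, Finset.HasAntidiagonal.mem_antidiagonal] at hx
    simp only [Finset.mem_product, Finset.mem_range]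
    omega
  · rintro ⟨n, x⟩ hx _ ⟨n', x'⟩ hx' _ hxx
    simp only [Finset.mem_sigma, Finset.HasAntidiagonal.mem_antidiagonal] at hx hx' hxx
    subst hxx
    obtain rfl : n = n' := by omega
    rfl
  · rintro ⟨x, y⟩ hx h0
    refine ⟨⟨x + y, (x, y)⟩, ?_, h0, rfl⟩
    simp only [Finset.mem_sigma, Finset.mem_range, Finset.HasAntidiagonal.mem_antidiagonal,
      and_true]
    by_contra h1
    exact h0 (h x y (by omega))
  · intros; rfl

/-- The contributions to the coefficient of `z ^ n` in a bosonized field. -/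
def vterm (φ : Fld s r) (τ : BFock s r) (w : Finset (Xi s r)) (m : Time s r →₀ ℕ) (p q : ℕ)
    (n : ℤ) : ℂ := MvPowerSeries.coeff m (Hc φ p * Dc φ q (Xm φ (n - p + q) τ w))

lemma vterm_eq_zero_of_lt {φ : Fld s r} {τ : BFock s r} {w : Finset (Xi s r)}
    {m : Time s r →₀ ℕ} {p : ℕ} (h : wt m < p) (q : ℕ) (n : ℤ) : vterm φ τ w m p q n = 0 :=
  coeff_Hc_mul_eq_zero h _

lemma vterm_eq_zero {φ : Fld s r} {τ : BFock s r} {w : Finset (Xi s r)}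
    {m : Time s r →₀ ℕ} {p q : ℕ} {n : ℤ} (h : gtop φ w < n - p + q) :
    vterm φ τ w m p q n = 0 := by
  rw [vterm, Xm_eq_zero φ h, map_zero, mul_zero, map_zero]

lemma crd_bB_eq (φ : Fld s r) (τ : BFock s r) (w : Finset (Xi s r)) (m : Time s r →₀ ℕ) (n : ℤ)
    {P Q : ℕ} (hP : wt m < P) (hQ : gtop φ w - n + wt m < Q) :
    crd w m (bB φ (-n - 1) τ) =
      ∑ p ∈ Finset.range P, ∑ q ∈ Finset.range Q, vterm φ τ w m p q n := by
  rw [crd_apply, coeff_bB φ (-n - 1) τ w hP (by omega : gtop φ w + (-n - 1) + 1 + wt m < Q), bBt,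
    map_sum]
  refine Finset.sum_congr rfl fun p _ => ?_
  rw [map_sum]
  refine Finset.sum_congr rfl fun q _ => ?_
  rw [vterm, show -(-n - 1) - 1 = n by ring]

lemma vterm_eq_zero_of_high {φ : Fld s r} {τ : BFock s r} {w : Finset (Xi s r)}
    {m : Time s r →₀ ℕ} {n : ℤ} (h : gtop φ w + wt m < n) (p q : ℕ) :
    vterm φ τ w m p q n = 0 := by
  by_cases hp : wt m < p
  · exact vterm_eq_zero_of_lt hp q n
  · exact vterm_eq_zero (by omega)

lemma crd_bB_eq_zero {φ : Fld s r} {τ : BFock s r} {w : Finset (Xi s r)}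
    {m : Time s r →₀ ℕ} {n : ℤ} (h : gtop φ w + wt m < n) : crd w m (bB φ (-n - 1) τ) = 0 := by
  rw [crd_bB_eq φ τ w m n (P := wt m + 1) (Q := (gtop φ w - n + wt m).toNat + 1) (by omega)
    (by omega)]
  exact Finset.sum_eq_zero fun p _ => Finset.sum_eq_zero fun q _ => vterm_eq_zero_of_high h p q

lemma crd_bB_mul_crd_bB (φ ψ : Fld s r) (τ : BFock s r) (w w' : Finset (Xi s r))
    (m m' : Time s r →₀ ℕ) (n : ℤ) {P Q : ℕ} (hP : wt m < P) (hP' : wt m' < P)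
    (hQ : gtop φ w + gtop ψ w' + 1 + wt m + wt m' < Q) :
    crd w m (bB φ (-n - 1) τ) * crd w' m' (bB ψ n τ) =
      ∑ p ∈ Finset.range P, ∑ p' ∈ Finset.range P, ∑ q ∈ Finset.range Q, ∑ q' ∈ Finset.range Q,
        vterm φ τ w m p q n * vterm ψ τ w' m' p' q' (-1 - n) := by
  have e : n = -(-1 - n) - 1 := by ring
  by_cases h1 : gtop φ w + wt m < n
  · rw [crd_bB_eq_zero h1, zero_mul]
    symm
    exact Finset.sum_eq_zero fun p _ => Finset.sum_eq_zero fun q _ => Finset.sum_eq_zero fun _ _ =>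
      Finset.sum_eq_zero fun _ _ => by rw [vterm_eq_zero_of_high h1, zero_mul]
  by_cases h2 : gtop ψ w' + wt m' < -1 - n
  · have e2 : crd w' m' (bB ψ n τ) = 0 := by
      rw [e]; exact crd_bB_eq_zero h2
    rw [e2, mul_zero]
    symm
    exact Finset.sum_eq_zero fun p _ => Finset.sum_eq_zero fun q _ => Finset.sum_eq_zero fun _ _ =>
      Finset.sum_eq_zero fun _ _ => by rw [vterm_eq_zero_of_high h2, mul_zero]
  have e1 := crd_bB_eq φ τ w m n hP (Q := Q) (by omega)
  have e2 := crd_bB_eq ψ τ w' m' (-1 - n) hP' (Q := Q) (by omega)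
  rw [← e] at e2
  rw [e1, e2, Finset.sum_mul_sum]
  refine Finset.sum_congr rfl fun p _ => Finset.sum_congr rfl fun p' _ => ?_
  rw [Finset.sum_mul_sum]

lemma vterm_mul_support (φ ψ : Fld s r) (τ : BFock s r) (w w' : Finset (Xi s r))
    (m m' : Time s r →₀ ℕ) (c : ℤ → ℂ) (p p' q q' : ℕ) :
    (Function.support fun n : ℤ => c n * (vterm φ τ w m p q n *
      vterm ψ τ w' m' p' q' (-1 - n))).Finite := by
  refine (Set.finite_Icc (-1 - (gtop ψ w' + wt m')) (gtop φ w + wt m)).subset fun n hn => ?_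
  by_contra h
  rw [Set.mem_Icc, not_and_or, not_le, not_le] at h
  refine hn ?_
  rcases h with h | h
  · change c n * (_ * _) = 0
    rw [vterm_eq_zero_of_high (w := w') (by omega), mul_zero, mul_zero]
  · change c n * (_ * _) = 0
    rw [vterm_eq_zero_of_high (w := w) h, zero_mul, mul_zero]

/-- The Grassmann part of the product of two fields. -/
def grass2 (η η' : ℂ) (φ ψ : Fld s r) (τ : BFock s r) (w w' : Finset (Xi s r)) (g : ℤ) :
    TSer2 s r :=
  ∑ᶠ h : ℤ, (η ^ h * η' ^ (g - h)) • (inT (Xm φ h τ w) * inTbar (Xm ψ (g - h) τ w'))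

lemma grass2_eq (η η' : ℂ) (φ ψ : Fld s r) (τ : BFock s r) (w w' : Finset (Xi s r)) (g : ℤ) :
    grass2 η η' φ ψ τ w w' g = ∑ h ∈ Finset.Icc (g - gtop ψ w') (gtop φ w),
      (η ^ h * η' ^ (g - h)) • (inT (Xm φ h τ w) * inTbar (Xm ψ (g - h) τ w')) := by
  refine finsum_eq_sum_of_support_subset _ fun h hh => ?_
  by_contra h0
  rw [Finset.coe_Icc, Set.mem_Icc, not_and_or, not_le, not_le] at h0
  refine hh ?_
  rcases h0 with h0 | h0
  · change _ • (_ * inTbar (Xm ψ (g - h) τ w')) = 0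
    rw [Xm_eq_zero ψ (by omega), inTbar_zero, mul_zero, smul_zero]
  · change _ • (inT (Xm φ h τ w) * _) = 0
    rw [Xm_eq_zero φ h0, inT_zero, zero_mul, smul_zero]

lemma grass2_eq_zero {η η' : ℂ} {φ ψ : Fld s r} {τ : BFock s r} {w w' : Finset (Xi s r)} {g : ℤ}
    (h : gtop φ w + gtop ψ w' < g) : grass2 η η' φ ψ τ w w' g = 0 := by
  rw [grass2_eq, Finset.Icc_eq_empty (by omega), Finset.sum_empty]

lemma zpow_sign {η : ℂ} (h : η * η = 1) (a b : ℤ) (k : ℕ) (hab : b = a + 2 * k) : η ^ b = η ^ a := by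
  have h0 : η ≠ 0 := left_ne_zero_of_mul (by rw [h]; exact one_ne_zero)
  rw [hab, zpow_add₀ h0, zpow_mul, zpow_ofNat, sq, h, one_zpow, mul_one]

lemma inT_mul (f g : TSer s r) : inT (f * g) = inT f * inT g := map_mul _ _ _
lemma inTbar_mul (f g : TSer s r) : inTbar (f * g) = inTbar f * inTbar g := map_mul _ _ _

lemma coeff_expT2_mul_expD2 {η η' : ℂ} (hη : η * η = 1) (hη' : η' * η' = 1) (φ ψ : Fld s r)
    (τ : BFock s r) (w w' : Finset (Xi s r)) (M : (Time s r ⊕ Time s r) →₀ ℕ) (p q : ℕ) :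
    MvPowerSeries.coeff M (PowerSeries.coeff p (expT2 η η' φ ψ) *
      PowerSeries.coeff q (expD2 η η' φ ψ) (grass2 η η' φ ψ τ w w' (q - p - 1))) =
    ∑ x ∈ Finset.HasAntidiagonal.antidiagonal p, ∑ y ∈ Finset.HasAntidiagonal.antidiagonal q,
      ∑ᶠ n : ℤ, (η ^ n * η' ^ (-1 - n)) * (vterm φ τ w (expL M) x.1 y.1 n *
        vterm ψ τ w' (expR M) x.2 y.2 (-1 - n)) := by
  have h0 : η ≠ 0 := left_ne_zero_of_mul (by rw [hη]; exact one_ne_zero)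
  have h0' : η' ≠ 0 := left_ne_zero_of_mul (by rw [hη']; exact one_ne_zero)
  rw [grass2_eq, map_sum]
  simp only [map_smul, coeff_expD2, coeff_expT2]
  rw [Finset.sum_mul, map_sum]
  refine Finset.sum_congr rfl fun x hx => ?_
  simp only [Finset.mul_sum, Finset.smul_sum, map_sum]
  rw [Finset.sum_comm]
  refine Finset.sum_congr rfl fun y hy => ?_
  rw [Finset.HasAntidiagonal.mem_antidiagonal] at hx hy
  have hb : Function.Bijective fun n : ℤ => n - x.1 + y.1 :=
    ⟨fun a b h => by simpa using h, fun b => ⟨b + x.1 - y.1, by ring⟩⟩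
  have hc : ∀ n : ℤ, (η ^ n * η' ^ (-1 - n)) * (vterm φ τ w (expL M) x.1 y.1 n *
      vterm ψ τ w' (expR M) x.2 y.2 (-1 - n)) =
      (fun h : ℤ => (η ^ x.1 * η' ^ x.2) * (η ^ h * η' ^ ((q : ℤ) - p - 1 - h)) *
        (η ^ y.1 * η' ^ y.2) *
        (MvPowerSeries.coeff (expL M) (Hc φ x.1 * Dc φ y.1 (Xm φ h τ w)) *
          MvPowerSeries.coeff (expR M) (Hc ψ x.2 * Dc ψ y.2 (Xm ψ ((q : ℤ) - p - 1 - h) τ w'))))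
        (n - x.1 + y.1) := by
    intro n
    simp only [vterm]
    have e : (q : ℤ) - p - 1 - (n - x.1 + y.1) = -1 - n - x.2 + y.2 := by omega
    rw [e]
    have e1 : η ^ x.1 * η ^ (n - x.1 + y.1) * η ^ y.1 = η ^ n := by
      rw [← zpow_natCast, ← zpow_natCast, ← zpow_add₀ h0, ← zpow_add₀ h0]
      exact zpow_sign hη _ _ y.1 (by ring)
    have e2 : η' ^ x.2 * η' ^ (-1 - n - x.2 + y.2) * η' ^ y.2 = η' ^ (-1 - n) := by
      rw [← zpow_natCast, ← zpow_natCast, ← zpow_add₀ h0', ← zpow_add₀ h0']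
      exact zpow_sign hη' _ _ y.2 (by ring)
    rw [← e1, ← e2]
    ring
  rw [finsum_congr hc, finsum_comp _ hb (g := fun h : ℤ => (η ^ x.1 * η' ^ x.2) *
    (η ^ h * η' ^ ((q : ℤ) - p - 1 - h)) * (η ^ y.1 * η' ^ y.2) *
        (MvPowerSeries.coeff (expL M) (Hc φ x.1 * Dc φ y.1 (Xm φ h τ w)) *
          MvPowerSeries.coeff (expR M) (Hc ψ x.2 * Dc ψ y.2 (Xm ψ ((q : ℤ) - p - 1 - h) τ w')))),
    finsum_eq_sum_of_support_subset (s := Finset.Icc ((q : ℤ) - p - 1 - gtop ψ w') (gtop φ w))]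
  · refine Finset.sum_congr rfl fun h _ => ?_
    rw [smul_mul_assoc, mul_smul_comm, mul_smul_comm, map_smul, map_smul, map_smul,
      mul_mul_mul_comm, ← inT_mul, ← inTbar_mul, coeff_inT_mul_inTbar]
    simp only [smul_eq_mul]
    ring
  · intro h hh
    by_contra h0
    rw [Finset.coe_Icc, Set.mem_Icc, not_and_or, not_le, not_le] at h0
    refine hh ?_
    rcases h0 with h0 | h0
    · simp only
      rw [Xm_eq_zero ψ (by omega : gtop ψ w' < (q : ℤ) - p - 1 - h)]
      simp
    · simp only
      rw [Xm_eq_zero φ h0]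
      simp

lemma finsum_sum_comm' {M : Type*} [AddCommMonoid M] {α β : Type*} (S : Finset β) (f : α → β → M)
    (h : ∀ b ∈ S, (Function.support fun a => f a b).Finite) :
    ∑ᶠ a, ∑ b ∈ S, f a b = ∑ b ∈ S, ∑ᶠ a, f a b := finsum_sum_comm S f h

/-- The residue of the product of two bosonized fields. -/
lemma coeff_resid {η η' : ℂ} (hη : η * η = 1) (hη' : η' * η' = 1) (φ ψ : Fld s r)
    (τ : BFock s r) (w w' : Finset (Xi s r)) (M : (Time s r ⊕ Time s r) →₀ ℕ) :
    MvPowerSeries.coeff M (resid (expT2 η η' φ ψ) (expD2 η η' φ ψ) (grass2 η η' φ ψ τ w w')) =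
      ∑ᶠ n : ℤ, (η ^ n * η' ^ (-1 - n)) *
        (crd w (expL M) (bB φ (-n - 1) τ) * crd w' (expR M) (bB ψ n τ)) := by
  set m := expL M with hm
  set m' := expR M with hm'
  let P : ℕ := wt m + wt m' + 1
  let Q : ℕ := (gtop φ w + gtop ψ w').toNat + 2 + 2 * P
  let S : ℕ → ℕ → ℕ → ℕ → ℂ := fun p p' q q' =>
    ∑ᶠ n : ℤ, (η ^ n * η' ^ (-1 - n)) * (vterm φ τ w m p q n * vterm ψ τ w' m' p' q' (-1 - n))
  have hS1 : ∀ p p' q q', P ≤ p + p' → S p p' q q' = 0 := by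
    intro p p' q q' h
    refine finsum_eq_zero_of_forall_eq_zero fun n => ?_
    by_cases hp : wt m < p
    · rw [vterm_eq_zero_of_lt hp, zero_mul, mul_zero]
    · rw [vterm_eq_zero_of_lt (p := p') (by omega), mul_zero, mul_zero]
  have hS2 : ∀ p p' q q', p < P → p' < P → Q ≤ q + q' → S p p' q q' = 0 := by
    intro p p' q q' hp hp' h
    refine finsum_eq_zero_of_forall_eq_zero fun n => ?_
    by_cases hn : gtop φ w < n - p + q
    · rw [vterm_eq_zero hn, zero_mul, mul_zero]
    · rw [vterm_eq_zero (φ := ψ) (by omega), mul_zero, mul_zero]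
  have h1 : MvPowerSeries.coeff M (resid (expT2 η η' φ ψ) (expD2 η η' φ ψ)
      (grass2 η η' φ ψ τ w w')) = ∑ p ∈ Finset.range P, ∑ q ∈ Finset.range Q,
        ∑ x ∈ Finset.HasAntidiagonal.antidiagonal p, ∑ y ∈ Finset.HasAntidiagonal.antidiagonal q,
        S x.1 x.2 y.1 y.2 := by
    change ∑ᶠ p : ℕ, MvPowerSeries.coeff M (PowerSeries.coeff p (expT2 η η' φ ψ) *
      ∑ᶠ q : ℕ, PowerSeries.coeff q (expD2 η η' φ ψ) (grass2 η η' φ ψ τ w w' (q - p - 1))) = _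
    have hfin : ∀ p N : ℕ, gtop φ w + gtop ψ w' + p + 2 ≤ N →
        ∑ᶠ q : ℕ, PowerSeries.coeff q (expD2 η η' φ ψ) (grass2 η η' φ ψ τ w w' (q - p - 1)) =
        ∑ q ∈ Finset.range N, PowerSeries.coeff q (expD2 η η' φ ψ)
          (grass2 η η' φ ψ τ w w' (q - p - 1)) := by
      intro p N hN
      refine finsum_eq_sum_of_support_subset _ fun q hq => ?_
      by_contra h0
      simp only [Finset.coe_range, Set.mem_Iio, not_lt] at h0
      refine hq ?_
      simp only
      rw [grass2_eq_zero (by omega), map_zero]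
    rw [finsum_eq_sum_of_support_subset (s := Finset.range P)]
    · refine Finset.sum_congr rfl fun p hp => ?_
      rw [Finset.mem_range] at hp
      rw [hfin p Q (by omega), Finset.mul_sum, map_sum]
      exact Finset.sum_congr rfl fun q _ => coeff_expT2_mul_expD2 hη hη' φ ψ τ w w' M p q
    · intro p hp
      by_contra h0
      simp only [Finset.coe_range, Set.mem_Iio, not_lt] at h0
      refine hp ?_
      simp only
      rw [hfin p ((gtop φ w + gtop ψ w').toNat + p + 2) (by push_cast; omega), Finset.mul_sum, map_sum]
      refine Finset.sum_eq_zero fun q _ => ?_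
      rw [coeff_expT2_mul_expD2 hη hη' φ ψ τ w w' M p q]
      refine Finset.sum_eq_zero fun x hx => Finset.sum_eq_zero fun y _ => hS1 _ _ _ _ ?_
      rw [Finset.HasAntidiagonal.mem_antidiagonal] at hx
      omega
  have h2 : ∀ n : ℤ, (η ^ n * η' ^ (-1 - n)) *
        (crd w m (bB φ (-n - 1) τ) * crd w' m' (bB ψ n τ)) =
      ∑ p ∈ Finset.range P, ∑ p' ∈ Finset.range P, ∑ q ∈ Finset.range Q, ∑ q' ∈ Finset.range Q,
        (η ^ n * η' ^ (-1 - n)) * (vterm φ τ w m p q n * vterm ψ τ w' m' p' q' (-1 - n)) := by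
    intro n
    rw [crd_bB_mul_crd_bB φ ψ τ w w' m m' n (P := P) (Q := Q) (by omega) (by omega) (by omega)]
    simp only [Finset.mul_sum]
  have hsup := vterm_mul_support φ ψ τ w w' m m' (fun n => η ^ n * η' ^ (-1 - n))
  have h3 : ∀ p p', (Function.support fun n : ℤ => ∑ q ∈ Finset.range Q, ∑ q' ∈ Finset.range Q,
        (η ^ n * η' ^ (-1 - n)) * (vterm φ τ w m p q n * vterm ψ τ w' m' p' q' (-1 - n))).Finite := by
    intro p p'
    refine (Set.Finite.biUnion (Finset.range Q).finite_toSet fun q _ =>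
      Set.Finite.biUnion (Finset.range Q).finite_toSet fun q' _ => hsup p p' q q').subset ?_
    intro n hn
    obtain ⟨q, hq, hn⟩ := Finset.exists_ne_zero_of_sum_ne_zero hn
    obtain ⟨q', hq', hn⟩ := Finset.exists_ne_zero_of_sum_ne_zero hn
    exact Set.mem_biUnion hq (Set.mem_biUnion hq' hn)
  have h3' : ∀ p p' q, (Function.support fun n : ℤ => ∑ q' ∈ Finset.range Q,
        (η ^ n * η' ^ (-1 - n)) * (vterm φ τ w m p q n * vterm ψ τ w' m' p' q' (-1 - n))).Finite := by
    intro p p' q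
    refine (Set.Finite.biUnion (Finset.range Q).finite_toSet fun q' _ => hsup p p' q q').subset ?_
    intro n hn
    obtain ⟨q', hq', hn⟩ := Finset.exists_ne_zero_of_sum_ne_zero hn
    exact Set.mem_biUnion hq' hn
  have h3'' : ∀ p, (Function.support fun n : ℤ => ∑ p' ∈ Finset.range P, ∑ q ∈ Finset.range Q,
      ∑ q' ∈ Finset.range Q, (η ^ n * η' ^ (-1 - n)) *
        (vterm φ τ w m p q n * vterm ψ τ w' m' p' q' (-1 - n))).Finite := by
    intro p
    refine (Set.Finite.biUnion (Finset.range P).finite_toSet fun p' _ => h3 p p').subset ?_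
    intro n hn
    obtain ⟨p', hp', hn⟩ := Finset.exists_ne_zero_of_sum_ne_zero hn
    exact Set.mem_biUnion hp' hn
  rw [h1, finsum_congr h2, finsum_sum_comm' _ _ fun p _ => h3'' p]
  have h4 : ∀ p ∈ Finset.range P, ∑ q ∈ Finset.range Q,
        ∑ x ∈ Finset.HasAntidiagonal.antidiagonal p, ∑ y ∈ Finset.HasAntidiagonal.antidiagonal q,
        S x.1 x.2 y.1 y.2 = ∑ x ∈ Finset.HasAntidiagonal.antidiagonal p,
        ∑ q ∈ Finset.range Q, ∑ q' ∈ Finset.range Q, S x.1 x.2 q q' := by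
    intro p hp
    rw [Finset.mem_range] at hp
    rw [Finset.sum_comm]
    refine Finset.sum_congr rfl fun x hx => ?_
    rw [Finset.HasAntidiagonal.mem_antidiagonal] at hx
    exact sum_range_antidiagonal Q (fun q q' => S x.1 x.2 q q') fun q q' h =>
      hS2 _ _ _ _ (by omega) (by omega) h
  rw [Finset.sum_congr rfl h4, sum_range_antidiagonal P (fun p p' => ∑ q ∈ Finset.range Q,
    ∑ q' ∈ Finset.range Q, S p p' q q') fun p p' h =>
      Finset.sum_eq_zero fun q _ => Finset.sum_eq_zero fun q' _ => hS1 _ _ _ _ h]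
  refine Finset.sum_congr rfl fun p _ => ?_
  rw [finsum_sum_comm' _ _ fun p' _ => h3 p p']
  refine Finset.sum_congr rfl fun p' _ => ?_
  rw [finsum_sum_comm' _ _ fun q _ => h3' p p' q]
  refine Finset.sum_congr rfl fun q _ => ?_
  rw [finsum_sum_comm' _ _ fun q' _ => hsup p p' q q']

end MCKP
end

noncomputable section
namespace MCKP

variable {s r : ℕ}

/-! ## The Hirota equations -/

lemma pairing_eq_sum {ι : Type*} [Fintype ι] (c : ι → ℤ → ℂ) {a b : ι → ℤ → ℂ}
    (ha : a ∈ highSeq ι) (hb : b ∈ highSeq ι) :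
    pairing c a b = ∑ i, ∑ᶠ n : ℤ, c i n * (a i n * b i (-1 - n)) := by
  obtain ⟨N, hN⟩ := ha
  obtain ⟨N', hN'⟩ := hb
  refine finsum_sum_comm' _ _ fun i _ => (Set.finite_Icc (-1 - N') N).subset fun n hn => ?_
  by_contra h
  refine hn ?_
  rw [Set.mem_Icc, not_and_or, not_le, not_le] at h
  rcases h with h | h
  · simp only
    rw [hN' i _ (by omega), mul_zero, mul_zero]
  · simp only
    rw [hN i _ h, zero_mul, mul_zero]

lemma finsum_bracket (φ ψ : Fld s r) (τ : BFock s r) (w w' : Finset (Xi s r)) (f : ℤ → ℂ)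
    (g d : ℤ) (hd : d = chg φ w + chg ψ w') (hf : ∀ h, f (h - chg φ w) = f h) :
    ∑ᶠ h : ℤ, f h • (inT (bracket φ τ w h) * inTbar (bracket ψ τ w' (g - d - h))) =
      ∑ᶠ h : ℤ, f h • (inT (Xm φ h τ w) * inTbar (Xm ψ (g - h) τ w')) := by
  have hb : Function.Bijective fun h : ℤ => h - chg φ w :=
    ⟨fun a b h => by simpa using h, fun b => ⟨b + chg φ w, by ring⟩⟩
  rw [← finsum_comp _ hb]
  refine finsum_congr fun h => ?_
  rw [hf, bracket_eq, bracket_eq, Xm_apply, Xm_apply,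
    show g - d - (h - chg φ w) = g - h - chg ψ w' by omega]

lemma hirotaPlus_eq (τ : BFock s r) (w w' : Finset (Xi s r)) (a : Fin s) :
    hirotaPlus τ w w' a = resid (expT2 1 1 (Sum.inl (a, true)) (Sum.inl (a, false)))
      (expD2 1 1 (Sum.inl (a, true)) (Sum.inl (a, false)))
      (grass2 1 1 (Sum.inl (a, true)) (Sum.inl (a, false)) τ w w') := by
  unfold hirotaPlus
  congr 1
  · unfold expT2
    congr 2
    ext1 k
    simp [texp, tdiff, Fld.sgn, sg, Fld.cmp, sub_eq_add_neg]
  · unfold expD2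
    congr 2
    ext1 k
    simp only [dexp, ddiff, Fld.sgn, sg, Fld.cmp, dfac, PowerSeries.coeff_mk, smul_sub, smul_smul]
    simp only [if_true, Bool.false_eq_true, if_false]
    rw [sub_eq_add_neg, ← neg_smul]
    congr 2 <;> ring
  · ext1 g
    have h := finsum_bracket (Sum.inl (a, true)) (Sum.inl (a, false)) τ w w' (fun _ => 1) g
      (zexp a w w') (by simp [zexp, chg]; ring) (fun _ => rfl)
    simp only [one_smul] at h
    rw [h, grass2]
    simp

lemma hirotaMinus_eq (τ : BFock s r) (w w' : Finset (Xi s r)) (a : Fin s) :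
    hirotaMinus τ w w' a = resid (expT2 (-1) (-1) (Sum.inl (a, false)) (Sum.inl (a, true)))
      (expD2 (-1) (-1) (Sum.inl (a, false)) (Sum.inl (a, true)))
      (grass2 (-1) (-1) (Sum.inl (a, false)) (Sum.inl (a, true)) τ w w') := by
  unfold hirotaMinus
  congr 1
  · unfold expT2
    congr 2
    ext1 k
    simp [texp, tdiff, Fld.sgn, sg, Fld.cmp, sub_eq_add_neg]
  · unfold expD2
    congr 2
    ext1 k
    simp only [dexp, ddiff, Fld.sgn, sg, Fld.cmp, dfac, PowerSeries.coeff_mk, smul_sub, smul_smul]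
    simp only [if_true, Bool.false_eq_true, if_false]
    rw [sub_eq_add_neg, ← neg_smul]
    congr 2 <;> ring
  · ext1 g
    have h := finsum_bracket (Sum.inl (a, false)) (Sum.inl (a, true)) τ w w' (fun _ => 1) g
      (-zexp a w w') (by simp [zexp, chg]; ring) (fun _ => rfl)
    simp only [one_smul, sub_neg_eq_add] at h
    rw [h, grass2, smul_finsum]
    refine finsum_congr fun h => ?_
    rw [← zpow_add₀ (by norm_num), add_sub_cancel]

lemma hirotaNeutral_eq (τ : BFock s r) (w w' : Finset (Xi s r)) (c : Fin r) :
    hirotaNeutral τ w w' c = resid (expT2 1 (-1) (Sum.inr c) (Sum.inr c))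
      (expD2 1 (-1) (Sum.inr c) (Sum.inr c))
      (grass2 1 (-1) (Sum.inr c) (Sum.inr c) τ w w') := by
  have h0 : ∀ k : ℕ, (-1 : ℂ) ^ k = -1 ∨ timeIdx (Sum.inr c : Cmp s r) k = none := by
    intro k
    rcases Nat.even_or_odd k with hk | hk
    · right
      rw [timeIdx, if_neg (by rw [Nat.even_iff.1 hk]; norm_num)]
    · left
      exact hk.neg_one_pow
  unfold hirotaNeutral
  congr 1
  · unfold expT2
    congr 2
    ext1 k
    simp only [texp, tdiff, Fld.sgn, Fld.cmp, PowerSeries.coeff_mk, one_smul, one_pow]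
    rcases h0 k with h | h
    · rw [h]; simp [sub_eq_add_neg]
    · simp [tvar_of_none _ h]
  · unfold expD2
    congr 2
    ext1 k
    simp only [dexp, ddiff, Fld.sgn, Fld.cmp, PowerSeries.coeff_mk, one_smul, one_pow, one_mul, dfac]
    rcases h0 k with h | h
    · rw [h, smul_sub, sub_eq_add_neg, smul_smul, neg_one_mul, neg_smul]
    · simp [dvar_of_none _ h]
  · ext1 g
    rw [grass2]
    refine finsum_congr fun h => ?_
    rw [bracket_eq, bracket_eq, Xm_apply, Xm_apply, inTbar_smul]
    simp [chg]

lemma coeff_hirota (τ : BFock s r) (w w' : Finset (Xi s r)) (M : (Time s r ⊕ Time s r) →₀ ℕ) :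
    MvPowerSeries.coeff M (∑ a : Fin s, (hirotaPlus τ w w' a + hirotaMinus τ w w' a) +
      ∑ c : Fin r, hirotaNeutral τ w w' c) =
    pairing ckpSign (fldSeq (fun φ j => bB φ j τ) (crd w (expL M)))
      (conjSeq (fun φ j => bB φ j τ) (crd w' (expR M))) := by
  rw [pairing_eq_sum ckpSign (fldSeq_crd_high τ w _) (conjSeq_high (fldSeq_crd_high τ w' _)),
    Fintype.sum_sum_type, Fintype.sum_prod_type, map_add, map_sum, map_sum]
  congr 1
  · refine Finset.sum_congr rfl fun a _ => ?_
    rw [map_add, hirotaPlus_eq, hirotaMinus_eq, coeff_resid (by norm_num) (by norm_num),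
      coeff_resid (by norm_num) (by norm_num), Fintype.sum_bool]
    congr 1
    · refine finsum_congr fun n => ?_
      simp only [fldSeq, conjSeq, ckpSign, Fld.conj, sg]
      rw [show -(-1 - n) - 1 = n by ring]
      simp
    · refine finsum_congr fun n => ?_
      simp only [fldSeq, conjSeq, ckpSign, Fld.conj, sg]
      rw [show -(-1 - n) - 1 = n by ring, ← zpow_add₀ (by norm_num), add_sub_cancel]
      simp
  · refine Finset.sum_congr rfl fun c _ => ?_
    rw [hirotaNeutral_eq, coeff_resid (by norm_num) (by norm_num)]
    refine finsum_congr fun n => ?_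
    simp only [fldSeq, conjSeq, ckpSign, Fld.conj]
    rw [show -(-1 - n) - 1 = n by ring, one_zpow, one_mul, show -1 - n = -(n + 1) by ring, zpow_neg,
      ← inv_zpow, inv_neg_one]

/-- The even part of the bosonic Fock space. -/
def IsEvenB (τ : BFock s r) : Prop := ∀ w : Finset (Xi s r), Odd w.card → τ w = 0

lemma IsEvenB.crd_bB {τ : BFock s r} (hτ : IsEvenB τ) (φ : Fld s r) (j : ℤ)
    {w : Finset (Xi s r)} (hw : ¬Odd w.card) (m : Time s r →₀ ℕ) : crd w m (bB φ j τ) = 0 := by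
  by_contra h
  obtain ⟨k, m', -, -, -, h1, -⟩ := bB_ne_zero h
  refine h1 ?_
  rw [hτ _ ((odd_card_tog w _).2 (Nat.not_odd_iff_even.1 hw)), map_zero]

lemma bosonicCKP_iff_hirotaCKP {τ : BFock s r} (hτ : IsEvenB τ) :
    BosonicCKP τ ↔ HirotaCKP τ := by
  constructor
  · intro h w w' _ _
    ext M
    rw [coeff_hirota, h, map_zero]
  · intro h w m w' m'
    by_cases hw : Odd w.card
    · by_cases hw' : Odd w'.card
      · have := congrArg (MvPowerSeries.coeff (expLR m m')) (h w w' hw hw')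
        rwa [coeff_hirota, expL_expLR, expR_expLR, map_zero] at this
      · have : conjSeq (fun φ j => bB φ j τ) (crd w' m') = 0 := by
          ext φ n; exact hτ.crd_bB _ _ hw' _
        rw [this, pairing_zero_right]
    · have : fldSeq (fun φ j => bB φ j τ) (crd w m) = 0 := by
        ext φ n; exact hτ.crd_bB _ _ hw _
      rw [this, pairing_zero_left]

end MCKP
end

noncomputable section
namespace MCKP

variable {s r : ℕ}

/-! ## The constant term of a solution -/

/-- The linear form `∑ d_v X_v`. -/
def linSer {V : Type*} (d : V → ℂ) : MvPowerSeries V ℂ :=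
  fun ν => if ν.degree = 1 then ∑ v ∈ ν.support, d v else 0

lemma coeff_linSer_single {V : Type*} (d : V → ℂ) (v : V) :
    MvPowerSeries.coeff (Finsupp.single v 1) (linSer d) = d v := by
  change (if (Finsupp.single v 1).degree = 1 then ∑ v ∈ (Finsupp.single v 1).support, d v else 0) = _
  rw [if_pos (by rw [Finsupp.degree_single]), Finsupp.support_single v one_ne_zero,
    Finset.sum_singleton]

lemma coeff_linSer_ne_zero {V : Type*} {d : V → ℂ} {ν : V →₀ ℕ}
    (h : MvPowerSeries.coeff ν (linSer d) ≠ 0) : ∃ v, ν = Finsupp.single v 1 := by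
  have h1 : (if ν.degree = 1 then ∑ v ∈ ν.support, d v else 0) ≠ 0 := h
  rw [ite_ne_right_iff] at h1
  have h2 : ν ∈ Set.range fun v : V => Finsupp.single v 1 := by
    rw [Finsupp.range_single_one]
    exact h1.1
  obtain ⟨v, hv⟩ := h2
  exact ⟨v, hv.symm⟩

lemma coeff_linSer_mul {V : Type*} (d : V → ℂ) (f : MvPowerSeries V ℂ) (μ : V →₀ ℕ)
    (S : Finset V) (hS : μ.support ⊆ S) :
    MvPowerSeries.coeff μ (linSer d * f) =
      ∑ v ∈ S, d v * MvPowerSeries.coeff μ (MvPowerSeries.X v * f) := by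
  classical
  have h1 : ∑ v ∈ S, d v * MvPowerSeries.coeff μ (MvPowerSeries.X v * f) =
      MvPowerSeries.coeff μ ((∑ v ∈ S, d v • MvPowerSeries.X v) * f) := by
    rw [Finset.sum_mul, map_sum]
    refine Finset.sum_congr rfl fun v _ => ?_
    rw [smul_mul_assoc, map_smul, smul_eq_mul]
  rw [h1, MvPowerSeries.coeff_mul, MvPowerSeries.coeff_mul]
  refine Finset.sum_congr rfl fun p hp => ?_
  congr 1
  rw [map_sum]
  simp only [map_smul, MvPowerSeries.coeff_X, smul_eq_mul]
  by_cases h : ∃ v, p.1 = Finsupp.single v 1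
  · obtain ⟨v, hv⟩ := h
    rw [hv, coeff_linSer_single, Finset.sum_eq_single v]
    · simp
    · intro v' _ hv'
      rw [if_neg, mul_zero]
      intro h
      exact hv' (Finsupp.single_left_injective one_ne_zero h).symm
    · intro hvS
      refine absurd (hS ?_) hvS
      rw [Finset.HasAntidiagonal.mem_antidiagonal, hv] at hp
      rw [Finsupp.mem_support_iff, ← hp, Finsupp.add_apply, Finsupp.single_eq_same]
      omega
  · have h2 : MvPowerSeries.coeff p.1 (linSer d) = 0 := by
      by_contra h0; exact h (coeff_linSer_ne_zero h0)
    rw [h2, Finset.sum_eq_zero]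
    intro v _
    rw [if_neg (fun h0 => h ⟨v, h0⟩), mul_zero]

lemma coeff_X_mul_eq_zero {V : Type*} {f : MvPowerSeries V ℂ} {v : V} {μ : V →₀ ℕ}
    (h : (μ.degree : ℕ∞) < f.order) : MvPowerSeries.coeff μ (MvPowerSeries.X v * f) = 0 :=
  MvPowerSeries.coeff_of_lt_order (lt_of_lt_of_le h
    (le_trans le_add_self (MvPowerSeries.le_order_mul)))

lemma constantCoeff_ne_zero {f : FFock s r} (hf : f ≠ 0) (h : FermionicCKP f) :
    MvPowerSeries.constantCoeff f ≠ 0 := by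
  classical
  intro h0
  obtain ⟨ρ, hρ, hd⟩ := MvPowerSeries.exists_coeff_ne_zero_and_order
    (MvPowerSeries.ne_zero_iff_order_finite.1 hf)
  have hρ0 : ρ ≠ 0 := by
    rintro rfl
    exact hρ (by rw [MvPowerSeries.coeff_zero_eq_constantCoeff]; exact h0)
  obtain ⟨v₀, hv₀⟩ := Finsupp.ne_iff.1 hρ0
  rw [Finsupp.zero_apply] at hv₀
  obtain ⟨μ, rfl⟩ : ∃ μ, ρ = μ + Finsupp.single v₀ 1 :=
    ⟨ρ - Finsupp.single v₀ 1, (tsub_add_cancel_of_le (Finsupp.single_le_iff.2 (by omega))).symm⟩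
  rw [map_add, Finsupp.degree_single] at hd
  let d : Fld s r × ℕ → ℂ := fun v => ckpSign v.1.conj (-v.2 - 1) * (v.1.conj.comm v.2 *
    MvPowerSeries.coeff μ (MvPowerSeries.pderiv ℂ v f))
  have hsg : ∀ (φ : Fld s r) n, ckpSign φ n ≠ 0 := by
    rintro (⟨a, δ⟩ | c) n
    · cases δ <;> simp [ckpSign, sg]
    · exact zpow_ne_zero _ (by norm_num)
  have hg : linSer d ≠ 0 := by
    intro hg
    have := coeff_linSer_single d v₀
    rw [hg, map_zero] at this
    have h1 : d v₀ ≠ 0 := by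
      refine mul_ne_zero (hsg _ _) (mul_ne_zero (Fld.comm_ne_zero _ _) ?_)
      rw [MvPowerSeries.coeff_pderiv]
      exact mul_ne_zero hρ (by norm_cast)
    exact h1 this.symm
  have hgf : linSer d * f ≠ 0 := mul_ne_zero hg hf
  obtain ⟨μ', hμ', hd'⟩ := MvPowerSeries.exists_coeff_ne_zero_and_order
    (MvPowerSeries.ne_zero_iff_order_finite.1 hgf)
  refine hμ' ?_
  obtain ⟨K, hK⟩ : ∃ K : ℕ, ∀ v ∈ μ'.support, v.2 < K := by
    refine ⟨μ'.support.sup (fun v => v.2 + 1), fun v hv => ?_⟩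
    exact Finset.le_sup (f := fun v : Fld s r × ℕ => v.2 + 1) hv
  rw [coeff_linSer_mul d f μ' (Finset.univ ×ˢ Finset.range K)
    fun v hv => Finset.mem_product.2 ⟨Finset.mem_univ _, Finset.mem_range.2 (hK v hv)⟩,
    Finset.sum_product_right]
  have h2 := (fermionicCKP_iff f).1 h μ μ'
  rw [← h2, pairing, finsum_eq_sum_of_support_subset
    (s := (Finset.range K).image fun k : ℕ => -(k : ℤ) - 1)]
  · rw [Finset.sum_image (by intro a _ b _ hab; simpa using hab)]
    refine Finset.sum_congr rfl fun k _ => ?_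
    rw [← (Function.Involutive.bijective (f := Fld.conj (s := s) (r := r))
      Fld.conj_conj).sum_comp]
    refine Finset.sum_congr rfl fun φ _ => ?_
    simp only [d, fldSeq, conjSeq, Fld.conj_conj]
    rw [show -(-(k : ℤ) - 1) - 1 = Int.ofNat k by simp,
      show -(-1 - (-(k : ℤ) - 1)) - 1 = Int.negSucc k by rw [Int.negSucc_eq]; ring]
    simp only [bF, map_smul, smul_eq_mul]
    ring
  · intro n hn
    by_contra hn'
    refine hn (Finset.sum_eq_zero fun φ _ => ?_)
    rcases lt_or_ge n 0 with h3 | h3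
    · obtain ⟨k, rfl⟩ : ∃ k : ℕ, n = -(k : ℤ) - 1 := ⟨(-n - 1).toNat, by omega⟩
      have hk : K ≤ k := by
        by_contra hk
        exact hn' (Finset.mem_coe.2 (Finset.mem_image.2 ⟨k, Finset.mem_range.2 (by omega), rfl⟩))
      simp only [conjSeq]
      rw [show -(-1 - (-(k : ℤ) - 1)) - 1 = Int.negSucc k by rw [Int.negSucc_eq]; ring]
      simp only [bF, MvPowerSeries.X, MvPowerSeries.coeff_monomial_mul]
      rw [if_neg, mul_zero, mul_zero]
      intro hle
      have h4 : (φ.conj, k) ∈ μ'.support := by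
        rw [Finsupp.mem_support_iff]
        have := Finsupp.single_le_iff.1 hle
        omega
      have := hK _ h4
      simp only at this
      omega
    · obtain ⟨k, rfl⟩ := Int.eq_ofNat_of_zero_le h3
      simp only [fldSeq]
      rw [show -(k : ℤ) - 1 = Int.negSucc k by rw [Int.negSucc_eq]; ring]
      simp only [bF]
      rw [coeff_X_mul_eq_zero, zero_mul, mul_zero]
      rw [← hd]
      exact_mod_cast Nat.lt_succ_self _

lemma constantCoeff_bos (f : FFock s r) :
    MvPowerSeries.constantCoeff (bos s r f ∅) = MvPowerSeries.constantCoeff f := by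
  have h0 : en (∅ : Finset (Xi s r)) (0 : Time s r →₀ ℕ) = 0 := by
    simp [en, egr, chgT, chg, iNum, jNum, wt]
  have h1 := crd_fockMap_energyPart 0 f (∅ : Finset (Xi s r)) 0
  rw [if_pos h0, crd_empty_fockMap, ← bos_apply] at h1
  have h2 := coeff_energyPart 0 f 0
  rw [if_pos (by simp [enF])] at h2
  rw [← MvPowerSeries.coeff_zero_eq_constantCoeff_apply,
    ← MvPowerSeries.coeff_zero_eq_constantCoeff_apply (φ := f), ← h2]
  exact h1.symm

end MCKP
end

noncomputable section
namespace MCKP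

variable {s r : ℕ}

/-! ## The entries of the wave matrices as modes of vertex operators -/

/-- The Grassmann monomial that belongs to a row of the wave matrix. -/
def rowW (ε : Bool) : Idx s r → Finset (Xi s r)
  | Sum.inl a => {xi a ε 0}
  | Sum.inr (Sum.inl a) => {xi a (!ε) 0}
  | Sum.inr (Sum.inr c) => {Sum.inr (c, 0)}

/-- The normalization of a row of the wave matrix. -/
def rowC (ε : Bool) : Idx s r → ℂ
  | Sum.inl _ => -sg ε
  | Sum.inr (Sum.inl _) => sg ε
  | Sum.inr (Sum.inr _) => 1

/-- The field that belongs to a column of the wave matrix. -/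
def colF (ε : Bool) : Idx s r → Fld s r
  | Sum.inl a => Sum.inl (a, ε)
  | Sum.inr (Sum.inl a) => Sum.inl (a, !ε)
  | Sum.inr (Sum.inr c) => Sum.inr c

/-- The factor of the spectral parameter in a column of the wave matrix. -/
def colS (s r : ℕ) (ε : Bool) : Idx s r → ℂ
  | Sum.inl _ => 1
  | Sum.inr (Sum.inl _) => -1
  | Sum.inr (Sum.inr _) => sg ε

lemma sg_not' (ε : Bool) : sg (!ε) = -sg ε := by cases ε <;> simp [sg]

lemma colS_mul_self (ε : Bool) (k : Idx s r) : colS s r ε k * colS s r ε k = 1 := by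
  rcases k with b | b | c
  · simp [colS]
  · simp [colS]
  · simp [colS, sg_mul_self]

lemma chg_inr (c : Fin r) (w : Finset (Xi s r)) : chg (Sum.inr c : Fld s r) w = 0 := rfl

lemma chg_inl_inr (a : Fin s) (δ : Bool) (x : Fin r × ℕ) :
    chg (Sum.inl (a, δ) : Fld s r) {Sum.inr x} = 0 := by
  classical
  have h : ∀ y : Fin r × ℕ, Xi.cmp (Sum.inr y : Xi s r) ≠ Sum.inl a := by rintro ⟨c, n⟩; simp [Xi.cmp]
  simp [chg, iNum, jNum, Finset.filter_singleton, h]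

lemma chg_inl_xi_of_ne {a b : Fin s} (h : a ≠ b) (δ δ' : Bool) (n : ℕ) :
    chg (Sum.inl (b, δ) : Fld s r) {xi a δ' n} = 0 := by
  classical
  simp [chg, iNum, jNum, Finset.filter_singleton, h]

lemma chg_inl_xi (a : Fin s) (δ : Bool) (n : ℕ) :
    chg (Sum.inl (a, δ) : Fld s r) {xi a δ n} = -1 := by
  classical
  have h : (0 : ℤ) < n + 1 := by omega
  have h1 : (-1 : ℤ) < n := by omega
  have h2 : ¬(n : ℤ) < -1 := by omega
  cases δ <;> simp [chg, iNum, jNum, Finset.filter_singleton, xi_pos, h, h.le, h1, h2]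

lemma chg_inl_xi_not (a : Fin s) (δ : Bool) (n : ℕ) :
    chg (Sum.inl (a, !δ) : Fld s r) {xi a δ n} = 1 := by
  classical
  have h : (0 : ℤ) < n + 1 := by omega
  have h1 : (-1 : ℤ) < n := by omega
  have h2 : ¬(n : ℤ) < -1 := by omega
  cases δ <;> simp [chg, iNum, jNum, Finset.filter_singleton, xi_pos, h, h.le, h1, h2]

lemma Nsign_of_ne {ξ η : Xi s r} (h : ξ.cmp ≠ η.cmp) : Nsign {ξ} η = 1 := by
  classical
  simp [Nsign, Finset.filter_singleton, h]

lemma Nsign_of_le {ξ η : Xi s r} (h : η.pos ≤ ξ.pos) : Nsign {ξ} η = 1 := by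
  classical
  simp [Nsign, Finset.filter_singleton, h.not_gt]

lemma Nsign_of_lt {ξ η : Xi s r} (h : ξ.cmp = η.cmp) (h' : ξ.pos < η.pos) : Nsign {ξ} η = -1 := by
  classical
  simp [Nsign, Finset.filter_singleton, h, h']

lemma Xm_eq (φ : Fld s r) (g k : ℤ) (τ : BFock s r) (w : Finset (Xi s r)) (h : g - chg φ w = k) :
    Xm φ g τ w = bracket φ τ w k := by
  rw [Xm_apply, bracket_eq, h]

lemma bracket_inl_negSucc (a : Fin s) (δ : Bool) (n : ℕ) (τ : BFock s r) (ξ : Xi s r)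
    (h : xi a (!δ) n ≠ ξ) : bracket (Sum.inl (a, δ)) τ {ξ} (Int.negSucc n) =
      Nsign {ξ} (xi a (!δ) n) • tau2 τ (xi a (!δ) n) ξ := by
  classical
  simp only [bracket, tau2]
  rw [if_neg (by simpa using h)]

lemma bracket_inr_negSucc (c : Fin r) (n : ℕ) (τ : BFock s r) (ξ : Xi s r)
    (h : Sum.inr (c, n) ≠ ξ) : bracket (Sum.inr c) τ {ξ} (Int.negSucc n) =
      Nsign {ξ} (Sum.inr (c, n)) • tau2 τ (Sum.inr (c, n)) ξ := by
  classical
  simp only [bracket, tau2]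
  rw [if_neg (by simpa using h)]

lemma tau2_comm (τ : BFock s r) (ξ η : Xi s r) : tau2 τ ξ η = tau2 τ η ξ := by
  classical
  simp only [tau2]
  rw [Finset.pair_comm]

section rows

variable (τ : BFock s r) (ε : Bool)

lemma neg_cast_sub (n : ℕ) : -((n + 1 : ℕ) : ℤ) - 0 = Int.negSucc n := by
  rw [Int.negSucc_eq]; push_cast; ring

lemma Xm_row_inl_inl (a : Fin s) (n : ℕ) :
    (-sg ε) • Xm (Sum.inl (a, ε)) (-(n : ℤ)) τ {xi a ε 0} =
      match n with
      | 0 => τ ∅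
      | 1 => 0
      | n + 2 => -tau2 τ (xi a (!ε) n) (xi a ε 0) := by
  classical
  rcases n with _ | _ | n
  · rw [Xm_eq _ _ (Int.ofNat (0 + 1)) _ _ (by rw [chg_inl_xi]; simp)]
    simp only [bracket]
    rw [if_pos (by simp), Nsign_of_le le_rfl]
    simp only [Nat.cast_zero, zero_add, mul_one]
    rw [← neg_smul, smul_smul, neg_mul_neg, sg_mul_self, one_smul]
    congr 1
    ext; simp
  · rw [Xm_eq _ _ (Int.ofNat 0) _ _ (by rw [chg_inl_xi]; simp)]
    simp [bracket]
  · rw [Xm_eq _ _ (Int.negSucc n) _ _ (by rw [chg_inl_xi, Int.negSucc_eq]; push_cast; ring),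
      bracket_inl_negSucc _ _ _ _ _ (by rw [Ne, xi_inj]; simp), smul_smul]
    have : Nsign {xi a ε 0} (xi a (!ε) n : Xi s r) = sg ε := by
      cases ε
      · exact Nsign_of_lt rfl (by simp only [xi_pos]; push_cast; simp)
      · exact Nsign_of_le (by simp [xi_pos]; omega)
    rw [this, neg_mul, sg_mul_self, neg_one_smul]

lemma Xm_row_inl_inl_of_ne {a b : Fin s} (h : a ≠ b) (n : ℕ) :
    (-sg ε) • Xm (Sum.inl (b, ε)) (-(n : ℤ)) τ {xi a ε 0} =
      match n with
      | 0 => 0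
      | n + 1 => -(sg ε • tau2 τ (xi b (!ε) n) (xi a ε 0)) := by
  rcases n with _ | n
  · rw [Xm_eq _ _ (Int.ofNat 0) _ _ (by rw [chg_inl_xi_of_ne h]; simp)]
    simp [bracket]
  · rw [Xm_eq _ _ (Int.negSucc n) _ _ (by rw [chg_inl_xi_of_ne h, neg_cast_sub]),
      bracket_inl_negSucc _ _ _ _ _ (by rw [Ne, xi_inj]; simp),
      Nsign_of_ne (by simpa using h), one_smul, neg_smul]

lemma Xm_row_inl_swap (a : Fin s) (n : ℕ) :
    (-sg ε) • Xm (Sum.inl (a, !ε)) (-(n : ℤ)) τ {xi a ε 0} =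
      match n with
      | 0 => 0
      | n + 1 => tau2 τ (xi a ε (n + 1)) (xi a ε 0) := by
  classical
  rcases n with _ | n
  · rw [Xm_eq _ _ (Int.negSucc 0) _ _ (by rw [chg_inl_xi_not]; rfl)]
    simp [bracket]
  · rw [Xm_eq _ _ (Int.negSucc (n + 1)) _ _
        (by rw [chg_inl_xi_not, Int.negSucc_eq]; push_cast; ring),
      bracket_inl_negSucc _ _ _ _ _ (by rw [Ne, xi_inj]; simp), smul_smul, Bool.not_not]
    have : Nsign {xi a ε 0} (xi a ε (n + 1) : Xi s r) = -sg ε := by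
      cases ε
      · rw [Nsign_of_le (by simp [xi_pos])]; simp [sg]
      · rw [Nsign_of_lt (by rfl) (by simp only [xi_pos]; push_cast; simp)]; simp [sg]
    rw [this, neg_mul_neg, sg_mul_self, one_smul]

lemma Xm_row_inl_swap_of_ne {a b : Fin s} (h : a ≠ b) (n : ℕ) :
    (-sg ε) • Xm (Sum.inl (b, !ε)) (-(n : ℤ)) τ {xi a ε 0} =
      match n with
      | 0 => 0
      | n + 1 => -(sg ε • tau2 τ (xi b ε n) (xi a ε 0)) := by
  rcases n with _ | n
  · rw [Xm_eq _ _ (Int.ofNat 0) _ _ (by rw [chg_inl_xi_of_ne h]; simp)]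
    simp [bracket]
  · rw [Xm_eq _ _ (Int.negSucc n) _ _ (by rw [chg_inl_xi_of_ne h, neg_cast_sub]),
      bracket_inl_negSucc _ _ _ _ _ (by rw [Ne, xi_inj]; simp [h.symm]),
      Nsign_of_ne (by simpa using h), one_smul, neg_smul, Bool.not_not]

lemma Xm_row_inl_inr (a : Fin s) (c : Fin r) (n : ℕ) :
    (-sg ε) • Xm (Sum.inr c) (-(n : ℤ)) τ {xi a ε 0} =
      match n with
      | 0 => 0
      | n + 1 => -(sg ε • tau2 τ (xi a ε 0) (Sum.inr (c, n))) := by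
  rcases n with _ | n
  · rw [Xm_eq _ _ (Int.ofNat 0) _ _ (by rw [chg_inr]; simp)]
    simp [bracket, xi]
  · rw [Xm_eq _ _ (Int.negSucc n) _ _ (by rw [chg_inr, neg_cast_sub]),
      bracket_inr_negSucc _ _ _ _ (by simp [xi]),
      Nsign_of_ne (by simp [Xi.cmp, xi]), one_smul, neg_smul, tau2_comm]

lemma Xm_row_inr_inl (c : Fin r) (a : Fin s) (n : ℕ) :
    Xm (Sum.inl (a, ε)) (-(n : ℤ)) τ {Sum.inr (c, 0)} =
      match n with
      | 0 => 0
      | n + 1 => tau2 τ (xi a (!ε) n) (Sum.inr (c, 0)) := by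
  rcases n with _ | n
  · rw [Xm_eq _ _ (Int.ofNat 0) _ _ (by rw [chg_inl_inr]; simp)]
    simp [bracket]
  · rw [Xm_eq _ _ (Int.negSucc n) _ _ (by rw [chg_inl_inr, neg_cast_sub]),
      bracket_inl_negSucc _ _ _ _ _ (by simp [xi]),
      Nsign_of_ne (by simp [Xi.cmp, xi]), one_smul]

lemma Xm_row_inr_inr (c : Fin r) (n : ℕ) :
    Xm (Sum.inr c) (-(n : ℤ)) τ {Sum.inr (c, 0)} =
      match n with
      | 0 => τ ∅
      | 1 => 0
      | n + 2 => -tau2 τ (Sum.inr (c, 0)) (Sum.inr (c, n + 1)) := by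
  classical
  rcases n with _ | _ | n
  · rw [Xm_eq _ _ (Int.ofNat 0) _ _ (by rw [chg_inr]; simp)]
    simp only [bracket]
    rw [if_pos (by simp), Nsign_of_le le_rfl]
    simp only [zero_add, pow_one, Nat.cast_zero, mul_zero, mul_one, neg_smul, one_smul, neg_neg]
    congr 1
    ext; simp
  · rw [Xm_eq _ _ (Int.negSucc 0) _ _ (by rw [chg_inr]; rfl)]
    simp [bracket]
  · rw [Xm_eq _ _ (Int.negSucc (n + 1)) _ _
        (by rw [chg_inr, Int.negSucc_eq]; push_cast; ring),
      bracket_inr_negSucc _ _ _ _ (by simp), Nsign_of_lt (by rfl) (by simp only [Xi.pos]; push_cast; omega),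
      neg_one_smul, tau2_comm]

lemma Xm_row_inr_inr_of_ne {c d : Fin r} (h : c ≠ d) (n : ℕ) :
    Xm (Sum.inr d) (-(n : ℤ)) τ {Sum.inr (c, 0)} =
      match n with
      | 0 => 0
      | n + 1 => tau2 τ (Sum.inr (c, 0)) (Sum.inr (d, n)) := by
  rcases n with _ | n
  · rw [Xm_eq _ _ (Int.ofNat 0) _ _ (by rw [chg_inr]; simp)]
    simp [bracket, h.symm]
  · rw [Xm_eq _ _ (Int.negSucc n) _ _ (by rw [chg_inr, neg_cast_sub]),
      bracket_inr_negSucc _ _ _ _ (by simp [h.symm]),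
      Nsign_of_ne (by simpa [Xi.cmp] using h), one_smul, tau2_comm]

end rows

/-- `∑_q D_q X_{q-N}`, the coefficient of `z^{-N}` in a vertex operator without its multiplication
part. -/
def vsum (φ : Fld s r) (τ : BFock s r) (w : Finset (Xi s r)) (N : ℕ) : TSer s r :=
  ∑ p ∈ Finset.HasAntidiagonal.antidiagonal N, Dc φ p.1 (Xm φ (-(p.2 : ℤ)) τ w)

lemma coeff_applyOp {φ : Fld s r} {τ : BFock s r} {w : Finset (Xi s r)} {c σ : ℂ}
    {Y : PowerSeries (Module.End ℂ (TSer s r))} {f : PowerSeries (TSer s r)}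
    (hY : ∀ q, PowerSeries.coeff q Y = σ ^ q • Dc φ q)
    (hf : ∀ n : ℕ, PowerSeries.coeff n f = (c * σ ^ n) • Xm φ (-(n : ℤ)) τ w) (N : ℕ) :
    PowerSeries.coeff N (applyOp Y f) = (c * σ ^ N) • vsum φ τ w N := by
  rw [applyOp, PowerSeries.coeff_mk, vsum, Finset.smul_sum]
  refine Finset.sum_congr rfl fun p hp => ?_
  rw [Finset.HasAntidiagonal.mem_antidiagonal] at hp
  rw [hY, hf, LinearMap.smul_apply, map_smul, smul_smul, ← hp, pow_add]
  congr 1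
  ring

lemma coeff_eUp (ε : Bool) (a : Fin s) (q : ℕ) :
    PowerSeries.coeff q (eUp ε a : PowerSeries (Module.End ℂ (TSer s r))) =
      (1 : ℂ) ^ q • Dc (Sum.inl (a, ε)) q := by
  rw [one_pow, one_smul, Dc, eUp, expD]
  simp only [Fld.sgn, Fld.cmp, dfac, mul_one_div]

lemma coeff_eDown (ε : Bool) (a : Fin s) (q : ℕ) :
    PowerSeries.coeff q (eDown ε a : PowerSeries (Module.End ℂ (TSer s r))) =
      (-1 : ℂ) ^ q • Dc (Sum.inl (a, !ε)) q := by
  rw [Dc, eDown, expD, ← pexp_rescale]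
  simp only [Fld.sgn, Fld.cmp, dfac, mul_one_div, PowerSeries.coeff_mk, smul_smul, sg_not']
  congr 3
  ext1 k
  congr 1
  ring

lemma coeff_eNeut (ε : Bool) (c : Fin r) (q : ℕ) :
    PowerSeries.coeff q (eNeut ε c : PowerSeries (Module.End ℂ (TSer s r))) =
      (sg ε) ^ q • Dc (Sum.inr c) q := by
  rw [Dc, eNeut, expD, ← pexp_rescale]
  simp only [Fld.sgn, Fld.cmp, dfac, PowerSeries.coeff_mk, smul_smul]
  congr 3
  ext1 k
  rcases Nat.even_or_odd k with hk | hk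
  · rw [dvar_of_none]
    · simp
    · rw [timeIdx, if_neg (by rw [Nat.even_iff.1 hk]; norm_num)]
  · have : (sg ε) ^ k = sg ε := by
      cases ε
      · simp [sg, hk.neg_one_pow]
      · simp [sg]
    rw [this]
    congr 1
    ring

lemma coeff_numA (τ : BFock s r) (ε : Bool) (a : Fin s) (j : Idx s r) (N : ℕ) :
    PowerSeries.coeff N (numA τ ε a j) =
      (-sg ε * colS s r ε j ^ N) • vsum (colF ε j) τ {xi a ε 0} N := by
  rcases j with b | b | c
  · by_cases h : a = b
    · subst h
      simp only [numA, colF, colS, if_true]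
      refine coeff_applyOp (coeff_eUp ε a) (fun n => ?_) N
      rw [one_pow, mul_one, Xm_row_inl_inl]
      rcases n with _ | _ | n <;> exact PowerSeries.coeff_mk _ _
    · simp only [numA, colF, colS, if_neg h]
      refine coeff_applyOp (coeff_eUp ε b) (fun n => ?_) N
      rw [one_pow, mul_one, Xm_row_inl_inl_of_ne τ ε h]
      rcases n with _ | n <;> exact PowerSeries.coeff_mk _ _
  · by_cases h : a = b
    · subst h
      simp only [numA, colF, colS, if_true]
      refine coeff_applyOp (coeff_eDown ε a) (fun n => ?_) N
      rw [mul_comm, mul_smul, Xm_row_inl_swap, PowerSeries.coeff_mk]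
      rcases n with _ | n <;> simp
    · simp only [numA, colF, colS, if_neg h]
      refine coeff_applyOp (coeff_eDown ε b) (fun n => ?_) N
      rw [mul_comm, mul_smul, Xm_row_inl_swap_of_ne τ ε h, PowerSeries.coeff_mk]
      rcases n with _ | n
      · simp
      · rw [smul_neg, smul_smul, mul_comm]
  · simp only [numA, colF, colS]
    refine coeff_applyOp (coeff_eNeut ε c) (fun n => ?_) N
    rw [mul_comm, mul_smul, Xm_row_inl_inr, PowerSeries.coeff_mk]
    rcases n with _ | n
    · simp
    · rw [smul_neg, smul_smul, mul_comm]

lemma coeff_numCA (τ : BFock s r) (ε : Bool) (c : Fin r) (a : Fin s) (N : ℕ) :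
    PowerSeries.coeff N (numCA τ ε c a) = vsum (Sum.inl (a, ε)) τ {Sum.inr (c, 0)} N := by
  have := coeff_applyOp (φ := Sum.inl (a, ε)) (τ := τ) (w := {Sum.inr (c, 0)}) (c := 1) (σ := 1)
    (f := PowerSeries.mk fun
      | 0 => 0
      | n + 1 => tau2 τ (xi a (!ε) n) (Sum.inr (c, 0))) (coeff_eUp ε a)
    (fun n => by rw [one_pow, mul_one, one_smul, Xm_row_inr_inl, PowerSeries.coeff_mk]) N
  rw [one_pow, mul_one, one_smul] at this
  exact this

lemma coeff_numCC (τ : BFock s r) (ε : Bool) (c d : Fin r) (N : ℕ) :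
    PowerSeries.coeff N (numCC τ ε c d) =
      (sg ε) ^ N • vsum (Sum.inr d) τ {Sum.inr (c, 0)} N := by
  rw [← one_mul (sg ε ^ N)]
  by_cases h : c = d
  · subst h
    simp only [numCC, if_true]
    refine coeff_applyOp (coeff_eNeut ε c) (fun n => ?_) N
    rw [one_mul, Xm_row_inr_inr, PowerSeries.coeff_mk]
    rcases n with _ | _ | n <;> simp
  · simp only [numCC, if_neg h]
    refine coeff_applyOp (coeff_eNeut ε d) (fun n => ?_) N
    rw [one_mul, Xm_row_inr_inr_of_ne τ h, PowerSeries.coeff_mk]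
    rcases n with _ | n <;> simp

/-- The entries of the wave operators in terms of vertex operators. -/
lemma waveCoeff_eq (τ : BFock s r) (ε : Bool) (i k : Idx s r) (N : ℕ) :
    waveCoeff τ ε N i k = (sg ε ^ N * (rowC ε i * colS s r ε k ^ N)) •
      (vsum (colF ε k) τ (rowW ε i) N * (τ ∅)⁻¹) := by
  have hneg : ∀ x y z : ℂ, (-x) ^ N * (y * z ^ N) = x ^ N * (y * (-z) ^ N) := by
    intro x y z; rw [neg_pow, neg_pow z]; ring
  rcases i with a | a | c
  · simp only [waveCoeff, symb, rowW, rowC]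
    rw [coeff_numA, smul_mul_assoc, smul_smul]
  · simp only [waveCoeff, symb, rowW, rowC]
    rw [coeff_numA, smul_mul_assoc, smul_smul, sg_not', neg_neg, hneg]
    rcases k with b | b | d <;> simp [swapIdx, colF, colS, sg_not']
  · rcases k with b | b | d
    · simp only [waveCoeff, symb, rowW, rowC, colF, colS]
      rw [coeff_numCA]; simp
    · simp only [waveCoeff, symb, rowW, rowC, colF, colS]
      rw [coeff_numCA, sg_not', neg_pow]; simp [mul_comm]
    · simp only [waveCoeff, symb, rowW, rowC, colF, colS]
      rw [coeff_numCC, smul_mul_assoc, smul_smul, one_mul]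

lemma bracket_inl_eq_zero {b : Fin s} {δ : Bool} {ξ : Xi s r} {k : ℤ} (hk : 0 ≤ k)
    (h : ∀ m : ℕ, k = m + 1 → xi b δ m ≠ ξ) (τ : BFock s r) :
    bracket (Sum.inl (b, δ)) τ {ξ} k = 0 := by
  obtain ⟨m, rfl⟩ := Int.eq_ofNat_of_zero_le hk
  rcases m with _ | m
  · exact rfl
  · exact if_neg (by rw [Finset.mem_singleton]; exact h m (by push_cast; rfl))

lemma bracket_inr_eq_zero {c : Fin r} {ξ : Xi s r} {k : ℤ} (hk : 0 ≤ k)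
    (h : ∀ m : ℕ, k = m → Sum.inr (c, m) ≠ ξ) (τ : BFock s r) :
    bracket (Sum.inr c) τ {ξ} k = 0 := by
  obtain ⟨m, rfl⟩ := Int.eq_ofNat_of_zero_le hk
  exact if_neg (by rw [Finset.mem_singleton]; exact h m rfl)

lemma Xm_row_inl_eq_zero (τ : BFock s r) (ε : Bool) (a : Fin s) (k : Idx s r) {g : ℤ} (hg : 0 < g) :
    Xm (colF ε k) g τ {xi a ε 0} = 0 := by
  rcases k with b | b | c
  · by_cases h : a = b
    · subst h
      rw [colF, Xm_eq _ _ (g + 1) _ _ (by rw [chg_inl_xi]; ring)]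
      refine bracket_inl_eq_zero (by omega) (fun m hm h => ?_) τ
      have := (xi_inj.1 h).2.2
      omega
    · rw [colF, Xm_eq _ _ g _ _ (by rw [chg_inl_xi_of_ne h]; ring)]
      exact bracket_inl_eq_zero hg.le (fun m _ h' => h (xi_inj.1 h').1.symm) τ
  · by_cases h : a = b
    · subst h
      rw [colF, Xm_eq _ _ (g - 1) _ _ (by rw [chg_inl_xi_not])]
      exact bracket_inl_eq_zero (by omega) (fun m hm h => by simpa using (xi_inj.1 h).2.1) τ
    · rw [colF, Xm_eq _ _ g _ _ (by rw [chg_inl_xi_of_ne h]; ring)]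
      exact bracket_inl_eq_zero hg.le (fun m _ h' => h (xi_inj.1 h').1.symm) τ
  · rw [colF, Xm_eq _ _ g _ _ (by rw [chg_inr]; ring)]
    exact bracket_inr_eq_zero hg.le (fun m _ h => by simp [xi] at h) τ

lemma colF_not_swapIdx (ε : Bool) (k : Idx s r) : colF (!ε) (swapIdx k) = colF ε k := by
  rcases k with b | b | c <;> simp [colF, swapIdx]

lemma Xm_row_eq_zero (τ : BFock s r) (ε : Bool) (i k : Idx s r) {g : ℤ} (hg : 0 < g) :
    Xm (colF ε k) g τ (rowW ε i) = 0 := by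
  rcases i with a | a | c
  · exact Xm_row_inl_eq_zero τ ε a k hg
  · rw [← colF_not_swapIdx]
    exact Xm_row_inl_eq_zero τ (!ε) a _ hg
  · rcases k with b | b | d
    · rw [colF, rowW, Xm_eq _ _ g _ _ (by rw [chg_inl_inr]; ring)]
      exact bracket_inl_eq_zero hg.le (fun m _ h => by simp [xi] at h) τ
    · rw [colF, rowW, Xm_eq _ _ g _ _ (by rw [chg_inl_inr]; ring)]
      exact bracket_inl_eq_zero hg.le (fun m _ h => by simp [xi] at h) τ
    · rw [colF, rowW, Xm_eq _ _ g _ _ (by rw [chg_inr]; ring)]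
      refine bracket_inr_eq_zero hg.le (fun m hm h => ?_) τ
      simp only [Sum.inr.injEq, Prod.mk.injEq] at h
      omega

end MCKP
end

noncomputable section
namespace MCKP

variable {s r : ℕ}

/-! ## Multiplication by exponentials of the times -/

/-- The sequence `h p` of series is homogeneous of weighted degree `p`. -/
def IsGraded (h : ℕ → TSer s r) : Prop := ∀ p m, MvPowerSeries.coeff m (h p) ≠ 0 → wt m = p

lemma IsGraded.coeff_mul {h : ℕ → TSer s r} (hh : IsGraded h) {p : ℕ} {m : Time s r →₀ ℕ}
    (hp : wt m < p) (u : TSer s r) : MvPowerSeries.coeff m (h p * u) = 0 := by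
  classical
  rw [MvPowerSeries.coeff_mul]
  refine Finset.sum_eq_zero fun x hx => ?_
  rw [Finset.HasAntidiagonal.mem_antidiagonal] at hx
  by_contra h0
  have h1 := hh p x.1 (left_ne_zero_of_mul h0)
  have h2 : wt m = wt x.1 + wt x.2 := by rw [← hx, wt, wt, wt, map_add]
  omega

lemma wt_add (m m' : Time s r →₀ ℕ) : wt (m + m') = wt m + wt m' := map_add _ _ _

lemma IsGraded.coeff_mul_mul {h h' : ℕ → TSer s r} (hh : IsGraded h) (hh' : IsGraded h')
    {p p' : ℕ} {m : Time s r →₀ ℕ} (hp : wt m < p + p') (u : TSer s r) :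
    MvPowerSeries.coeff m (h p * h' p' * u) = 0 := by
  classical
  rw [mul_assoc, MvPowerSeries.coeff_mul]
  refine Finset.sum_eq_zero fun x hx => ?_
  rw [Finset.HasAntidiagonal.mem_antidiagonal] at hx
  by_contra h0
  have h1 := hh p x.1 (left_ne_zero_of_mul h0)
  refine right_ne_zero_of_mul h0 (hh'.coeff_mul ?_ u)
  rw [← hx, wt_add] at hp
  omega

/-- The coefficient of `z ^ n` in `(∑_p h_p z ^ p) (∑_g a_g z ^ g)`. -/
def mcut (h : ℕ → TSer s r) (a : ℤ → TSer s r) (n : ℤ) : TSer s r := fun m =>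
  ∑ p ∈ Finset.range (wt m + 1), MvPowerSeries.coeff m (h p * a (n - p))

lemma coeff_mcut_def (h : ℕ → TSer s r) (a : ℤ → TSer s r) (n : ℤ) (m : Time s r →₀ ℕ) :
    MvPowerSeries.coeff m (mcut h a n) =
      ∑ p ∈ Finset.range (wt m + 1), MvPowerSeries.coeff m (h p * a (n - p)) := rfl

lemma coeff_mcut {h : ℕ → TSer s r} (hh : IsGraded h) (a : ℤ → TSer s r) (n : ℤ)
    {m : Time s r →₀ ℕ} {P : ℕ} (hP : wt m < P) :
    MvPowerSeries.coeff m (mcut h a n) =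
      MvPowerSeries.coeff m (∑ p ∈ Finset.range P, h p * a (n - p)) := by
  rw [map_sum, coeff_mcut_def]
  refine Finset.sum_subset (Finset.range_subset_range.2 hP) fun p _ hp => ?_
  rw [Finset.mem_range, not_lt] at hp
  exact hh.coeff_mul (by omega) _

lemma coeff_mcut_eq_zero {h : ℕ → TSer s r} {a : ℤ → TSer s r} {N n : ℤ}
    (ha : ∀ g, N < g → a g = 0) {m : Time s r →₀ ℕ} (hn : N + wt m < n) :
    MvPowerSeries.coeff m (mcut h a n) = 0 := by
  rw [coeff_mcut_def]
  refine Finset.sum_eq_zero fun p hp => ?_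
  rw [Finset.mem_range] at hp
  rw [ha _ (by omega), mul_zero, map_zero]

lemma mcut_zero (h : ℕ → TSer s r) (n : ℤ) : mcut h 0 n = 0 := by
  ext m
  rw [coeff_mcut_def, map_zero]
  exact Finset.sum_eq_zero fun p _ => by rw [Pi.zero_apply, mul_zero, map_zero]

lemma mcut_add (h : ℕ → TSer s r) (a b : ℤ → TSer s r) (n : ℤ) :
    mcut h (a + b) n = mcut h a n + mcut h b n := by
  ext m
  rw [map_add, coeff_mcut_def, coeff_mcut_def, coeff_mcut_def, ← Finset.sum_add_distrib]
  exact Finset.sum_congr rfl fun p _ => by rw [Pi.add_apply, mul_add, map_add]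

lemma mcut_smul (h : ℕ → TSer s r) (c : ℂ) (a : ℤ → TSer s r) (n : ℤ) :
    mcut h (c • a) n = c • mcut h a n := by
  ext m
  rw [map_smul, coeff_mcut_def, coeff_mcut_def, Finset.smul_sum]
  exact Finset.sum_congr rfl fun p _ => by rw [Pi.smul_apply, mul_smul_comm, map_smul]

lemma mcut_sum {ι : Type*} (S : Finset ι) (h : ℕ → TSer s r) (a : ι → ℤ → TSer s r) (n : ℤ) :
    mcut h (∑ i ∈ S, a i) n = ∑ i ∈ S, mcut h (a i) n := by
  classical
  induction S using Finset.induction_on with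
  | empty => exact mcut_zero h n
  | insert i S hi ih => rw [Finset.sum_insert hi, Finset.sum_insert hi, mcut_add, ih]

lemma coeff_mul_congr {V : Type*} {f f' u u' : MvPowerSeries V ℂ} {m : V →₀ ℕ}
    (h : ∀ μ ≤ m, MvPowerSeries.coeff μ f = MvPowerSeries.coeff μ f')
    (h' : ∀ μ ≤ m, MvPowerSeries.coeff μ u = MvPowerSeries.coeff μ u') :
    MvPowerSeries.coeff m (f * u) = MvPowerSeries.coeff m (f' * u') := by
  classical
  rw [MvPowerSeries.coeff_mul, MvPowerSeries.coeff_mul]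
  refine Finset.sum_congr rfl fun x hx => ?_
  rw [Finset.HasAntidiagonal.mem_antidiagonal] at hx
  rw [h x.1 (hx ▸ le_self_add), h' x.2 (hx ▸ le_add_self)]

lemma wt_mono {μ m : Time s r →₀ ℕ} (h : μ ≤ m) : wt μ ≤ wt m := by
  rw [← tsub_add_cancel_of_le h, wt, wt, map_add]
  exact le_add_self

lemma mcut_mul {h : ℕ → TSer s r} (hh : IsGraded h) (a : ℤ → TSer s r) (n : ℤ) (u : TSer s r) :
    mcut h (fun g => a g * u) n = mcut h a n * u := by
  ext m
  have h1 : MvPowerSeries.coeff m (mcut h a n * u) = MvPowerSeries.coeff m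
      ((∑ p ∈ Finset.range (wt m + 1), h p * a (n - p)) * u) :=
    coeff_mul_congr (fun μ hμ => coeff_mcut hh a n (Nat.lt_succ_of_le (wt_mono hμ)))
      fun _ _ => rfl
  rw [h1, coeff_mcut hh _ n (Nat.lt_succ_self _), Finset.sum_mul]
  simp only [mul_assoc]

lemma pderiv_mcut {h : ℕ → TSer s r} (hh : IsGraded h) {i : Time s r} {c : ℂ}
    (hd : ∀ p, MvPowerSeries.pderiv ℂ i (h p) = if tdeg i ≤ p then c • h (p - tdeg i) else 0)
    (a : ℤ → TSer s r) (n : ℤ) : MvPowerSeries.pderiv ℂ i (mcut h a n) =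
      mcut h (fun g => MvPowerSeries.pderiv ℂ i (a g) + c • a (g - tdeg i)) n := by
  ext m
  have h1 : MvPowerSeries.coeff m (MvPowerSeries.pderiv ℂ i (mcut h a n)) =
      MvPowerSeries.coeff m (MvPowerSeries.pderiv ℂ i
        (∑ p ∈ Finset.range (tdeg i + (wt m + 1)), h p * a (n - p))) := by
    rw [MvPowerSeries.coeff_pderiv, MvPowerSeries.coeff_pderiv,
      coeff_mcut hh a n (P := tdeg i + (wt m + 1)) (by rw [wt_add_single]; omega)]
  have h2 : mcut h (fun g => MvPowerSeries.pderiv ℂ i (a g) + c • a (g - tdeg i)) n =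
      mcut h (fun g => MvPowerSeries.pderiv ℂ i (a g)) n +
        c • mcut h (fun g => a (g - tdeg i)) n := by
    rw [← mcut_smul, ← mcut_add]; rfl
  rw [h1, h2, map_add, map_smul, coeff_mcut hh _ n (by omega : wt m < tdeg i + (wt m + 1)),
    coeff_mcut hh (fun g => a (g - tdeg i)) n (Nat.lt_succ_self (wt m)), ← map_smul, ← map_add,
    map_sum]
  congr 1
  have h3 : ∀ p : ℕ, MvPowerSeries.pderiv ℂ i (h p * a (n - p)) =
      h p * MvPowerSeries.pderiv ℂ i (a (n - p)) +
        if tdeg i ≤ p then c • (h (p - tdeg i) * a (n - p)) else 0 := by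
    intro p
    rw [Derivation.leibniz, hd, smul_eq_mul, smul_eq_mul]
    split_ifs
    · rw [mul_smul_comm, mul_comm (a _)]
    · rw [mul_zero]
  simp only [h3]
  rw [Finset.sum_add_distrib, Finset.smul_sum]
  congr 1
  rw [Finset.sum_range_add, Finset.sum_eq_zero, zero_add]
  · refine Finset.sum_congr rfl fun p _ => ?_
    rw [if_pos (by omega), Nat.add_sub_cancel_left]
    congr 3
    push_cast
    ring
  · intro p hp
    rw [Finset.mem_range] at hp
    rw [if_neg (by omega)]

lemma mcut_mul_mcut {h h' : ℕ → TSer s r} (hh : IsGraded h) (hh' : IsGraded h')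
    (hinv : ∀ k, ∑ p ∈ Finset.HasAntidiagonal.antidiagonal k, h p.1 * h' p.2 =
      if k = 0 then 1 else 0)
    {a b : ℤ → TSer s r} {N N' : ℤ} (ha : ∀ g, N < g → a g = 0) (hb : ∀ g, N' < g → b g = 0)
    (M : Time s r →₀ ℕ) :
    ∑ x ∈ Finset.HasAntidiagonal.antidiagonal M, ∑ᶠ n : ℤ, MvPowerSeries.coeff x.1 (mcut h a n) *
        MvPowerSeries.coeff x.2 (mcut h' b (-1 - n)) =
      MvPowerSeries.coeff M (∑ᶠ g : ℤ, a g * b (-1 - g)) := by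
  classical
  set P := wt M + 1 with hP
  let I := Finset.Icc (-1 - N' - P) (N + P)
  let Z : ℕ → TSer s r := fun k => ∑ᶠ g : ℤ, a g * b (-1 - g - k)
  have hI : ∀ p p', p < P → p' < P → ∑ n ∈ I, a (n - p) * b (-1 - n - p') = Z (p + p') := by
    intro p p' hp hp'
    have hbij : Function.Bijective fun n : ℤ => n - p :=
      ⟨fun x y h => by simpa using h, fun y => ⟨y + p, by ring⟩⟩
    have : Z (p + p') = ∑ᶠ n : ℤ, a (n - p) * b (-1 - n - p') := by
      simp only [Z]
      rw [← finsum_comp _ hbij (g := fun g => a g * b (-1 - g - (p + p' : ℕ)))]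
      refine finsum_congr fun n => ?_
      congr 2
      push_cast
      ring
    rw [this, finsum_eq_sum_of_support_subset]
    intro n hn
    rw [Finset.coe_Icc, Set.mem_Icc]
    by_contra h0
    rw [not_and_or, not_le, not_le] at h0
    refine hn ?_
    simp only
    rcases h0 with h0 | h0
    · rw [hb _ (by omega), mul_zero]
    · rw [ha _ (by omega), zero_mul]
  have h1 : ∀ x ∈ Finset.HasAntidiagonal.antidiagonal M, ∑ᶠ n : ℤ,
      MvPowerSeries.coeff x.1 (mcut h a n) * MvPowerSeries.coeff x.2 (mcut h' b (-1 - n)) =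
      ∑ n ∈ I, MvPowerSeries.coeff x.1 (mcut h a n) *
        MvPowerSeries.coeff x.2 (mcut h' b (-1 - n)) := by
    intro x hx
    rw [Finset.HasAntidiagonal.mem_antidiagonal] at hx
    have hx1 : wt x.1 ≤ wt M := wt_mono (hx ▸ le_self_add)
    have hx2 : wt x.2 ≤ wt M := wt_mono (hx ▸ le_add_self)
    refine finsum_eq_sum_of_support_subset _ fun n hn => ?_
    rw [Finset.coe_Icc, Set.mem_Icc]
    by_contra h0
    rw [not_and_or, not_le, not_le] at h0
    refine hn ?_
    simp only
    rcases h0 with h0 | h0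
    · rw [coeff_mcut_eq_zero hb (by omega), mul_zero]
    · rw [coeff_mcut_eq_zero ha (by omega), zero_mul]
  rw [Finset.sum_congr rfl h1, Finset.sum_comm]
  have h2 : ∀ n ∈ I, ∑ x ∈ Finset.HasAntidiagonal.antidiagonal M,
      MvPowerSeries.coeff x.1 (mcut h a n) * MvPowerSeries.coeff x.2 (mcut h' b (-1 - n)) =
      ∑ p ∈ Finset.range P, ∑ p' ∈ Finset.range P,
        MvPowerSeries.coeff M (h p * h' p' * (a (n - p) * b (-1 - n - p'))) := by
    intro n _
    rw [← MvPowerSeries.coeff_mul,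
      coeff_mul_congr (fun μ hμ => coeff_mcut hh a n (Nat.lt_succ_of_le (wt_mono hμ)))
        (fun μ hμ => coeff_mcut hh' b (-1 - n) (Nat.lt_succ_of_le (wt_mono hμ))),
      Finset.sum_mul_sum, map_sum]
    refine Finset.sum_congr rfl fun p _ => ?_
    rw [map_sum]
    refine Finset.sum_congr rfl fun p' _ => ?_
    rw [mul_mul_mul_comm]
  rw [Finset.sum_congr rfl h2, Finset.sum_comm]
  have h3 : ∀ p ∈ Finset.range P, ∑ n ∈ I, ∑ p' ∈ Finset.range P,
        MvPowerSeries.coeff M (h p * h' p' * (a (n - p) * b (-1 - n - p'))) =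
      ∑ p' ∈ Finset.range P, MvPowerSeries.coeff M (h p * h' p' * Z (p + p')) := by
    intro p hp
    rw [Finset.sum_comm]
    refine Finset.sum_congr rfl fun p' hp' => ?_
    rw [← map_sum, ← Finset.mul_sum, hI p p' (Finset.mem_range.1 hp) (Finset.mem_range.1 hp')]
  rw [Finset.sum_congr rfl h3, ← sum_range_antidiagonal P
    (fun p p' => MvPowerSeries.coeff M (h p * h' p' * Z (p + p')))]
  · have h4 : ∀ k ∈ Finset.range P, ∑ x ∈ Finset.HasAntidiagonal.antidiagonal k,
        MvPowerSeries.coeff M (h x.1 * h' x.2 * Z (x.1 + x.2)) =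
        if k = 0 then MvPowerSeries.coeff M (Z 0) else 0 := by
      intro k _
      have : ∀ x ∈ Finset.HasAntidiagonal.antidiagonal k,
          MvPowerSeries.coeff M (h x.1 * h' x.2 * Z (x.1 + x.2)) =
          MvPowerSeries.coeff M (h x.1 * h' x.2 * Z k) := by
        intro x hx
        rw [Finset.HasAntidiagonal.mem_antidiagonal.1 hx]
      rw [Finset.sum_congr rfl this, ← map_sum, ← Finset.sum_mul, hinv]
      split_ifs with hk
      · rw [hk, one_mul]
      · rw [zero_mul, map_zero]
    rw [Finset.sum_congr rfl h4, Finset.sum_ite_eq' (Finset.range P) 0, if_pos (by simp [hP])]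
    simp [Z]
  · intro p p' hpp
    exact hh.coeff_mul_mul hh' (by omega) _

end MCKP
end

noncomputable section
namespace MCKP

variable {s r : ℕ}

/-! ## The shift of the first times -/

/-- The first time of a component. -/
def time1 : Cmp s r → Time s r
  | Sum.inl a => Sum.inl (a, 0)
  | Sum.inr c => Sum.inr (c, 0)

lemma timeIdx_one (b : Cmp s r) : timeIdx b 1 = some (time1 b) := by
  rcases b with a | c <;> rfl

@[simp] lemma tdeg_time1 (b : Cmp s r) : tdeg (time1 b) = 1 := by rcases b with a | c <;> rfl
@[simp] lemma tcmp_time1 (b : Cmp s r) : tcmp (time1 b) = b := by rcases b with a | c <;> rfl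

/-- The derivation `∑_b ∂/∂t^{(b)}_1`. -/
def dX (s r : ℕ) : Module.End ℂ (TSer s r) := ∑ b : Cmp s r, dvar id b 1

lemma dX_apply (f : TSer s r) :
    dX s r f = ∑ b : Cmp s r, MvPowerSeries.pderiv ℂ (time1 b) f := by
  rw [dX, LinearMap.sum_apply]
  refine Finset.sum_congr rfl fun b _ => ?_
  rw [dvar_of_some id (timeIdx_one b)]
  rfl

lemma dX_mul (f g : TSer s r) : dX s r (f * g) = f * dX s r g + dX s r f * g := by
  simp only [dX_apply, Derivation.leibniz, smul_eq_mul, Finset.sum_add_distrib, Finset.mul_sum,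
    Finset.sum_mul]
  congr 1
  exact Finset.sum_congr rfl fun b _ => mul_comm _ _

lemma dX_pderiv (i : Time s r) (f : TSer s r) :
    dX s r (MvPowerSeries.pderiv ℂ i f) = MvPowerSeries.pderiv ℂ i (dX s r f) := by
  rw [dX_apply, dX_apply, map_sum]
  exact Finset.sum_congr rfl fun b _ => pderiv_comm _ _ _

lemma dX_one : dX s r 1 = 0 := by
  rw [dX_apply]
  exact Finset.sum_eq_zero fun b _ => Derivation.map_one_eq_zero _

lemma dX_X (i : Time s r) : dX s r (MvPowerSeries.X i) = if tdeg i = 1 then 1 else 0 := by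
  classical
  rw [dX_apply]
  simp only [MvPowerSeries.pderiv_X]
  by_cases h : tdeg i = 1
  · have hi : i = time1 (tcmp i) := by
      have h1 := timeIdx_tcmp i
      rw [h, timeIdx_one] at h1
      exact (Option.some.inj h1).symm
    rw [if_pos h, Finset.sum_eq_single (tcmp i)]
    · rw [← hi]; simp
    · intro b _ hb
      rw [Pi.single_apply, if_neg]
      intro h'
      exact hb (by simpa using (congrArg tcmp h').symm)
    · simp
  · rw [if_neg h]
    refine Finset.sum_eq_zero fun b _ => ?_
    rw [Pi.single_apply, if_neg]
    intro h'
    exact h (by simpa using congrArg tdeg h')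

lemma coeff_shiftX (n : ℕ) (f : TSer s r) :
    PowerSeries.coeff n (shiftX f) = ((n.factorial : ℂ)⁻¹) • ((dX s r) ^ n) f := by
  rw [shiftX, PowerSeries.coeff_mk, dX]

lemma derivative_shiftX (f : TSer s r) :
    PowerSeries.derivative (TSer s r) (shiftX f) = shiftX (dX s r f) := by
  ext1 n
  rw [PowerSeries.coeff_derivative, coeff_shiftX, coeff_shiftX, pow_succ, Module.End.mul_apply,
    Nat.factorial_succ]
  have h : (n : ℂ) + 1 ≠ 0 := by exact_mod_cast n.succ_ne_zero
  have h' : ((n : TSer s r) + 1) = algebraMap ℂ (TSer s r) ((n : ℂ) + 1) := by simp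
  rw [h', mul_comm, ← Algebra.smul_def, smul_smul]
  congr 1
  push_cast
  field_simp

lemma XSer.coeff_succ (F : XSer s r) (n : ℕ) : PowerSeries.coeff (n + 1) F =
    ((n : ℂ) + 1)⁻¹ • PowerSeries.coeff n (PowerSeries.derivative (TSer s r) F) := by
  have h : (n : ℂ) + 1 ≠ 0 := by exact_mod_cast n.succ_ne_zero
  have h' : ((n : TSer s r) + 1) = algebraMap ℂ (TSer s r) ((n : ℂ) + 1) := by simp
  rw [PowerSeries.coeff_derivative, h', mul_comm, ← Algebra.smul_def, smul_smul,
    inv_mul_cancel₀ h, one_smul]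

lemma coeff_zero_shiftX (f : TSer s r) : PowerSeries.coeff 0 (shiftX f) = f := by
  rw [coeff_shiftX]; simp

lemma shiftX_add (f g : TSer s r) : shiftX (f + g) = shiftX f + shiftX g := by
  ext1 n
  simp only [coeff_shiftX, map_add, smul_add]

lemma shiftX_smul (c : ℂ) (f : TSer s r) : shiftX (c • f) = c • shiftX f := by
  ext1 n
  rw [coeff_shiftX, map_smul]
  change _ = c • PowerSeries.coeff n (shiftX f)
  rw [coeff_shiftX, smul_comm]

lemma shiftX_mul (f g : TSer s r) : shiftX (f * g) = shiftX f * shiftX g := by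
  ext1 n
  induction n generalizing f g with
  | zero =>
    rw [coeff_zero_shiftX, PowerSeries.coeff_zero_eq_constantCoeff_apply, map_mul,
      ← PowerSeries.coeff_zero_eq_constantCoeff_apply, coeff_zero_shiftX,
      ← PowerSeries.coeff_zero_eq_constantCoeff_apply, coeff_zero_shiftX]
  | succ n ih =>
    rw [XSer.coeff_succ, XSer.coeff_succ, derivative_shiftX, Derivation.leibniz,
      derivative_shiftX, derivative_shiftX, dX_mul, shiftX_add, map_add, map_add, ih, ih,
      smul_eq_mul, smul_eq_mul, mul_comm (shiftX g)]

lemma shiftX_one : shiftX (1 : TSer s r) = 1 := by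
  ext1 n
  rcases n with _ | n
  · rw [coeff_zero_shiftX]; simp
  · rw [XSer.coeff_succ, derivative_shiftX, dX_one, ← zero_smul ℂ (0 : TSer s r), shiftX_smul,
      zero_smul, map_zero, smul_zero, PowerSeries.coeff_one, if_neg n.succ_ne_zero]

/-- The shift as a ring homomorphism. -/
def shiftHom (s r : ℕ) : TSer s r →+* XSer s r where
  toFun := shiftX
  map_one' := shiftX_one
  map_mul' := shiftX_mul
  map_zero' := by rw [← zero_smul ℂ (0 : TSer s r), shiftX_smul, zero_smul]
  map_add' := shiftX_add

/-- The shift as an algebra homomorphism. -/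
def shiftAlg (s r : ℕ) : TSer s r →ₐ[ℂ] XSer s r :=
  { shiftHom s r with
    commutes' := fun c => by
      change shiftX (algebraMap ℂ (TSer s r) c) = _
      rw [Algebra.algebraMap_eq_smul_one, shiftX_smul, shiftX_one, Algebra.algebraMap_eq_smul_one] }

lemma shiftAlg_apply (f : TSer s r) : shiftAlg s r f = shiftX f := rfl

lemma shiftX_zero : shiftX (0 : TSer s r) = 0 := map_zero (shiftAlg s r)

lemma shiftX_X (i : Time s r) : shiftX (MvPowerSeries.X i : TSer s r) =
    PowerSeries.C (MvPowerSeries.X i) + if tdeg i = 1 then PowerSeries.X else 0 := by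
  ext1 n
  rcases n with _ | n
  · rw [coeff_zero_shiftX]
    split_ifs <;> simp
  · rw [XSer.coeff_succ, derivative_shiftX, dX_X, map_add, PowerSeries.coeff_C,
      if_neg n.succ_ne_zero, zero_add]
    split_ifs
    · rw [shiftX_one, PowerSeries.coeff_X, PowerSeries.coeff_one]
      rcases n with _ | n <;> simp
    · rw [shiftX_zero]; simp

lemma shiftX_tvar (b : Cmp s r) (k : ℕ) : shiftX (tvar id b k) =
    PowerSeries.C (tvar id b k) + if k = 1 then PowerSeries.X else 0 := by
  rcases h : timeIdx b k with _ | i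
  · rw [tvar_of_none id h, shiftX_zero, map_zero, if_neg, add_zero]
    rintro rfl
    rw [timeIdx_one] at h
    simp at h
  · rw [tvar_of_some id h, id, shiftX_X, ((timeIdx_eq_some _ _ _).1 h).2]

/-! ## The exponential factor of the wave function -/

/-- The coefficients of the exponential factor of the wave function, at `x = 0`. -/
def waveK (ε : Bool) (k : Idx s r) (p : ℕ) : TSer s r := colS s r ε k ^ p • Hc (colF ε k) p

lemma isGraded_Hc (φ : Fld s r) : IsGraded (Hc φ) := coeff_Hc_ne_zero φ

lemma IsGraded.smul {h : ℕ → TSer s r} (hh : IsGraded h) (c : ℕ → ℂ) :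
    IsGraded fun p => c p • h p := fun p m h0 => by
  rw [map_smul] at h0
  exact hh p m (right_ne_zero_of_smul h0)

lemma isGraded_waveK (ε : Bool) (k : Idx s r) : IsGraded (waveK ε k) :=
  (isGraded_Hc _).smul _

lemma pderiv_waveK (ε : Bool) (k : Idx s r) (i : Time s r) (p : ℕ) :
    MvPowerSeries.pderiv ℂ i (waveK ε k p) = if tdeg i ≤ p then
      (tsgn (colF ε k) i * colS s r ε k ^ tdeg i) • waveK ε k (p - tdeg i) else 0 := by
  rw [waveK, Derivation.map_smul, pderiv_Hc]
  split_ifs with h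
  · rw [waveK, smul_smul, smul_smul]
    congr 1
    nth_rw 1 [← Nat.add_sub_cancel' h, pow_add]
    ring
  · rw [smul_zero]

/-- The exponent of the exponential factor of the wave function. -/
def waveExp (ε : Bool) (k : Idx s r) : PowerSeries (TSer s r) :=
  PowerSeries.mk fun n => colS s r ε k ^ n •
    PowerSeries.coeff n (PowerSeries.mk fun n => (colF ε k).sgn • tvar id (colF ε k).cmp n)

lemma coeff_pexp_waveExp (ε : Bool) (k : Idx s r) (p : ℕ) :
    PowerSeries.coeff p (pexp (waveExp ε k)) = waveK ε k p := pexp_rescale _ _ p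

lemma sg_pow_odd (ε : Bool) {n : ℕ} (h : Odd n) : sg ε ^ n = sg ε := by
  cases ε
  · simp [sg, h.neg_one_pow]
  · simp [sg]

lemma waveExp_add (k : Idx s r) : waveExp true k + waveExp false k = 0 := by
  ext1 n
  rw [waveExp, waveExp, map_add, PowerSeries.coeff_mk, PowerSeries.coeff_mk, PowerSeries.coeff_mk,
    PowerSeries.coeff_mk, map_zero]
  rcases k with b | b | c
  · simp [colS, colF, Fld.sgn, Fld.cmp, sg]
  · simp [colS, colF, Fld.sgn, Fld.cmp, sg]
  · rcases Nat.even_or_odd n with hn | hn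
    · have : timeIdx (Sum.inr c : Cmp s r) n = none := by
        rw [timeIdx, if_neg (by rw [Nat.even_iff.1 hn]; norm_num)]
      simp [colF, Fld.cmp, tvar_of_none id this]
    · simp [colS, colF, Fld.sgn, Fld.cmp, hn.neg_one_pow, sg]

lemma waveExp_coeff_zero (ε : Bool) (k : Idx s r) : PowerSeries.coeff 0 (waveExp ε k) = 0 := by
  simp [waveExp, tvar_zero]

lemma pexp_zero {E : Type*} [Ring E] [Algebra ℂ E] : pexp (0 : PowerSeries E) = 1 := by
  ext1 n
  rw [pexp, PowerSeries.coeff_mk, Finset.sum_eq_single 0]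
  · simp
  · intro m _ hm
    rw [zero_pow hm, map_zero, smul_zero]
  · simp

lemma waveK_inv (k : Idx s r) (n : ℕ) :
    ∑ p ∈ Finset.HasAntidiagonal.antidiagonal n, waveK true k p.1 * waveK false k p.2 =
      if n = 0 then 1 else 0 := by
  have h := pexp_add (waveExp_coeff_zero true k) (waveExp_coeff_zero false k)
    (fun _ _ => Commute.all _ _) (fun _ _ => Commute.all _ _) (fun _ _ => Commute.all _ _)
  rw [waveExp_add, pexp_zero] at h
  have h1 := congrArg (PowerSeries.coeff n) h
  rw [PowerSeries.coeff_mul, PowerSeries.coeff_one] at h1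
  rw [h1]
  simp only [coeff_pexp_waveExp]

lemma coeff_waveS_mul_waveX (ε : Bool) (k : Idx s r) (p : ℕ) :
    PowerSeries.coeff p (waveS ε k * waveX ε) = shiftX (waveK ε k p) := by
  have hmap : ∀ n, PowerSeries.coeff n
      (PowerSeries.map (shiftAlg s r : TSer s r →+* XSer s r) (waveExp ε k)) =
      (colS s r ε k ^ n * (colF ε k).sgn) • (PowerSeries.C (tvar id (colF ε k).cmp n) +
        if n = 1 then PowerSeries.X else 0 : XSer s r) := by
    intro n
    rw [PowerSeries.coeff_map]
    change shiftX _ = _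
    rw [waveExp, PowerSeries.coeff_mk, PowerSeries.coeff_mk, shiftX_smul, shiftX_smul, shiftX_tvar,
      smul_smul]
  rw [← coeff_pexp_waveExp, ← shiftAlg_apply, ← pexp_map]
  congr 1
  have hS : waveS ε k = pexp (PowerSeries.mk fun n =>
      (colS s r ε k ^ n * (colF ε k).sgn) • (PowerSeries.C (tvar id (colF ε k).cmp n) : XSer s r)) := by
    rcases k with b | b | c
    · simp [waveS, colS, colF, Fld.sgn, Fld.cmp]
    · simp [waveS, colS, colF, Fld.sgn, Fld.cmp, sg_not', mul_comm]
    · simp only [waveS]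
      congr 1
      ext1 n
      rw [PowerSeries.coeff_mk, PowerSeries.coeff_mk]
      rcases Nat.even_or_odd n with hn | hn
      · have : timeIdx (Sum.inr c : Cmp s r) n = none := by
          rw [timeIdx, if_neg (by rw [Nat.even_iff.1 hn]; norm_num)]
        simp [colF, Fld.cmp, tvar_of_none id this]
      · simp [colS, colF, Fld.sgn, Fld.cmp, sg_pow_odd _ hn]
  have hsg : colS s r ε k * (colF ε k).sgn = sg ε := by
    rcases k with b | b | c <;> simp [colS, colF, Fld.sgn, sg_not']
  rw [hS, waveX, ← pexp_add]
  · congr 1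
    ext1 n
    rw [hmap, map_add, PowerSeries.coeff_mk, PowerSeries.coeff_mk, smul_add]
    congr 1
    split_ifs with h
    · rw [h, pow_one, hsg]
    · rw [smul_zero]
  · simp [tvar_zero]
  · simp
  all_goals exact fun _ _ => Commute.all _ _

end MCKP
end

noncomputable section
namespace MCKP

variable {s r : ℕ}

/-! ## Wave functions -/

/-- Families of coefficients of matrix pseudo-differential operators, at `x = 0`. -/
abbrev SymFam (s r : ℕ) := ℤ → Idx s r → Idx s r → TSer s r

/-- The coefficients of the wave operator, at `x = 0`. -/
def symZ (τ : BFock s r) (ε : Bool) : SymFam s r := fun g i k =>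
  if g ≤ 0 then waveCoeff τ ε (-g).toNat i k else 0

lemma waveOp_coeff (τ : BFock s r) (ε : Bool) (g : ℤ) (i k : Idx s r) :
    (waveOp τ ε).coeff g i k = shiftX (symZ τ ε g i k) := by
  change (if g ≤ 0 then Matrix.of fun i j => shiftX (waveCoeff τ ε (-g).toNat i j) else 0 : Mat s r)
    i k = shiftX (if g ≤ 0 then waveCoeff τ ε (-g).toNat i k else 0)
  split_ifs
  · rfl
  · exact shiftX_zero.symm

/-- The coefficient of `z ^ n` in the wave function of an operator, at `x = 0`. -/
def wv (ε : Bool) (a : SymFam s r) (i k : Idx s r) (n : ℤ) : TSer s r :=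
  mcut (waveK ε k) (fun g => sg ε ^ g • a g i k) n

lemma bB_eq_mcut {φ : Fld s r} {τ : BFock s r} {w : Finset (Xi s r)}
    (h : ∀ g : ℤ, 0 < g → Xm φ g τ w = 0) (n : ℤ) :
    bB φ (-n - 1) τ w = mcut (Hc φ) (fun g => if g ≤ 0 then vsum φ τ w (-g).toNat else 0) n := by
  ext m
  obtain ⟨N, hN1, hN2⟩ : ∃ N : ℕ, gtop φ w + -n + wt m < N ∧ -n + wt m < N :=
    ⟨(gtop φ w + -n + wt m).toNat + (-n + wt m).toNat + 1, by omega, by omega⟩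
  rw [coeff_bB φ (-n - 1) (P := wt m + 1) (N := N) τ w (by omega) (by omega), bBt, map_sum,
    coeff_mcut_def]
  refine Finset.sum_congr rfl fun p hp => ?_
  rw [Finset.mem_range] at hp
  rw [← Finset.mul_sum]
  congr 2
  split_ifs with hg
  · have hN : (-(n - p)).toNat + 1 ≤ N := by omega
    rw [vsum, Finset.Nat.sum_antidiagonal_eq_sum_range_succ
      (fun x y => Dc φ x (Xm φ (-(y : ℤ)) τ w)), ← Finset.sum_subset (Finset.range_subset_range.2 hN)]
    · refine Finset.sum_congr rfl fun q hq => ?_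
      rw [Finset.mem_range] at hq
      rw [show -(-n - 1) - 1 - (p : ℤ) + q = -(((-(n - p)).toNat - q : ℕ) : ℤ) by omega]
    · intro q _ hq
      rw [Finset.mem_range, not_lt] at hq
      rw [h _ (by omega), map_zero]
  · refine Finset.sum_eq_zero fun q _ => ?_
    rw [h _ (by omega), map_zero]

lemma mcut_rescale {σ : ℂ} (hσ : σ * σ = 1) (h : ℕ → TSer s r) (a : ℤ → TSer s r) (n : ℤ) :
    mcut (fun p => σ ^ p • h p) (fun g => σ ^ g • a g) n = σ ^ n • mcut h a n := by
  have h0 : σ ≠ 0 := left_ne_zero_of_mul (by rw [hσ]; exact one_ne_zero)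
  ext m
  rw [map_smul, coeff_mcut_def, coeff_mcut_def, Finset.smul_sum]
  refine Finset.sum_congr rfl fun p _ => ?_
  rw [smul_mul_smul_comm, map_smul, ← zpow_natCast, ← zpow_add₀ h0]
  congr 2
  ring

lemma sg_zpow_neg (ε : Bool) (g : ℤ) : sg ε ^ (-g) = sg ε ^ g := by
  cases ε
  · rw [zpow_neg, ← inv_zpow]; simp [sg, inv_neg]
  · simp [sg]

lemma sg_ne_zero (ε : Bool) : sg ε ≠ 0 := by cases ε <;> simp [sg]

lemma wv_symZ (τ : BFock s r) (ε : Bool) (i k : Idx s r) (n : ℤ) :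
    wv ε (symZ τ ε) i k n = (rowC ε i * colS s r ε k ^ n) •
      (bB (colF ε k) (-n - 1) τ (rowW ε i) * (τ ∅)⁻¹) := by
  have hσ := colS_mul_self ε k
  have h0 : colS s r ε k ≠ 0 := left_ne_zero_of_mul (by rw [hσ]; exact one_ne_zero)
  rw [bB_eq_mcut (fun g hg => Xm_row_eq_zero τ ε i k hg), ← mcut_mul (isGraded_Hc _), mul_comm,
    mul_smul, ← mcut_smul, ← mcut_rescale hσ, wv]
  congr 1
  ext1 g
  rw [Pi.smul_apply, symZ]
  split_ifs with hg
  · obtain ⟨N, rfl⟩ : ∃ N : ℕ, g = -(N : ℤ) := ⟨(-g).toNat, by omega⟩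
    rw [neg_neg, Int.toNat_natCast, waveCoeff_eq, smul_smul, smul_smul, sg_zpow_neg, zpow_natCast,
      ← mul_assoc, ← mul_pow, sg_mul_self, one_pow, one_mul, mul_comm]
    congr 2
    rw [zpow_neg, zpow_natCast, ← inv_pow, inv_eq_of_mul_eq_one_left hσ]
  · rw [smul_zero, zero_mul, smul_zero, smul_zero]

/-- Functionals that depend on finitely many coefficients. -/
def IsLow (L : TSer s r →ₗ[ℂ] ℂ) : Prop :=
  ∃ N : ℕ, ∀ f, (∀ μ, wt μ ≤ N → MvPowerSeries.coeff μ f = 0) → L f = 0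

lemma isLow_coeff (m : Time s r →₀ ℕ) : IsLow (MvPowerSeries.coeff (R := ℂ) m) :=
  ⟨wt m, fun _ h => h m le_rfl⟩

lemma IsLow.pderiv {L : TSer s r →ₗ[ℂ] ℂ} (hL : IsLow L) (i : Time s r) :
    IsLow (L ∘ₗ (MvPowerSeries.pderiv ℂ i).toLinearMap) := by
  obtain ⟨N, hN⟩ := hL
  refine ⟨N + tdeg i, fun f hf => hN _ fun μ hμ => ?_⟩
  change MvPowerSeries.coeff μ (MvPowerSeries.pderiv ℂ i f) = 0
  rw [MvPowerSeries.coeff_pderiv, hf _ (by rw [wt_add_single]; omega), zero_mul]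

lemma IsLow.dX {L : TSer s r →ₗ[ℂ] ℂ} (hL : IsLow L) : IsLow (L ∘ₗ dX s r) := by
  obtain ⟨N, hN⟩ := hL
  refine ⟨N + 1, fun f hf => hN _ fun μ hμ => ?_⟩
  rw [dX_apply, map_sum]
  refine Finset.sum_eq_zero fun b _ => ?_
  rw [MvPowerSeries.coeff_pderiv, hf _ (by rw [wt_add_single, tdeg_time1]; omega), zero_mul]

lemma IsLow.dX_pow {L : TSer s r →ₗ[ℂ] ℂ} (hL : IsLow L) (l : ℕ) : IsLow (L ∘ₗ (MCKP.dX s r) ^ l) := by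
  induction l with
  | zero => exact hL
  | succ l ih => rw [pow_succ]; exact ih.dX

lemma IsLow.smul {L : TSer s r →ₗ[ℂ] ℂ} (hL : IsLow L) (c : ℂ) : IsLow (c • L) := by
  obtain ⟨N, hN⟩ := hL
  exact ⟨N, fun f hf => by rw [LinearMap.smul_apply, hN f hf, smul_zero]⟩

lemma coeff_mul_eq_zero_of_low {N : ℕ} {f : TSer s r}
    (hf : ∀ μ, wt μ ≤ N → MvPowerSeries.coeff μ f = 0) (u : TSer s r) (μ : Time s r →₀ ℕ)
    (hμ : wt μ ≤ N) : MvPowerSeries.coeff μ (f * u) = 0 := by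
  classical
  rw [MvPowerSeries.coeff_mul]
  refine Finset.sum_eq_zero fun x hx => ?_
  rw [Finset.HasAntidiagonal.mem_antidiagonal] at hx
  rw [hf _ ((wt_mono (hx ▸ le_self_add : x.1 ≤ μ)).trans hμ), zero_mul]

/-- The functional `τ ↦ L(τ_w u)`. -/
def rowFun (L : TSer s r →ₗ[ℂ] ℂ) (u : TSer s r) (w : Finset (Xi s r)) : BFock s r →ₗ[ℂ] ℂ :=
  L ∘ₗ LinearMap.mulRight ℂ u ∘ₗ LinearMap.proj w

lemma rowFun_apply (L : TSer s r →ₗ[ℂ] ℂ) (u : TSer s r) (w : Finset (Xi s r)) (τ : BFock s r) :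
    rowFun L u w τ = L (τ w * u) := rfl

lemma IsLow.rowFun_mem {L : TSer s r →ₗ[ℂ] ℂ} (hL : IsLow L) (u : TSer s r)
    (w : Finset (Xi s r)) : rowFun L u w ∈
      Submodule.span ℂ (Set.range fun x : Finset (Xi s r) × (Time s r →₀ ℕ) => crd x.1 x.2) := by
  classical
  obtain ⟨N, hN⟩ := hL
  refine mem_span_of_finDep _ ((finite_wt_le N).toFinset.image fun m => (w, m)) fun τ hτ => ?_
  rw [rowFun_apply]
  refine hN _ fun μ hμ => coeff_mul_eq_zero_of_low (fun μ hμ => ?_) u μ hμ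
  refine hτ (w, μ) (Finset.mem_image_of_mem _ ?_)
  rw [Set.Finite.mem_toFinset]
  exact hμ

lemma wave_pairing {τ : BFock s r} (h : BosonicCKP τ) {L L' : TSer s r →ₗ[ℂ] ℂ} (hL : IsLow L)
    (hL' : IsLow L') (i j : Idx s r) :
    ∑ᶠ n : ℤ, ∑ k : Idx s r, L (wv true (symZ τ true) i k n) *
      L' (wv false (symZ τ false) j k (-1 - n)) = 0 := by
  have h1 := pairing_fldSeq_eq_zero (b := fun φ j => bB φ j τ)
    (S := Set.range fun x : Finset (Xi s r) × (Time s r →₀ ℕ) => crd x.1 x.2)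
    (by rintro _ ⟨x, rfl⟩; exact fldSeq_crd_high _ _ _)
    (by rintro _ ⟨x, rfl⟩ _ ⟨y, rfl⟩; exact h _ _ _ _)
    (hL.rowFun_mem (τ ∅)⁻¹ (rowW true i)) (hL'.rowFun_mem (τ ∅)⁻¹ (rowW false j))
  have h2 : ∀ n : ℤ, ∑ k : Idx s r, L (wv true (symZ τ true) i k n) *
      L' (wv false (symZ τ false) j k (-1 - n)) = (rowC true i * rowC false j) •
      ∑ φ, ckpSign φ n * (fldSeq (fun φ j => bB φ j τ) (rowFun L (τ ∅)⁻¹ (rowW true i)) φ n *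
        conjSeq (fun φ j => bB φ j τ) (rowFun L' (τ ∅)⁻¹ (rowW false j)) φ (-1 - n)) := by
    intro n
    have hs : (-1 : ℂ) ^ n * (-1) ^ (-1 - n) = -1 := by
      rw [← zpow_add₀ (by norm_num)]; simp
    have hn : (-1 : ℂ) ^ (-1 - n) = (-1) ^ (n + 1) := by
      have := sg_zpow_neg false (n + 1)
      rw [← (by ring : -1 - n = -(n + 1))] at this
      simpa [sg] using this
    rw [Finset.smul_sum, Fintype.sum_sum_type, Fintype.sum_sum_type, Fintype.sum_sum_type,
      Fintype.sum_prod_type, ← add_assoc, ← Finset.sum_add_distrib]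
    congr 1
    · refine Finset.sum_congr rfl fun a _ => ?_
      simp only [wv_symZ, map_smul, smul_eq_mul, Fintype.sum_bool, fldSeq, conjSeq, rowFun_apply,
        ckpSign, Fld.conj, colF, colS, one_zpow]
      simp only [Bool.not_true, Bool.not_false, sg, if_true, Bool.false_eq_true, if_false]
      linear_combination (rowC true i * L (bB (Sum.inl (a, false)) (-n - 1) τ (rowW true i) *
        (τ ∅)⁻¹) * (rowC false j * L' (bB (Sum.inl (a, true)) (-(-1 - n) - 1) τ (rowW false j) *
        (τ ∅)⁻¹))) * hs
    · refine Finset.sum_congr rfl fun c _ => ?_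
      simp only [wv_symZ, map_smul, smul_eq_mul, fldSeq, conjSeq, rowFun_apply,
        ckpSign, Fld.conj, colF, colS, sg, if_true, Bool.false_eq_true, if_false, one_zpow, ← hn]
      ring
  rw [finsum_congr h2, ← smul_finsum]
  change _ • pairing _ _ _ = _
  rw [h1, smul_zero]

lemma sub_low {N : ℕ} {L : TSer s r →ₗ[ℂ] ℂ}
    (hN : ∀ f, (∀ μ, wt μ ≤ N → MvPowerSeries.coeff μ f = 0) → L f = 0) {f g : TSer s r}
    (h : ∀ μ, wt μ ≤ N → MvPowerSeries.coeff μ f = MvPowerSeries.coeff μ g) : L f = L g := by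
  rw [← sub_eq_zero, ← map_sub]
  exact hN _ fun μ hμ => by rw [map_sub, h μ hμ, sub_self]

lemma finsum_low {L : TSer s r →ₗ[ℂ] ℂ} (hL : IsLow L) {h : ℕ → TSer s r} (hh : IsGraded h)
    (a : ℤ → TSer s r) (n : ℤ) : ∑ᶠ p : ℕ, L (h p * a (n - p)) = L (mcut h a n) := by
  obtain ⟨N, hN⟩ := hL
  rw [sub_low hN (fun μ hμ => coeff_mcut hh a n (Nat.lt_succ_of_le hμ)), map_sum]
  refine finsum_eq_sum_of_support_subset _ fun p hp => ?_
  by_contra h0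
  rw [Finset.coe_range, Set.mem_Iio, not_lt] at h0
  exact hp (hN _ fun μ hμ => hh.coeff_mul (by omega) _)

/-- A coefficient of a shifted series. -/
def shiftFun (l : ℕ) (m : Time s r →₀ ℕ) : TSer s r →ₗ[ℂ] ℂ :=
  ((l.factorial : ℂ)⁻¹) • (MvPowerSeries.coeff m ∘ₗ (dX s r) ^ l)

lemma isLow_shiftFun (l : ℕ) (m : Time s r →₀ ℕ) : IsLow (shiftFun (s := s) (r := r) l m) :=
  ((isLow_coeff m).dX_pow l).smul _

lemma shiftFun_apply (l : ℕ) (m : Time s r →₀ ℕ) (f : TSer s r) :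
    shiftFun l m f = MvPowerSeries.coeff m (PowerSeries.coeff l (shiftX f)) := by
  rw [coeff_shiftX, map_smul]
  rfl

lemma coeff_waveV (τ : BFock s r) (ε : Bool) (i k : Idx s r) (n : ℤ) (l : ℕ) (m : Time s r →₀ ℕ) :
    MvPowerSeries.coeff m (PowerSeries.coeff l (waveV τ ε i k n)) =
      shiftFun l m (wv ε (symZ τ ε) i k n) := by
  rw [wv, ← finsum_low (isLow_shiftFun l m) (isGraded_waveK ε k)]
  have h1 : PowerSeries.coeff l (waveV τ ε i k n) = fun m => ∑ᶠ p : ℕ, MvPowerSeries.coeff m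
      (PowerSeries.coeff l (PowerSeries.coeff p (waveS ε k * waveX ε) *
        (sg ε ^ (n - p) • (waveOp τ ε).coeff (n - p) i k))) := PowerSeries.coeff_mk _ _
  refine (congrArg (MvPowerSeries.coeff m) h1).trans (finsum_congr fun p => ?_)
  rw [shiftFun_apply, shiftX_mul, shiftX_smul, coeff_waveS_mul_waveX, waveOp_coeff]

lemma waveBilinear_of_bosonicCKP {τ : BFock s r} (h : BosonicCKP τ) : WaveBilinear τ := by
  intro i j l l' m m'
  rw [← wave_pairing h (isLow_shiftFun l m) (isLow_shiftFun l' m') i j]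
  refine finsum_congr fun n => Finset.sum_congr rfl fun k _ => ?_
  rw [coeff_waveV, coeff_waveV]

/-! ## Derivatives of wave functions -/

/-- The coefficients of `∂ ∘ A`. -/
def symD (a : SymFam s r) : SymFam s r := fun g i k => a (g - 1) i k + dX s r (a g i k)

/-- The constant operator that describes the dependence of the exponential factor on a time. -/
def flowC (ε : Bool) (t : Time s r) (k : Idx s r) : ℂ :=
  tsgn (colF ε k) t * (colS s r ε k * sg ε) ^ tdeg t

/-- The coefficients of `∂A/∂t + A F`, where `F` is the constant operator of a time. -/
def symT (ε : Bool) (t : Time s r) (a : SymFam s r) : SymFam s r := fun g i k =>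
  MvPowerSeries.pderiv ℂ t (a g i k) + flowC ε t k • a (g - tdeg t) i k

lemma wv_symT (ε : Bool) (t : Time s r) (a : SymFam s r) (i k : Idx s r) (n : ℤ) :
    wv ε (symT ε t a) i k n = MvPowerSeries.pderiv ℂ t (wv ε a i k n) := by
  rw [wv, wv, pderiv_mcut (isGraded_waveK ε k) (pderiv_waveK ε k t)]
  congr 1
  ext1 g
  rw [symT, smul_add, Derivation.map_smul, flowC, smul_smul, smul_smul]
  congr 2
  rw [mul_pow, zpow_sub₀ (sg_ne_zero ε), zpow_natCast, div_eq_mul_inv, ← inv_pow,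
    inv_eq_of_mul_eq_one_left (sg_mul_self ε)]
  ring

lemma sum_flowC_time1 (ε : Bool) (k : Idx s r) : ∑ b : Cmp s r, flowC ε (time1 b) k = 1 := by
  rw [Finset.sum_eq_single (colF ε k).cmp]
  · have := sg_mul_self ε
    rcases k with b | b | c <;>
      simp [flowC, tsgn, colF, Fld.cmp, Fld.sgn, colS, sg_not', this]
  · intro b _ hb
    rw [flowC, tsgn, tcmp_time1, if_neg hb, zero_mul]
  · simp

lemma wv_symD (ε : Bool) (a : SymFam s r) (i k : Idx s r) (n : ℤ) :
    wv ε (symD a) i k n = dX s r (wv ε a i k n) := by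
  rw [dX_apply]
  simp only [← wv_symT]
  simp only [wv]
  rw [← mcut_sum]
  congr 1
  ext1 g
  rw [Finset.sum_apply, ← Finset.smul_sum, symD, dX_apply]
  congr 1
  simp only [symT, tdeg_time1, Finset.sum_add_distrib, ← Finset.sum_smul]
  rw [sum_flowC_time1, one_smul, add_comm, Nat.cast_one]

/-- The family has an upper bound for its non-zero coefficients. -/
def SymFam.Bdd (a : SymFam s r) : Prop := ∃ N : ℤ, ∀ g, N < g → ∀ i k, a g i k = 0

lemma symZ_bdd (τ : BFock s r) (ε : Bool) : (symZ τ ε).Bdd :=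
  ⟨0, fun g hg i k => if_neg (by omega)⟩

lemma SymFam.Bdd.symD {a : SymFam s r} (h : a.Bdd) : (symD a).Bdd := by
  obtain ⟨N, hN⟩ := h
  exact ⟨N + 1, fun g hg i k => by rw [MCKP.symD, hN _ (by omega), hN _ (by omega), map_zero, add_zero]⟩

lemma SymFam.Bdd.symT {a : SymFam s r} (h : a.Bdd) (ε : Bool) (t : Time s r) :
    (symT ε t a).Bdd := by
  obtain ⟨N, hN⟩ := h
  exact ⟨N + tdeg t, fun g hg i k => by
    rw [MCKP.symT, hN _ (by omega), hN _ (by omega), map_zero, smul_zero, add_zero]⟩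

lemma SymFam.Bdd.iterate {a : SymFam s r} (h : a.Bdd) (l : ℕ) : (MCKP.symD^[l] a).Bdd := by
  induction l with
  | zero => exact h
  | succ l ih => rw [Function.iterate_succ_apply']; exact ih.symD

lemma wv_iterate_symD (ε : Bool) (a : SymFam s r) (l : ℕ) (i k : Idx s r) (n : ℤ) :
    wv ε (symD^[l] a) i k n = ((dX s r) ^ l) (wv ε a i k n) := by
  induction l with
  | zero => rfl
  | succ l ih => rw [Function.iterate_succ_apply', wv_symD, ih, pow_succ']; rfl

/-- The bilinear identity on the diagonal. -/
lemma residue_eq_zero {a b : SymFam s r} (ha : a.Bdd) (hb : b.Bdd) (i j : Idx s r)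
    (h : ∀ m m' : Time s r →₀ ℕ, ∑ᶠ n : ℤ, ∑ k : Idx s r,
      MvPowerSeries.coeff m (wv true a i k n) * MvPowerSeries.coeff m' (wv false b j k (-1 - n)) = 0) :
    ∑ k : Idx s r, ∑ᶠ g : ℤ, a g i k * ((-1 : ℂ) ^ (-1 - g) • b (-1 - g) j k) = 0 := by
  obtain ⟨N, hN⟩ := ha
  obtain ⟨N', hN'⟩ := hb
  ext M
  have h1 : ∀ k : Idx s r, MvPowerSeries.coeff M
      (∑ᶠ g : ℤ, a g i k * ((-1 : ℂ) ^ (-1 - g) • b (-1 - g) j k)) =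
      ∑ x ∈ Finset.HasAntidiagonal.antidiagonal M, ∑ᶠ n : ℤ,
        MvPowerSeries.coeff x.1 (wv true a i k n) *
        MvPowerSeries.coeff x.2 (wv false b j k (-1 - n)) := by
    intro k
    have h2 := mcut_mul_mcut (isGraded_waveK true k) (isGraded_waveK false k) (waveK_inv k)
      (a := fun g => sg true ^ g • a g i k) (b := fun g => sg false ^ g • b g j k) (N := N) (N' := N')
      (fun g hg => by rw [hN g hg, smul_zero]) (fun g hg => by rw [hN' g hg, smul_zero]) M
    have h3 : (fun g : ℤ => a g i k * ((-1 : ℂ) ^ (-1 - g) • b (-1 - g) j k)) =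
        fun g => (sg true ^ g • a g i k) * (sg false ^ (-1 - g) • b (-1 - g) j k) := by
      ext1 g; simp [sg]
    rw [h3]
    exact h2.symm
  have hfin : ∀ (x : (Time s r →₀ ℕ) × (Time s r →₀ ℕ)), ∀ k : Idx s r, (Function.support fun n : ℤ =>
      MvPowerSeries.coeff x.1 (wv true a i k n) *
        MvPowerSeries.coeff x.2 (wv false b j k (-1 - n))).Finite := by
    intro x k
    refine (Set.finite_Icc (-1 - (N' + wt x.2)) (N + wt x.1)).subset fun n hn => ?_
    by_contra h0
    rw [Set.mem_Icc, not_and_or, not_le, not_le] at h0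
    refine hn ?_
    simp only
    rcases h0 with h0 | h0
    · rw [wv, wv, coeff_mcut_eq_zero (a := fun g => sg false ^ g • b g j k)
        (fun g hg => by rw [hN' g hg, smul_zero]) (by omega), mul_zero]
    · rw [wv, wv, coeff_mcut_eq_zero (a := fun g => sg true ^ g • a g i k)
        (fun g hg => by rw [hN g hg, smul_zero]) (by omega), zero_mul]
  rw [map_sum, Finset.sum_congr rfl fun k _ => h1 k, Finset.sum_comm, map_zero]
  refine Finset.sum_eq_zero fun x _ => ?_
  rw [← h x.1 x.2, finsum_sum_comm' _ _ fun k _ => hfin x k]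

lemma residue_wave {τ : BFock s r} (h : BosonicCKP τ) (i j : Idx s r) (l : ℕ) :
    ∑ k : Idx s r, ∑ᶠ g : ℤ, symZ τ true g i k *
      ((-1 : ℂ) ^ (-1 - g) • symD^[l] (symZ τ false) (-1 - g) j k) = 0 := by
  refine residue_eq_zero (symZ_bdd τ true) ((symZ_bdd τ false).iterate l) i j fun m m' => ?_
  rw [← wave_pairing h (isLow_coeff m) ((isLow_coeff m').dX_pow l) i j]
  refine finsum_congr fun n => Finset.sum_congr rfl fun k _ => ?_
  rw [wv_iterate_symD]
  rfl

lemma residue_symT_wave {τ : BFock s r} (h : BosonicCKP τ) (t : Time s r) (i j : Idx s r) (l : ℕ) :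
    ∑ k : Idx s r, ∑ᶠ g : ℤ, symT true t (symZ τ true) g i k *
      ((-1 : ℂ) ^ (-1 - g) • symD^[l] (symZ τ false) (-1 - g) j k) = 0 := by
  refine residue_eq_zero ((symZ_bdd τ true).symT true t) ((symZ_bdd τ false).iterate l) i j
    fun m m' => ?_
  rw [← wave_pairing h ((isLow_coeff m).pderiv t) ((isLow_coeff m').dX_pow l) i j]
  refine finsum_congr fun n => Finset.sum_congr rfl fun k _ => ?_
  rw [wv_iterate_symD, wv_symT]
  rfl

end MCKP
end

noncomputable section
namespace MCKP

variable {s r : ℕ}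

/-- The `l`-th `x`-derivative of matrices as an additive map. -/
def dxHom (l : ℕ) : Mat s r →+ Mat s r where
  toFun := dx l
  map_zero' := by ext1 i j; simp [dx, iterate_map_zero]
  map_add' M N := by ext1 i j; simp [dx, iterate_map_add]

lemma dxHom_apply (l : ℕ) (M : Mat s r) : dxHom l M = dx l M := rfl

@[simp] lemma dx_null (l : ℕ) : dx l (0 : Mat s r) = 0 := map_zero (dxHom l)

lemma dx_add (l : ℕ) (M N : Mat s r) : dx l (M + N) = dx l M + dx l N := map_add (dxHom l) M N

lemma dx_zsmul (l : ℕ) (z : ℤ) (M : Mat s r) : dx l (z • M) = z • dx l M := map_zsmul (dxHom l) z M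

lemma dx_sum {ι : Type*} (l : ℕ) (S : Finset ι) (f : ι → Mat s r) :
    dx l (∑ i ∈ S, f i) = ∑ i ∈ S, dx l (f i) := map_sum (dxHom l) f S

@[simp] lemma dx_zero_left (M : Mat s r) : dx 0 M = M := rfl

lemma dx_dx (a b : ℕ) (M : Mat s r) : dx a (dx b M) = dx (a + b) M := by
  ext1 i j
  simp [dx, Function.iterate_add_apply]

lemma dx_transpose (l : ℕ) (M : Mat s r) : dx l M.transpose = (dx l M).transpose := rfl

lemma dx_one_mul (M N : Mat s r) : dx 1 (M * N) = dx 1 M * N + M * dx 1 N := by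
  ext1 i j
  simp only [dx, Function.iterate_one, Matrix.map_apply, Matrix.add_apply, Matrix.mul_apply,
    map_sum, Derivation.leibniz, smul_eq_mul, ← Finset.sum_add_distrib]
  exact Finset.sum_congr rfl fun k _ => by ring

lemma dx_mul (l : ℕ) (M N : Mat s r) : dx l (M * N) =
    ∑ p ∈ Finset.HasAntidiagonal.antidiagonal l, l.choose p.1 • (dx p.1 M * dx p.2 N) := by
  induction l with
  | zero => simp
  | succ l ih =>
    rw [Finset.sum_antidiagonal_choose_succ_nsmul (fun a b => dx a M * dx b N) l, add_comm l,
      ← dx_dx, ih, dx_sum, ← Finset.sum_add_distrib]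
    refine Finset.sum_congr rfl fun p _ => ?_
    rw [← dxHom_apply, map_nsmul, dxHom_apply, dx_one_mul, dx_dx, dx_dx, smul_add, add_comm 1,
      add_comm 1, add_comm]
    rw [Finset.HasAntidiagonal.mem_antidiagonal] at *
    rw [Nat.choose_symm_of_eq_add (by omega : l = p.1 + p.2)]

namespace PDO

@[ext] lemma ext {P Q : PDO s r} (h : ∀ n, P.coeff n = Q.coeff n) : P = Q :=
  Subtype.ext (funext h)

@[simp] lemma coeff_zero (n : ℤ) : (0 : PDO s r).coeff n = 0 := rfl
@[simp] lemma coeff_add (P Q : PDO s r) (n : ℤ) : (P + Q).coeff n = P.coeff n + Q.coeff n := rfl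
@[simp] lemma coeff_neg (P : PDO s r) (n : ℤ) : (-P).coeff n = -P.coeff n := rfl
@[simp] lemma coeff_sub (P Q : PDO s r) (n : ℤ) : (P - Q).coeff n = P.coeff n - Q.coeff n := rfl

/-- The coefficient as an additive map. -/
def coeffHom (n : ℤ) : PDO s r →+ Mat s r where
  toFun P := P.coeff n
  map_zero' := rfl
  map_add' _ _ := rfl

lemma coeff_single (k : ℤ) (M : Mat s r) (n : ℤ) : (single k M).coeff n = if n = k then M else 0 := by
  change (Pi.single k M : ℤ → Mat s r) n = _
  rw [Pi.single_apply]

/-- All coefficients of `∂^k`, `k ≥ m`, vanish. -/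
def Low (m : ℤ) (P : PDO s r) : Prop := ∀ k, m ≤ k → P.coeff k = 0

lemma exists_low (P : PDO s r) : ∃ m, P.Low m := by
  obtain ⟨N, hN⟩ := P.2
  exact ⟨N + 1, fun k hk => hN k (by omega)⟩

lemma low_single (k : ℤ) (M : Mat s r) : (single k M).Low (k + 1) := fun n hn => by
  rw [coeff_single, if_neg (by omega)]

lemma single_add (k : ℤ) (M N : Mat s r) : single k (M + N) = single k M + single k N := by
  ext1 n
  rw [coeff_add, coeff_single, coeff_single, coeff_single]
  split_ifs <;> simp

/-- An additive map that kills the operators of low order and all monomials vanishes. -/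
lemma addHom_eq_zero {G : Type*} [AddCommGroup G] (Φ : PDO s r →+ G) (m : ℤ)
    (hm : ∀ P, P.Low m → Φ P = 0) (hs : ∀ k M, Φ (single k M) = 0) (P : PDO s r) : Φ P = 0 := by
  obtain ⟨N, hN⟩ := P.exists_low
  have key : ∀ d : ℕ, ∀ P : PDO s r, P.Low (m + d) → Φ P = 0 := by
    intro d
    induction d with
    | zero => exact fun P hP => hm P (by simpa using hP)
    | succ d ih =>
      intro P hP
      have h1 : (P - single (m + d) (P.coeff (m + d))).Low (m + d) := by
        intro k hk
        rw [coeff_sub, coeff_single]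
        split_ifs with h
        · rw [h, sub_self]
        · rw [hP k (by push_cast; omega), sub_zero]
      rw [← sub_add_cancel P (single (m + d) (P.coeff (m + d))), map_add, ih _ h1, hs, add_zero]
  exact key (N - m).toNat P fun k hk => hN k (by omega)

lemma mul_coeff_def (P Q : PDO s r) (n : ℤ) : (P * Q).coeff n = ∑ᶠ il : ℤ × ℕ,
    Ring.choose il.1 il.2 • (P.coeff il.1 * dx il.2 (Q.coeff (n - il.1 + il.2))) := rfl

lemma finite_support_mul (P Q : PDO s r) (n : ℤ) : (Function.support fun il : ℤ × ℕ =>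
    Ring.choose il.1 il.2 • (P.coeff il.1 * dx il.2 (Q.coeff (n - il.1 + il.2)))).Finite := by
  obtain ⟨N, hN⟩ := P.exists_low
  obtain ⟨N', hN'⟩ := Q.exists_low
  refine ((Set.finite_Icc (n - N') N).prod (Set.finite_Iio (N + N' - n).toNat)).subset fun il h => ?_
  by_contra h0
  refine h ?_
  simp only
  by_cases h1 : N ≤ il.1
  · rw [hN _ h1, zero_mul, smul_zero]
  · by_cases h2 : N' ≤ n - il.1 + il.2
    · rw [hN' _ h2, dx_null, mul_zero, smul_zero]
    · exact absurd ⟨⟨by omega, by omega⟩, by rw [Set.mem_Iio]; omega⟩ h0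

lemma Low.mul {a b : ℤ} {P Q : PDO s r} (hP : P.Low a) (hQ : Q.Low b) : (P * Q).Low (a + b - 1) := by
  intro n hn
  rw [mul_coeff_def]
  refine finsum_eq_zero_of_forall_eq_zero fun il => ?_
  by_cases h1 : a ≤ il.1
  · rw [hP _ h1, zero_mul, smul_zero]
  · rw [hQ _ (by omega), dx_null, mul_zero, smul_zero]

instance : NonUnitalNonAssocRing (PDO s r) :=
  { (inferInstance : AddCommGroup (PDO s r)), (inferInstance : Mul (PDO s r)) with
    left_distrib := fun P Q R => by
      ext1 n
      rw [coeff_add, mul_coeff_def, mul_coeff_def, mul_coeff_def,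
        ← finsum_add_distrib (finite_support_mul P Q n) (finite_support_mul P R n)]
      simp only [coeff_add, dx_add, mul_add, smul_add]
    right_distrib := fun P Q R => by
      ext1 n
      rw [coeff_add, mul_coeff_def, mul_coeff_def, mul_coeff_def,
        ← finsum_add_distrib (finite_support_mul P R n) (finite_support_mul Q R n)]
      simp only [coeff_add, add_mul, smul_add]
    zero_mul := fun P => by
      ext1 n
      rw [mul_coeff_def]
      exact finsum_eq_zero_of_forall_eq_zero fun il => by simp
    mul_zero := fun P => by
      ext1 n
      rw [mul_coeff_def]
      exact finsum_eq_zero_of_forall_eq_zero fun il => by simp }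

/-- `Ring.choose i l`, extended by zero to negative `l`. -/
def cz (i l : ℤ) : ℤ := if 0 ≤ l then Ring.choose i l.toNat else 0

lemma cz_natCast (i : ℤ) (l : ℕ) : cz i l = Ring.choose i l := by simp [cz]

lemma cz_of_neg (i : ℤ) {l : ℤ} (h : l < 0) : cz i l = 0 := if_neg (by omega)

lemma single_mul_single (i j : ℤ) (A B : Mat s r) (n : ℤ) : (single i A * single j B).coeff n =
    cz i (i + j - n) • (A * dx (i + j - n).toNat B) := by
  rw [mul_coeff_def, finsum_eq_single _ (i, (i + j - n).toNat)]
  · by_cases h : 0 ≤ i + j - n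
    · rw [cz, if_pos h]
      simp only [coeff_single, if_pos (by omega : n - i + ((i + j - n).toNat : ℤ) = j), if_true]
    · rw [cz, if_neg h]
      simp only [coeff_single, if_neg (by omega : ¬ n - i + ((i + j - n).toNat : ℤ) = j), dx_null,
        mul_zero, smul_zero, zero_smul]
  · rintro ⟨i', l⟩ h
    simp only [coeff_single]
    split_ifs with h1 h2
    · refine absurd ?_ h
      subst h1
      ext1 <;> simp; omega
    all_goals simp

lemma single_mul (i : ℤ) (A : Mat s r) (Q : PDO s r) (n : ℤ) : (single i A * Q).coeff n =
    ∑ᶠ l : ℕ, Ring.choose i l • (A * dx l (Q.coeff (n - i + l))) := by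
  rw [mul_coeff_def, finsum_curry _ (finite_support_mul _ _ _), finsum_eq_single _ i]
  · simp only [coeff_single, if_true]
  · intro i' h
    exact finsum_eq_zero_of_forall_eq_zero fun l => by simp [coeff_single, h]

lemma mul_single (k : ℤ) (P : PDO s r) (C : Mat s r) (n : ℤ) : (P * single k C).coeff n =
    ∑ᶠ l : ℕ, Ring.choose (n + l - k) l • (P.coeff (n + l - k) * dx l C) := by
  rw [mul_coeff_def]
  rw [← finsum_comp_equiv (Equiv.prodComm ℕ ℤ), finsum_curry]
  · refine finsum_congr fun l => ?_
    rw [finsum_eq_single _ (n + l - k)]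
    · simp only [Equiv.prodComm_apply, Prod.swap_prod_mk]
      rw [coeff_single, if_pos (by omega)]
    · intro i h
      simp only [Equiv.prodComm_apply, Prod.swap_prod_mk, coeff_single]
      rw [if_neg (by omega), dx_null, mul_zero, smul_zero]
  · exact (finite_support_mul P (single k C) n).preimage (Equiv.injective _).injOn

lemma sum_triple {G : Type*} [AddCommMonoid G] (L : ℕ) (f : ℕ → ℕ → ℕ → G) :
    ∑ p ∈ Finset.HasAntidiagonal.antidiagonal L,
      ∑ q ∈ Finset.HasAntidiagonal.antidiagonal p.1, f q.1 q.2 p.2 =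
    ∑ p ∈ Finset.HasAntidiagonal.antidiagonal L,
      ∑ q ∈ Finset.HasAntidiagonal.antidiagonal p.2, f p.1 q.1 q.2 := by
  rw [Finset.sum_sigma', Finset.sum_sigma']
  refine Finset.sum_nbij' (fun x => ⟨(x.2.1, x.2.2 + x.1.2), (x.2.2, x.1.2)⟩)
    (fun x => ⟨(x.1.1 + x.2.1, x.2.2), (x.1.1, x.2.1)⟩) ?_ ?_ ?_ ?_ ?_
  all_goals
    rintro ⟨⟨a, b⟩, ⟨c, d⟩⟩ h
    simp only [Finset.mem_sigma, Finset.HasAntidiagonal.mem_antidiagonal] at h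
    obtain ⟨h1, h2⟩ := h
    have h3 : a + b = L := h1
    subst h2
  · simp only [Finset.mem_sigma, Finset.HasAntidiagonal.mem_antidiagonal, and_true]
    omega
  · simp only [Finset.mem_sigma, Finset.HasAntidiagonal.mem_antidiagonal, and_true]
    omega
  · rfl
  · rfl
  · rfl

lemma leibniz_vandermonde (i j : ℤ) (L : ℕ) (B C : Mat s r) :
    ∑ p ∈ Finset.HasAntidiagonal.antidiagonal L,
      (Ring.choose i p.1 * Ring.choose (i + j - p.1) p.2) • (dx p.1 B * dx p.2 C) =
    ∑ p ∈ Finset.HasAntidiagonal.antidiagonal L,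
      (Ring.choose i p.1 * Ring.choose j p.2) • dx p.1 (B * dx p.2 C) := by
  have h1 : ∀ p : ℕ × ℕ, (Ring.choose i p.1 * Ring.choose j p.2) • dx p.1 (B * dx p.2 C) =
      ∑ q ∈ Finset.HasAntidiagonal.antidiagonal p.1, (fun u v e =>
        (Ring.choose i u * (Ring.choose (i - u) v * Ring.choose j e)) • (dx u B * dx (v + e) C))
        q.1 q.2 p.2 := by
    intro p
    rw [_root_.MCKP.dx_mul, Finset.smul_sum]
    refine Finset.sum_congr rfl fun q hq => ?_
    rw [Finset.HasAntidiagonal.mem_antidiagonal] at hq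
    have h2 := Ring.choose_smul_choose i (show q.1 ≤ p.1 by omega)
    rw [show p.1 - q.1 = q.2 by omega, nsmul_eq_mul] at h2
    rw [dx_dx, ← natCast_zsmul, smul_smul]
    congr 1
    linear_combination Ring.choose j p.2 * h2
  rw [Finset.sum_congr rfl fun p _ => h1 p]
  refine Eq.trans ?_ (sum_triple L (fun u v e => (Ring.choose i u *
    (Ring.choose (i - u) v * Ring.choose j e)) • (dx u B * dx (v + e) C))).symm
  refine Finset.sum_congr rfl fun p _ => ?_
  rw [show i + j - p.1 = (i - p.1) + j by ring, Ring.add_choose_eq _ (Commute.all _ _),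
    Finset.mul_sum, Finset.sum_smul]
  refine Finset.sum_congr rfl fun q hq => ?_
  rw [Finset.HasAntidiagonal.mem_antidiagonal] at hq
  simp only [hq]

lemma finsum_of_low {G : Type*} [AddCommMonoid G] (f : ℕ → G) (L : ℕ) (h : ∀ l, L < l → f l = 0) :
    ∑ᶠ l, f l = ∑ p ∈ Finset.HasAntidiagonal.antidiagonal L, f p.2 := by
  rw [finsum_eq_sum_of_support_subset _ (s := Finset.range (L + 1)),
    Finset.Nat.sum_antidiagonal_eq_sum_range_succ_mk]
  · exact (Finset.sum_range_reflect f (L + 1)).symm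
  · intro l hl
    by_contra h0
    exact hl (h l (by simpa using h0))

lemma single_mul_assoc (i j k : ℤ) (A B C : Mat s r) :
    single i A * single j B * single k C = single i A * (single j B * single k C) := by
  ext1 n
  rw [mul_single, single_mul]
  simp only [single_mul_single]
  by_cases hL : i + j + k - n < 0
  · rw [finsum_eq_zero_of_forall_eq_zero, finsum_eq_zero_of_forall_eq_zero]
    · intro l
      rw [cz_of_neg _ (by omega), zero_smul, dx_null, mul_zero, smul_zero]
    · intro l
      rw [cz_of_neg _ (by omega), zero_smul, zero_mul, smul_zero]
  · obtain ⟨L, hL'⟩ := Int.eq_ofNat_of_zero_le (not_lt.1 hL)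
    have h1 := congrArg (A * ·) (leibniz_vandermonde i j L B C)
    simp only [Finset.mul_sum] at h1
    rw [finsum_of_low _ L, finsum_of_low _ L, ← Finset.Nat.sum_antidiagonal_swap (n := L)
      (f := fun p => Ring.choose i p.2 • _)]
    · convert h1 using 1
      · refine Finset.sum_congr rfl fun p hp => ?_
        rw [Finset.HasAntidiagonal.mem_antidiagonal] at hp
        rw [show i + j - (n + (p.2 : ℤ) - k) = (p.1 : ℕ) by omega,
          show n + (p.2 : ℤ) - k = i + j - p.1 by omega, cz_natCast, Int.toNat_natCast,
          smul_mul_assoc, smul_smul, mul_smul_comm, mul_assoc, mul_comm (Ring.choose i p.1)]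
      · refine Finset.sum_congr rfl fun p hp => ?_
        rw [Finset.HasAntidiagonal.mem_antidiagonal] at hp
        simp only [Prod.snd_swap]
        rw [show j + k - (n - i + (p.1 : ℤ)) = (p.2 : ℕ) by omega, cz_natCast, Int.toNat_natCast,
          dx_zsmul, mul_smul_comm, smul_smul, mul_smul_comm]
    · intro l hl
      rw [cz_of_neg _ (by omega), zero_smul, dx_null, mul_zero, smul_zero]
    · intro l hl
      rw [cz_of_neg _ (by omega), zero_smul, zero_mul, smul_zero]

end PDO

end MCKP
end

noncomputable section
namespace MCKP

variable {s r : ℕ}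

namespace PDO

/-- Additive maps that shift the order by a bounded amount are determined by the monomials. -/
lemma addHom_ext (Φ Ψ : PDO s r →+ PDO s r) (c : ℤ) (hΦ : ∀ m P, P.Low m → (Φ P).Low (m + c))
    (hΨ : ∀ m P, P.Low m → (Ψ P).Low (m + c)) (hs : ∀ k M, Φ (single k M) = Ψ (single k M))
    (P : PDO s r) : Φ P = Ψ P := by
  ext1 n
  refine sub_eq_zero.1 (addHom_eq_zero ((coeffHom n).comp (Φ - Ψ)) (n - c) (fun P hP => ?_)
    (fun k M => ?_) P)
  · change (Φ P).coeff n - (Ψ P).coeff n = 0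
    rw [hΦ _ P hP n (by omega), hΨ _ P hP n (by omega), sub_zero]
  · change (Φ (single k M)).coeff n - (Ψ (single k M)).coeff n = 0
    rw [hs, sub_self]

lemma Low.mono {a b : ℤ} {P : PDO s r} (h : P.Low a) (hab : a ≤ b) : P.Low b :=
  fun k hk => h k (hab.trans hk)

protected lemma mul_assoc (P Q R : PDO s r) : P * Q * R = P * (Q * R) := by
  obtain ⟨b, hQ⟩ := Q.exists_low
  obtain ⟨c, hR⟩ := R.exists_low
  refine addHom_ext ((AddMonoidHom.mulRight R).comp (AddMonoidHom.mulRight Q))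
    (AddMonoidHom.mulRight (Q * R)) (b + c - 2)
    (fun m P hP => ((hP.mul hQ).mul hR).mono (by omega))
    (fun m P hP => (hP.mul (hQ.mul hR)).mono (by omega)) (fun i A => ?_) P
  refine addHom_ext ((AddMonoidHom.mulRight R).comp (AddMonoidHom.mulLeft (single i A)))
    ((AddMonoidHom.mulLeft (single i A)).comp (AddMonoidHom.mulRight R)) (i + c - 1)
    (fun m P hP => (((low_single i A).mul hP).mul hR).mono (by omega))
    (fun m P hP => ((low_single i A).mul (hP.mul hR)).mono (by omega)) (fun j B => ?_) Q
  exact addHom_ext (AddMonoidHom.mulLeft (single i A * single j B))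
    ((AddMonoidHom.mulLeft (single i A)).comp (AddMonoidHom.mulLeft (single j B))) (i + j)
    (fun m P hP => (((low_single i A).mul (low_single j B)).mul hP).mono (by omega))
    (fun m P hP => ((low_single i A).mul ((low_single j B).mul hP)).mono (by omega))
    (fun k C => single_mul_assoc i j k A B C) R

lemma one_def : (1 : PDO s r) = single 0 1 := rfl

lemma choose_zero_left (l : ℕ) : Ring.choose (0 : ℤ) l = if l = 0 then 1 else 0 :=
  Ring.choose_zero_ite ℤ l

lemma single_zero_mul_coeff (M : Mat s r) (P : PDO s r) (n : ℤ) :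
    (single 0 M * P).coeff n = M * P.coeff n := by
  rw [single_mul, finsum_eq_single _ 0 fun l hl => by rw [choose_zero_left, if_neg hl, zero_smul]]
  simp

/-- The derivatives of a matrix with constant entries vanish. -/
def IsConst (M : Mat s r) : Prop := dx 1 M = 0

lemma IsConst.dx_eq_zero {M : Mat s r} (h : IsConst M) {l : ℕ} (hl : l ≠ 0) : dx l M = 0 := by
  obtain ⟨k, rfl⟩ := Nat.exists_eq_succ_of_ne_zero hl
  rw [Nat.succ_eq_add_one, ← dx_dx, h, dx_null]

lemma mul_single_coeff {C : Mat s r} (h : IsConst C) (k : ℤ) (P : PDO s r) (n : ℤ) :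
    (P * single k C).coeff n = P.coeff (n - k) * C := by
  rw [mul_single, finsum_eq_single _ 0 fun l hl => by rw [h.dx_eq_zero hl, mul_zero, smul_zero]]
  simp

lemma isConst_one : IsConst (1 : Mat s r) := by
  have h := dx_one_mul (1 : Mat s r) 1
  rw [mul_one, one_mul, mul_one] at h
  exact left_eq_add.1 h

instance : Ring (PDO s r) :=
  { (inferInstance : NonUnitalNonAssocRing (PDO s r)), (inferInstance : One (PDO s r)) with
    mul_assoc := PDO.mul_assoc
    one_mul := fun P => by ext1 n; rw [one_def, single_zero_mul_coeff, one_mul]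
    mul_one := fun P => by ext1 n; rw [one_def, mul_single_coeff isConst_one, mul_one, sub_zero]
    npow := fun n P => npow P n
    npow_zero := fun _ => rfl
    npow_succ := fun _ _ => rfl }

lemma single_mul_single_const {C : Mat s r} (h : IsConst C) (i j : ℤ) (A : Mat s r) :
    single i A * single j C = single (i + j) (A * C) := by
  ext1 n
  rw [mul_single_coeff h, coeff_single, coeff_single]
  by_cases h1 : n = i + j
  · rw [if_pos h1, if_pos (by omega)]
  · rw [if_neg h1, if_neg (by omega), zero_mul]

/-- The power `∂^k`. -/
def del (k : ℤ) : PDO s r := single k 1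

lemma del_mul_del (i j : ℤ) : (del i * del j : PDO s r) = del (i + j) := by
  rw [del, del, single_mul_single_const isConst_one, mul_one, del]

lemma del_zero : (del 0 : PDO s r) = 1 := rfl

lemma single_eq (k : ℤ) (M : Mat s r) : single k M = single 0 M * del k := by
  rw [del, single_mul_single_const isConst_one, zero_add, mul_one]

lemma del_one_mul_coeff (P : PDO s r) (n : ℤ) :
    (del 1 * P).coeff n = P.coeff (n - 1) + dx 1 (P.coeff n) := by
  rw [del, single_mul, finsum_eq_sum_of_support_subset _ (s := {0, 1}), Finset.sum_pair (by simp)]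
  · simp
  · intro l hl
    by_contra h0
    refine hl ?_
    simp only [Finset.coe_insert, Finset.coe_singleton, Set.mem_insert_iff, Set.mem_singleton_iff,
      not_or] at h0
    simp only
    rw [show (1 : ℤ) = ((1 : ℕ) : ℤ) by rfl, Ring.choose_natCast, Nat.choose_eq_zero_of_lt (by omega)]
    simp

lemma adj_coeff_def (P : PDO s r) (n : ℤ) : P.adj.coeff n = ∑ᶠ l : ℕ,
    (((n + l).negOnePow : ℤ) * Ring.choose (n + l) l) • dx l (P.coeff (n + l)).transpose := rfl

lemma finite_support_adj (P : PDO s r) (n : ℤ) : (Function.support fun l : ℕ =>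
    (((n + l).negOnePow : ℤ) * Ring.choose (n + l) l) •
      dx l (P.coeff (n + l)).transpose).Finite := by
  obtain ⟨N, hN⟩ := P.exists_low
  refine (Set.finite_Iio (N - n).toNat).subset fun l hl => ?_
  by_contra h0
  rw [Set.mem_Iio] at h0
  exact hl (by simp only; rw [hN _ (by omega), Matrix.transpose_zero, dx_null, smul_zero])

/-- The formal adjoint as an additive map. -/
def adjHom : PDO s r →+ PDO s r := AddMonoidHom.mk' adj fun P Q => by
  ext1 n
  rw [coeff_add, adj_coeff_def, adj_coeff_def, adj_coeff_def,
    ← finsum_add_distrib (finite_support_adj P n) (finite_support_adj Q n)]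
  simp only [coeff_add, Matrix.transpose_add, dx_add, smul_add]

lemma Low.adj {m : ℤ} {P : PDO s r} (h : P.Low m) : P.adj.Low m := by
  intro n hn
  rw [adj_coeff_def]
  refine finsum_eq_zero_of_forall_eq_zero fun l => ?_
  rw [h _ (by omega), Matrix.transpose_zero, dx_null, smul_zero]

lemma adj_single (i : ℤ) (A : Mat s r) :
    (single i A).adj = (i.negOnePow : ℤ) • (del i * single 0 A.transpose) := by
  ext1 n
  have h1 : ((i.negOnePow : ℤ) • (del i * single 0 A.transpose : PDO s r)).coeff n =
      (i.negOnePow : ℤ) • (del i * single 0 A.transpose : PDO s r).coeff n :=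
    map_zsmul (coeffHom n) _ _
  rw [h1, del, single_mul_single, adj_coeff_def, add_zero, one_mul]
  by_cases h : 0 ≤ i - n
  · rw [finsum_eq_single _ (i - n).toNat]
    · rw [show n + ((i - n).toNat : ℤ) = i by omega, coeff_single, if_pos rfl, cz, if_pos h, smul_smul]
    · intro l hl
      rw [coeff_single, if_neg (by omega), Matrix.transpose_zero, dx_null, smul_zero]
  · rw [cz, if_neg h, zero_smul, smul_zero]
    refine finsum_eq_zero_of_forall_eq_zero fun l => ?_
    rw [coeff_single, if_neg (by omega), Matrix.transpose_zero, dx_null, smul_zero]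

lemma adj_zsmul (z : ℤ) (P : PDO s r) : (z • P).adj = z • P.adj := map_zsmul adjHom z P
lemma adj_add (P Q : PDO s r) : (P + Q).adj = P.adj + Q.adj := map_add adjHom P Q
lemma adj_sub (P Q : PDO s r) : (P - Q).adj = P.adj - Q.adj := map_sub adjHom P Q

lemma adj_single_zero (A : Mat s r) : (single 0 A).adj = single 0 A.transpose := by
  rw [adj_single, del_zero, one_mul, Int.negOnePow_zero, Units.val_one, one_smul]

lemma adj_del (i : ℤ) : (del i : PDO s r).adj = (i.negOnePow : ℤ) • del i := by
  rw [del, adj_single, Matrix.transpose_one, ← one_def, mul_one, del]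

lemma adj_single_zero_mul (A : Mat s r) (P : PDO s r) :
    (single 0 A * P).adj = P.adj * single 0 A.transpose := by
  refine addHom_ext (adjHom.comp (AddMonoidHom.mulLeft (single 0 A)))
    ((AddMonoidHom.mulRight (single 0 A.transpose)).comp adjHom) 0
    (fun m P hP => (((low_single 0 A).mul hP).adj).mono (by omega))
    (fun m P hP => (hP.adj.mul (low_single 0 _)).mono (by omega)) (fun k C => ?_) P
  change (single 0 A * single k C).adj = (single k C).adj * single 0 A.transpose
  have h1 : single 0 A * single k C = single k (A * C) := by
    ext1 n
    rw [single_zero_mul_coeff, coeff_single, coeff_single]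
    split_ifs <;> simp
  have h2 : single 0 C.transpose * single 0 A.transpose = single 0 (A * C).transpose := by
    ext1 n
    rw [single_zero_mul_coeff, coeff_single, coeff_single, Matrix.transpose_mul]
    split_ifs <;> simp
  rw [h1, adj_single, adj_single, smul_mul_assoc, mul_assoc, h2]

lemma del_one_mul_single_zero (M : Mat s r) :
    del 1 * single 0 M = single 0 M * del 1 + single 0 (dx 1 M) := by
  ext1 n
  rw [del_one_mul_coeff, ← single_eq, coeff_add, coeff_single, coeff_single, coeff_single, coeff_single]
  congr 1
  · congr 1; simp only [eq_iff_iff]; omega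
  · split_ifs <;> simp

lemma adj_del_one_mul (P : PDO s r) : (del 1 * P).adj = -(P.adj * del 1) := by
  refine addHom_ext (adjHom.comp (AddMonoidHom.mulLeft (del 1)))
    (-((AddMonoidHom.mulRight (del 1)).comp adjHom)) 1
    (fun m P hP => (((low_single 1 1).mul hP).adj).mono (by omega))
    (fun m P hP k hk => ?_) (fun k C => ?_) P
  · change -(P.adj * del 1).coeff k = 0
    rw [(hP.adj.mul (Q := del 1) (low_single 1 1)) k (by omega), neg_zero]
  · change (del 1 * single k C).adj = -((single k C).adj * del 1)
    have h2 := del_one_mul_single_zero C.transpose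
    rw [dx_transpose] at h2
    rw [single_eq, ← mul_assoc, del_one_mul_single_zero, add_mul, mul_assoc, del_mul_del, adj_add,
      ← single_eq, ← single_eq, ← single_eq, adj_single, adj_single, adj_single, smul_mul_assoc,
      mul_assoc, ← sub_eq_iff_eq_add.2 h2, mul_sub, ← mul_assoc, del_mul_del, add_comm 1 k,
      Int.negOnePow_succ, smul_sub, neg_sub, Units.val_neg, neg_smul]
    abel

lemma adj_del_mul (i : ℤ) (P : PDO s r) : (del i * P).adj = P.adj * (del i).adj := by
  have h1 : ∀ P : PDO s r, (del (-1) * P).adj = -(P.adj * del (-1)) := by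
    intro P
    have h := adj_del_one_mul (del (-1) * P)
    rw [← mul_assoc, del_mul_del, add_neg_cancel, del_zero, one_mul] at h
    rw [h, neg_mul, mul_assoc, del_mul_del, add_neg_cancel, del_zero, mul_one, neg_neg]
  rw [adj_del]
  induction i with
  | zero => simp [del_zero]
  | succ i ih =>
    rw [add_comm (i : ℤ) 1, ← del_mul_del, mul_assoc, adj_del_one_mul, ih, add_comm 1 (i : ℤ),
      Int.negOnePow_succ, mul_smul_comm, mul_smul_comm, smul_mul_assoc, mul_assoc, del_mul_del, del_mul_del,
      add_comm 1 (i : ℤ)]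
    simp
  | pred i ih =>
    rw [sub_eq_add_neg, add_comm _ (-1 : ℤ), ← del_mul_del, mul_assoc, h1, ih, mul_smul_comm,
      mul_smul_comm, smul_mul_assoc, mul_assoc, del_mul_del, del_mul_del, add_comm (-1 : ℤ),
      ← sub_eq_add_neg, Int.negOnePow_sub]
    simp

/-- The formal adjoint reverses products. -/
lemma adj_mul (P Q : PDO s r) : (P * Q).adj = Q.adj * P.adj := by
  obtain ⟨b, hQ⟩ := Q.exists_low
  refine addHom_ext (adjHom.comp (AddMonoidHom.mulRight Q))
    ((AddMonoidHom.mulLeft Q.adj).comp adjHom) (b - 1)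
    (fun m P hP => ((hP.mul hQ).adj).mono (by omega))
    (fun m P hP => (hQ.adj.mul hP.adj).mono (by omega)) (fun k C => ?_) P
  change (single k C * Q).adj = Q.adj * (single k C).adj
  rw [single_eq, mul_assoc, adj_single_zero_mul, adj_del_mul, adj_single_zero_mul, mul_assoc]

/-- The pairing `Res A B^*`. -/
def pair (A B : PDO s r) : Mat s r :=
  ∑ᶠ g : ℤ, ((-1 - g).negOnePow : ℤ) • (A.coeff g * (B.coeff (-1 - g)).transpose)

lemma finite_support_pair (A B : PDO s r) : (Function.support fun g : ℤ =>
    ((-1 - g).negOnePow : ℤ) • (A.coeff g * (B.coeff (-1 - g)).transpose)).Finite := by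
  obtain ⟨a, ha⟩ := A.exists_low
  obtain ⟨b, hb⟩ := B.exists_low
  refine (Set.finite_Icc (-b) a).subset fun g hg => ?_
  by_contra h0
  rw [Set.mem_Icc, not_and_or, not_le, not_le] at h0
  refine hg ?_
  simp only
  rcases h0 with h0 | h0
  · rw [hb _ (by omega), Matrix.transpose_zero, mul_zero, smul_zero]
  · rw [ha _ h0.le, zero_mul, smul_zero]

/-- `pair` as a biadditive map. -/
def pairHom : PDO s r →+ PDO s r →+ Mat s r :=
  AddMonoidHom.mk' (fun A => AddMonoidHom.mk' (pair A) fun B B' => by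
    rw [pair, pair, pair, ← finsum_add_distrib (finite_support_pair A B) (finite_support_pair A B')]
    simp only [coeff_add, Matrix.transpose_add, mul_add, smul_add]) fun A A' => by
    ext1 B
    change pair _ _ = pair _ _ + pair _ _
    rw [pair, pair, pair, ← finsum_add_distrib (finite_support_pair A B) (finite_support_pair A' B)]
    simp only [coeff_add, add_mul, smul_add]

lemma pair_eq_zero {A B : PDO s r} {a b : ℤ} (ha : A.Low a) (hb : B.Low b) (hab : a + b ≤ 0) :
    pair A B = 0 := by
  refine finsum_eq_zero_of_forall_eq_zero fun g => ?_
  by_cases h : a ≤ g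
  · rw [ha _ h, zero_mul, smul_zero]
  · rw [hb _ (by omega), Matrix.transpose_zero, mul_zero, smul_zero]

/-- The `(-1)`-st coefficient of `A B^*`. -/
lemma mul_adj_coeff_neg_one (A B : PDO s r) : (A * B.adj).coeff (-1) = pair A B := by
  obtain ⟨b, hb⟩ := B.exists_low
  refine sub_eq_zero.1 (addHom_eq_zero ((coeffHom (-1)).comp (AddMonoidHom.mulRight B.adj) -
    pairHom.flip B) (-b) (fun P hP => ?_) (fun k M => ?_) A)
  · change (P * B.adj).coeff (-1) - pair P B = 0
    rw [hP.mul hb.adj _ (by omega), pair_eq_zero hP hb (by omega), sub_zero]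
  change (single k M * B.adj).coeff (-1) - pair (single k M) B = 0
  refine addHom_eq_zero ((coeffHom (-1)).comp ((AddMonoidHom.mulLeft (single k M)).comp adjHom) -
    pairHom (single k M)) (-(k + 1)) (fun P hP => ?_) (fun l M' => ?_) B
  · change (single k M * P.adj).coeff (-1) - pair (single k M) P = 0
    rw [(low_single k M).mul hP.adj _ (by omega), pair_eq_zero (low_single k M) hP (by omega), sub_zero]
  change (single k M * (single l M').adj).coeff (-1) - pair (single k M) (single l M') = 0
  have h1 : single k M * (single l M').adj =
      (l.negOnePow : ℤ) • (single (k + l) M * single 0 M'.transpose) := by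
    rw [adj_single, mul_smul_comm, ← mul_assoc, del, single_mul_single_const isConst_one, mul_one]
  have h2 : (single k M * (single l M').adj).coeff (-1) =
      (l.negOnePow : ℤ) • (single (k + l) M * single 0 M'.transpose : PDO s r).coeff (-1) := by
    rw [h1]
    exact map_zsmul (coeffHom (-1)) _ _
  rw [h2, single_mul_single, pair, finsum_eq_single _ k fun g hg => by
    rw [coeff_single, if_neg hg, zero_mul, smul_zero], coeff_single, if_pos rfl, coeff_single]
  by_cases h : k + l = -1
  · rw [if_pos (by omega), show (-1 - k) = l by omega, h]
    simp [cz]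
  · rw [if_neg (by omega), Matrix.transpose_zero, mul_zero, smul_zero, sub_zero]
    have h3 : cz (k + l) (k + l + 0 - -1) = 0 := by
      by_cases h4 : 0 ≤ k + l
      · obtain ⟨N, hN⟩ := Int.eq_ofNat_of_zero_le h4
        rw [hN, show (N : ℤ) + 0 - -1 = ((N + 1 : ℕ) : ℤ) by push_cast; ring, cz_natCast,
          Ring.choose_natCast, Nat.choose_eq_zero_of_lt (by omega), Nat.cast_zero]
      · exact cz_of_neg _ (by omega)
    rw [h3, zero_smul, smul_zero]

lemma dtMat_add (t : Time s r) (M N : Mat s r) : dtMat t (M + N) = dtMat t M + dtMat t N := by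
  ext1 i j; ext1 n
  simp [dtMat]

lemma dtMat_mul (t : Time s r) (M N : Mat s r) :
    dtMat t (M * N) = dtMat t M * N + M * dtMat t N := by
  ext1 i j; ext1 n
  simp only [dtMat, Matrix.map_apply, Matrix.add_apply, Matrix.mul_apply, PowerSeries.coeff_mk,
    map_sum, map_add, PowerSeries.coeff_mul, Derivation.leibniz, smul_eq_mul,
    ← Finset.sum_add_distrib]
  exact Finset.sum_congr rfl fun k _ => Finset.sum_congr rfl fun p _ => by ring

lemma dtMat_dx (t : Time s r) (l : ℕ) (M : Mat s r) : dtMat t (dx l M) = dx l (dtMat t M) := by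
  induction l generalizing M with
  | zero => rfl
  | succ l ih =>
    rw [← dx_dx, ih, ← dx_dx]
    congr 1
    ext1 i j; ext1 n
    simp [dtMat, dx, PowerSeries.coeff_derivative, Derivation.leibniz]
    exact mul_comm _ _

/-- The time derivative as an additive map. -/
def dtHom (t : Time s r) : PDO s r →+ PDO s r :=
  AddMonoidHom.mk' (dt t) fun _ _ => ext fun _ => dtMat_add t _ _

lemma Low.dt {m : ℤ} {P : PDO s r} (h : P.Low m) (t : Time s r) : (dt t P).Low m := fun k hk => by
  change dtMat t (P.coeff k) = 0
  rw [h k hk]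
  exact map_zero (AddMonoidHom.mk' (dtMat t) (dtMat_add t))

lemma dt_single (t : Time s r) (k : ℤ) (M : Mat s r) : dt t (single k M) = single k (dtMat t M) := by
  ext1 n
  change dtMat t ((single k M).coeff n) = _
  rw [coeff_single, coeff_single]
  split_ifs
  · rfl
  · exact map_zero (AddMonoidHom.mk' (dtMat t) (dtMat_add t))

lemma dt_mul (t : Time s r) (P Q : PDO s r) : dt t (P * Q) = dt t P * Q + P * dt t Q := by
  obtain ⟨b, hQ⟩ := Q.exists_low
  refine addHom_ext ((dtHom t).comp (AddMonoidHom.mulRight Q))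
    ((AddMonoidHom.mulRight Q).comp (dtHom t) + AddMonoidHom.mulRight (dt t Q)) (b - 1)
    (fun m P hP => ((hP.mul hQ).dt t).mono (by omega)) (fun m P hP k hk => ?_) (fun i A => ?_) P
  · change (dt t P * Q).coeff k + (P * dt t Q).coeff k = 0
    rw [((hP.dt t).mul hQ) k (by omega), (hP.mul (hQ.dt t)) k (by omega), add_zero]
  refine addHom_ext ((dtHom t).comp (AddMonoidHom.mulLeft (single i A)))
    (AddMonoidHom.mulLeft (dt t (single i A)) + (AddMonoidHom.mulLeft (single i A)).comp (dtHom t)) i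
    (fun m P hP => (((low_single i A).mul hP).dt t).mono (by omega)) (fun m P hP k hk => ?_)
    (fun j B => ?_) Q
  · change (dt t (single i A) * P).coeff k + (single i A * dt t P).coeff k = 0
    rw [(((low_single i A).dt t).mul hP) k (by omega),
      ((low_single i A).mul (hP.dt t)) k (by omega), add_zero]
  change dt t (single i A * single j B) = dt t (single i A) * single j B + single i A * dt t (single j B)
  ext1 n
  change dtMat t ((single i A * single j B).coeff n) = _
  rw [coeff_add, dt_single, dt_single, single_mul_single, single_mul_single, single_mul_single,
    ← dtMat_dx, ← smul_add, ← dtMat_mul]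
  exact map_zsmul (AddMonoidHom.mk' (dtMat t) (dtMat_add t)) _ _

end PDO

end MCKP
end

noncomputable section
namespace MCKP

variable {s r : ℕ}

/-- Integral diagonal matrices. -/
def diag (v : Idx s r → ℤ) : Mat s r := Matrix.diagonal fun i => (v i : XSer s r)

lemma diag_mul (v w : Idx s r → ℤ) : diag v * diag w = diag (v * w) := by
  rw [diag, diag, Matrix.diagonal_mul_diagonal, diag]
  congr 1; ext1 i
  rw [Pi.mul_apply, Int.cast_mul]

lemma diag_sub (v w : Idx s r → ℤ) : diag v - diag w = diag (v - w) := by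
  rw [diag, diag, Matrix.diagonal_sub, diag]
  congr 1; ext1 i
  rw [Pi.sub_apply, Int.cast_sub]

lemma diag_add (v w : Idx s r → ℤ) : diag v + diag w = diag (v + w) := by
  rw [diag, diag, Matrix.diagonal_add, diag]
  congr 1; ext1 i
  rw [Pi.add_apply, Int.cast_add]

lemma diag_zsmul (z : ℤ) (v : Idx s r → ℤ) : z • diag v = diag (z • v) := by
  rw [diag, diag, ← Matrix.diagonal_smul]
  congr 1; ext1 i
  simp

/-- The diagonal matrices as an additive map. -/
def diagHom : (Idx s r → ℤ) →+ Mat s r := AddMonoidHom.mk' diag fun v w => (diag_add v w).symm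

lemma diag_sum {ι : Type*} (S : Finset ι) (f : ι → Idx s r → ℤ) :
    ∑ i ∈ S, diag (f i) = diag (∑ i ∈ S, f i) := (map_sum diagHom f S).symm

lemma eMat_eq (i : Idx s r) : eMat i = diag (Pi.single i 1) := by
  ext1 a b
  rw [eMat, diag, Matrix.single_apply, Matrix.diagonal_apply]
  by_cases h : a = b
  · subst h
    by_cases h' : i = a
    · subst h'; simp
    · rw [if_neg (by tauto), if_pos rfl, Pi.single_eq_of_ne (Ne.symm h'), Int.cast_zero]
  · rw [if_neg h, if_neg (by rintro ⟨rfl, rfl⟩; exact h rfl)]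

lemma derivative_intCast (z : ℤ) : PowerSeries.derivative (TSer s r) (z : XSer s r) = 0 :=
  Derivation.map_intCast _ z

lemma isConst_diag (v : Idx s r → ℤ) : PDO.IsConst (diag v) := by
  ext1 i j
  simp only [dx, diag, Function.iterate_one, Matrix.map_apply, Matrix.diagonal_apply]
  split_ifs
  · exact derivative_intCast _
  · simp

lemma dtMat_diag (t : Time s r) (v : Idx s r → ℤ) : dtMat t (diag v) = 0 := by
  ext1 i j; ext1 n
  simp only [dtMat, diag, Matrix.map_apply, Matrix.diagonal_apply, PowerSeries.coeff_mk]
  split_ifs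
  · rw [← map_intCast (PowerSeries.C (R := TSer s r)), PowerSeries.coeff_C]
    split_ifs
    · rw [Derivation.map_intCast]; simp
    · simp
  · simp

/-- The matrix `N + I`. -/
def swapMat : Mat s r := Matrix.of fun i j => if j = swapIdx i then 1 else 0

lemma swapIdx_swapIdx (i : Idx s r) : swapIdx (swapIdx i) = i := by
  rcases i with a | a | c <;> rfl

lemma swapMat_mul (M : Mat s r) (i j : Idx s r) : (swapMat * M : Mat s r) i j = M (swapIdx i) j := by
  rw [Matrix.mul_apply, Finset.sum_eq_single (swapIdx i)] <;> simp +contextual [swapMat]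

lemma mul_swapMat (M : Mat s r) (i j : Idx s r) : (M * swapMat : Mat s r) i j = M i (swapIdx j) := by
  rw [Matrix.mul_apply, Finset.sum_eq_single (swapIdx j)]
  · simp [swapMat, swapIdx_swapIdx]
  · intro k _ hk
    rw [swapMat, Matrix.of_apply, if_neg, mul_zero]
    rintro rfl
    exact hk (swapIdx_swapIdx k).symm
  · simp

lemma opNI_eq : opNI s r = PDO.single 0 swapMat := by
  rw [opNI]
  congr 1
  ext1 i j
  rcases i with a | a | c <;> rcases j with b | b | d <;>
    simp [swapMat, swapIdx, eMat, Matrix.add_apply, Matrix.sum_apply, Matrix.single_apply, ite_and,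
      -Finset.sum_boole, eq_comm]

lemma isConst_swapMat : PDO.IsConst (swapMat : Mat s r) := by
  ext1 i j
  simp only [dx, swapMat, Function.iterate_one, Matrix.map_apply, Matrix.of_apply]
  split_ifs
  · exact Derivation.map_one_eq_zero _
  · simp

lemma swapMat_mul_self : (swapMat * swapMat : Mat s r) = 1 := by
  ext1 i j
  rw [swapMat_mul, swapMat, Matrix.of_apply, swapIdx_swapIdx, Matrix.one_apply]
  simp only [eq_comm]

lemma swapMat_transpose : (swapMat : Mat s r).transpose = swapMat := by
  ext1 i j
  simp only [Matrix.transpose_apply, swapMat, Matrix.of_apply]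
  congr 1
  rw [eq_iff_iff]
  constructor <;> rintro rfl <;> rw [swapIdx_swapIdx]

namespace PDO

lemma opNI_mul_self : opNI s r * opNI s r = 1 := by
  rw [opNI_eq, single_mul_single_const isConst_swapMat, swapMat_mul_self, add_zero, one_def]

lemma adj_opNI : (opNI s r).adj = opNI s r := by
  rw [opNI_eq, adj_single_zero, swapMat_transpose]

lemma opNI_conj_coeff (P : PDO s r) (n : ℤ) (i j : Idx s r) :
    (opNI s r * P * opNI s r).coeff n i j = P.coeff n (swapIdx i) (swapIdx j) := by
  rw [opNI_eq, mul_single_coeff isConst_swapMat, mul_swapMat, single_zero_mul_coeff, swapMat_mul,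
    sub_zero]

/-- The operator `∂^k` times an integral diagonal matrix. -/
def con (k : ℤ) (v : Idx s r → ℤ) : PDO s r := single k (diag v)

lemma con_mul_con (k l : ℤ) (v w : Idx s r → ℤ) : con k v * con l w = con (k + l) (v * w) := by
  rw [con, con, single_mul_single_const (isConst_diag w), diag_mul, con]

lemma con_pow (v : Idx s r → ℤ) (n : ℕ) : con 1 v ^ n = con n (v ^ n) := by
  induction n with
  | zero =>
    rw [pow_zero, pow_zero, con, one_def]
    congr 1
    ext1 i j
    simp [diag, Matrix.one_apply, Matrix.diagonal_apply]
  | succ n ih => rw [pow_succ, ih, con_mul_con, pow_succ, Nat.cast_succ]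

lemma neg_con (k : ℤ) (v : Idx s r → ℤ) : -con k v = con k (-v) := by
  ext1 n
  rw [coeff_neg, con, con, coeff_single, coeff_single]
  split_ifs
  · rw [← neg_one_zsmul, diag_zsmul, neg_one_zsmul]
  · exact neg_zero

lemma dt_con (t : Time s r) (k : ℤ) (v : Idx s r → ℤ) : dt t (con k v) = 0 := by
  rw [con, dt_single, dtMat_diag]
  ext1 n
  rw [coeff_single, ite_self, coeff_zero]

lemma adj_con_zero (v : Idx s r → ℤ) : (con 0 v).adj = con 0 v := by
  rw [con, adj_single_zero, diag, Matrix.diagonal_transpose]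

lemma adj_con_one (v : Idx s r → ℤ) : (con 1 v).adj = -con 1 v := by
  rw [con, adj_single, diag, Matrix.diagonal_transpose, ← diag, del,
    single_mul_single_const (isConst_diag v), one_mul, add_zero, Int.negOnePow_one]
  simp

lemma opNI_con (k : ℤ) (v : Idx s r → ℤ) :
    opNI s r * con k v * opNI s r = con k (v ∘ swapIdx) := by
  ext1 n; ext1 i j
  rw [opNI_conj_coeff, con, con, coeff_single, coeff_single]
  split_ifs
  · simp only [diag, Matrix.diagonal_apply, Function.comp_apply]
    congr 1
    rw [eq_iff_iff]
    exact ⟨fun h => by rw [← swapIdx_swapIdx i, h, swapIdx_swapIdx], fun h => by rw [h]⟩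
  · rfl

lemma adj_adj (P : PDO s r) : P.adj.adj = P := by
  refine addHom_ext (adjHom.comp adjHom) (AddMonoidHom.id _) 0
    (fun m P hP => hP.adj.adj.mono (by omega)) (fun m P hP => hP.mono (by omega)) (fun k M => ?_) P
  change (single k M).adj.adj = single k M
  rw [adj_single, adj_zsmul, adj_mul, adj_single_zero, Matrix.transpose_transpose, adj_del,
    mul_smul_comm, smul_smul, ← single_eq, ← Units.val_mul, Int.units_mul_self, Units.val_one, one_smul]

lemma low_sub_one {P : PDO s r} (h : P.Low 1) (h0 : P.coeff 0 = 1) : (P - 1).Low 0 := fun k hk => by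
  rw [coeff_sub, one_def, coeff_single]
  split_ifs with h1
  · rw [h1, h0, sub_self]
  · rw [h k (by omega), sub_zero]

lemma adj_one : (1 : PDO s r).adj = 1 := by
  rw [one_def, adj_single_zero, Matrix.transpose_one]

/-- Operators `1 + ∑_{k < 0} P_k ∂^k` are left cancellable. -/
lemma eq_zero_of_mul_eq_zero {P X : PDO s r} (hP : (P - 1).Low 0) (h : P * X = 0) : X = 0 := by
  obtain ⟨m, hm⟩ := X.exists_low
  have key : ∀ d : ℕ, X.Low (m - d) := by
    intro d
    induction d with
    | zero => simpa using hm
    | succ d ih =>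
      have h1 : X = -((P - 1) * X) := by rw [sub_mul, h, one_mul, zero_sub, neg_neg]
      rw [h1]
      intro k hk
      rw [coeff_neg, (hP.mul ih) k (by push_cast at hk; omega), neg_zero]
  ext1 n
  exact key (m - n).toNat n (by omega)

lemma mul_adj_eq_one {P R : PDO s r} (hP : (P - 1).Low 0) (hR : (R - 1).Low 0)
    (h : ∀ n < 0, (P * R.adj).coeff n = 0) : P * R.adj = 1 := by
  have hQ : (R.adj - 1).Low 0 := by rw [← adj_one, ← adj_sub]; exact hR.adj
  have h1 : P * R.adj - 1 = (P - 1) * (R.adj - 1) + (P - 1) + (R.adj - 1) := by noncomm_ring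
  refine sub_eq_zero.1 (ext fun n => ?_)
  by_cases hn : n < 0
  · rw [coeff_sub, h n hn, one_def, coeff_single, if_neg hn.ne, sub_zero, coeff_zero]
  · rw [h1, coeff_add, coeff_add, hP n (by omega), hQ n (by omega), (hP.mul hQ) n (by omega)]
    simp

lemma coeff_eq_zero_of_pair {A B : PDO s r} (h : ∀ l : ℕ, pair A (del l * B) = 0) {n : ℤ}
    (hn : n < 0) : (A * B.adj).coeff n = 0 := by
  obtain ⟨l, hl⟩ : ∃ l : ℕ, n = -1 - l := ⟨(-1 - n).toNat, by omega⟩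
  have h1 := h l
  rw [← mul_adj_coeff_neg_one, adj_mul, adj_del, mul_smul_comm, mul_smul_comm, ← mul_assoc] at h1
  have h2 : ((l : ℤ).negOnePow : ℤ) • (A * B.adj * del l).coeff (-1) = 0 := by
    rw [← h1]
    exact (map_zsmul (coeffHom (-1)) _ _).symm
  rw [del, mul_single_coeff isConst_one, mul_one, ← hl] at h2
  rcases Int.units_eq_one_or (l : ℤ).negOnePow with h3 | h3 <;> simpa [h3] using h2

end PDO

end MCKP
end

noncomputable section
namespace MCKP

variable {s r : ℕ}

open PDO

/-- The operator `A` has the coefficients `a` at `x = 0`, and depends on `x` only through the shift of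
the times. -/
def Rep (A : PDO s r) (a : SymFam s r) : Prop := ∀ g i k, A.coeff g i k = shiftX (a g i k)

lemma rep_waveOp (τ : BFock s r) (ε : Bool) : Rep (waveOp τ ε) (symZ τ ε) := waveOp_coeff τ ε

lemma Rep.del_one_mul {A : PDO s r} {a : SymFam s r} (h : Rep A a) : Rep (del 1 * A) (symD a) := by
  intro g i k
  rw [del_one_mul_coeff, Matrix.add_apply, h, symD, shiftX_add, ← derivative_shiftX, ← h g]
  rfl

lemma Rep.del_mul {A : PDO s r} {a : SymFam s r} (h : Rep A a) (l : ℕ) :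
    Rep (del l * A) (symD^[l] a) := by
  induction l with
  | zero => rw [Nat.cast_zero, del_zero, one_mul]; exact h
  | succ l ih =>
    rw [Function.iterate_succ_apply', Nat.cast_succ, add_comm, ← del_mul_del, mul_assoc]
    exact ih.del_one_mul

lemma pderiv_dX_pow (t : Time s r) (n : ℕ) (f : TSer s r) :
    MvPowerSeries.pderiv ℂ t ((dX s r ^ n) f) = (dX s r ^ n) (MvPowerSeries.pderiv ℂ t f) := by
  induction n generalizing f with
  | zero => rfl
  | succ n ih => rw [pow_succ, Module.End.mul_apply, Module.End.mul_apply, ih, dX_pderiv]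

lemma Rep.dt_add_mul_con {A : PDO s r} {a : SymFam s r} (h : Rep A a) (t : Time s r)
    {v : Idx s r → ℤ} (hv : ∀ k, flowC true t k = v k) :
    Rep (dt t A + A * con (tdeg t) v) (symT true t a) := by
  intro g i k
  rw [coeff_add, con, mul_single_coeff (isConst_diag v), Matrix.add_apply, diag,
    Matrix.mul_diagonal, h, symT, hv, shiftX_add, shiftX_smul]
  congr 1
  · change PowerSeries.mk (fun n => MvPowerSeries.pderiv ℂ t (PowerSeries.coeff n (A.coeff g i k))) = _
    ext1 n
    rw [h, PowerSeries.coeff_mk, coeff_shiftX, coeff_shiftX, ← pderiv_dX_pow, Derivation.map_smul]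
  · rw [Int.cast_smul_eq_zsmul, zsmul_eq_mul, mul_comm]

lemma Rep.pair_eq_zero {A B : PDO s r} {a b : SymFam s r} (hA : Rep A a) (hB : Rep B b)
    (ha : a.Bdd) (hb : b.Bdd)
    (h : ∀ i j, ∑ k : Idx s r, ∑ᶠ g : ℤ, a g i k * ((-1 : ℂ) ^ (-1 - g) • b (-1 - g) j k) = 0) :
    pair A B = 0 := by
  ext1 i j
  obtain ⟨N, hN⟩ := ha
  obtain ⟨N', hN'⟩ := hb
  have hfin : ∀ k, (Function.support fun g : ℤ =>
      a g i k * ((-1 : ℂ) ^ (-1 - g) • b (-1 - g) j k)).Finite := by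
    intro k
    refine (Set.finite_Icc (-1 - N') N).subset fun g hg => ?_
    by_contra h0
    rw [Set.mem_Icc, not_and_or, not_le, not_le] at h0
    refine hg ?_
    simp only
    rcases h0 with h0 | h0
    · rw [hN' _ (by omega), smul_zero, mul_zero]
    · rw [hN _ h0, zero_mul]
  have h1 : pair A B i j = ∑ᶠ g : ℤ, shiftHom s r (∑ k : Idx s r,
      a g i k * ((-1 : ℂ) ^ (-1 - g) • b (-1 - g) j k)) := by
    rw [pair]
    refine (AddMonoidHom.map_finsum (Matrix.entryAddMonoidHom (XSer s r) i j)
      (finite_support_pair A B)).trans (finsum_congr fun g => ?_)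
    change (((-1 - g).negOnePow : ℤ) • (A.coeff g * (B.coeff (-1 - g)).transpose)) i j = _
    rw [Matrix.smul_apply, Matrix.mul_apply, map_sum, Finset.smul_sum]
    refine Finset.sum_congr rfl fun k _ => ?_
    rw [Matrix.transpose_apply, hA, hB, map_mul, ← Int.cast_negOnePow, Int.cast_smul_eq_zsmul,
      map_zsmul, mul_smul_comm]
    rfl
  have hs : (Function.support fun g : ℤ => ∑ k : Idx s r,
      a g i k * ((-1 : ℂ) ^ (-1 - g) • b (-1 - g) j k)).Finite := by
    refine (Set.finite_iUnion hfin).subset fun g hg => ?_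
    obtain ⟨k, -, hk⟩ := Finset.exists_ne_zero_of_sum_ne_zero hg
    exact Set.mem_iUnion.2 ⟨k, hk⟩
  refine (h1.trans (AddMonoidHom.map_finsum (shiftHom s r).toAddMonoidHom hs).symm).trans ?_
  rw [finsum_sum_comm' _ _ fun k _ => hfin k, h, map_zero]
  rfl

/-- The integral diagonal matrix of the flow of a time. -/
def flowV : Time s r → Idx s r → ℤ
  | Sum.inl (a, n) => Pi.single (Sum.inl a) 1 - (-1) ^ (n + 1) • Pi.single (Sum.inr (Sum.inl a)) 1
  | Sum.inr (c, _) => Pi.single (Sum.inr (Sum.inr c)) 1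

lemma flowC_eq (t : Time s r) (k : Idx s r) : flowC true t k = flowV t k := by
  rcases t with ⟨a, n⟩ | ⟨c, n⟩ <;> rcases k with b | b | d <;>
    simp [flowC, flowV, tsgn, colF, colS, tcmp, tdeg, sg, Pi.single_apply, Fld.cmp, Fld.sgn, eq_comm]
  split_ifs <;> simp

lemma chargedFlow_eq (a : Fin s) (n : ℕ) :
    (chargedFlow a (n + 1) : PDO s r) = con (n + 1 : ℕ) (flowV (Sum.inl (a, n))) := by
  rw [chargedFlow, con, eMat_eq, eMat_eq, diag_zsmul, diag_sub, flowV]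

lemma neutralFlow_eq (c : Fin r) (n : ℕ) :
    (neutralFlow c (2 * n + 1) : PDO s r) = con (2 * n + 1 : ℕ) (flowV (Sum.inr (c, n))) := by
  rw [neutralFlow, con, eMat_eq, flowV]

section
variable {τ : BFock s r}

lemma waveCoeff_swap (τ : BFock s r) (ε : Bool) (n : ℕ) (i k : Idx s r) :
    waveCoeff τ ε n i k = waveCoeff τ (!ε) n (swapIdx i) (swapIdx k) := by
  rcases i with a | a | c <;> rcases k with b | b | d <;>
    simp only [waveCoeff, swapIdx, Bool.not_not]
  rw [symb, symb, coeff_numCC, coeff_numCC, smul_mul_assoc, smul_mul_assoc, smul_smul, smul_smul,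
    ← mul_pow, ← mul_pow, sg_mul_self, sg_mul_self]

lemma waveCoeff_zero (h0 : MvPowerSeries.constantCoeff (τ ∅) ≠ 0) (ε : Bool) (i k : Idx s r) :
    waveCoeff τ ε 0 i k = if i = k then 1 else 0 := by
  have h1 : τ ∅ * (τ ∅)⁻¹ = 1 := MvPowerSeries.mul_inv_cancel _ h0
  have h2 : ∀ ε i k, waveCoeff τ ε 0 i k =
      rowC ε i • Xm (colF ε k) (-((0 : ℕ) : ℤ)) τ (rowW ε i) * (τ ∅)⁻¹ := fun ε i k => by
    rw [waveCoeff_eq, pow_zero, pow_zero, one_mul, mul_one, ← smul_mul_assoc, vsum]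
    simp
  have h3 : ∀ ε a k, waveCoeff τ ε 0 (Sum.inl a) k = if Sum.inl a = k then 1 else 0 := by
    intro ε a k
    rw [h2]
    rcases k with b | b | d <;> simp only [rowC, colF, rowW] <;> try by_cases h : a = b
    · subst h
      rw [Xm_row_inl_inl]; simpa using h1
    · rw [Xm_row_inl_inl_of_ne τ ε h]; simp [h]
    · subst h
      rw [Xm_row_inl_swap]; simp
    · rw [Xm_row_inl_swap_of_ne τ ε h]; simp
    · rw [Xm_row_inl_inr]; simp
  rcases i with a | a | c
  · exact h3 ε a k
  · rw [waveCoeff_swap, swapIdx, h3]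
    rcases k with b | b | d <;> simp [swapIdx]
  · rw [h2]
    rcases k with b | b | d <;> simp only [rowC, colF, rowW, one_smul]
    · rw [Xm_row_inr_inl]; simp
    · rw [Xm_row_inr_inl]; simp
    · by_cases h : c = d
      · subst h
        rw [Xm_row_inr_inr]; simpa using h1
      · rw [Xm_row_inr_inr_of_ne τ h]; simp [h]

lemma low_waveOp (τ : BFock s r) (ε : Bool) : (waveOp τ ε).Low 1 := fun k hk => if_neg (by omega)

lemma waveOp_coeff_zero (h0 : MvPowerSeries.constantCoeff (τ ∅) ≠ 0) (ε : Bool) :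
    (waveOp τ ε).coeff 0 = 1 := by
  ext1 i k
  rw [waveOp_coeff, symZ, if_pos le_rfl, neg_zero, Int.toNat_zero, waveCoeff_zero h0,
    Matrix.one_apply]
  split_ifs
  · exact shiftX_one
  · exact shiftX_zero

lemma waveOp_swap (τ : BFock s r) (ε : Bool) :
    waveOp τ ε = opNI s r * waveOp τ (!ε) * opNI s r := by
  ext1 n; ext1 i k
  rw [opNI_conj_coeff, waveOp_coeff, waveOp_coeff, symZ, symZ, waveCoeff_swap]

lemma mul_adj_waveOp (h0 : MvPowerSeries.constantCoeff (τ ∅) ≠ 0) (h : BosonicCKP τ) :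
    waveOp τ true * (waveOp τ false).adj = 1 :=
  mul_adj_eq_one (low_sub_one (low_waveOp τ _) (waveOp_coeff_zero h0 _))
    (low_sub_one (low_waveOp τ _) (waveOp_coeff_zero h0 _)) fun _ hn =>
    coeff_eq_zero_of_pair (fun l => (rep_waveOp τ true).pair_eq_zero ((rep_waveOp τ false).del_mul l)
      (symZ_bdd τ true) ((symZ_bdd τ false).iterate l) fun i j => residue_wave h i j l) hn

lemma adj_mul_waveOp (h0 : MvPowerSeries.constantCoeff (τ ∅) ≠ 0) (h : BosonicCKP τ) :
    (waveOp τ false).adj * waveOp τ true = 1 := by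
  refine sub_eq_zero.1 (eq_zero_of_mul_eq_zero
    (low_sub_one (low_waveOp τ true) (waveOp_coeff_zero h0 _)) ?_)
  rw [mul_sub, ← mul_assoc, mul_adj_waveOp h0 h, one_mul, mul_one, sub_self]

/-- The Sato–Wilson equations. -/
lemma dt_waveOp_mul (h0 : MvPowerSeries.constantCoeff (τ ∅) ≠ 0) (h : BosonicCKP τ)
    (t : Time s r) : dt t (waveOp τ true) * (waveOp τ false).adj =
      -(waveOp τ true * con (tdeg t) (flowV t) * (waveOp τ false).adj).neg := by
  set P := waveOp τ true
  set R := waveOp τ false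
  have h1 : (dt t P).Low 0 := fun k hk => by
    change dtMat t (P.coeff k) = 0
    rcases hk.eq_or_lt with rfl | hk
    · rw [waveOp_coeff_zero h0, ← dtMat_diag t (fun _ => 1)]
      congr 1
      ext1 i j
      simp [diag, Matrix.one_apply, Matrix.diagonal_apply]
    · exact (low_waveOp τ true).dt t k (by omega)
  ext1 n
  change _ = -(if n < 0 then (P * con (tdeg t) (flowV t) * R.adj).coeff n else 0)
  split_ifs with hn
  · rw [eq_neg_iff_add_eq_zero, ← coeff_add, ← add_mul]
    exact coeff_eq_zero_of_pair (fun l =>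
      ((rep_waveOp τ true).dt_add_mul_con t (flowC_eq t)).pair_eq_zero
      ((rep_waveOp τ false).del_mul l) ((symZ_bdd τ true).symT true t) ((symZ_bdd τ false).iterate l)
      fun i j => residue_symT_wave h t i j l) hn
  · rw [h1.mul (low_waveOp τ false).adj n (by omega), neg_zero]

end

end MCKP
end

noncomputable section
namespace MCKP

variable {s r : ℕ}

open PDO

/-- The diagonal of `∑_a (E_{aa} - E_{s+a,s+a}) + ∑_c E_{2s+c,2s+c}`. -/
def laxV : Idx s r → ℤ
  | Sum.inl _ => 1
  | Sum.inr (Sum.inl _) => -1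
  | Sum.inr (Sum.inr _) => 1

/-- The diagonal of `E_{aa} - E_{s+a,s+a}`. -/
def dV (a : Fin s) : Idx s r → ℤ := Pi.single (Sum.inl a) 1 - Pi.single (Sum.inr (Sum.inl a)) 1

/-- The diagonal of `E_{aa} + E_{s+a,s+a}`. -/
def eV (a : Fin s) : Idx s r → ℤ := Pi.single (Sum.inl a) 1 + Pi.single (Sum.inr (Sum.inl a)) 1

lemma laxL_eq (P Q : PDO s r) : laxL P Q = P * con 1 laxV * Q := by
  rw [laxL, con]
  simp only [eMat_eq, diag_sub, diag_sum, diag_add]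
  congr 4
  funext i
  rcases i with b | b | d <;> simp [laxV, Finset.sum_apply, Pi.single_apply]

lemma laxC_eq (P Q : PDO s r) (b : Idx s r) : laxC P Q b = P * con 0 (Pi.single b 1) * Q := by
  rw [laxC, eMat_eq, con]

lemma laxD_eq (P Q : PDO s r) (a : Fin s) : laxD P Q a = P * con 0 (dV a) * Q := by
  rw [laxD, eMat_eq, eMat_eq, diag_sub, con, dV]

lemma laxE_eq (P Q : PDO s r) (a : Fin s) : laxE P Q a = P * con 0 (eV a) * Q := by
  rw [laxE, eMat_eq, eMat_eq, diag_add, con, eV]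

section dressing

variable {P Q : PDO s r}

lemma dress_mul_dress (hQP : Q * P = 1) (k l : ℤ) (v w : Idx s r → ℤ) :
    P * con k v * Q * (P * con l w * Q) = P * con (k + l) (v * w) * Q := by
  rw [← con_mul_con, mul_assoc (P * con k v), ← mul_assoc Q, ← mul_assoc Q, hQP, one_mul]
  simp only [mul_assoc]

lemma laxL_pow (hPQ : P * Q = 1) (hQP : Q * P = 1) (n : ℕ) : laxL P Q ^ n = P * con n (laxV ^ n) * Q := by
  induction n with
  | zero =>
    have h := con_pow (laxV : Idx s r → ℤ) 0
    rw [pow_zero] at h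
    rw [← h, mul_one, hPQ]
    rfl
  | succ n ih =>
    change npow (laxL P Q) n * laxL P Q = _
    rw [show npow (laxL P Q) n = laxL P Q ^ n from rfl, ih, laxL_eq, dress_mul_dress hQP, pow_succ,
      Nat.cast_succ]

lemma laxL_pow_mul_laxD (hPQ : P * Q = 1) (hQP : Q * P = 1) (a : Fin s) (n : ℕ) : laxL P Q ^ (n + 1) * laxD P Q a =
    P * con (tdeg (Sum.inl (a, n) : Time s r)) (flowV (Sum.inl (a, n))) * Q := by
  rw [laxL_pow hPQ hQP, laxD_eq, dress_mul_dress hQP, add_zero]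
  congr 3
  funext i
  rcases i with b | b | d <;> simp [laxV, dV, flowV, Pi.single_apply]

lemma laxL_pow_mul_laxC (hPQ : P * Q = 1) (hQP : Q * P = 1) (c : Fin r) (n : ℕ) :
    laxL P Q ^ (2 * n + 1) * laxC P Q (Sum.inr (Sum.inr c)) =
    P * con (tdeg (Sum.inr (c, n) : Time s r)) (flowV (Sum.inr (c, n))) * Q := by
  rw [laxL_pow hPQ hQP, laxC_eq, dress_mul_dress hQP, add_zero]
  congr 3
  funext i
  rcases i with b | b | d <;> simp [laxV, flowV, Pi.single_apply]

lemma pos_add_neg (A : PDO s r) : A.pos + A.neg = A := by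
  ext1 n
  change (if 0 ≤ n then A.coeff n else 0) + (if n < 0 then A.coeff n else 0) = _
  by_cases h : n < 0
  · rw [if_neg (by omega), if_pos h, zero_add]
  · rw [if_pos (by omega), if_neg h, add_zero]

lemma dt_dress (hPQ : P * Q = 1) (hQP : Q * P = 1) (t : Time s r) (k : ℤ) (v : Idx s r → ℤ)
    (h : dt t P * Q = -(P * con (tdeg t) (flowV t) * Q).neg) :
    dt t (P * con k v * Q) =
      PDO.comm (P * con (tdeg t) (flowV t) * Q).pos (P * con k v * Q) := by
  set A := P * con (tdeg t) (flowV t) * Q with hA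
  have h1 : A * (P * con k v * Q) = P * con k v * Q * A := by
    rw [hA, dress_mul_dress hQP, dress_mul_dress hQP, add_comm k, mul_comm v]
  have h2 : dt t Q = -(Q * (dt t P * Q)) := by
    have h3 := dt_mul t P Q
    rw [hPQ, show (1 : PDO s r) = con 1 0 ^ 0 from (pow_zero _).symm, con_pow, dt_con] at h3
    have h4 := congrArg (Q * ·) h3
    simp only [mul_zero, mul_add] at h4
    rw [← mul_assoc Q P, hQP, one_mul] at h4
    rw [eq_neg_iff_add_eq_zero, add_comm, ← h4]
  have h5 : A.pos = A - A.neg := eq_sub_of_add_eq (pos_add_neg A)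
  have h6 : dt t P = dt t P * Q * P := by rw [mul_assoc, hQP, mul_one]
  rw [dt_mul, dt_mul, dt_con, mul_zero, add_zero, h2, h6, mul_assoc (dt t P * Q) P Q, hPQ, mul_one, h,
    PDO.comm, h5, sub_mul, mul_sub, h1]
  simp only [mul_assoc, neg_mul, mul_neg, neg_neg]
  abel

lemma satoWilson_of_dt (hQP : Q * P = 1)
    (h : ∀ t, dt t P * Q = -(P * con (tdeg t) (flowV t) * Q).neg) : SatoWilson P Q where
  charged a n := by
    rw [chargedFlow_eq, ← neg_mul, show ((n + 1 : ℕ) : ℤ) = tdeg (Sum.inl (a, n) : Time s r) from rfl,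
      ← h, mul_assoc, hQP, mul_one]
  neutral c n := by
    rw [neutralFlow_eq, ← neg_mul, show ((2 * n + 1 : ℕ) : ℤ) = tdeg (Sum.inr (c, n) : Time s r) from rfl,
      ← h, mul_assoc, hQP, mul_one]

lemma laxSato_dress (hPQ : P * Q = 1) (hQP : Q * P = 1) (h : ∀ t, dt t P * Q = -(P * con (tdeg t) (flowV t) * Q).neg)
    (k : ℤ) (v : Idx s r → ℤ) : LaxSato P Q (P * con k v * Q) where
  charged a n := by rw [laxL_pow_mul_laxD hPQ hQP, dt_dress hPQ hQP _ k v (h _)]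
  neutral c n := by rw [laxL_pow_mul_laxC hPQ hQP, dt_dress hPQ hQP _ k v (h _)]

lemma opNI_mul_cancel_left (A : PDO s r) : opNI s r * (opNI s r * A) = A := by
  rw [← mul_assoc, opNI_mul_self, one_mul]

/-- The adjoint of a dressed operator, when `P^{-1} = J P^* J`. -/
lemma adj_dress (hQ : Q = opNI s r * P.adj * opNI s r) (A : PDO s r) :
    (P * A * Q).adj = opNI s r * (P * (opNI s r * A.adj * opNI s r) * Q) * opNI s r := by
  have h1 : P.adj = opNI s r * Q * opNI s r := by
    rw [hQ]
    simp only [mul_assoc, opNI_mul_cancel_left, opNI_mul_self, mul_one]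
  have h2 : Q.adj = opNI s r * P * opNI s r := by
    rw [hQ, adj_mul, adj_mul, adj_opNI, adj_adj, mul_assoc]
  rw [adj_mul, adj_mul, h1, h2]
  simp only [mul_assoc]

lemma opNI_eq_one (hs : s = 0) : opNI s r = 1 := by
  subst hs
  rw [opNI_eq, one_def]
  congr 1
  ext1 i j
  rcases i with a | a | c
  · exact a.elim0
  · exact a.elim0
  · simp only [swapMat, Matrix.of_apply, swapIdx, Matrix.one_apply, eq_comm]
    congr!

lemma laxSymmetry_of_adj (hQP : Q * P = 1) (hQ : Q = opNI s r * P.adj * opNI s r) : LaxSymmetry P Q := by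
  have h0 : ∀ v, (P * con 0 v * Q).adj =
      opNI s r * (P * con 0 (v ∘ swapIdx) * Q) * opNI s r := fun v => by
    rw [adj_dress hQ, adj_con_zero, opNI_con]
  have hL : (laxL P Q).adj = opNI s r * (P * con 1 (-(laxV ∘ swapIdx)) * Q) * opNI s r := by
    rw [laxL_eq, adj_dress hQ, adj_con_one, ← neg_con, ← opNI_con, mul_neg, neg_mul]
  have hC : ∀ c : Fin r, (laxC P Q (Sum.inr (Sum.inr c))).adj =
      opNI s r * laxC P Q (Sum.inr (Sum.inr c)) * opNI s r := fun c => by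
    rw [laxC_eq, h0]
    congr 5
    funext i
    rcases i with b | b | d <;> simp [swapIdx, Pi.single_apply]
  refine ⟨hC, fun a => ?_, fun a => ?_, ?_, fun hs => ⟨?_, fun c => ?_⟩, fun hr => ?_⟩
  · rw [laxD_eq, h0, ← neg_mul, ← mul_neg, ← neg_mul, ← mul_neg, neg_con]
    congr 5
    funext i
    rcases i with b | b | d <;> simp [dV, swapIdx, Pi.single_apply]
  · rw [laxE_eq, h0]
    congr 5
    funext i
    rcases i with b | b | d <;> simp [eV, swapIdx, Pi.single_apply]
  · have h1 : ∑ a : Fin s, laxE P Q a - ∑ c : Fin r, laxC P Q (Sum.inr (Sum.inr c)) =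
        P * con 0 (∑ a : Fin s, eV a - ∑ c : Fin r, Pi.single (Sum.inr (Sum.inr c)) 1) * Q := by
      simp only [laxE_eq, laxC_eq]
      rw [← Finset.sum_mul, ← Finset.sum_mul, ← Finset.mul_sum, ← Finset.mul_sum, ← sub_mul,
        ← mul_sub]
      congr 2
      let Φ : (Idx s r → ℤ) →+ PDO s r := AddMonoidHom.mk' (con 0) fun v w => by
        rw [con, ← diag_add, single_add]; rfl
      exact ((map_sub Φ _ _).trans (congrArg₂ _ (map_sum Φ _ _) (map_sum Φ _ _))).symm
    rw [hL, h1, laxL_eq, dress_mul_dress hQP, zero_add]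
    congr 5
    funext i
    rcases i with b | b | d <;> simp [laxV, eV, swapIdx, Pi.single_apply, Finset.sum_apply]
  · rw [hL, opNI_eq_one hs, one_mul, mul_one, laxL_eq, ← neg_mul, ← mul_neg, neg_con]
    subst hs
    congr 3
    funext i
    rcases i with b | b | d
    · exact b.elim0
    · exact b.elim0
    · simp [laxV, swapIdx]
  · rw [hC, opNI_eq_one hs, one_mul, mul_one]
  · rw [hL, laxL_eq]
    subst hr
    congr 5
    funext i
    rcases i with b | b | d
    · simp [laxV, swapIdx]
    · simp [laxV, swapIdx]
    · exact d.elim0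

end dressing

end MCKP
end

open MCKP in
theorem mainTheorem3 (s r : ℕ) :
    -- the bosonization exists and is unique
    (∃! σ : FFock s r ≃ₗ[ℂ] BFock s r, IsBosonization σ) ∧
    ∀ σ : FFock s r ≃ₗ[ℂ] BFock s r, IsBosonization σ →
      -- it identifies the polynomial spaces and the even parts
      (∀ f, IsPolyF f ↔ IsPolyB (σ f)) ∧
      (∀ f, IsEvenF f ↔ ∀ w : Finset (Xi s r), Odd w.card → σ f w = 0) ∧
      -- the CKP equation is equivalent to the Hirota equations
      (∀ f, IsEvenF f → (FermionicCKP f ↔ HirotaCKP (σ f))) ∧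
      -- wave function, dressing operator, Sato–Wilson and Lax equations
      ∀ f, IsEvenF f → FermionicCKP f → f ≠ 0 →
        MvPowerSeries.constantCoeff (σ f ∅) ≠ 0 ∧
        WaveBilinear (σ f) ∧
        (∀ ε, (waveOp (σ f) ε).coeff 0 = 1 ∧ ∀ k, 0 < k → (waveOp (σ f) ε).coeff k = 0) ∧
        (∀ ε, waveOp (σ f) ε = opNI s r * waveOp (σ f) (!ε) * opNI s r) ∧
        ∃ Q : PDO s r,
          waveOp (σ f) true * Q = 1 ∧ Q * waveOp (σ f) true = 1 ∧
          Q = (waveOp (σ f) false).adj ∧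
          Q = opNI s r * (waveOp (σ f) true).adj * opNI s r ∧
          SatoWilson (waveOp (σ f) true) Q ∧
          LaxSato (waveOp (σ f) true) Q (laxL (waveOp (σ f) true) Q) ∧
          (∀ b, LaxSato (waveOp (σ f) true) Q (laxC (waveOp (σ f) true) Q b)) ∧
          (∀ a, LaxSato (waveOp (σ f) true) Q (laxD (waveOp (σ f) true) Q a)) ∧
          (∀ a, LaxSato (waveOp (σ f) true) Q (laxE (waveOp (σ f) true) Q a)) ∧
          (∀ a, laxE (waveOp (σ f) true) Q a =
            laxD (waveOp (σ f) true) Q a * laxD (waveOp (σ f) true) Q a) ∧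
          LaxSymmetry (waveOp (σ f) true) Q := by
  refine ⟨existsUnique_bosonization s r, fun σ hσ => ?_⟩
  obtain rfl := hσ.eq_bos
  refine ⟨isPolyF_iff, isEvenF_iff, fun f hf => ?_, fun f hf h hf0 => ?_⟩
  · rw [fermionicCKP_iff_bosonicCKP, bosonicCKP_iff_hirotaCKP ((isEvenF_iff f).1 hf)]
  have hB : BosonicCKP (bos s r f) := (fermionicCKP_iff_bosonicCKP f).1 h
  have h0 : MvPowerSeries.constantCoeff (bos s r f ∅) ≠ 0 := by
    rw [constantCoeff_bos]
    exact constantCoeff_ne_zero hf0 h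
  have hPQ := mul_adj_waveOp h0 hB
  have hQP := adj_mul_waveOp h0 hB
  have hQ : (waveOp (bos s r f) false).adj =
      opNI s r * (waveOp (bos s r f) true).adj * opNI s r := by
    rw [waveOp_swap _ false, PDO.adj_mul, PDO.adj_mul, PDO.adj_opNI, mul_assoc]
    rfl
  have hdt := dt_waveOp_mul h0 hB
  refine ⟨h0, waveBilinear_of_bosonicCKP hB,
    fun ε => ⟨waveOp_coeff_zero h0 ε, fun k hk => low_waveOp _ ε k hk⟩, waveOp_swap _,
    (waveOp (bos s r f) false).adj, hPQ, hQP, rfl, hQ, satoWilson_of_dt hQP hdt,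
    ?_, fun b => ?_, fun a => ?_, fun a => ?_, fun a => ?_, laxSymmetry_of_adj hQP hQ⟩
  · rw [laxL_eq]; exact laxSato_dress hPQ hQP hdt _ _
  · rw [laxC_eq]; exact laxSato_dress hPQ hQP hdt _ _
  · rw [laxD_eq]; exact laxSato_dress hPQ hQP hdt _ _
  · rw [laxE_eq]; exact laxSato_dress hPQ hQP hdt _ _
  · rw [laxE_eq, laxD_eq, dress_mul_dress hQP, zero_add]
    congr 3
    funext i
    rcases i with b | b | d <;> simp [eV, dV, Pi.single_apply] <;> split_ifs <;> simp
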